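/- Let $\chi$ be a primitive Dirichlet character of conductor $m$ with $\chi^3=1$, and let $p\mid m$ be a prime. Write $m=p^cm'$ with $p\nmid m'$ and $\chi=\chi_p\chi_p'$ with $\chi_p$ a character modulo $p^c$ and $\chi_p'$ a character modulo $m'$. Let $\tilde\chi$ be the idele class character of $\mathbb Q$ obtained from $\chi$ through $\mathbb A^\times=\mathbb R_{+}^\times\cdot\widehat{\mathbb Z}^\times\cdot\mathbb Q^\times\to\widehat{\mathbb Z}^\times\to(\mathbb Z/m)^\times$, let $\tilde\chi_p$ be its restriction to $\mathbb Q_p^\times$, and let $\tau(\chi_p)=\sum_{t\in(\mathbb Z/p^c)^\times}\chi_p(t)e^{2\pi i t/p^c}$. For a ring $R$ let $V_R$ be the set of binary cubic forms $a(u,v)=a_1u^3+a_2u^2v+a_3uv^2+a_4v^3$ over $R$, written $(a_1,a_2,a_3,a_4)$, with $G_R=\mathrm{GL}_2(R)$ acting by $(g\cdot a)(u,v)=(\det g)^{-1}a((u,v)g)$, and let $P$ be the discriminant. For $a\in V_{\mathbb Z_p}$ let $\Phi_{p,a}$ be the characteristic function of $a+p^eV_{\mathbb Z_p}$ on $V_{\mathbb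 Q_p}$, put $\mathcal M_{p,\chi^{-1}}\Phi(x)=\int_{G_{\mathbb Z_p}}\tilde\chi_p(\det g)^{-1}\Phi(gx)\,dg$, and $$\mathcal C_{p^e}(a,\chi)=p^{4e}L_p(\tfrac13,\chi^{-1})^{-1}\int_{\mathbb Q_p^\times\times\mathbb Q_p^3}\tilde\chi_p(t)|t|_p^{1/3}\,\mathcal M_{p,\chi^{-1}}\Phi_{p,a}(t,u_2,u_3,u_4)\,d^\times t\,du_2\,du_3\,du_4 ,$$ where the Haar measures give volume $1$ to $G_{\mathbb Z_p}$, $\mathbb Z_p^\times$ and $\mathbb Z_p$, and $L_p(s,\chi^{-1})=1$ since $p\mid m$. Put $$\tilde{\mathcal C}_{p^e}(a,\chi)=(1-p^{-2})\,\frac{\mathcal C_{p^e}(a,\chi)}{\tilde\chi_p\bigl(P(a)/p^{\mathrm{ord}_p P(a)}\bigr)} .$$ Call $e$ admissible for $a$ if $e\ge c$, the set of $x\in V_{\mathbb Z_p}$ whose reduction modulo $p^e$ lies in the $G_{\mathbb Z/p^e}$-orbit of $a\bmod p^e$ is a single $G_{\mathbb Z_p}$-orbit, and $P(a')\neq0$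 and $\tilde\chi_p(P(a')/p^{\mathrm{ord}_pP(a')})=\tilde\chi_p(P(a)/p^{\mathrm{ord}_pP(a)})$ for all $a'\equiv a\bmod p^e$. A form $a\in V_{\mathbb Z_p}$ has type $(3)$, $(21)$ or $(111)$ if $a\bmod p$ has no root in $\mathbb P^1(\mathbb F_p)$, is a nonzero linear form times a quadratic form without roots in $\mathbb P^1(\mathbb F_p)$, or is a product of three pairwise non-proportional linear forms, respectively. With $R=\mathbb Z/p^2$, it has type $(1^21_{\max})$ if $a\bmod p^2$ is $G_R$-equivalent to some $(0,a_2,a_3,a_4)$ with $a_2\in R^\times$, $a_3\in pR$, $a_4\in pR^\times$, and type $(1^3_{\max})$ if it is $G_R$-equivalent to some $(a_1,a_2,a_3,a_4)$ with $a_1\in R^\times$, $a_2,a_3\in pR$, $a_4\in pR^\times$. The forms of these five types are the maximal ones. Then in the following tables every form of the indicated type is $G_{\mathbb Z_p}$-equivalent to a listed one, and all listed forms have that type. For every $a$ in the $G_{\mathbb Z_p}$-orbit of a listed form, every $e\ge e_0$ is admissible for $a$, and $\tilde{\mathcal C}_{p^e}(a,\chi)$ (for all $e\ge e_0$), $|P(a)|_p^{-1}$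 and the order of the stabilizer $G_{\mathbb Z_p,a}$ are as listed. For each type, $e_0$ is the least $e$ that is admissible for all forms of that type. If $p\equiv1\bmod 3$: $$\begin{array}{c|c|c|c|c|c} \text{type}&a&e_0&\tilde{\mathcal C}_{p^e}(a,\chi)&|P(a)|_p^{-1}&|G_{\mathbb Z_p,a}|\\\hline (3)&\text{any}&1&\tau(\chi_p)^3/p^2&1&3\\ (21)&\text{any}&1&-\tau(\chi_p)^3/p^2&1&2\\ (111)&\text{any}&1&\tau(\chi_p)^3/p^2&1&6\\ (1^21_{\max})&(0,1,0,p\alpha),\ \alpha\in\mathbb Z_p^\times&2&\chi_p(2)\chi_p'(p)^2p^{-1/3}&p&2\\ (1^3_{\max})&(1,0,0,p\alpha),\ \alpha\in\mathbb Z_p^\times&2&\chi_p(\alpha)+\chi_p(\alpha)^2\chi_p'(p)^2p^{-1/3}&p^2&3 \end{array}$$ If $p=3$ (in this case $\tau(\chi_p)^3/p^4=\chi_p(2)/p$, and the orbits of the listed forms of types $(1^21_{\max})$ and $(1^3_{\max})$ are pairwise distinct): $$\begin{array}{c|c|c|c|c|c} \text{type}&a&e_0&\tilde{\mathcal C}_{p^e}(a,\chi)&|P(a)|_p^{-1}&|G_{\mathbb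 Z_p,a}|\\\hline (3)&\text{any}&2&\tau(\chi_p)^3/p^4&1&3\\ (21)&\text{any}&2&\tau(\chi_p)^3/p^4&1&2\\ (111)&\text{any}&2&\tau(\chi_p)^3/p^4&1&6\\ (1^21_{\max})&(0,1,0,\pm3)&3&\pm(1-\chi_p(4))\chi_p'(p)^2p^{-4/3}&p&2\\ (1^3_{\max})&(1,0,3,3)&3&(\chi_p(2)-1)/p&p^3&1\\ &(1,0,6,3)&3&(2\chi_p(2)+1)/p&p^3&1\\ &(1,3,0,3)&3&\chi_p(4)\chi_p'(p)^2p^{-1/3}&p^4&1\\ &(1,-3,0,3\alpha),\ \alpha=1,4,7&3&\chi_p(\alpha)^2+\chi_p'(p)^2p^{-1/3}&p^4&3\\ &(1,0,0,3\alpha),\ \alpha=1,4,7&3&\chi_p(\alpha)^2\chi_p'(p)^2p^{-1/3}&p^5&1 \end{array}$$ -/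

import Mathlib

open scoped RestrictedProduct

noncomputable section

namespace BinaryCubic

/-! ### Binary cubic forms and the twisted action of `GL₂` -/

/-- The binary cubic form `x₁u³ + x₂u²v + x₃uv² + x₄v³` is the vector `![x₁, x₂, x₃, x₄]`. -/
abbrev Form (R : Type*) := Fin 4 → R

section Forms

variable {R S : Type*} [CommRing R] [CommRing S]

/-- The value `a(u,v)`. -/
def eval (a : Form R) (u v : R) : R :=
  a 0 * u ^ 3 + a 1 * u ^ 2 * v + a 2 * u * v ^ 2 + a 3 * v ^ 3

/-- The discriminant. -/
def disc (x : Form R) : R :=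
  x 1 ^ 2 * x 2 ^ 2 + 18 * x 0 * x 1 * x 2 * x 3 - 4 * x 0 * x 2 ^ 3 - 4 * x 1 ^ 3 * x 3
    - 27 * x 0 ^ 2 * x 3 ^ 2

/-- `(g · x)(u,v) = (det g)⁻¹ x(αu + γv, βu + δv)` for `g = (α β; γ δ)`, in coordinates. -/
def act (g : GL (Fin 2) R) (x : Form R) : Form R :=
  let α := g.val 0 0
  let β := g.val 0 1
  let γ := g.val 1 0
  let δ := g.val 1 1
  let d : R := ((Matrix.GeneralLinearGroup.det g)⁻¹ : Rˣ)
  ![d * (α ^ 3 * x 0 + α ^ 2 * β * x 1 + α * β ^ 2 * x 2 + β ^ 3 * x 3),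
    d * (3 * α ^ 2 * γ * x 0 + (α ^ 2 * δ + 2 * α * β * γ) * x 1
      + (β ^ 2 * γ + 2 * α * β * δ) * x 2 + 3 * β ^ 2 * δ * x 3),
    d * (3 * α * γ ^ 2 * x 0 + (β * γ ^ 2 + 2 * α * γ * δ) * x 1
      + (α * δ ^ 2 + 2 * β * γ * δ) * x 2 + 3 * β * δ ^ 2 * x 3),
    d * (γ ^ 3 * x 0 + γ ^ 2 * δ * x 1 + γ * δ ^ 2 * x 2 + δ ^ 3 * x 3)]

/-- The `GL₂(R)`-orbit of a form. -/
def orbit (a : Form R) : Set (Form R) := {x | ∃ g : GL (Fin 2) R, x = act g a}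

/-- The order of the stabilizer of a form in `GL₂(R)` (it is `0` if the stabilizer is infinite). -/
def stabCard (a : Form R) : ℕ := Nat.card {g : GL (Fin 2) R // act g a = a}

/-- Coefficientwise image of a form under a ring homomorphism. -/
def mapForm (f : R →+* S) (a : Form R) : Form S := fun i => f (a i)

end Forms

/-! ### Types of forms -/

section FieldTypes

variable {F : Type*} [Field F]

/-- No root in the projective line. -/
def IsIrr (a : Form F) : Prop := ∀ u v : F, (u, v) ≠ (0, 0) → eval a u v ≠ 0

/-- Product of a nonzero linear form and a quadratic form without roots in the projective line. -/
def IsLinQuad (a : Form F) : Prop :=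
  ∃ r s q₀ q₁ q₂ : F, (r, s) ≠ (0, 0) ∧
    (∀ u v : F, (u, v) ≠ (0, 0) → q₀ * u ^ 2 + q₁ * u * v + q₂ * v ^ 2 ≠ 0) ∧
    a = ![r * q₀, r * q₁ + s * q₀, r * q₂ + s * q₁, s * q₂]

/-- Product of three pairwise non-proportional linear forms `rᵢ u + sᵢ v`. -/
def IsSplit (a : Form F) : Prop :=
  ∃ r₁ s₁ r₂ s₂ r₃ s₃ : F, r₁ * s₂ - r₂ * s₁ ≠ 0 ∧ r₁ * s₃ - r₃ * s₁ ≠ 0 ∧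
    r₂ * s₃ - r₃ * s₂ ≠ 0 ∧
    a = ![r₁ * r₂ * r₃, r₁ * r₂ * s₃ + r₁ * s₂ * r₃ + s₁ * r₂ * r₃,
      r₁ * s₂ * s₃ + s₁ * r₂ * s₃ + s₁ * s₂ * r₃, s₁ * s₂ * s₃]

end FieldTypes

/-- The types of maximal forms over `ℤ_p`:
`(3)`, `(21)`, `(111)`, `(1²1_max)`, `(1³_max)`. -/
inductive MaxType
  | t3 | t21 | t111 | t121max | t13max

section Local

variable (p : ℕ) [Fact p.Prime]

/-- Forms `(0, a₂, a₃, a₄)` over `R = ℤ/p²` with `a₂ ∈ Rˣ`, `a₃ ∈ pR`, `a₄ ∈ pRˣ`. -/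
def D121max : Set (Form (ZMod (p ^ 2))) :=
  {a | a 0 = 0 ∧ IsUnit (a 1) ∧ (∃ t, a 2 = p * t) ∧ ∃ t, IsUnit t ∧ a 3 = p * t}

/-- Forms `(a₁, a₂, a₃, a₄)` over `R = ℤ/p²` with `a₁ ∈ Rˣ`, `a₂, a₃ ∈ pR`, `a₄ ∈ pRˣ`. -/
def D13max : Set (Form (ZMod (p ^ 2))) :=
  {a | IsUnit (a 0) ∧ (∃ t, a 1 = p * t) ∧ (∃ t, a 2 = p * t) ∧ ∃ t, IsUnit t ∧ a 3 = p * t}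

/-- The forms over `ℤ_p` of a given type. The union over the five types is the set of
maximal forms. -/
def formsOfType : MaxType → Set (Form ℤ_[p])
  | .t3 => {a | IsIrr (mapForm PadicInt.toZMod a)}
  | .t21 => {a | IsLinQuad (mapForm PadicInt.toZMod a)}
  | .t111 => {a | IsSplit (mapForm PadicInt.toZMod a)}
  | .t121max => {a | ∃ d ∈ D121max p, mapForm (PadicInt.toZModPow 2) a ∈ orbit d}
  | .t13max => {a | ∃ d ∈ D13max p, mapForm (PadicInt.toZModPow 2) a ∈ orbit d}

end Local

/-! ### Dirichlet characters and idele class characters -/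

instance factPrimes (l : Nat.Primes) : Fact (l : ℕ).Prime := ⟨l.2⟩

section Characters

variable {m : ℕ} [NeZero m] (χ : DirichletCharacter ℂ m) (p : ℕ) [Fact p.Prime]

/-- `ℤ_pˣ` as a subgroup of `ℚ_pˣ`. -/
def integralUnits : Subgroup ℚ_[p]ˣ :=
  (Units.map (PadicInt.Coe.ringHom (p := p) : ℤ_[p] →* ℚ_[p])).range

/-- The idele group of `ℚ`. -/
abbrev Ideles : Type :=
  ℝˣ × Πʳ l : Nat.Primes, [ℚ_[(l : ℕ)]ˣ, integralUnits (l : ℕ)]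

/-- The idele class character attached to `χ`: an idele is written as `r · z · q` with a positive
real `r`, an element `z` of `∏ ℤ_lˣ` and `q ∈ ℚˣ` embedded diagonally, and it is sent to `χ(n)` for
an integer `n` congruent to `z` modulo `m` at all primes. (Such `r, z, q, n` always exist, and
`χ(n)` does not depend on the choice.) -/
def ideleLift (x : Ideles) : ℂ :=
  open Classical in
  if h : ∃ (r : ℝ) (q : ℚ) (z : ∀ l : Nat.Primes, ℤ_[(l : ℕ)]ˣ) (n : ℤ),
      0 < r ∧ q ≠ 0 ∧ (x.1 : ℝ) = r * q ∧
      (∀ l : Nat.Primes, (x.2 l : ℚ_[(l : ℕ)]) = ((z l : ℤ_[(l : ℕ)]) : ℚ_[(l : ℕ)]) * q) ∧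
      (∀ l : Nat.Primes, (m : ℤ_[(l : ℕ)]) ∣ (n : ℤ_[(l : ℕ)]) - z l)
  then χ ((h.choose_spec.choose_spec.choose_spec.choose : ℤ) : ZMod m)
  else 0

/-- The component at `p` of the idele class character attached to `χ`, extended by `0` to `ℚ_p`. -/
def localChar (t : ℚ_[p]) : ℂ :=
  open Classical in
  if h : t ≠ 0 then
    ideleLift χ (1, RestrictedProduct.mulSingle
      (fun l : Nat.Primes => integralUnits (l : ℕ)) ⟨p, Fact.out⟩ (Units.mk0 t h))
  else 0

/-- The exponent of `p` in the modulus `m`. -/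
abbrev condExp (m p : ℕ) : ℕ := m.factorization p

/-- `ℤ/m ≃ ℤ/pᶜ × ℤ/m'`, where `m = pᶜ m'` and `p ∤ m'`. -/
def splitModulus (m : ℕ) [NeZero m] (p : ℕ) [Fact p.Prime] :
    ZMod m ≃+* ZMod (p ^ condExp m p) × ZMod (m / p ^ condExp m p) :=
  (ZMod.ringEquivCongr (Nat.ordProj_mul_ordCompl_eq_self m p).symm).trans
    (ZMod.chineseRemainder
      (Nat.Coprime.pow_left _ (Nat.coprime_ordCompl (Fact.out : p.Prime) (NeZero.ne m))))

/-- The component `χ_p`, a character modulo `pᶜ`. -/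
def primaryPart : DirichletCharacter ℂ (p ^ condExp m p) :=
  MulChar.ofUnitHom (χ.toUnitHom.comp
    ((Units.mapEquiv (splitModulus m p).symm.toMulEquiv).toMonoidHom.comp
      (MulEquiv.prodUnits.symm.toMonoidHom.comp (MonoidHom.inl _ _))))

/-- The prime-to-`p` component `χ_p'`, a character modulo `m' = m / pᶜ`. -/
def coprimaryPart : DirichletCharacter ℂ (m / p ^ condExp m p) :=
  MulChar.ofUnitHom (χ.toUnitHom.comp
    ((Units.mapEquiv (splitModulus m p).symm.toMulEquiv).toMonoidHom.comp
      (MulEquiv.prodUnits.symm.toMonoidHom.comp (MonoidHom.inr _ _))))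

instance neZeroPow (c : ℕ) : NeZero (p ^ c) := ⟨pow_ne_zero c (Fact.out : p.Prime).ne_zero⟩

/-- The Gauss sum `τ(χ_p) = ∑_t χ_p(t) exp(2πi t / pᶜ)`. -/
def tau : ℂ := gaussSum (primaryPart χ p) ZMod.stdAddChar

/-- `L_p(s, χ) = (1 - χ(p) p^{-s})⁻¹`; this is `1` if `p ∣ m`. -/
def localL (s : ℂ) : ℂ := (1 - χ (p : ZMod m) * (p : ℂ) ^ (-s))⁻¹

end Characters

/-! ### Normalized Haar measures -/

section Measures

open MeasureTheory TopologicalSpace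

variable (p : ℕ) [Fact p.Prime]

instance padicMeasurableSpace : MeasurableSpace ℚ_[p] := borel _

instance padicBorelSpace : BorelSpace ℚ_[p] := ⟨rfl⟩

instance padicUnitsBorelSpace : BorelSpace ℚ_[p]ˣ :=
  ⟨by
    rw [Units.isEmbedding_val₀.eq_induced, borel_comap]
    rfl⟩

instance glMeasurableSpace : MeasurableSpace (GL (Fin 2) ℤ_[p]) := borel _

instance glBorelSpace : BorelSpace (GL (Fin 2) ℤ_[p]) := ⟨rfl⟩

/-- `ℤ_p` as a compact subset of `ℚ_p`. -/
def intCompacts : PositiveCompacts ℚ_[p] where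
  carrier := Metric.closedBall 0 1
  isCompact' := isCompact_closedBall 0 1
  interior_nonempty' :=
    ⟨0, Metric.ball_subset_interior_closedBall (Metric.mem_ball_self one_pos)⟩

/-- `ℤ_pˣ` as a compact subset of `ℚ_pˣ`. -/
def unitCompacts : PositiveCompacts ℚ_[p]ˣ where
  carrier := (integralUnits p : Set ℚ_[p]ˣ)
  isCompact' := by
    have h : Continuous (Units.map (PadicInt.Coe.ringHom (p := p) : ℤ_[p] →* ℚ_[p])) :=
      Continuous.units_map _ continuous_subtype_val
    exact isCompact_range h
  interior_nonempty' := by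
    have h : (integralUnits p : Set ℚ_[p]ˣ) = {u : ℚ_[p]ˣ | ‖(u : ℚ_[p])‖ = 1} := by
      ext u
      constructor
      · rintro ⟨v, rfl⟩
        exact PadicInt.norm_units v
      · intro hu
        have hu' : ‖(u : ℚ_[p])‖ = 1 := hu
        exact ⟨PadicInt.mkUnits hu', Units.ext rfl⟩
    have ho : IsOpen {u : ℚ_[p]ˣ | ‖(u : ℚ_[p])‖ = 1} := by
      have hs : IsOpen (Metric.sphere (0 : ℚ_[p]) 1) :=
        IsUltrametricDist.isOpen_sphere 0 one_ne_zero
      have hc := hs.preimage (Units.continuous_val (M := ℚ_[p]))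
      convert hc using 1
      ext u
      simp
    rw [h, ho.interior_eq]
    exact ⟨1, by simp⟩

instance glCompactSpace : CompactSpace (GL (Fin 2) ℤ_[p]) := by
  have : CompactSpace (Matrix (Fin 2) (Fin 2) ℤ_[p]) :=
    inferInstanceAs (CompactSpace (Fin 2 → Fin 2 → ℤ_[p]))
  infer_instance

/-- Additive Haar measure on `ℚ_p` with `ℤ_p` of volume `1`. -/
def addHaarQ : Measure ℚ_[p] := Measure.addHaarMeasure (intCompacts p)

/-- Haar measure on `ℚ_pˣ` with `ℤ_pˣ` of volume `1`. -/
def mulHaarQ : Measure ℚ_[p]ˣ := Measure.haarMeasure (unitCompacts p)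

/-- Haar probability measure on `GL₂(ℤ_p)`. -/
def haarGL : Measure (GL (Fin 2) ℤ_[p]) := Measure.haarMeasure ⊤

end Measures

/-! ### The local residue factors -/

section Residues

open MeasureTheory

variable {m : ℕ} [NeZero m] (χ : DirichletCharacter ℂ m) (p : ℕ) [Fact p.Prime]

/-- The characteristic function of `a + p^e V(ℤ_p)` on `V(ℚ_p)`. -/
def charFun (e : ℕ) (a : Form ℤ_[p]) : Form ℚ_[p] → ℂ :=
  Set.indicator {x | ∃ y : Form ℤ_[p], ∀ i, x i = ((a i + (p : ℤ_[p]) ^ e * y i : ℤ_[p]) : ℚ_[p])}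
    (fun _ => 1)

/-- `(M_{p,χ} Φ)(x) = ∫_{GL₂(ℤ_p)} χ̃_p(det g) Φ(g x) dg`. -/
def average (Φ : Form ℚ_[p] → ℂ) (x : Form ℚ_[p]) : ℂ :=
  ∫ g : GL (Fin 2) ℤ_[p],
    localChar χ p (((Matrix.GeneralLinearGroup.det g : ℤ_[p]ˣ) : ℤ_[p]) : ℚ_[p])
      * Φ (act (Matrix.GeneralLinearGroup.map (PadicInt.Coe.ringHom (p := p)) g) x) ∂(haarGL p)

/-- `C_{p^e}(a,χ) = p^{4e} L_p(1/3,χ⁻¹)⁻¹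
  ∫_{ℚ_pˣ × ℚ_p³} χ̃_p(t) |t|^{1/3} (M_{p,χ⁻¹} Φ_{p,a})(t,u₂,u₃,u₄) dˣt du₂ du₃ du₄`. -/
def residueC (e : ℕ) (a : Form ℤ_[p]) : ℂ :=
  (p : ℂ) ^ (4 * e) * (localL χ⁻¹ p (1 / 3))⁻¹ *
    ∫ z : ℚ_[p]ˣ × ℚ_[p] × ℚ_[p] × ℚ_[p],
      localChar χ p (z.1 : ℚ_[p]) * ((‖(z.1 : ℚ_[p])‖ : ℝ) : ℂ) ^ (1 / 3 : ℂ)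
        * average χ⁻¹ p (charFun p e a) ![(z.1 : ℚ_[p]), z.2.1, z.2.2.1, z.2.2.2]
      ∂((mulHaarQ p).prod ((addHaarQ p).prod ((addHaarQ p).prod (addHaarQ p))))

/-- `χ̃_p(P(a) / p^{ord_p P(a)})`. -/
def discChar (a : Form ℤ_[p]) : ℂ :=
  localChar χ p (((disc a : ℤ_[p]) : ℚ_[p]) / (p : ℚ_[p]) ^ (disc a).valuation)

/-- `e` is admissible for `a`: `e` is at least the conductor exponent of `χ` at `p`, the set
`GL₂(ℤ/p^e) a + p^e V(ℤ_p)` is a single `GL₂(ℤ_p)`-orbit, and `χ̃_p(P(a) / p^{ord_p P(a)})` depends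
only on `a` modulo `p^e`. -/
def Admissible (e : ℕ) (a : Form ℤ_[p]) : Prop :=
  condExp m p ≤ e ∧
  {x | mapForm (PadicInt.toZModPow e) x ∈ orbit (mapForm (PadicInt.toZModPow e) a)} = orbit a ∧
  ∀ a' : Form ℤ_[p], mapForm (PadicInt.toZModPow e) a' = mapForm (PadicInt.toZModPow e) a →
    disc a' ≠ 0 ∧ discChar χ p a' = discChar χ p a

/-- The normalized residue factor
`(1 - p^{-2}) C_{p^e}(a,χ) / χ̃_p(P(a) / p^{ord_p P(a)})`. -/
def normC (e : ℕ) (a : Form ℤ_[p]) : ℂ :=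
  (1 - (p : ℂ) ^ (-2 : ℤ)) * residueC χ p e a / discChar χ p a

/-- One row of the table for the form `a`: every `e ≥ e₀` is admissible, and the normalized residue
factor is then `val`; moreover `|P(a)|_p⁻¹ = d` and the stabilizer of `a` has order `s`. -/
def TableRow (a : Form ℤ_[p]) (e₀ : ℕ) (val : ℂ) (d s : ℕ) : Prop :=
  (∀ e, e₀ ≤ e → Admissible χ p e a ∧ normC χ p e a = val) ∧
    ‖disc a‖⁻¹ = d ∧ stabCard a = s

/-- `e₀` is the least exponent that is admissible for all forms of type `σ`. -/
def MinimalExp (σ : MaxType) (e₀ : ℕ) : Prop :=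
  IsLeast {e | ∀ a ∈ formsOfType p σ, Admissible χ p e a} e₀

end Residues

end BinaryCubic

end

open BinaryCubic

set_option linter.unusedSectionVars false

/-! The residue factor is turned into a character sum over a projective line, and this sum is
evaluated on one representative of each orbit.

Decomposing ideles gives χ̃_p(u p^k) = χ_p(u) χ_p'(p)^(-k) for units u (`localChar_eq`). Since
Φ_{p,a} sees only residues modulo p^e, the integrals over GL₂(ℤ_p) and over u₂, u₃, u₄ become finite
sums. The first coefficient of γ·a is det(γ)⁻¹ times the value of a at the first row of γ, and the
two determinant twists cancel (`residueC_eq_sum_gl`). Because a is cubic and χ³ = 1, the remaining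
summand depends only on the point of ℙ¹(ℤ/p^e) defined by that row. So the normalized factor is, up
to 1 - 1/p and the discriminant character, the sum over ℙ¹(ℤ/p^e) of I(a(x,y)), where I(s) is the
integral of χ̃_p(t)|t|^(1/3) over t ≡ s mod p^e (`normC_eq_valueSum`). After multiplication by
φ(p^e), I is χ_p on units, a constant times χ_p(u) on p·u, and it sums to zero over the nonunits
because χ_p is nontrivial. Hence the residue disc of a simple root contributes nothing, while near
the multiple root of a ramified maximal form the value has valuation exactly one. A sum over
residues modulo p^c is left. For p ≡ 1 mod 3 one has c = 1, and the sums are elementary or reduce to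
the Jacobi sum J(χ_p,χ_p) = τ³/p. For p = 3 one has c = 2, χ_p is determined by the primitive cube
root of unity χ_p(2), and nine residues are added up.

All entries of a row are constant along orbits, so orbits must be classified. A form of unit
discriminant is determined up to equivalence by its reduction: the derivative of the action is a 4×4
matrix whose determinant is the discriminant, and Newton's method applies (`mem_orbit_of_tangent`).
For (1²1_max) the simple root is lifted and a square is completed. For (1³_max) with p ≠ 3, and for
p = 3 when the two middle coefficients are divisible by 9, the Hessian splits, and moving its roots
to 0 and ∞ makes the form diagonal (`exists_diagonal`). The other forms over ℤ₃ are handled by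
Newton's method relative to two lattices stable under the second order terms; `wildForm_invariants`
separates the nine resulting orbits.

For admissibility it is shown that forms congruent modulo p^e to a member of the orbit stay in the
orbit. For ramified rows the discriminant condition then comes for free: C depends only on a mod
p^e, the normalized factor is an orbit invariant, and the listed values do not vanish
(`admissible_of_isolated`). Explicit congruent forms show that e₀ is least.

A stabilizing matrix has determinant ±1. If the determinant is 1 it preserves the Hessian, hence has
the form (τ + yH)/2 with H built from the Hessian, and the only solutions are the identity and pairs
with τ = -1, P y² = 1 (`automorphism_of_det_one`). So there are three or one of them, according to
whether P is a square (with an integrality condition). Determinant -1 forces a rational root. -/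

namespace BinaryCubic

/-! ### Substitutions, the twisted action, discriminant and Hessian. -/

section FormAlgebra

variable {R S : Type*} [CommRing R] [CommRing S]

/-- Coefficients of `x(αu + γv, βu + δv)`. -/
def subst (α β γ δ : R) (x : Form R) : Form R :=
  ![α ^ 3 * x 0 + α ^ 2 * β * x 1 + α * β ^ 2 * x 2 + β ^ 3 * x 3,
    3 * α ^ 2 * γ * x 0 + (α ^ 2 * δ + 2 * α * β * γ) * x 1
      + (β ^ 2 * γ + 2 * α * β * δ) * x 2 + 3 * β ^ 2 * δ * x 3,
    3 * α * γ ^ 2 * x 0 + (β * γ ^ 2 + 2 * α * γ * δ) * x 1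
      + (α * δ ^ 2 + 2 * β * γ * δ) * x 2 + 3 * β * δ ^ 2 * x 3,
    γ ^ 3 * x 0 + γ ^ 2 * δ * x 1 + γ * δ ^ 2 * x 2 + δ ^ 3 * x 3]

/-- The determinant of `g`, as an expression in its entries. -/
abbrev ddet (g : GL (Fin 2) R) : R :=
  g.val 0 0 * g.val 1 1 - g.val 0 1 * g.val 1 0

theorem coe_det (g : GL (Fin 2) R) :
    ((Matrix.GeneralLinearGroup.det g : Rˣ) : R) = ddet g := by
  rw [Matrix.GeneralLinearGroup.val_det_apply, Matrix.det_fin_two]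

theorem isUnit_ddet (g : GL (Fin 2) R) : IsUnit (ddet g) := by
  rw [← coe_det]; exact Units.isUnit _

theorem act_apply (g : GL (Fin 2) R) (x : Form R) (i : Fin 4) :
    act g x i = ((Matrix.GeneralLinearGroup.det g)⁻¹ : Rˣ) *
      subst (g.val 0 0) (g.val 0 1) (g.val 1 0) (g.val 1 1) x i := by
  fin_cases i <;> rfl

theorem ddet_mul_act (g : GL (Fin 2) R) (x : Form R) (i : Fin 4) :
    ddet g * act g x i = subst (g.val 0 0) (g.val 0 1) (g.val 1 0) (g.val 1 1) x i := by
  rw [act_apply, ← coe_det, Units.mul_inv_cancel_left]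

theorem ddet_smul_act (g : GL (Fin 2) R) (x : Form R) :
    (fun i => ddet g * act g x i) = subst (g.val 0 0) (g.val 0 1) (g.val 1 0) (g.val 1 1) x :=
  funext fun i => ddet_mul_act g x i

/-- Clearing the inverse determinant turns equations for the twisted action into polynomial
identities; later orbit computations rest on this form. -/
theorem act_eq_iff (g : GL (Fin 2) R) (x y : Form R) :
    act g x = y ↔ subst (g.val 0 0) (g.val 0 1) (g.val 1 0) (g.val 1 1) x =
      fun i => ddet g * y i := by
  constructor
  · rintro rfl; exact (ddet_smul_act g x).symm
  · intro h
    funext i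
    have := ddet_mul_act g x i
    rw [h] at this
    exact (isUnit_ddet g).mul_left_cancel this

theorem act_one (x : Form R) : act 1 x = x := by
  rw [act_eq_iff]
  funext i
  fin_cases i <;> simp [subst, ddet]

theorem subst_subst (α β γ δ α' β' γ' δ' : R) (x : Form R) :
    subst α β γ δ (subst α' β' γ' δ' x) =
      subst (α * α' + β * γ') (α * β' + β * δ') (γ * α' + δ * γ') (γ * β' + δ * δ') x := by
  funext i
  fin_cases i <;> simp [subst] <;> ring

theorem subst_smul (α β γ δ c : R) (x : Form R) :
    subst α β γ δ (fun i => c * x i) = fun i => c * subst α β γ δ x i := by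
  funext i
  fin_cases i <;> simp [subst] <;> ring

theorem act_mul (g h : GL (Fin 2) R) (x : Form R) : act (g * h) x = act g (act h x) := by
  rw [act_eq_iff]
  have h1 := ddet_smul_act h x
  have h2 := ddet_smul_act g (act h x)
  have h3 : ddet (g * h) = ddet h * ddet g := by
    rw [← coe_det, ← coe_det, ← coe_det, map_mul, Units.val_mul, mul_comm]
  have h4 : ∀ i j, (g * h).val i j = g.val i 0 * h.val 0 j + g.val i 1 * h.val 1 j := by
    intro i j
    simp [Matrix.mul_apply, Fin.sum_univ_two]
  rw [h3]
  simp only [mul_assoc]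
  rw [h4, h4, h4, h4, ← subst_subst, ← h1, subst_smul, ← h2]

theorem act_inv_act (g : GL (Fin 2) R) (x : Form R) : act g⁻¹ (act g x) = x := by
  rw [← act_mul, inv_mul_cancel, act_one]

theorem act_act_inv (g : GL (Fin 2) R) (x : Form R) : act g (act g⁻¹ x) = x := by
  rw [← act_mul, mul_inv_cancel, act_one]

theorem mem_orbit_self (a : Form R) : a ∈ orbit a := ⟨1, (act_one a).symm⟩

theorem act_mem_orbit (g : GL (Fin 2) R) (a : Form R) : act g a ∈ orbit a := ⟨g, rfl⟩

theorem mem_orbit_symm {a b : Form R} (h : a ∈ orbit b) : b ∈ orbit a := by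
  obtain ⟨g, rfl⟩ := h
  exact ⟨g⁻¹, (act_inv_act g b).symm⟩

theorem mem_orbit_trans {a b c : Form R} (h : a ∈ orbit b) (h' : b ∈ orbit c) : a ∈ orbit c := by
  obtain ⟨g, rfl⟩ := h
  obtain ⟨k, rfl⟩ := h'
  exact ⟨g * k, (act_mul g k c).symm⟩

theorem orbit_eq {a b : Form R} (h : a ∈ orbit b) : orbit a = orbit b :=
  Set.ext fun _ => ⟨fun hx => mem_orbit_trans hx h, fun hx => mem_orbit_trans hx (mem_orbit_symm h)⟩

/-- The invertible matrix with given entries. -/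
noncomputable def glOf (α β γ δ : R) (h : IsUnit (α * δ - β * γ)) : GL (Fin 2) R :=
  Matrix.GeneralLinearGroup.mk'' !![α, β; γ, δ] (by rw [Matrix.det_fin_two_of]; exact h)

theorem glOf_val (α β γ δ : R) (h : IsUnit (α * δ - β * γ)) :
    (glOf α β γ δ h).val = !![α, β; γ, δ] := rfl

theorem ddet_glOf (α β γ δ : R) (h : IsUnit (α * δ - β * γ)) :
    ddet (glOf α β γ δ h) = α * δ - β * γ := by
  simp [ddet, glOf_val]

theorem glOf_act_eq_iff (α β γ δ : R) (h : IsUnit (α * δ - β * γ)) (x y : Form R) :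
    act (glOf α β γ δ h) x = y ↔ subst α β γ δ x = fun i => (α * δ - β * γ) * y i := by
  rw [act_eq_iff, ddet_glOf]
  simp [glOf_val]

theorem mem_orbit_of_subst {x a : Form R} (α β γ δ : R) (h : IsUnit (α * δ - β * γ))
    (hx : subst α β γ δ a = fun i => (α * δ - β * γ) * x i) : x ∈ orbit a :=
  ⟨glOf α β γ δ h, ((glOf_act_eq_iff α β γ δ h a x).2 hx).symm⟩

theorem exists_subst_of_mem_orbit {x a : Form R} (h : x ∈ orbit a) :
    ∃ α β γ δ : R, IsUnit (α * δ - β * γ) ∧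
      subst α β γ δ a = fun i => (α * δ - β * γ) * x i := by
  obtain ⟨g, rfl⟩ := h
  exact ⟨_, _, _, _, isUnit_ddet g, (ddet_smul_act g a).symm⟩

theorem eval_subst (α β γ δ : R) (x : Form R) (u v : R) :
    eval (subst α β γ δ x) u v = eval x (α * u + γ * v) (β * u + δ * v) := by
  simp [eval, subst]; ring

theorem eval_smul (c : R) (x : Form R) (u v : R) :
    eval (fun i => c * x i) u v = c * eval x u v := by
  simp [eval]; ring

theorem ddet_mul_eval_act (g : GL (Fin 2) R) (x : Form R) (u v : R) :
    ddet g * eval (act g x) u v =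
      eval x (g.val 0 0 * u + g.val 1 0 * v) (g.val 0 1 * u + g.val 1 1 * v) := by
  rw [← eval_smul, ddet_smul_act, eval_subst]

theorem eval_mul_mul (a : Form R) (t u v : R) : eval a (t * u) (t * v) = t ^ 3 * eval a u v := by
  simp [eval]; ring

theorem disc_subst (α β γ δ : R) (x : Form R) :
    disc (subst α β γ δ x) = (α * δ - β * γ) ^ 6 * disc x := by
  simp [disc, subst]; ring

theorem disc_smul (c : R) (x : Form R) : disc (fun i => c * x i) = c ^ 4 * disc x := by
  simp [disc]; ring

theorem disc_act (g : GL (Fin 2) R) (x : Form R) : disc (act g x) = ddet g ^ 2 * disc x := by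
  have h := congrArg disc (ddet_smul_act g x)
  rw [disc_subst, disc_smul] at h
  have hu := (isUnit_ddet g).pow 4
  apply hu.mul_left_cancel
  rw [h]; ring

theorem mapForm_act (f : R →+* S) (g : GL (Fin 2) R) (x : Form R) :
    mapForm f (act g x) = act (Matrix.GeneralLinearGroup.map f g) (mapForm f x) := by
  symm
  rw [act_eq_iff]
  have h := ddet_smul_act g x
  funext i
  have h' := congrArg f (congrFun h i)
  rw [map_mul] at h'
  have e1 : ddet (Matrix.GeneralLinearGroup.map f g) = f (ddet g) := by simp [ddet]
  rw [e1]
  change _ = f (ddet g) * f (act g x i)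
  rw [h']
  fin_cases i <;> simp [subst, mapForm, map_ofNat f]

theorem mapForm_mem_orbit (f : R →+* S) {x a : Form R} (h : x ∈ orbit a) :
    mapForm f x ∈ orbit (mapForm f a) := by
  obtain ⟨g, rfl⟩ := h
  exact ⟨_, mapForm_act f g a⟩

theorem disc_mapForm (f : R →+* S) (a : Form R) : disc (mapForm f a) = f (disc a) := by
  simp [disc, mapForm, map_ofNat f]

theorem eval_mapForm (f : R →+* S) (a : Form R) (u v : R) :
    eval (mapForm f a) (f u) (f v) = f (eval a u v) := by
  simp [eval, mapForm]

/-- Coefficients of the Hessian covariant. -/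
def hess (a : Form R) : R × R × R :=
  (a 1 ^ 2 - 3 * a 0 * a 2, a 1 * a 2 - 9 * a 0 * a 3, a 2 ^ 2 - 3 * a 1 * a 3)

theorem hess_smul (c : R) (a : Form R) :
    hess (fun i => c * a i) =
      (c ^ 2 * (hess a).1, c ^ 2 * (hess a).2.1, c ^ 2 * (hess a).2.2) := by
  simp only [hess, Prod.mk.injEq]
  refine ⟨by ring, by ring, by ring⟩

theorem hess_subst (α β γ δ : R) (a : Form R) :
    hess (subst α β γ δ a) =
      ((α * δ - β * γ) ^ 2 * ((hess a).1 * α ^ 2 + (hess a).2.1 * α * β + (hess a).2.2 * β ^ 2),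
       (α * δ - β * γ) ^ 2 * (2 * (hess a).1 * α * γ + (hess a).2.1 * (α * δ + β * γ)
          + 2 * (hess a).2.2 * β * δ),
       (α * δ - β * γ) ^ 2 * ((hess a).1 * γ ^ 2 + (hess a).2.1 * γ * δ + (hess a).2.2 * δ ^ 2)) := by
  simp only [hess, subst, Prod.mk.injEq, Matrix.cons_val_zero, Matrix.cons_val_one,
    Matrix.cons_val]
  refine ⟨by ring, by ring, by ring⟩

/-- The Hessian is quadratic in the coefficients, so the twist contributes `det⁻²`, which cancels
the `det²` of the untwisted covariance. The Hessian therefore moves as a plain binary quadratic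
form. -/
theorem hess_act (g : GL (Fin 2) R) (a : Form R) :
    hess (act g a) =
      ((hess a).1 * g.val 0 0 ^ 2 + (hess a).2.1 * g.val 0 0 * g.val 0 1
          + (hess a).2.2 * g.val 0 1 ^ 2,
       2 * (hess a).1 * g.val 0 0 * g.val 1 0
          + (hess a).2.1 * (g.val 0 0 * g.val 1 1 + g.val 0 1 * g.val 1 0)
          + 2 * (hess a).2.2 * g.val 0 1 * g.val 1 1,
       (hess a).1 * g.val 1 0 ^ 2 + (hess a).2.1 * g.val 1 0 * g.val 1 1
          + (hess a).2.2 * g.val 1 1 ^ 2) := by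
  have h := congrArg hess (ddet_smul_act g a)
  rw [hess_smul, hess_subst] at h
  have hu := (isUnit_ddet g).pow 2
  simp only [Prod.mk.injEq] at h
  obtain ⟨h1, h2, h3⟩ := h
  exact Prod.ext (hu.mul_left_cancel h1)
    (Prod.ext (hu.mul_left_cancel h2) (hu.mul_left_cancel h3))

/-- Square roots of `-3` and of the discriminant together split the Hessian; this link drives both
the diagonalization and the count of automorphisms. -/
theorem hess_disc (a : Form R) :
    (hess a).2.1 ^ 2 - 4 * (hess a).1 * (hess a).2.2 = -3 * disc a := by
  simp [hess, disc]; ring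

end FormAlgebra

end BinaryCubic

namespace BinaryCubic

/-! ### The components of a Dirichlet character at and away from p. -/

section LocalCharacter

variable {m : ℕ} [NeZero m] (χ : DirichletCharacter ℂ m) (p : ℕ) [Fact p.Prime]

/-- The character `χ_p` as a function on `ℤ_p`, zero on nonunits when `p ∣ m`. -/
noncomputable def unitChar : ℤ_[p] →* ℂ :=
  (primaryPart χ p).toMonoidHom.comp (PadicInt.toZModPow (p := p) (condExp m p)).toMonoidHom

theorem unitChar_apply (x : ℤ_[p]) :
    unitChar χ p x = primaryPart χ p (PadicInt.toZModPow (condExp m p) x) := rfl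

theorem toZModPow_eq_iff (n : ℕ) (x y : ℤ_[p]) :
    PadicInt.toZModPow n x = PadicInt.toZModPow n y ↔ (p : ℤ_[p]) ^ n ∣ x - y := by
  rw [← sub_eq_zero, ← map_sub, ← RingHom.mem_ker, PadicInt.ker_toZModPow,
    Ideal.mem_span_singleton]

theorem toZMod_eq_iff (x y : ℤ_[p]) :
    PadicInt.toZMod x = PadicInt.toZMod y ↔ (p : ℤ_[p]) ∣ x - y := by
  rw [← sub_eq_zero, ← map_sub, ← RingHom.mem_ker, PadicInt.ker_toZMod,
    PadicInt.maximalIdeal_eq_span_p, Ideal.mem_span_singleton]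

theorem unitChar_congr {x y : ℤ_[p]} (h : (p : ℤ_[p]) ^ condExp m p ∣ x - y) :
    unitChar χ p x = unitChar χ p y := by
  rw [unitChar_apply, unitChar_apply, (toZModPow_eq_iff p _ x y).2 h]

theorem apply_eq_primary_mul_coprimary (x : ZMod m) :
    χ x = primaryPart χ p (splitModulus m p x).1 * coprimaryPart χ p (splitModulus m p x).2 := by
  by_cases hx : IsUnit x
  · obtain ⟨u, rfl⟩ := hx
    set v := MulEquiv.prodUnits (Units.mapEquiv (splitModulus m p).toMulEquiv u) with hv
    have h1 : (splitModulus m p (u : ZMod m)).1 = (v.1 : ZMod (p ^ condExp m p)) := rfl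
    have h2 : (splitModulus m p (u : ZMod m)).2 = (v.2 : ZMod (m / p ^ condExp m p)) := rfl
    rw [h1, h2, primaryPart, coprimaryPart, MulChar.ofUnitHom_coe, MulChar.ofUnitHom_coe,
      ← MulChar.coe_toUnitHom, ← Units.val_mul]
    congr 1
    simp only [MonoidHom.comp_apply, ← map_mul]
    congr 1
    have : (MonoidHom.inl _ _) v.1 * (MonoidHom.inr _ _) v.2 = v := by
      simp
    rw [this, hv]
    simp only [MulEquiv.coe_toMonoidHom, MulEquiv.symm_apply_apply]
    ext
    simp
  · rw [MulChar.map_nonunit _ hx]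
    by_cases h1 : IsUnit (splitModulus m p x).1
    · have h2 : ¬ IsUnit (splitModulus m p x).2 := fun h2 => hx <| by
        have : IsUnit (splitModulus m p x) := Prod.isUnit_iff.2 ⟨h1, h2⟩
        exact (MulEquiv.isUnit_map (splitModulus m p)).1 this
      rw [MulChar.map_nonunit _ h2, mul_zero]
    · rw [MulChar.map_nonunit _ h1, zero_mul]

theorem intCast_eq_primary_mul_coprimary (n : ℤ) :
    χ (n : ZMod m) = primaryPart χ p n * coprimaryPart χ p n := by
  rw [apply_eq_primary_mul_coprimary χ p, map_intCast]
  rfl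

theorem primaryPart_intCast (n : ℤ) :
    primaryPart χ p n = unitChar χ p n := by
  rw [unitChar_apply, map_intCast (PadicInt.toZModPow _)]

theorem toUnitHom_pow_three (hχ3 : χ ^ 3 = 1) (u : (ZMod m)ˣ) : χ.toUnitHom u ^ 3 = 1 := by
  have h : (χ ^ 3) (u : ZMod m) = 1 := by rw [hχ3]; simp
  rw [MulChar.pow_apply_coe] at h
  ext
  rw [Units.val_pow_eq_pow_val, MulChar.coe_toUnitHom, h, Units.val_one]

theorem primaryPart_pow_three (hχ3 : χ ^ 3 = 1) {x : ZMod (p ^ condExp m p)} (hx : IsUnit x) :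
    primaryPart χ p x ^ 3 = 1 := by
  obtain ⟨u, rfl⟩ := hx
  rw [primaryPart, MulChar.ofUnitHom_coe, ← Units.val_pow_eq_pow_val, MonoidHom.comp_apply,
    toUnitHom_pow_three χ hχ3, Units.val_one]

theorem coprimaryPart_pow_three (hχ3 : χ ^ 3 = 1) {x : ZMod (m / p ^ condExp m p)}
    (hx : IsUnit x) : coprimaryPart χ p x ^ 3 = 1 := by
  obtain ⟨u, rfl⟩ := hx
  rw [coprimaryPart, MulChar.ofUnitHom_coe, ← Units.val_pow_eq_pow_val, MonoidHom.comp_apply,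
    toUnitHom_pow_three χ hχ3, Units.val_one]

theorem unitChar_pow_three (hχ3 : χ ^ 3 = 1) {x : ℤ_[p]} (hx : IsUnit x) :
    unitChar χ p x ^ 3 = 1 :=
  primaryPart_pow_three χ p hχ3 (hx.map _)

theorem unitChar_of_not_isUnit (hpm : p ∣ m) {x : ℤ_[p]} (hx : ¬ IsUnit x) :
    unitChar χ p x = 0 := by
  rw [unitChar_apply]
  apply MulChar.map_nonunit
  intro h
  apply hx
  have hc : condExp m p ≠ 0 :=
    (Nat.Prime.factorization_pos_of_dvd (Fact.out : p.Prime) (NeZero.ne m) hpm).ne'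
  obtain ⟨y, hy⟩ := h.exists_right_inv
  obtain ⟨z, rfl⟩ := ZMod.ringHom_surjective (PadicInt.toZModPow (p := p) (condExp m p)) y
  rw [← map_mul, ← map_one (PadicInt.toZModPow (p := p) (condExp m p)), toZModPow_eq_iff] at hy
  have h2 : (p : ℤ_[p]) ∣ x * z - 1 := (dvd_pow_self _ hc).trans hy
  by_contra hx
  rw [PadicInt.isUnit_iff] at hx
  have h3 : ‖x‖ < 1 := lt_of_le_of_ne (PadicInt.norm_le_one x) hx
  rw [PadicInt.norm_lt_one_iff_dvd] at h3
  have h4 : (p : ℤ_[p]) ∣ 1 := by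
    have := (h3.mul_right z).sub h2
    simpa using this
  exact PadicInt.prime_p.not_isUnit (isUnit_of_dvd_one h4)

theorem isUnit_coprime_modulus : IsUnit ((p : ZMod (m / p ^ condExp m p))) := by
  rw [ZMod.isUnit_iff_coprime]
  exact Nat.coprime_ordCompl (Fact.out : p.Prime) (NeZero.ne m)

theorem coprimaryPart_p_ne_zero : coprimaryPart χ p p ≠ 0 := by
  obtain ⟨u, hu⟩ := isUnit_coprime_modulus (m := m) p
  rw [← hu]
  exact ((u.isUnit).map (coprimaryPart χ p)).ne_zero

/-- A primitive character is nontrivial on units congruent to `1` modulo `m / p`. -/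
theorem exists_unitChar_ne_one (hχ : χ.IsPrimitive) (hpm : p ∣ m) :
    ∃ ε : ℤ_[p]ˣ, (p : ℤ_[p]) ^ (condExp m p - 1) ∣ (ε : ℤ_[p]) - 1 ∧ unitChar χ p ε ≠ 1 := by
  have hp : p.Prime := Fact.out
  have hm : m ≠ 0 := NeZero.ne m
  have hc : condExp m p ≠ 0 := (hp.factorization_pos_of_dvd hm hpm).ne'
  have hd : m / p ∣ m := Nat.div_dvd_of_dvd hpm
  have hfac : m = p ^ condExp m p * (m / p ^ condExp m p) :=
    (Nat.ordProj_mul_ordCompl_eq_self m p).symm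
  have hmp : m / p = p ^ (condExp m p - 1) * (m / p ^ condExp m p) := by
    apply Nat.div_eq_of_eq_mul_right hp.pos
    rw [← mul_assoc, ← pow_succ', Nat.sub_add_cancel (Nat.pos_of_ne_zero hc)]
    exact hfac
  -- If χ were trivial on the kernel of reduction to modulus m/p, it would factor through m/p,
  -- against primitivity.
  have key : ∃ u : (ZMod m)ˣ, ZMod.unitsMap hd u = 1 ∧ χ u ≠ 1 := by
    by_contra! hcon
    have hft : χ.FactorsThrough (m / p) := by
      rw [DirichletCharacter.factorsThrough_iff_ker_unitsMap hd]
      intro u hu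
      have := hcon u hu
      rw [MonoidHom.mem_ker]
      ext
      rw [MulChar.coe_toUnitHom, this, Units.val_one]
    have h1 : χ.conductor ≤ m / p := Nat.sInf_le hft
    rw [DirichletCharacter.isPrimitive_def] at hχ
    rw [hχ] at h1
    exact absurd h1 (not_le.2 (Nat.div_lt_self (Nat.pos_of_ne_zero hm) hp.one_lt))
  obtain ⟨u, hu1, hu2⟩ := key
  obtain ⟨n, hn⟩ := ZMod.intCast_surjective (u : ZMod m)
  have hn1 : ((m / p : ℕ) : ℤ) ∣ n - 1 := by
    have h := congrArg Units.val hu1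
    rw [ZMod.unitsMap_val, Units.val_one, ← hn] at h
    rw [← ZMod.intCast_zmod_eq_zero_iff_dvd]
    rw [ZMod.cast_intCast hd] at h
    push_cast
    rw [h, sub_self]
  have hco : coprimaryPart χ p (n : ZMod (m / p ^ condExp m p)) = 1 := by
    have : ((n : ℤ) : ZMod (m / p ^ condExp m p)) = 1 := by
      have h2 : ((m / p ^ condExp m p : ℕ) : ℤ) ∣ n - 1 := by
        refine dvd_trans ?_ hn1
        rw [hmp]; push_cast; exact dvd_mul_left _ _
      rw [← ZMod.intCast_zmod_eq_zero_iff_dvd] at h2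
      push_cast at h2
      exact sub_eq_zero.1 h2
    rw [this, map_one]
  have hχn := intCast_eq_primary_mul_coprimary χ p n
  rw [hn, hco, mul_one, primaryPart_intCast] at hχn
  have hun : IsUnit ((n : ℤ) : ℤ_[p]) := by
    by_contra hcon
    rw [unitChar_of_not_isUnit χ p hpm hcon] at hχn
    exact (u.isUnit.map χ).ne_zero hχn
  obtain ⟨ε, hε⟩ := hun
  refine ⟨ε, ?_, ?_⟩
  · rw [hε]
    have h2 : ((p ^ (condExp m p - 1) : ℕ) : ℤ) ∣ n - 1 := by
      refine dvd_trans ?_ hn1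
      rw [hmp]; push_cast; exact dvd_mul_right _ _
    have h3 := (PadicInt.pow_p_dvd_int_iff (p := p) (condExp m p - 1) (n - 1)).2
      (by exact_mod_cast h2)
    exact_mod_cast h3
  · rw [hε, ← hχn]; exact hu2

/-- A prime power dividing m' belongs to some l ≠ p and also divides m, so divisibility by m' can be
tested in ℤ_l for the primes l ≠ p. -/
theorem ordCompl_dvd_of_forall_dvd (N : ℤ)
    (h : ∀ l : Nat.Primes, (l : ℕ) ≠ p → (m : ℤ_[(l : ℕ)]) ∣ (N : ℤ_[(l : ℕ)])) :
    ((m / p ^ condExp m p : ℕ) : ℤ) ∣ N := by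
  have hp : p.Prime := Fact.out
  rw [Int.natCast_dvd, Nat.dvd_iff_prime_pow_dvd_dvd]
  intro l k hl hk
  rcases Nat.eq_zero_or_pos k with rfl | hk0
  · simp
  have hlp : l ≠ p := by
    rintro rfl
    have h1 : l ∣ m / l ^ condExp m l := (dvd_pow_self l hk0.ne').trans hk
    exact Nat.not_dvd_ordCompl hl (NeZero.ne m) h1
  have : Fact l.Prime := ⟨hl⟩
  have h1 := h ⟨l, hl⟩ hlp
  have h2 : ((l : ℤ_[l]) ^ k) ∣ (m : ℤ_[l]) := by
    have : l ^ k ∣ m := hk.trans (Nat.ordCompl_dvd m p)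
    exact_mod_cast Nat.cast_dvd_cast (α := ℤ_[l]) this
  have h3 := (PadicInt.pow_p_dvd_int_iff (p := l) k N).1 (h2.trans h1)
  rw [← Int.natCast_dvd]
  exact_mod_cast h3

/-- This is uniqueness of the rational factor of an idele: norm at most 1 at every prime leaves
denominator 1, and the same holds for the inverse. -/
theorem rat_eq_one_of_norm_eq_one {q : ℚ} (hq : 0 < q)
    (h : ∀ l : Nat.Primes, ‖(q : ℚ_[(l : ℕ)])‖ = 1) : q = 1 := by
  have key : ∀ r : ℚ, (∀ l : Nat.Primes, ‖(r : ℚ_[(l : ℕ)])‖ = 1) → r.den = 1 := by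
    intro r hr
    by_contra hne
    obtain ⟨l, hl, hld⟩ := Nat.exists_prime_and_dvd hne
    have : Fact l.Prime := ⟨hl⟩
    have h1 := PadicInt.isUnit_den (p := l) r (hr ⟨l, hl⟩).le
    rw [PadicInt.isUnit_iff, PadicInt.norm_natCast_eq_one_iff] at h1
    exact hl.one_lt.ne' (Nat.eq_one_of_dvd_coprimes h1 dvd_rfl hld)
  have h1 := key q h
  have h2 := key q⁻¹ (fun l => by
    have := h l
    rw [Rat.cast_inv, norm_inv, this, inv_one])
  have h3 : q.num = 1 := by
    rw [Rat.inv_def, Rat.den_divInt] at h2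
    have hnum : 0 < q.num := Rat.num_pos.2 hq
    have := hnum.ne'
    simp only [this, if_false] at h2
    have hcop : q.num.gcd (q.den : ℤ) = 1 := by
      rw [h1]; simp
    rw [hcop] at h2
    simp at h2
    omega
  rw [← Rat.num_div_den q, h1, h3]; norm_num

end LocalCharacter

end BinaryCubic

namespace BinaryCubic

/-! ### The idele class character on ℚ_pˣ. -/

section LocalCharacterFormula

variable {m : ℕ} [NeZero m] (χ : DirichletCharacter ℂ m) (p : ℕ) [Fact p.Prime]

/-- The idele concentrated at `p`. -/
noncomputable def ideleAt (t : ℚ_[p]ˣ) : Ideles :=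
  (1, RestrictedProduct.mulSingle
      (fun l : Nat.Primes => integralUnits (l : ℕ)) ⟨p, Fact.out⟩ t)

/-- The data in the definition of `ideleLift`. -/
def IsIdeleWitness (m : ℕ) (x : Ideles) (r : ℝ) (q : ℚ) (z : ∀ l : Nat.Primes, ℤ_[(l : ℕ)]ˣ)
    (n : ℤ) : Prop :=
  0 < r ∧ q ≠ 0 ∧ (x.1 : ℝ) = r * q ∧
      (∀ l : Nat.Primes, (x.2 l : ℚ_[(l : ℕ)]) = ((z l : ℤ_[(l : ℕ)]) : ℚ_[(l : ℕ)]) * q) ∧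
      (∀ l : Nat.Primes, (m : ℤ_[(l : ℕ)]) ∣ (n : ℤ_[(l : ℕ)]) - z l)

/-- `ideleLift` chooses a decomposition, so its value is known once a decomposition exists and all
of them give the same answer. -/
theorem ideleLift_of_witness {x : Ideles} {w : ℂ}
    (hex : ∃ r q z n, IsIdeleWitness m x r q z n)
    (hall : ∀ r q z n, IsIdeleWitness m x r q z n → χ (n : ZMod m) = w) :
    ideleLift χ x = w := by
  unfold ideleLift
  split_ifs with h
  · exact hall _ _ _ _ h.choose_spec.choose_spec.choose_spec.choose_spec
  · exact absurd hex h

theorem ideleAt_same (t : ℚ_[p]ˣ) : (ideleAt p t).2 ⟨p, Fact.out⟩ = t :=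
  RestrictedProduct.mulSingle_eq_same _ _ _

theorem ideleAt_ne (t : ℚ_[p]ˣ) {l : Nat.Primes} (h : (l : ℕ) ≠ p) : (ideleAt p t).2 l = 1 :=
  RestrictedProduct.mulSingle_eq_of_ne _ _ (fun h' => h (by rw [h']))

theorem norm_p_of_ne {l : ℕ} [Fact l.Prime] (h : l ≠ p) : ‖(p : ℚ_[l])‖ = 1 := by
  rw [Padic.norm_natCast_eq_one_iff]
  exact (Nat.coprime_primes Fact.out Fact.out).2 h

theorem natCast_dvd_intCast_of_dvd {R : Type*} [CommRing R] {M : ℕ} {N : ℤ} (h : (M : ℤ) ∣ N) :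
    (M : R) ∣ (N : R) := by
  obtain ⟨w, rfl⟩ := h
  exact ⟨w, by push_cast; rfl⟩

/-- The rational factor must be p^k, which forces z = u at p and z = p^(-k) elsewhere. Thus n ≡ u
modulo p^c and n p^k ≡ 1 modulo m'. -/
theorem witness_value {k : ℤ} {u : ℤ_[p]ˣ} {t : ℚ_[p]ˣ} (ht : (t : ℚ_[p]) = (u : ℤ_[p]) * (p : ℚ_[p]) ^ k)
    {r : ℝ} {q : ℚ} {z : ∀ l : Nat.Primes, ℤ_[(l : ℕ)]ˣ} {n : ℤ}
    (h : IsIdeleWitness m (ideleAt p t) r q z n) :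
    χ (n : ZMod m) = unitChar χ p u * coprimaryPart χ p p ^ (-k) := by
  obtain ⟨hr, hq0, hrq, hz, hn⟩ := h
  have hp : p.Prime := Fact.out
  have hp0 : (p : ℚ) ≠ 0 := Nat.cast_ne_zero.2 hp.ne_zero
  have hrq' : (1 : ℝ) = r * q := hrq
  have hq : 0 < q := by
    have : (0 : ℝ) < q := by
      by_contra hcon
      have := mul_nonpos_of_nonneg_of_nonpos hr.le (not_lt.1 hcon)
      linarith
    exact_mod_cast this
  have hnz : ∀ l : Nat.Primes, ‖((z l : ℤ_[(l : ℕ)]) : ℚ_[(l : ℕ)])‖ = 1 :=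
    fun l => PadicInt.norm_units (z l)
  have hqk : q = (p : ℚ) ^ k := by
    have h1 : q / (p : ℚ) ^ k = 1 := by
      apply rat_eq_one_of_norm_eq_one (div_pos hq (zpow_pos (by exact_mod_cast hp.pos) _))
      intro l
      have hzl := congrArg norm (hz l)
      rw [norm_mul, hnz, one_mul] at hzl
      rw [Rat.cast_div, norm_div, ← hzl, Rat.cast_zpow, Rat.cast_natCast]
      by_cases hl : (l : ℕ) = p
      · obtain ⟨l, hl'⟩ := l
        subst hl
        have : (ideleAt l t).2 ⟨l, hl'⟩ = t := ideleAt_same l t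
        rw [this, ht, norm_mul]
        have : ‖((u : ℤ_[l]) : ℚ_[l])‖ = 1 := PadicInt.norm_units u
        rw [this, one_mul, div_self]
        rw [norm_ne_zero_iff]
        exact zpow_ne_zero _ (by exact_mod_cast hp.ne_zero)
      · rw [ideleAt_ne p t hl, norm_zpow, norm_p_of_ne p hl]
        simp
    rw [div_eq_one_iff_eq (zpow_ne_zero _ hp0)] at h1
    exact h1
  have hzp : (z ⟨p, Fact.out⟩ : ℤ_[p]) = u := by
    have h1 := hz ⟨p, Fact.out⟩
    rw [ideleAt_same, ht, hqk] at h1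
    have hpk : ((((p : ℚ) ^ k : ℚ)) : ℚ_[p]) = (p : ℚ_[p]) ^ k := by push_cast; rfl
    rw [hpk] at h1
    have := mul_right_cancel₀ (zpow_ne_zero k (by exact_mod_cast hp.ne_zero)) h1
    exact (Subtype.coe_injective this).symm
  have hprim : primaryPart χ p n = unitChar χ p u := by
    rw [primaryPart_intCast]
    apply unitChar_congr
    have h1 := hn ⟨p, Fact.out⟩
    rw [hzp] at h1
    refine dvd_trans ?_ h1
    exact_mod_cast Nat.cast_dvd_cast (α := ℤ_[p]) (Nat.ordProj_dvd m p)
  -- Writing k = i - j replaces negative powers of p by a congruence between integers.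
  obtain ⟨i, j, rfl⟩ : ∃ i j : ℕ, k = i - j := ⟨k.toNat, (-k).toNat, by omega⟩
  have hco : ((m / p ^ condExp m p : ℕ) : ℤ) ∣ n * (p : ℤ) ^ i - (p : ℤ) ^ j := by
    apply ordCompl_dvd_of_forall_dvd
    intro l hl
    have h1 := hz l
    rw [ideleAt_ne p t hl, hqk] at h1
    have hpl : (p : ℚ_[(l : ℕ)]) ≠ 0 := by exact_mod_cast hp.ne_zero
    have h2 : (z l : ℤ_[(l : ℕ)]) * (p : ℤ_[(l : ℕ)]) ^ i = (p : ℤ_[(l : ℕ)]) ^ j := by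
      apply Subtype.coe_injective
      push_cast at h1 ⊢
      rw [zpow_sub₀ hpl, zpow_natCast, zpow_natCast] at h1
      field_simp at h1
      exact h1.symm
    have h3 := (hn l).mul_right ((p : ℤ_[(l : ℕ)]) ^ i)
    rw [sub_mul, h2] at h3
    exact_mod_cast h3
  have hco' : coprimaryPart χ p n * coprimaryPart χ p p ^ i = coprimaryPart χ p p ^ j := by
    rw [← map_pow, ← map_pow, ← map_mul]
    congr 1
    rw [← ZMod.intCast_zmod_eq_zero_iff_dvd] at hco
    push_cast at hco
    exact sub_eq_zero.1 hco
  rw [intCast_eq_primary_mul_coprimary χ p, hprim]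
  have h0 := coprimaryPart_p_ne_zero χ p
  congr 1
  rw [neg_sub, zpow_sub₀ h0, zpow_natCast, zpow_natCast, eq_div_iff (pow_ne_zero _ h0), hco']

/-- Take q = p^k, r = p^(-k), z equal to u at p and to p^(-k) at the other primes; the Chinese
remainder theorem supplies n. -/
theorem exists_witness {k : ℤ} {u : ℤ_[p]ˣ} {t : ℚ_[p]ˣ}
    (ht : (t : ℚ_[p]) = (u : ℤ_[p]) * (p : ℚ_[p]) ^ k) :
    ∃ r q z n, IsIdeleWitness m (ideleAt p t) r q z n := by
  have hp : p.Prime := Fact.out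
  have hp0 : (p : ℚ) ≠ 0 := Nat.cast_ne_zero.2 hp.ne_zero
  obtain ⟨P, hP⟩ := isUnit_coprime_modulus (m := m) p
  obtain ⟨n, hn⟩ := ZMod.intCast_surjective ((splitModulus m p).symm
    (PadicInt.toZModPow (condExp m p) (u : ℤ_[p]), ((P ^ (-k) : (ZMod _)ˣ) : ZMod _)))
  have hn' := congrArg (splitModulus m p) hn
  rw [RingEquiv.apply_symm_apply, map_intCast] at hn'
  have hn1 : ((n : ℤ) : ZMod (p ^ condExp m p)) = PadicInt.toZModPow (condExp m p) (u : ℤ_[p]) :=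
    congrArg Prod.fst hn'
  have hn2 : ((n : ℤ) : ZMod (m / p ^ condExp m p)) = ((P ^ (-k) : (ZMod _)ˣ) : ZMod _) :=
    congrArg Prod.snd hn'
  have hpu : ∀ l : Nat.Primes, (l : ℕ) ≠ p → IsUnit (p : ℤ_[(l : ℕ)]) := fun l hl => by
    rw [PadicInt.isUnit_iff, PadicInt.norm_natCast_eq_one_iff]
    exact (Nat.coprime_primes l.2 hp).2 hl
  have hfac : m = p ^ condExp m p * (m / p ^ condExp m p) :=
    (Nat.ordProj_mul_ordCompl_eq_self m p).symm
  classical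
  let z : ∀ l : Nat.Primes, ℤ_[(l : ℕ)]ˣ := Function.update
    (fun l => if h : (l : ℕ) = p then 1 else (hpu l h).unit ^ (-k)) ⟨p, Fact.out⟩ u
  have hzp : (z ⟨p, Fact.out⟩ : ℤ_[p]) = u := congrArg Units.val (Function.update_self _ _ _)
  have hzl : ∀ l : Nat.Primes, ∀ h : (l : ℕ) ≠ p, z l = (hpu l h).unit ^ (-k) :=
    fun l h => by
      have h' : l ≠ ⟨p, Fact.out⟩ := fun h' => h (by rw [h'])
      simp only [z, Function.update_of_ne h', h, dif_neg, not_false_eq_true]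
  refine ⟨(p : ℝ) ^ (-k), (p : ℚ) ^ k, z, n, zpow_pos (by exact_mod_cast hp.pos) _,
    zpow_ne_zero _ hp0, ?_, ?_, ?_⟩
  · change (1 : ℝ) = _
    push_cast
    rw [← zpow_add₀ (by exact_mod_cast hp.ne_zero)]
    simp
  · intro l
    by_cases hl : (l : ℕ) = p
    · obtain ⟨l, hl'⟩ := l
      subst hl
      have h1 : (ideleAt l t).2 ⟨l, hl'⟩ = t := ideleAt_same l t
      have h2 : (z ⟨l, hl'⟩ : ℤ_[l]) = u := hzp
      rw [h1, h2, ht]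
      push_cast
      rfl
    · rw [ideleAt_ne p t hl, hzl l hl]
      have hpl : (p : ℚ_[(l : ℕ)]) ≠ 0 := by exact_mod_cast hp.ne_zero
      have h1 : ((((hpu l hl).unit ^ (-k) : ℤ_[(l : ℕ)]ˣ) : ℤ_[(l : ℕ)]) : ℚ_[(l : ℕ)])
          = (p : ℚ_[(l : ℕ)]) ^ (-k) := by
        have := map_zpow (Units.map (PadicInt.Coe.ringHom (p := (l : ℕ)) : ℤ_[(l : ℕ)] →* ℚ_[(l : ℕ)]))
          (hpu l hl).unit (-k)
        have h2 := congrArg Units.val this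
        rw [Units.val_zpow_eq_zpow_val] at h2
        exact h2
      rw [h1]
      push_cast
      rw [← zpow_add₀ hpl]
      simp
  · intro l
    by_cases hl : (l : ℕ) = p
    · obtain ⟨l, hl'⟩ := l
      subst hl
      have h2 : (z ⟨l, hl'⟩ : ℤ_[l]) = u := hzp
      change (m : ℤ_[l]) ∣ (n : ℤ_[l]) - (z ⟨l, hl'⟩ : ℤ_[l])
      rw [h2]
      have h3 : (l : ℤ_[l]) ^ condExp m l ∣ (n : ℤ_[l]) - u := by
        rw [← toZModPow_eq_iff, map_intCast (PadicInt.toZModPow _)]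
        exact hn1
      have h4 : IsUnit (((m / l ^ condExp m l : ℕ) : ℤ_[l])) := by
        rw [PadicInt.isUnit_iff, PadicInt.norm_natCast_eq_one_iff]
        exact Nat.coprime_ordCompl (Fact.out : l.Prime) (NeZero.ne m)
      have h5 : (m : ℤ_[l]) = (l : ℤ_[l]) ^ condExp m l * ((m / l ^ condExp m l : ℕ) : ℤ_[l]) := by
        exact_mod_cast congrArg (Nat.cast (R := ℤ_[l])) hfac
      rw [h5, h4.mul_right_dvd]
      exact h3
    · obtain ⟨i, j, rfl⟩ : ∃ i j : ℕ, k = i - j := ⟨k.toNat, (-k).toNat, by omega⟩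
      rw [hzl l hl]
      have hU : (hpu l hl).unit ^ (-((i : ℤ) - j)) * (hpu l hl).unit ^ i = (hpu l hl).unit ^ j := by
        rw [← zpow_natCast, ← zpow_natCast, ← zpow_add]; congr 1; ring
      have hU' := congrArg Units.val hU
      rw [Units.val_mul, Units.val_pow_eq_pow_val, Units.val_pow_eq_pow_val, IsUnit.unit_spec] at hU'
      have hV : P ^ (-((i : ℤ) - j)) * P ^ i = P ^ j := by
        rw [← zpow_natCast, ← zpow_natCast, ← zpow_add]; congr 1; ring
      have hV' := congrArg Units.val hV
      rw [Units.val_mul, Units.val_pow_eq_pow_val, Units.val_pow_eq_pow_val, ← hn2, hP] at hV'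
      have h1 : ((m / p ^ condExp m p : ℕ) : ℤ) ∣ n * (p : ℤ) ^ i - (p : ℤ) ^ j := by
        rw [← ZMod.intCast_zmod_eq_zero_iff_dvd]
        push_cast
        rw [hV', sub_self]
      have h2 : ((m / p ^ condExp m p : ℕ) : ℤ_[(l : ℕ)]) ∣
          (n : ℤ_[(l : ℕ)]) * (p : ℤ_[(l : ℕ)]) ^ i - (p : ℤ_[(l : ℕ)]) ^ j := by
        have := natCast_dvd_intCast_of_dvd (R := ℤ_[(l : ℕ)]) h1
        push_cast at this
        exact this
      have h5 : (m : ℤ_[(l : ℕ)]) =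
          (p : ℤ_[(l : ℕ)]) ^ condExp m p * ((m / p ^ condExp m p : ℕ) : ℤ_[(l : ℕ)]) := by
        exact_mod_cast congrArg (Nat.cast (R := ℤ_[(l : ℕ)])) hfac
      rw [h5, ((hpu l hl).pow _).mul_left_dvd, ← ((hpu l hl).pow i).dvd_mul_right, sub_mul, hU']
      exact h2

/-- Moving p^k into the rational factor leaves p^(-k) at every other prime, whence the negative
exponent on the prime-to-p component. -/
theorem localChar_eq (k : ℤ) (u : ℤ_[p]ˣ) :
    localChar χ p ((u : ℤ_[p]) * (p : ℚ_[p]) ^ k) =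
      unitChar χ p u * coprimaryPart χ p p ^ (-k) := by
  have hp : p.Prime := Fact.out
  have h0 : ((u : ℤ_[p]) : ℚ_[p]) * (p : ℚ_[p]) ^ k ≠ 0 := by
    apply mul_ne_zero
    · intro h
      exact u.ne_zero (Subtype.coe_injective h)
    · exact zpow_ne_zero _ (by exact_mod_cast hp.ne_zero)
  unfold localChar
  rw [dif_pos h0]
  exact ideleLift_of_witness χ (exists_witness p rfl) (fun r q z n h => witness_value χ p rfl h)

theorem localChar_unit (u : ℤ_[p]ˣ) : localChar χ p (u : ℤ_[p]) = unitChar χ p u := by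
  have := localChar_eq χ p 0 u
  simpa using this

/-- Every nonzero `p`-adic number is a unit times a power of `p`. -/
theorem exists_unit_mul_zpow {t : ℚ_[p]} (ht : t ≠ 0) :
    ∃ (u : ℤ_[p]ˣ) (k : ℤ), t = (u : ℤ_[p]) * (p : ℚ_[p]) ^ k := by
  have hp : (p : ℚ_[p]) ≠ 0 := by exact_mod_cast (Fact.out : p.Prime).ne_zero
  have h1 : ‖t * (p : ℚ_[p]) ^ (-t.valuation)‖ = 1 := by
    rw [norm_mul, Padic.norm_p_zpow, Padic.norm_eq_zpow_neg_valuation ht, neg_neg,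
      ← zpow_add₀ (by exact_mod_cast (Fact.out : p.Prime).ne_zero)]
    simp
  refine ⟨PadicInt.mkUnits h1, t.valuation, ?_⟩
  rw [PadicInt.mkUnits_eq, mul_assoc, ← zpow_add₀ hp]
  simp

theorem localChar_unit_mul (u : ℤ_[p]ˣ) (t : ℚ_[p]) :
    localChar χ p ((u : ℤ_[p]) * t) = unitChar χ p u * localChar χ p t := by
  by_cases ht : t = 0
  · simp [ht, localChar]
  obtain ⟨w, k, rfl⟩ := exists_unit_mul_zpow p ht
  rw [localChar_eq]
  have h := localChar_eq χ p k (u * w)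
  rw [Units.val_mul, map_mul, PadicInt.coe_mul, mul_assoc] at h
  rw [h, mul_assoc]

end LocalCharacterFormula

end BinaryCubic

namespace BinaryCubic

/-! ### Volumes of residue classes in ℚ_p and ℚ_pˣ. -/

section Volumes

open MeasureTheory

variable (p : ℕ) [Fact p.Prime]

/-- The set of `p`-adic integers in `ℚ_p` with a given residue modulo `p ^ e`. -/
def residueClass (e : ℕ) (s : ZMod (p ^ e)) : Set ℚ_[p] :=
  {t | ∃ y : ℤ_[p], (y : ℚ_[p]) = t ∧ PadicInt.toZModPow e y = s}

theorem coe_mem_residueClass (e : ℕ) (s : ZMod (p ^ e)) (y : ℤ_[p]) :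
    (y : ℚ_[p]) ∈ residueClass p e s ↔ PadicInt.toZModPow e y = s :=
  ⟨fun ⟨z, hz, h⟩ => by rwa [← Subtype.coe_injective hz], fun h => ⟨y, rfl, h⟩⟩

theorem residueClass_eq_closedBall (e : ℕ) (y : ℤ_[p]) :
    residueClass p e (PadicInt.toZModPow e y) =
      Metric.closedBall (y : ℚ_[p]) ((p : ℝ) ^ (-e : ℤ)) := by
  have key : ∀ z : ℤ_[p], PadicInt.toZModPow e z = PadicInt.toZModPow e y ↔
      ‖(z : ℚ_[p]) - y‖ ≤ (p : ℝ) ^ (-e : ℤ) := fun z => by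
    rw [toZModPow_eq_iff, ← Ideal.mem_span_singleton, ← PadicInt.norm_le_pow_iff_mem_span_pow]
    rfl
  ext t
  rw [Metric.mem_closedBall, dist_eq_norm]
  constructor
  · rintro ⟨z, rfl, hz⟩
    exact (key z).1 hz
  · intro h
    have h1 : (p : ℝ) ^ (-e : ℤ) ≤ 1 := by
      apply zpow_le_one_of_nonpos₀
      · exact_mod_cast (Fact.out : p.Prime).one_lt.le
      · omega
    have h2 : ‖t‖ ≤ 1 := by
      have := IsUltrametricDist.norm_add_le_max (t - (y : ℚ_[p])) (y : ℚ_[p])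
      rw [sub_add_cancel] at this
      exact this.trans (max_le (h.trans h1) (PadicInt.norm_le_one y))
    exact ⟨⟨t, h2⟩, rfl, (key ⟨t, h2⟩).2 h⟩

theorem exists_toZModPow_eq (e : ℕ) (s : ZMod (p ^ e)) : ∃ y : ℤ_[p], PadicInt.toZModPow e y = s :=
  ZMod.ringHom_surjective _ s

theorem isOpen_residueClass (e : ℕ) (s : ZMod (p ^ e)) : IsOpen (residueClass p e s) := by
  obtain ⟨y, rfl⟩ := exists_toZModPow_eq p e s
  rw [residueClass_eq_closedBall]
  apply IsUltrametricDist.isOpen_closedBall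
  exact zpow_ne_zero _ (by exact_mod_cast (Fact.out : p.Prime).ne_zero)

theorem pairwise_disjoint_residueClass (e : ℕ) :
    Pairwise (Function.onFun Disjoint (residueClass p e)) := by
  intro s s' hs
  rw [Function.onFun, Set.disjoint_left]
  rintro t ⟨y, rfl, hy⟩ ht
  rw [coe_mem_residueClass] at ht
  exact hs (hy.symm.trans ht)

/-- Applied to classes in ℤ_p, ℤ_pˣ and GL₂(ℤ_p), where translations show that all classes have the
same volume. -/
theorem measure_of_equal_partition {Ω ι : Type*} [MeasurableSpace Ω] [Fintype ι] [Nonempty ι]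
    (μ : Measure Ω) {A : ι → Set Ω} (hm : ∀ i, MeasurableSet (A i))
    (hd : Pairwise (Function.onFun Disjoint A)) (heq : ∀ i j, μ (A i) = μ (A j))
    (h1 : μ (⋃ i, A i) = 1) (i : ι) : μ (A i) = (Fintype.card ι : ENNReal)⁻¹ := by
  rw [measure_iUnion hd hm, tsum_fintype, Finset.sum_congr rfl (fun j _ => heq j i),
    Finset.sum_const, Finset.card_univ, nsmul_eq_mul] at h1
  exact ENNReal.eq_inv_of_mul_eq_one_left (by rwa [mul_comm])

instance : (addHaarQ p).IsAddHaarMeasure := by unfold addHaarQ; infer_instance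

instance : (mulHaarQ p).IsHaarMeasure := by unfold mulHaarQ; infer_instance

instance : (haarGL p).IsHaarMeasure := by unfold haarGL; infer_instance

theorem addHaarQ_residueClass (e : ℕ) (s : ZMod (p ^ e)) :
    addHaarQ p (residueClass p e s) = ((p ^ e : ℕ) : ENNReal)⁻¹ := by
  have := measure_of_equal_partition (addHaarQ p) (A := residueClass p e)
    (fun s => (isOpen_residueClass p e s).measurableSet) (pairwise_disjoint_residueClass p e)
    ?_ ?_ s
  · rw [this, ZMod.card]
  · have key : ∀ s, addHaarQ p (residueClass p e s) = addHaarQ p (residueClass p e 0) := by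
      intro s
      obtain ⟨y, rfl⟩ := exists_toZModPow_eq p e s
      rw [← measure_preimage_add (addHaarQ p) (y : ℚ_[p])]
      congr 1
      ext t
      rw [Set.mem_preimage]
      constructor
      · rintro ⟨z, hz, h⟩
        refine ⟨z - y, ?_, by rw [map_sub, h, sub_self]⟩
        push_cast; rw [hz]; ring
      · rintro ⟨z, rfl, h⟩
        exact ⟨y + z, by push_cast; rfl, by rw [map_add, h, add_zero]⟩
    exact fun i j => (key i).trans (key j).symm
  · have : (⋃ s, residueClass p e s) = (intCompacts p : Set ℚ_[p]) := by
      ext t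
      rw [Set.mem_iUnion]
      change _ ↔ t ∈ Metric.closedBall (0 : ℚ_[p]) 1
      rw [mem_closedBall_zero_iff]
      constructor
      · rintro ⟨s, y, rfl, -⟩; exact PadicInt.norm_le_one y
      · intro h; exact ⟨_, ⟨t, h⟩, rfl, rfl⟩
    rw [this]
    exact Measure.addHaarMeasure_self

theorem isUnit_of_isUnit_toZModPow {e : ℕ} (he : e ≠ 0) {y : ℤ_[p]}
    (h : IsUnit (PadicInt.toZModPow e y)) : IsUnit y := by
  obtain ⟨w, hw⟩ := h.exists_right_inv
  obtain ⟨z, rfl⟩ := exists_toZModPow_eq p e w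
  rw [← map_mul, ← map_one (PadicInt.toZModPow (p := p) e), toZModPow_eq_iff] at hw
  have h2 : (p : ℤ_[p]) ∣ y * z - 1 := (dvd_pow_self _ he).trans hw
  by_contra hx
  rw [PadicInt.isUnit_iff] at hx
  have h3 : ‖y‖ < 1 := lt_of_le_of_ne (PadicInt.norm_le_one y) hx
  rw [PadicInt.norm_lt_one_iff_dvd] at h3
  have h4 : (p : ℤ_[p]) ∣ 1 := by
    have := (h3.mul_right z).sub h2
    simpa using this
  exact PadicInt.prime_p.not_isUnit (isUnit_of_dvd_one h4)

theorem isUnit_toZModPow_iff {e : ℕ} (he : e ≠ 0) (y : ℤ_[p]) :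
    IsUnit (PadicInt.toZModPow e y) ↔ IsUnit y :=
  ⟨isUnit_of_isUnit_toZModPow p he, fun h => h.map _⟩

theorem isUnit_iff_not_dvd (y : ℤ_[p]) : IsUnit y ↔ ¬ (p : ℤ_[p]) ∣ y := by
  rw [← PadicInt.norm_lt_one_iff_dvd, PadicInt.isUnit_iff, not_lt]
  exact ⟨fun h => h.ge, fun h => le_antisymm (PadicInt.norm_le_one y) h⟩

/-- The trace on `ℚ_pˣ` of a residue class. -/
def unitsClass (e : ℕ) (s : ZMod (p ^ e)) : Set ℚ_[p]ˣ := {t | (t : ℚ_[p]) ∈ residueClass p e s}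

theorem isOpen_unitsClass (e : ℕ) (s : ZMod (p ^ e)) : IsOpen (unitsClass p e s) :=
  (isOpen_residueClass p e s).preimage Units.continuous_val

/-- A unit of `ℤ_p` as a unit of `ℚ_p`. -/
noncomputable abbrev coeUnit (u : ℤ_[p]ˣ) : ℚ_[p]ˣ :=
  Units.map (PadicInt.Coe.ringHom (p := p) : ℤ_[p] →* ℚ_[p]) u

theorem coeUnit_mul_mem_unitsClass (e : ℕ) (u : ℤ_[p]ˣ) (s : ZMod (p ^ e)) (t : ℚ_[p]ˣ) :
    coeUnit p u * t ∈ unitsClass p e (PadicInt.toZModPow e (u : ℤ_[p]) * s) ↔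
      t ∈ unitsClass p e s := by
  constructor
  · rintro ⟨z, hz, h⟩
    refine ⟨(u⁻¹ : ℤ_[p]ˣ) * z, ?_, ?_⟩
    · rw [PadicInt.coe_mul, hz, Units.val_mul, ← mul_assoc]
      change (((u⁻¹ : ℤ_[p]ˣ) : ℤ_[p]) : ℚ_[p]) * ((u : ℤ_[p]) : ℚ_[p]) * _ = _
      rw [← PadicInt.coe_mul, Units.inv_mul, PadicInt.coe_one, one_mul]
    · rw [map_mul, h, ← mul_assoc, ← map_mul, Units.inv_mul, map_one, one_mul]
  · rintro ⟨z, hz, h⟩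
    exact ⟨u * z, by rw [PadicInt.coe_mul, hz]; rfl, by rw [map_mul, h]⟩

theorem mulHaarQ_unitsClass {e : ℕ} (he : e ≠ 0) (u : ℤ_[p]ˣ) :
    mulHaarQ p (unitsClass p e (PadicInt.toZModPow e (u : ℤ_[p]))) =
      (((p ^ e).totient : ℕ) : ENNReal)⁻¹ := by
  have := measure_of_equal_partition (mulHaarQ p)
    (A := fun s : (ZMod (p ^ e))ˣ => unitsClass p e (s : ZMod (p ^ e)))
    (fun s => (isOpen_unitsClass p e s).measurableSet) ?_ ?_ ?_ (Units.map
      (PadicInt.toZModPow (p := p) e).toMonoidHom u)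
  · rw [ZMod.card_units_eq_totient] at this
    exact this
  · intro s s' hs
    rw [Function.onFun, Set.disjoint_left]
    rintro t ht ht'
    exact Set.disjoint_left.1 (pairwise_disjoint_residueClass p e
      (fun h => hs (Units.ext h))) ht ht'
  · have key : ∀ s : (ZMod (p ^ e))ˣ, mulHaarQ p (unitsClass p e s) =
        mulHaarQ p (unitsClass p e 1) := by
      intro s
      obtain ⟨y, hy⟩ := exists_toZModPow_eq p e (s : ZMod (p ^ e))
      obtain ⟨w, rfl⟩ := isUnit_of_isUnit_toZModPow p he (by rw [hy]; exact s.isUnit)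
      rw [← measure_preimage_mul (mulHaarQ p) (coeUnit p w), ← hy]
      congr 1
      ext t
      rw [Set.mem_preimage]
      have := coeUnit_mul_mem_unitsClass p e w 1 t
      rwa [mul_one] at this
    exact fun i j => (key i).trans (key j).symm
  · have : (⋃ s : (ZMod (p ^ e))ˣ, unitsClass p e (s : ZMod (p ^ e)))
        = (unitCompacts p : Set ℚ_[p]ˣ) := by
      ext t
      rw [Set.mem_iUnion]
      change _ ↔ t ∈ (integralUnits p : Set ℚ_[p]ˣ)
      constructor
      · rintro ⟨s, y, hy, hs⟩
        obtain ⟨w, rfl⟩ := isUnit_of_isUnit_toZModPow p he (by rw [hs]; exact s.isUnit)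
        exact ⟨w, Units.ext hy⟩
      · rintro ⟨w, rfl⟩
        exact ⟨Units.map (PadicInt.toZModPow (p := p) e).toMonoidHom w, w, rfl, rfl⟩
    rw [this]
    exact Measure.haarMeasure_self

/-- `p` as a unit of `ℚ_p`. -/
noncomputable def pUnit : ℚ_[p]ˣ :=
  Units.mk0 (p : ℚ_[p]) (by exact_mod_cast (Fact.out : p.Prime).ne_zero)

theorem pUnit_mul_mem_unitsClass (e : ℕ) (y : ℤ_[p]) (t : ℚ_[p]ˣ) :
    pUnit p * t ∈ unitsClass p (e + 1) (PadicInt.toZModPow (e + 1) ((p : ℤ_[p]) * y)) ↔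
      t ∈ unitsClass p e (PadicInt.toZModPow e y) := by
  have hp : (p : ℤ_[p]) ≠ 0 := by exact_mod_cast (Fact.out : p.Prime).ne_zero
  have hp' : (p : ℚ_[p]) ≠ 0 := by exact_mod_cast (Fact.out : p.Prime).ne_zero
  constructor
  · rintro ⟨z, hz, h⟩
    rw [toZModPow_eq_iff] at h
    obtain ⟨w, hw⟩ := h
    have hzw : z = p * (y + p ^ e * w) := by linear_combination hw
    refine ⟨y + p ^ e * w, ?_, ?_⟩
    · rw [hzw, Units.val_mul, PadicInt.coe_mul] at hz
      change ((p : ℤ_[p]) : ℚ_[p]) * _ = (p : ℚ_[p]) * _ at hz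
      exact mul_left_cancel₀ hp' hz
    · rw [toZModPow_eq_iff]; exact ⟨w, by ring⟩
  · rintro ⟨z, hz, h⟩
    refine ⟨p * z, by rw [PadicInt.coe_mul, hz]; rfl, ?_⟩
    rw [toZModPow_eq_iff] at h ⊢
    obtain ⟨w, hw⟩ := h
    exact ⟨w, by linear_combination (p : ℤ_[p]) * hw⟩

/-- The class of p·u modulo p^(e+1) is p times the class of u modulo p^e, so its multiplicative
volume is governed by e, not e + 1. -/
theorem mulHaarQ_unitsClass_p_mul {e : ℕ} (he : e ≠ 0) (u : ℤ_[p]ˣ) :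
    mulHaarQ p (unitsClass p (e + 1) (PadicInt.toZModPow (e + 1) ((p : ℤ_[p]) * u))) =
      (((p ^ e).totient : ℕ) : ENNReal)⁻¹ := by
  rw [← mulHaarQ_unitsClass p he u, ← measure_preimage_mul (mulHaarQ p) (pUnit p)]
  congr 1
  ext t
  exact pUnit_mul_mem_unitsClass p e u t

theorem mulHaarQ_norm_eq (k : ℕ) :
    mulHaarQ p {t : ℚ_[p]ˣ | ‖(t : ℚ_[p])‖ = (p : ℝ) ^ (-k : ℤ)} = 1 := by
  have h0 : mulHaarQ p (integralUnits p : Set ℚ_[p]ˣ) = 1 := Measure.haarMeasure_self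
  rw [← h0, ← measure_preimage_mul (mulHaarQ p) (pUnit p ^ k)]
  congr 1
  ext t
  have hp : (p : ℝ) ≠ 0 := by exact_mod_cast (Fact.out : p.Prime).ne_zero
  rw [Set.mem_preimage, Set.mem_ofPred_eq, Units.val_mul, Units.val_pow_eq_pow_val, norm_mul,
    norm_pow]
  change ‖(p : ℚ_[p])‖ ^ k * _ = _ ↔ t ∈ (integralUnits p : Set ℚ_[p]ˣ)
  rw [Padic.norm_p, zpow_neg, zpow_natCast, inv_pow, mul_eq_left₀ (inv_ne_zero (pow_ne_zero _ hp))]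
  constructor
  · intro h
    exact ⟨PadicInt.mkUnits h, Units.ext rfl⟩
  · rintro ⟨w, rfl⟩
    exact PadicInt.norm_units w

end Volumes

/-! ### Haar integrals over GL₂(ℤ_p) as averages over GL₂(ℤ/p^e). -/

section FiniteLevel

open MeasureTheory

variable (p : ℕ) [Fact p.Prime]

theorem map_val_apply {R S : Type*} [CommRing R] [CommRing S] (f : R →+* S) (g : GL (Fin 2) R)
    (i j : Fin 2) : (Matrix.GeneralLinearGroup.map f g).val i j = f (g.val i j) := rfl

theorem gl_map_surjective {e : ℕ} (he : e ≠ 0) :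
    Function.Surjective (Matrix.GeneralLinearGroup.map (n := Fin 2)
      (PadicInt.toZModPow (p := p) e)) := by
  intro γ
  choose f hf using exists_toZModPow_eq p e
  have hdet : IsUnit (f (γ.val 0 0) * f (γ.val 1 1) - f (γ.val 0 1) * f (γ.val 1 0)) := by
    apply isUnit_of_isUnit_toZModPow p he
    rw [map_sub, map_mul, map_mul, hf, hf, hf, hf]
    exact isUnit_ddet γ
  refine ⟨glOf _ _ _ _ hdet, ?_⟩
  ext i j
  rw [map_val_apply, glOf_val]
  fin_cases i <;> fin_cases j <;> simp [hf]

theorem isOpen_gl_fiber (e : ℕ) (γ : GL (Fin 2) (ZMod (p ^ e))) :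
    IsOpen {g : GL (Fin 2) ℤ_[p] |
      Matrix.GeneralLinearGroup.map (PadicInt.toZModPow (p := p) e) g = γ} := by
  have h1 : {g : GL (Fin 2) ℤ_[p] |
      Matrix.GeneralLinearGroup.map (PadicInt.toZModPow (p := p) e) g = γ} =
      ⋂ i : Fin 2, ⋂ j : Fin 2, (fun g : GL (Fin 2) ℤ_[p] => ((g.val i j : ℤ_[p]) : ℚ_[p])) ⁻¹'
        residueClass p e (γ.val i j) := by
    ext g
    simp only [Set.mem_iInter, Set.mem_preimage, coe_mem_residueClass, Set.mem_ofPred_eq]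
    constructor
    · rintro rfl i j; rfl
    · intro h; ext i j; exact h i j
  rw [h1]
  refine isOpen_iInter_of_finite fun i => isOpen_iInter_of_finite fun j => ?_
  refine (isOpen_residueClass p e _).preimage ?_
  refine continuous_subtype_val.comp ?_
  exact (Units.continuous_val (M := Matrix (Fin 2) (Fin 2) ℤ_[p])).matrix_elem i j

theorem haarGL_univ : haarGL p Set.univ = 1 := by
  have := Measure.haarMeasure_self (K₀ := (⊤ : TopologicalSpace.PositiveCompacts (GL (Fin 2) ℤ_[p])))
  exact this

instance : IsProbabilityMeasure (haarGL p) := ⟨haarGL_univ p⟩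

/-- The fibres of reduction modulo p^e are cosets of its kernel, hence open of equal volume. -/
theorem integral_haarGL {e : ℕ} (he : e ≠ 0) (f : GL (Fin 2) (ZMod (p ^ e)) → ℂ) :
    ∫ g, f (Matrix.GeneralLinearGroup.map (PadicInt.toZModPow (p := p) e) g) ∂(haarGL p) =
      (Fintype.card (GL (Fin 2) (ZMod (p ^ e))) : ℂ)⁻¹ * ∑ γ, f γ := by
  set π := Matrix.GeneralLinearGroup.map (n := Fin 2) (PadicInt.toZModPow (p := p) e) with hπ
  let A : GL (Fin 2) (ZMod (p ^ e)) → Set (GL (Fin 2) ℤ_[p]) := fun γ => {g | π g = γ}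
  have hA : ∀ γ, MeasurableSet (A γ) := fun γ => (isOpen_gl_fiber p e γ).measurableSet
  have hvol : ∀ γ, haarGL p (A γ) = (Fintype.card (GL (Fin 2) (ZMod (p ^ e))) : ENNReal)⁻¹ := by
    apply measure_of_equal_partition (haarGL p) hA
    · intro γ γ' h
      rw [Function.onFun, Set.disjoint_left]
      intro g hg hg'
      exact h (hg.symm.trans hg')
    · have key : ∀ γ, haarGL p (A γ) = haarGL p (A 1) := by
        intro γ
        obtain ⟨k, rfl⟩ := gl_map_surjective p he γ
        rw [← measure_preimage_mul (haarGL p) k]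
        congr 1
        ext g
        change π (k * g) = π k ↔ π g = 1
        rw [map_mul, mul_eq_left]
      exact fun i j => (key i).trans (key j).symm
    · rw [← haarGL_univ p]
      congr 1
      ext g
      simp [A]
  have hsum : ∀ g, f (π g) = ∑ γ, (A γ).indicator (fun _ => f γ) g := by
    intro g
    classical
    rw [Finset.sum_eq_single (π g)]
    · rw [Set.indicator_of_mem (show g ∈ A (π g) from rfl)]
    · intro γ _ h
      exact Set.indicator_of_notMem (fun h' => h (Eq.symm h')) _
    · simp
  simp_rw [hsum]
  rw [integral_finsetSum _ (fun γ _ => (integrable_const (f γ)).indicator (hA γ)), Finset.mul_sum]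
  refine Finset.sum_congr rfl fun γ _ => ?_
  rw [integral_indicator_const _ (hA γ), Measure.real, hvol]
  simp

end FiniteLevel

end BinaryCubic

namespace BinaryCubic

/-! ### Integrals of χ̃_p(t)|t|^(1/3) over residue classes. -/

section ClassIntegrals

open MeasureTheory

variable {m : ℕ} [NeZero m] (χ : DirichletCharacter ℂ m) (p : ℕ) [Fact p.Prime]

theorem norm_localChar (hχ3 : χ ^ 3 = 1) (t : ℚ_[p]ˣ) : ‖localChar χ p t‖ = 1 := by
  obtain ⟨u, k, h⟩ := exists_unit_mul_zpow p t.ne_zero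
  rw [h, localChar_eq, norm_mul, norm_zpow,
    Complex.norm_eq_one_of_pow_eq_one (unitChar_pow_three χ p hχ3 u.isUnit) three_ne_zero,
    Complex.norm_eq_one_of_pow_eq_one
      (coprimaryPart_pow_three χ p hχ3 (isUnit_coprime_modulus p)) three_ne_zero]
  simp

theorem continuous_localChar (hpm : p ∣ m) : Continuous fun t : ℚ_[p]ˣ => localChar χ p t := by
  have hc : condExp m p ≠ 0 :=
    (Nat.Prime.factorization_pos_of_dvd (Fact.out : p.Prime) (NeZero.ne m) hpm).ne'
  apply IsLocallyConstant.continuous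
  rw [IsLocallyConstant.iff_eventually_eq]
  intro t
  have hopen : IsOpen {x : ℚ_[p]ˣ | t⁻¹ * x ∈ unitsClass p (condExp m p) 1} :=
    (isOpen_unitsClass p _ 1).preimage (continuous_const.mul continuous_id)
  have hmem : t ∈ {x : ℚ_[p]ˣ | t⁻¹ * x ∈ unitsClass p (condExp m p) 1} := by
    change t⁻¹ * t ∈ unitsClass p (condExp m p) 1
    rw [inv_mul_cancel]
    exact ⟨1, by simp, map_one _⟩
  filter_upwards [hopen.mem_nhds hmem] with x hx
  obtain ⟨y, hy, h⟩ := hx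
  obtain ⟨w, rfl⟩ := isUnit_of_isUnit_toZModPow p hc (by rw [h]; exact isUnit_one)
  have hx : (x : ℚ_[p]) = (w : ℤ_[p]) * (t : ℚ_[p]) := by
    rw [hy, ← Units.val_mul, mul_comm, mul_inv_cancel_left]
  rw [hx, localChar_unit_mul, unitChar_apply, h, map_one, one_mul]

/-- The weight `χ̃_p(t)|t|^{1/3}`. -/
noncomputable def weight (t : ℚ_[p]ˣ) : ℂ :=
  localChar χ p (t : ℚ_[p]) * ((‖(t : ℚ_[p])‖ : ℝ) : ℂ) ^ (1 / 3 : ℂ)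

theorem continuous_weight (hpm : p ∣ m) : Continuous (weight χ p) := by
  apply (continuous_localChar χ p hpm).mul
  exact (Complex.continuous_ofReal_cpow_const (by norm_num)).comp
    (continuous_norm.comp Units.continuous_val)

theorem norm_weight (hχ3 : χ ^ 3 = 1) (t : ℚ_[p]ˣ) :
    ‖weight χ p t‖ = ‖(t : ℚ_[p])‖ ^ (1 / 3 : ℝ) := by
  rw [weight, norm_mul, norm_localChar χ p hχ3, one_mul,
    Complex.norm_cpow_eq_rpow_re_of_pos (norm_pos_iff.2 t.ne_zero)]
  norm_num

theorem weight_coeUnit_mul (u : ℤ_[p]ˣ) (t : ℚ_[p]ˣ) :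
    weight χ p (coeUnit p u * t) = unitChar χ p u * weight χ p t := by
  have h1 : ((coeUnit p u * t : ℚ_[p]ˣ) : ℚ_[p]) = (u : ℤ_[p]) * (t : ℚ_[p]) := rfl
  have h2 : ‖((u : ℤ_[p]) : ℚ_[p])‖ = 1 := PadicInt.norm_units u
  rw [weight, weight, h1, localChar_unit_mul, norm_mul, h2, one_mul, mul_assoc]

instance : SecondCountableTopology ℚ_[p]ˣ := Units.isEmbedding_val₀.secondCountableTopology

/-- The class of 0 contains elements of arbitrarily small norm. On the sphere |t| = p^(-k), of
volume 1, the weight has absolute value p^(-k/3), and the geometric series converges. -/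
theorem integrable_weight (hχ3 : χ ^ 3 = 1) (hpm : p ∣ m) (e : ℕ) (s : ZMod (p ^ e)) :
    Integrable ((unitsClass p e s).indicator (weight χ p)) (mulHaarQ p) := by
  have hp1 : (1 : ℝ) < p := by exact_mod_cast (Fact.out : p.Prime).one_lt
  have hp0 : (0 : ℝ) < p := by linarith
  rw [integrable_indicator_iff (isOpen_unitsClass p e s).measurableSet]
  let S : ℕ → Set ℚ_[p]ˣ := fun k => {t | ‖(t : ℚ_[p])‖ = (p : ℝ) ^ (-k : ℤ)}
  have hS : ∀ k, MeasurableSet (S k) := fun k => by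
    apply measurableSet_eq_fun _ measurable_const
    exact (continuous_norm.comp Units.continuous_val).measurable
  have hsub : unitsClass p e s ⊆ ⋃ k, S k := by
    rintro t ⟨y, hy, -⟩
    have hy0 : y ≠ 0 := by
      rintro rfl
      exact t.ne_zero hy.symm
    rw [Set.mem_iUnion]
    refine ⟨y.valuation, ?_⟩
    change ‖(t : ℚ_[p])‖ = _
    rw [← hy]
    exact PadicInt.norm_eq_zpow_neg_valuation hy0
  refine IntegrableOn.mono_set ?_ hsub
  have hval : ∀ k, ∀ t ∈ S k, ‖weight χ p t‖ = ((p : ℝ) ^ (-(1 / 3) : ℝ)) ^ k := by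
    intro k t ht
    rw [norm_weight χ p hχ3]
    change ‖(t : ℚ_[p])‖ = _ at ht
    rw [ht, zpow_neg, zpow_natCast, ← Real.rpow_natCast, ← Real.rpow_natCast,
      ← Real.rpow_neg hp0.le, ← Real.rpow_mul hp0.le, ← Real.rpow_mul hp0.le]
    ring_nf
  have hμ : ∀ k, mulHaarQ p (S k) = 1 := fun k => mulHaarQ_norm_eq p k
  apply integrableOn_iUnion_of_summable_integral_norm
  · intro k
    refine Measure.integrableOn_of_bounded (by rw [hμ]; exact ENNReal.one_ne_top)
      (continuous_weight χ p hpm).aestronglyMeasurable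
      (M := ((p : ℝ) ^ (-(1 / 3) : ℝ)) ^ k) ?_
    rw [ae_restrict_iff' (hS k)]
    exact Filter.Eventually.of_forall fun t ht => (hval k t ht).le
  · have : (fun k => ∫ t in S k, ‖weight χ p t‖ ∂(mulHaarQ p)) =
        fun k => ((p : ℝ) ^ (-(1 / 3) : ℝ)) ^ k := by
      funext k
      rw [setIntegral_congr_fun (hS k) (hval k), setIntegral_const, Measure.real, hμ]
      simp
    rw [this]
    apply summable_geometric_of_lt_one (by positivity)
    exact Real.rpow_lt_one_of_one_lt_of_neg hp1 (by norm_num)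

/-- The integral of `χ̃_p(t)|t|^{1/3}` over a residue class. -/
noncomputable def classIntegral (e : ℕ) (s : ZMod (p ^ e)) : ℂ :=
  ∫ t, (unitsClass p e s).indicator (weight χ p) t ∂(mulHaarQ p)

theorem classIntegral_unit_mul (e : ℕ) (u : ℤ_[p]ˣ) (s : ZMod (p ^ e)) :
    classIntegral χ p e (PadicInt.toZModPow e (u : ℤ_[p]) * s) =
      unitChar χ p u * classIntegral χ p e s := by
  unfold classIntegral
  rw [← integral_mul_left_eq_self _ (coeUnit p u), ← integral_const_mul]
  congr 1
  funext t
  by_cases ht : t ∈ unitsClass p e s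
  · rw [Set.indicator_of_mem ht,
      Set.indicator_of_mem ((coeUnit_mul_mem_unitsClass p e u s t).2 ht), weight_coeUnit_mul]
  · rw [Set.indicator_of_notMem ht, mul_zero,
      Set.indicator_of_notMem (fun h => ht ((coeUnit_mul_mem_unitsClass p e u s t).1 h))]

theorem classIntegral_of_forall_eq {e : ℕ} {s : ZMod (p ^ e)} {w : ℂ}
    (h : ∀ t ∈ unitsClass p e s, weight χ p t = w) :
    classIntegral χ p e s = (mulHaarQ p).real (unitsClass p e s) * w := by
  unfold classIntegral
  have : (unitsClass p e s).indicator (weight χ p) = (unitsClass p e s).indicator fun _ => w := by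
    funext t
    by_cases ht : t ∈ unitsClass p e s
    · rw [Set.indicator_of_mem ht, Set.indicator_of_mem ht, h t ht]
    · rw [Set.indicator_of_notMem ht, Set.indicator_of_notMem ht]
  rw [this, integral_indicator_const _ (isOpen_unitsClass p e s).measurableSet]
  simp

theorem classIntegral_unit {e : ℕ} (he : e ≠ 0) (hce : condExp m p ≤ e) (u : ℤ_[p]ˣ) :
    classIntegral χ p e (PadicInt.toZModPow e (u : ℤ_[p])) =
      ((p ^ e).totient : ℂ)⁻¹ * unitChar χ p u := by
  rw [classIntegral_of_forall_eq χ p (w := unitChar χ p u), Measure.real,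
    mulHaarQ_unitsClass p he]
  · simp
  · rintro t ⟨y, hy, h⟩
    obtain ⟨w, rfl⟩ := isUnit_of_isUnit_toZModPow p he (by rw [h]; exact u.isUnit.map _)
    have h2 : ‖((w : ℤ_[p]) : ℚ_[p])‖ = 1 := PadicInt.norm_units w
    rw [weight, ← hy, localChar_unit, h2]
    simp only [Complex.ofReal_one, Complex.one_cpow, mul_one]
    rw [toZModPow_eq_iff] at h
    exact unitChar_congr χ p ((pow_dvd_pow _ hce).trans h)

/-- Every element of the class is p·w with w ≡ u modulo p^e, and c ≤ e makes the weight constant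
there. -/
theorem classIntegral_p_mul_unit {e : ℕ} (he : e ≠ 0) (hce : condExp m p ≤ e) (u : ℤ_[p]ˣ) :
    classIntegral χ p (e + 1) (PadicInt.toZModPow (e + 1) ((p : ℤ_[p]) * u)) =
      ((p ^ e).totient : ℂ)⁻¹ * (unitChar χ p u * (coprimaryPart χ p p)⁻¹
        * (p : ℂ) ^ (-(1 / 3) : ℂ)) := by
  have hp : (p : ℤ_[p]) ≠ 0 := by exact_mod_cast (Fact.out : p.Prime).ne_zero
  rw [classIntegral_of_forall_eq χ p (w := unitChar χ p u * (coprimaryPart χ p p)⁻¹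
        * (p : ℂ) ^ (-(1 / 3) : ℂ)), Measure.real, mulHaarQ_unitsClass_p_mul p he]
  · simp
  · rintro t ⟨y, hy, h⟩
    rw [toZModPow_eq_iff] at h
    obtain ⟨z, hz⟩ := h
    have hyw : y = p * (u + p ^ e * z) := by linear_combination hz
    have hu : IsUnit ((u : ℤ_[p]) + p ^ e * z) := by
      rw [isUnit_iff_not_dvd]
      intro h
      have h1 := (Dvd.dvd.mul_right (dvd_pow_self (p : ℤ_[p]) he) z)
      have h2 := (dvd_add_left h1).1 h
      exact (isUnit_iff_not_dvd p _).1 u.isUnit h2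
    obtain ⟨w, hw⟩ := hu
    rw [← hw] at hyw
    have hl := localChar_eq χ p 1 w
    have ht : (t : ℚ_[p]) = (w : ℤ_[p]) * (p : ℚ_[p]) ^ (1 : ℤ) := by
      rw [← hy, hyw, zpow_one, PadicInt.coe_mul, mul_comm]; rfl
    have h2 : ‖((w : ℤ_[p]) : ℚ_[p])‖ = 1 := PadicInt.norm_units w
    have h3 : unitChar χ p w = unitChar χ p u := by
      apply unitChar_congr
      refine (pow_dvd_pow _ hce).trans ⟨z, ?_⟩
      rw [hw]; ring
    rw [weight, ht, hl, h3, norm_mul, h2, one_mul, zpow_one, Padic.norm_p, zpow_neg_one]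
    congr 1
    rw [Complex.ofReal_inv, Complex.ofReal_natCast, Complex.inv_cpow, Complex.cpow_neg]
    rw [Complex.natCast_arg]
    exact Real.pi_pos.ne

end ClassIntegrals

/-! ### The residue factor as a finite sum. -/

section Residue

open MeasureTheory

variable {m : ℕ} [NeZero m] (χ : DirichletCharacter ℂ m) (p : ℕ) [Fact p.Prime]

theorem charFun_coe (e : ℕ) (a y : Form ℤ_[p]) :
    charFun p e a (fun i => (y i : ℚ_[p])) =
      if mapForm (PadicInt.toZModPow e) y = mapForm (PadicInt.toZModPow e) a then 1 else 0 := by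
  unfold charFun
  split_ifs with h
  · apply Set.indicator_of_mem
    have h1 : ∀ i, ∃ w, y i - a i = (p : ℤ_[p]) ^ e * w := fun i =>
      (toZModPow_eq_iff p e _ _).1 (congrFun h i)
    choose w hw using h1
    refine ⟨w, fun i => ?_⟩
    have : a i + (p : ℤ_[p]) ^ e * w i = y i := by rw [← hw]; ring
    rw [this]
  · apply Set.indicator_of_notMem
    rintro ⟨w, hw⟩
    apply h
    funext i
    change PadicInt.toZModPow e (y i) = PadicInt.toZModPow e (a i)
    rw [toZModPow_eq_iff]
    exact ⟨w i, by rw [Subtype.coe_injective (hw i)]; ring⟩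

theorem integral_of_charFun_ne_zero {e : ℕ} {a : Form ℤ_[p]} {x : Form ℚ_[p]}
    (h : charFun p e a x ≠ 0) : ∃ y : Form ℤ_[p], x = mapForm PadicInt.Coe.ringHom y := by
  unfold charFun at h
  obtain ⟨w, hw⟩ := Set.mem_of_indicator_ne_zero h
  exact ⟨fun i => a i + (p : ℤ_[p]) ^ e * w i, funext hw⟩

/-- The character `χ_p` modulo `p ^ e`. -/
noncomputable def redChar (e : ℕ) (s : ZMod (p ^ e)) : ℂ :=
  unitChar χ p (exists_toZModPow_eq p e s).choose

theorem redChar_toZModPow {e : ℕ} (hce : condExp m p ≤ e) (y : ℤ_[p]) :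
    redChar χ p e (PadicInt.toZModPow e y) = unitChar χ p y := by
  apply unitChar_congr
  refine (pow_dvd_pow _ hce).trans ?_
  rw [← toZModPow_eq_iff]
  exact (exists_toZModPow_eq p e (PadicInt.toZModPow e y)).choose_spec

open Classical in
/-- The average `M_{p,χ}` of the characteristic function of `a`, at finite level. -/
noncomputable def finiteAverage (e : ℕ) (a x : Form (ZMod (p ^ e))) : ℂ :=
  (Fintype.card (GL (Fin 2) (ZMod (p ^ e))) : ℂ)⁻¹ *
    ∑ γ : GL (Fin 2) (ZMod (p ^ e)), redChar χ p e (ddet γ) * if act γ x = a then 1 else 0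

theorem average_coe {e : ℕ} (he : e ≠ 0) (hce : condExp m p ≤ e) (a y : Form ℤ_[p]) :
    average χ p (charFun p e a) (mapForm PadicInt.Coe.ringHom y) =
      finiteAverage χ p e (mapForm (PadicInt.toZModPow e) a)
        (mapForm (PadicInt.toZModPow e) y) := by
  classical
  unfold average finiteAverage
  rw [← integral_haarGL p he fun γ => redChar χ p e (ddet γ) *
    if act γ (mapForm (PadicInt.toZModPow e) y) = mapForm (PadicInt.toZModPow e) a
      then 1 else 0]
  congr 1
  funext g
  rw [← mapForm_act, ← mapForm_act]
  have h1 : charFun p e a (mapForm PadicInt.Coe.ringHom (act g y)) = _ :=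
    charFun_coe p e a (act g y)
  rw [h1, localChar_unit]
  congr 1
  have h2 : ddet (Matrix.GeneralLinearGroup.map (PadicInt.toZModPow (p := p) e) g) =
      PadicInt.toZModPow e (ddet g) := by
    simp [ddet]
  rw [h2, redChar_toZModPow χ p hce, coe_det]

/-- GL₂(ℤ_p) preserves integral forms: if g x were integral for some g, then x = g⁻¹(g x) would be.
-/
theorem average_eq_zero {e : ℕ} {a : Form ℤ_[p]} {x : Form ℚ_[p]}
    (hx : ¬ ∃ y : Form ℤ_[p], x = mapForm PadicInt.Coe.ringHom y) :
    average χ p (charFun p e a) x = 0 := by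
  unfold average
  rw [← integral_zero (GL (Fin 2) ℤ_[p]) ℂ (μ := haarGL p)]
  congr 1
  funext g
  by_contra hne
  have h1 := right_ne_zero_of_mul hne
  obtain ⟨y, hy⟩ := integral_of_charFun_ne_zero p h1
  apply hx
  refine ⟨act g⁻¹ y, ?_⟩
  rw [mapForm_act, ← hy, map_inv, act_inv_act]

/-- Indicator of a residue class. -/
noncomputable def classInd (e : ℕ) (s : ZMod (p ^ e)) : ℚ_[p] → ℂ :=
  (residueClass p e s).indicator fun _ => 1

theorem classInd_coe (e : ℕ) (s : ZMod (p ^ e)) (y : ℤ_[p]) [Decidable (PadicInt.toZModPow e y = s)] :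
    classInd p e s y = if PadicInt.toZModPow e y = s then 1 else 0 := by
  unfold classInd
  split_ifs with h
  · exact Set.indicator_of_mem ((coe_mem_residueClass p e s y).2 h) _
  · exact Set.indicator_of_notMem (fun h' => h ((coe_mem_residueClass p e s y).1 h')) _

theorem integral_classInd (e : ℕ) (s : ZMod (p ^ e)) :
    ∫ t, classInd p e s t ∂(addHaarQ p) = ((p : ℂ) ^ e)⁻¹ := by
  unfold classInd
  rw [integral_indicator_const _ (isOpen_residueClass p e s).measurableSet, Measure.real,
    addHaarQ_residueClass]
  simp

theorem integrable_classInd (e : ℕ) (s : ZMod (p ^ e)) : Integrable (classInd p e s) (addHaarQ p) := by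
  unfold classInd
  rw [integrable_indicator_iff (isOpen_residueClass p e s).measurableSet]
  apply integrableOn_const
  · rw [addHaarQ_residueClass]
    simp [(Fact.out : p.Prime).ne_zero]
  · simp

theorem indicator_weight_eq (e : ℕ) (s : ZMod (p ^ e)) (t : ℚ_[p]ˣ) :
    (unitsClass p e s).indicator (weight χ p) t = weight χ p t * classInd p e s t := by
  unfold classInd
  by_cases h : t ∈ unitsClass p e s
  · rw [Set.indicator_of_mem h, Set.indicator_of_mem (show (t : ℚ_[p]) ∈ residueClass p e s from h),
      mul_one]
  · rw [Set.indicator_of_notMem h,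
      Set.indicator_of_notMem (show (t : ℚ_[p]) ∉ residueClass p e s from h), mul_zero]

/-- A finite combination of products of functions of one coordinate, to which Fubini applies
directly. -/
theorem average_eq_sum {e : ℕ} (he : e ≠ 0) (hce : condExp m p ≤ e) (a : Form ℤ_[p])
    (x : Form ℚ_[p]) :
    average χ p (charFun p e a) x =
      ∑ s : Form (ZMod (p ^ e)), finiteAverage χ p e (mapForm (PadicInt.toZModPow e) a) s *
        (classInd p e (s 0) (x 0) * (classInd p e (s 1) (x 1) * (classInd p e (s 2) (x 2) *
          classInd p e (s 3) (x 3)))) := by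
  classical
  by_cases hx : ∃ y : Form ℤ_[p], x = mapForm PadicInt.Coe.ringHom y
  · obtain ⟨y, rfl⟩ := hx
    rw [average_coe χ p he hce, Finset.sum_eq_single (mapForm (PadicInt.toZModPow e) y)]
    · have : ∀ i, classInd p e (mapForm (PadicInt.toZModPow e) y i)
          (mapForm PadicInt.Coe.ringHom y i) = 1 := fun i => by
        change classInd p e (PadicInt.toZModPow e (y i)) (y i : ℚ_[p]) = 1
        rw [classInd_coe, if_pos rfl]
      rw [this, this, this, this]
      simp
    · intro s _ hs
      have : ∃ i, PadicInt.toZModPow e (y i) ≠ s i := by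
        by_contra! hcon
        exact hs (funext fun i => (hcon i).symm)
      obtain ⟨i, hi⟩ := this
      have h0 : classInd p e (s i) (mapForm PadicInt.Coe.ringHom y i) = 0 := by
        change classInd p e (s i) (y i : ℚ_[p]) = 0
        rw [classInd_coe, if_neg hi]
      fin_cases i <;> simp only [Fin.zero_eta, Fin.mk_one, Fin.reduceFinMk] at h0 <;>
        rw [h0] <;> simp
    · simp
  · rw [average_eq_zero χ p hx, Finset.sum_eq_zero]
    intro s _
    by_contra hne
    apply hx
    have h1 := right_ne_zero_of_mul hne
    have h2 := right_ne_zero_of_mul h1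
    have h3 := right_ne_zero_of_mul h2
    have key : ∀ (s : ZMod (p ^ e)) (t : ℚ_[p]), classInd p e s t ≠ 0 → ∃ y : ℤ_[p], t = y := by
      intro s t h
      obtain ⟨y, hy, -⟩ := Set.mem_of_indicator_ne_zero h
      exact ⟨y, hy.symm⟩
    have h4 : ∀ i, ∃ y : ℤ_[p], x i = y := by
      intro i
      fin_cases i
      · exact key _ _ (left_ne_zero_of_mul h1)
      · exact key _ _ (left_ne_zero_of_mul h2)
      · exact key _ _ (left_ne_zero_of_mul h3)
      · exact key _ _ (right_ne_zero_of_mul h3)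
    choose y hy using h4
    exact ⟨y, funext hy⟩

theorem condExp_ne_zero (hpm : p ∣ m) : condExp m p ≠ 0 :=
  (Nat.Prime.factorization_pos_of_dvd (Fact.out : p.Prime) (NeZero.ne m) hpm).ne'

theorem localL_eq_one (hpm : p ∣ m) (s : ℂ) : localL χ p s = 1 := by
  unfold localL
  have : ¬ IsUnit (p : ZMod m) := by
    rw [ZMod.isUnit_iff_coprime]
    intro h
    exact (Fact.out : p.Prime).one_lt.ne' (Nat.eq_one_of_dvd_coprimes h dvd_rfl hpm)
  rw [MulChar.map_nonunit _ this]
  simp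

/-- The three additive integrals contribute p^(-3e), leaving p^e of the normalizing factor p^(4e);
the Euler factor is 1 because p divides m. -/
theorem residueC_eq_sum (hχ3 : χ ^ 3 = 1) (hpm : p ∣ m) {e : ℕ} (hce : condExp m p ≤ e)
    (a : Form ℤ_[p]) :
    residueC χ p e a = (p : ℂ) ^ e * ∑ s : Form (ZMod (p ^ e)),
      finiteAverage χ⁻¹ p e (mapForm (PadicInt.toZModPow e) a) s * classIntegral χ p e (s 0) := by
  have he : e ≠ 0 := fun h => condExp_ne_zero p hpm (Nat.le_zero.1 (h ▸ hce))
  have hp : (p : ℂ) ≠ 0 := by exact_mod_cast (Fact.out : p.Prime).ne_zero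
  unfold residueC
  rw [localL_eq_one χ⁻¹ p hpm, inv_one, mul_one]
  have h1 : ∀ z : ℚ_[p]ˣ × ℚ_[p] × ℚ_[p] × ℚ_[p],
      localChar χ p (z.1 : ℚ_[p]) * ((‖(z.1 : ℚ_[p])‖ : ℝ) : ℂ) ^ (1 / 3 : ℂ)
        * average χ⁻¹ p (charFun p e a) ![(z.1 : ℚ_[p]), z.2.1, z.2.2.1, z.2.2.2] =
      ∑ s : Form (ZMod (p ^ e)), finiteAverage χ⁻¹ p e (mapForm (PadicInt.toZModPow e) a) s *
        ((unitsClass p e (s 0)).indicator (weight χ p) z.1 * (classInd p e (s 1) z.2.1 *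
          (classInd p e (s 2) z.2.2.1 * classInd p e (s 3) z.2.2.2))) := by
    intro z
    rw [average_eq_sum χ⁻¹ p he hce, Finset.mul_sum]
    refine Finset.sum_congr rfl fun s _ => ?_
    rw [indicator_weight_eq, weight]
    simp only [Matrix.cons_val_zero, Matrix.cons_val_one, Matrix.cons_val]
    ring
  simp_rw [h1]
  rw [integral_finsetSum]
  · rw [Finset.mul_sum, Finset.mul_sum]
    refine Finset.sum_congr rfl fun s _ => ?_
    rw [integral_const_mul,
      integral_prod_mul (fun t => (unitsClass p e (s 0)).indicator (weight χ p) t)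
        (fun w : ℚ_[p] × ℚ_[p] × ℚ_[p] => classInd p e (s 1) w.1 *
          (classInd p e (s 2) w.2.1 * classInd p e (s 3) w.2.2)),
      integral_prod_mul (fun t => classInd p e (s 1) t)
        (fun w : ℚ_[p] × ℚ_[p] => classInd p e (s 2) w.1 * classInd p e (s 3) w.2),
      integral_prod_mul (fun t => classInd p e (s 2) t) (fun t => classInd p e (s 3) t),
      integral_classInd, integral_classInd, integral_classInd, classIntegral]
    field_simp
    ring
  · intro s _
    apply Integrable.const_mul
    refine Integrable.mul_prod (integrable_weight χ p hχ3 hpm e (s 0))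
      (g := fun w : ℚ_[p] × ℚ_[p] × ℚ_[p] => classInd p e (s 1) w.1 *
          (classInd p e (s 2) w.2.1 * classInd p e (s 3) w.2.2)) ?_
    refine Integrable.mul_prod (integrable_classInd p e (s 1))
      (g := fun w : ℚ_[p] × ℚ_[p] => classInd p e (s 2) w.1 * classInd p e (s 3) w.2) ?_
    exact Integrable.mul_prod (integrable_classInd p e (s 2)) (integrable_classInd p e (s 3))

end Residue

end BinaryCubic

namespace BinaryCubic

/-! ### Averages over GL₂ of functions of the first row. -/

section RowSums

variable {R : Type*} [CommRing R] [Fintype R] [DecidableEq R]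

open Classical in
/-- Number of invertible matrices with given first row. -/
noncomputable def rowCount (r : R × R) : ℕ :=
  (Finset.univ.filter fun γ : GL (Fin 2) R => (γ.val 0 0, γ.val 0 1) = r).card

theorem exists_gl_row {r : R × R} (hr : IsUnit r.1 ∨ IsUnit r.2) :
    ∃ k : GL (Fin 2) R, (k.val 0 0, k.val 0 1) = r := by
  rcases hr with h | h
  · exact ⟨glOf r.1 r.2 0 1 (by simpa using h), by simp [glOf_val]⟩
  · exact ⟨glOf r.1 r.2 1 0 (by simpa using h), by simp [glOf_val]⟩

theorem mul_row (γ k : GL (Fin 2) R) (j : Fin 2) :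
    (γ * k).val 0 j = γ.val 0 0 * k.val 0 j + γ.val 0 1 * k.val 1 j := by
  simp [Matrix.mul_apply, Fin.sum_univ_two]

/-- Right multiplication by a matrix with first row r maps the matrices with first row (1, 0)
bijectively to those with first row r. -/
theorem rowCount_eq {r : R × R} (hr : IsUnit r.1 ∨ IsUnit r.2) :
    rowCount r = rowCount ((1, 0) : R × R) := by
  classical
  obtain ⟨k, hk⟩ := exists_gl_row hr
  symm
  unfold rowCount
  refine Finset.card_bij (fun γ _ => γ * k) ?_ ?_ ?_
  · intro γ hγ
    simp only [Finset.mem_filter, Finset.mem_univ, true_and, Prod.mk.injEq] at hγ ⊢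
    rw [mul_row, mul_row, hγ.1, hγ.2, ← hk]
    simp
  · intro γ _ γ' _ h
    exact mul_right_cancel h
  · intro γ hγ
    refine ⟨γ * k⁻¹, ?_, by simp⟩
    simp only [Finset.mem_filter, Finset.mem_univ, true_and] at hγ ⊢
    rw [mul_row, mul_row]
    have h1 : (k * k⁻¹).val 0 0 = 1 := by rw [mul_inv_cancel]; simp
    have h2 : (k * k⁻¹).val 0 1 = 0 := by rw [mul_inv_cancel]; simp
    rw [mul_row] at h1 h2
    have h3 := hγ.trans hk.symm
    rw [Prod.mk.injEq] at h3
    rw [h3.1, h3.2, h1, h2]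

/-- With both row entries nonunits, the determinant would be a sum of two nonunits, which in a local
ring is a nonunit. -/
theorem rowCount_eq_zero (hloc : ∀ x y : R, ¬ IsUnit x → ¬ IsUnit y → ¬ IsUnit (x + y))
    {r : R × R} (hr : ¬ (IsUnit r.1 ∨ IsUnit r.2)) : rowCount r = 0 := by
  classical
  unfold rowCount
  rw [Finset.card_eq_zero, Finset.filter_eq_empty_iff]
  rintro γ - rfl
  push Not at hr
  refine hloc (γ.val 0 0 * γ.val 1 1) (-(γ.val 0 1 * γ.val 1 0)) ?_ ?_ ?_
  · exact fun h => hr.1 (isUnit_of_mul_isUnit_left h)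
  · exact fun h => hr.2 (isUnit_of_mul_isUnit_left (IsUnit.neg_iff _ |>.1 h))
  · rw [← sub_eq_add_neg]; exact isUnit_ddet γ

open Classical in
theorem sum_rows (h : R → R → ℂ) :
    ∑ γ : GL (Fin 2) R, h (γ.val 0 0) (γ.val 0 1) =
      ∑ r : R × R, (rowCount r : ℂ) * h r.1 r.2 := by
  rw [← Finset.sum_fiberwise Finset.univ fun γ : GL (Fin 2) R => (γ.val 0 0, γ.val 0 1)]
  refine Finset.sum_congr rfl fun r _ => ?_
  rw [rowCount, ← nsmul_eq_mul, ← Finset.sum_const]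
  refine Finset.sum_congr rfl fun γ hγ => ?_
  simp only [Finset.mem_filter, Finset.mem_univ, true_and] at hγ
  rw [← hγ]

open Classical in
/-- Sum over the projective line of `R`. -/
noncomputable def projSum (h : R → R → ℂ) : ℂ :=
  ∑ x : R, h x 1 + ∑ y ∈ Finset.univ.filter (fun y : R => ¬ IsUnit y), h 1 y

open Classical in
-- Primitive vectors form an Rˣ-torsor over the projective line, covered by the points (x : 1) and
-- the points (1 : y) with y a nonunit.
theorem sum_primitive (h : R → R → ℂ)
    (hh : ∀ t x y : R, IsUnit t → h (t * x) (t * y) = h x y) :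
    ∑ r ∈ Finset.univ.filter (fun r : R × R => IsUnit r.1 ∨ IsUnit r.2), h r.1 r.2 =
      (Fintype.card Rˣ : ℂ) * projSum h := by
  have hU : ∀ f : R → ℂ, ∑ x ∈ Finset.univ.filter (fun x : R => IsUnit x), f x = ∑ u : Rˣ, f u := by
    intro f
    refine (Finset.sum_bij (fun (u : Rˣ) _ => (u : R)) ?_ ?_ ?_ ?_).symm
    · intro u _; simp
    · intro u _ v _ h; exact Units.ext h
    · intro b hb
      rw [Finset.mem_filter] at hb
      exact ⟨hb.2.unit, Finset.mem_univ _, hb.2.unit_spec⟩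
    · intro u _; rfl
  rw [Finset.sum_filter, Fintype.sum_prod_type_right]
  rw [← Finset.sum_filter_add_sum_filter_not Finset.univ (fun y : R => IsUnit y), projSum, mul_add]
  congr 1
  · rw [hU]
    have : ∀ u : Rˣ, (∑ x : R, if IsUnit x ∨ IsUnit (u : R) then h x u else 0) =
        ∑ x : R, h x 1 := by
      intro u
      rw [← Equiv.sum_comp (Units.mulLeft u)]
      refine Finset.sum_congr rfl fun x _ => ?_
      rw [if_pos (Or.inr u.isUnit)]
      have := hh u x 1 u.isUnit
      rw [mul_one] at this
      rw [← this]; rfl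
    rw [Finset.sum_congr rfl fun u _ => this u]
    simp
  · have h1 : ∀ y ∈ Finset.univ.filter (fun y : R => ¬ IsUnit y),
        (∑ x : R, if IsUnit x ∨ IsUnit y then h x y else 0) = ∑ u : Rˣ, h u y := by
      intro y hy
      rw [Finset.mem_filter] at hy
      rw [← hU (fun x => h x y), Finset.sum_filter]
      refine Finset.sum_congr rfl fun x _ => ?_
      simp [hy.2]
    rw [Finset.sum_congr rfl h1, Finset.sum_comm]
    have h2 : ∀ u : Rˣ, ∑ y ∈ Finset.univ.filter (fun y : R => ¬ IsUnit y), h u y =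
        ∑ y ∈ Finset.univ.filter (fun y : R => ¬ IsUnit y), h 1 y := by
      intro u
      rw [Finset.sum_filter, Finset.sum_filter, ← Equiv.sum_comp (Units.mulLeft u)]
      refine Finset.sum_congr rfl fun y _ => ?_
      have h3 : IsUnit ((Units.mulLeft u) y) ↔ IsUnit y := by
        change IsUnit ((u : R) * y) ↔ _
        exact Units.isUnit_units_mul u y
      have h4 := hh u 1 y u.isUnit
      rw [mul_one] at h4
      simp only [h3]
      rw [← h4]; rfl
    rw [Finset.sum_congr rfl fun u _ => h2 u]
    simp

open Classical in
theorem average_rows [Nontrivial R]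
    (hloc : ∀ x y : R, ¬ IsUnit x → ¬ IsUnit y → ¬ IsUnit (x + y)) (h : R → R → ℂ)
    (hh : ∀ t x y : R, IsUnit t → h (t * x) (t * y) = h x y) :
    (Fintype.card (GL (Fin 2) R) : ℂ)⁻¹ * ∑ γ : GL (Fin 2) R, h (γ.val 0 0) (γ.val 0 1) =
      ((Fintype.card R : ℂ) +
        ((Finset.univ.filter (fun y : R => ¬ IsUnit y)).card : ℂ))⁻¹ * projSum h := by
  have key : ∀ h : R → R → ℂ, (∀ t x y : R, IsUnit t → h (t * x) (t * y) = h x y) →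
      ∑ γ : GL (Fin 2) R, h (γ.val 0 0) (γ.val 0 1) =
        (rowCount ((1, 0) : R × R) : ℂ) * (Fintype.card Rˣ : ℂ) * projSum h := by
    intro h hh
    rw [sum_rows, mul_assoc, ← sum_primitive h hh, Finset.mul_sum, Finset.sum_filter]
    refine Finset.sum_congr rfl fun r _ => ?_
    split_ifs with hr
    · rw [rowCount_eq hr]
    · rw [rowCount_eq_zero hloc hr]; simp
  -- The constant function expresses |GL₂(R)| through the same unknown fibre size, which then
  -- cancels from the average.
  have h1 := key (fun _ _ => 1) (fun _ _ _ _ => rfl)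
  have h2 : projSum (fun _ _ : R => (1 : ℂ)) = (Fintype.card R : ℂ) +
      ((Finset.univ.filter (fun y : R => ¬ IsUnit y)).card : ℂ) := by
    simp [projSum]
  simp only [Finset.sum_const, Finset.card_univ, nsmul_eq_mul, mul_one] at h1
  rw [h1, key h hh, h2]
  have h3 : ((rowCount ((1, 0) : R × R) : ℂ) * (Fintype.card Rˣ : ℂ)) ≠ 0 := by
    intro h0
    rw [h0, zero_mul] at h1
    exact Fintype.card_ne_zero (α := GL (Fin 2) R) (by exact_mod_cast h1)
  rw [mul_inv, mul_mul_mul_comm, inv_mul_cancel₀ h3, one_mul]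

end RowSums

/-! ### The residue factor as a sum over the projective line; invariance along orbits. -/

section ResidueFormula

variable {m : ℕ} [NeZero m] (χ : DirichletCharacter ℂ m) (p : ℕ) [Fact p.Prime]

theorem unitChar_inv_apply {x : ℤ_[p]} (hx : IsUnit x) :
    unitChar χ⁻¹ p x = (unitChar χ p x)⁻¹ := by
  rw [unitChar_apply, unitChar_apply]
  have h := hx.map (PadicInt.toZModPow (p := p) (condExp m p))
  obtain ⟨u, hu⟩ := h
  rw [← hu, primaryPart, primaryPart, MulChar.ofUnitHom_coe, MulChar.ofUnitHom_coe,
    ← Units.val_inv_eq_inv_val]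
  congr 1
  simp only [MonoidHom.comp_apply]
  generalize (((Units.mapEquiv (splitModulus m p).symm.toMulEquiv).toMonoidHom _) : (ZMod m)ˣ) = w
  ext
  rw [MulChar.coe_toUnitHom, Units.val_inv_eq_inv_val, MulChar.coe_toUnitHom, MulChar.inv_apply_eq_inv',
    ]

theorem exists_unit_lift {e : ℕ} (he : e ≠ 0) {s : ZMod (p ^ e)} (hs : IsUnit s) :
    ∃ u : ℤ_[p]ˣ, PadicInt.toZModPow e (u : ℤ_[p]) = s := by
  obtain ⟨y, rfl⟩ := exists_toZModPow_eq p e s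
  obtain ⟨u, rfl⟩ := isUnit_of_isUnit_toZModPow p he hs
  exact ⟨u, rfl⟩

theorem classIntegral_isUnit_mul {e : ℕ} (he : e ≠ 0) (hce : condExp m p ≤ e)
    {r : ZMod (p ^ e)} (hr : IsUnit r) (s : ZMod (p ^ e)) :
    classIntegral χ p e (r * s) = redChar χ p e r * classIntegral χ p e s := by
  obtain ⟨u, rfl⟩ := exists_unit_lift p he hr
  rw [classIntegral_unit_mul, redChar_toZModPow χ p hce]

theorem redChar_ne_zero (hχ3 : χ ^ 3 = 1) {e : ℕ} (he : e ≠ 0) (hce : condExp m p ≤ e)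
    {r : ZMod (p ^ e)} (hr : IsUnit r) : redChar χ p e r ≠ 0 := by
  obtain ⟨u, rfl⟩ := exists_unit_lift p he hr
  rw [redChar_toZModPow χ p hce]
  intro h
  have := unitChar_pow_three χ p hχ3 u.isUnit
  rw [h] at this
  norm_num at this

theorem redChar_inv_mul (hχ3 : χ ^ 3 = 1) {e : ℕ} (he : e ≠ 0) (hce : condExp m p ≤ e)
    {r : ZMod (p ^ e)} (hr : IsUnit r) : redChar χ⁻¹ p e r * redChar χ p e r = 1 := by
  have h0 := redChar_ne_zero χ p hχ3 he hce hr
  obtain ⟨u, rfl⟩ := exists_unit_lift p he hr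
  rw [redChar_toZModPow χ p hce] at h0 ⊢
  rw [redChar_toZModPow χ⁻¹ p hce, unitChar_inv_apply χ p u.isUnit, inv_mul_cancel₀ h0]

theorem not_isUnit_add {e : ℕ} (he : e ≠ 0) (x y : ZMod (p ^ e)) (hx : ¬ IsUnit x)
    (hy : ¬ IsUnit y) : ¬ IsUnit (x + y) := by
  obtain ⟨x, rfl⟩ := exists_toZModPow_eq p e x
  obtain ⟨y, rfl⟩ := exists_toZModPow_eq p e y
  rw [← map_add]
  rw [isUnit_toZModPow_iff p he, isUnit_iff_not_dvd, not_not] at *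
  exact dvd_add hx hy

open Classical in
-- After γ ↦ γ⁻¹, only s = γ·b contributes for each γ, where b is a modulo p^e. Its first
-- coefficient is det(γ)⁻¹ times the value of b at the first row, and the χ-factor extracted from
-- det(γ)⁻¹ cancels the χ⁻¹-twist of the average.
theorem residueC_eq_sum_gl (hχ3 : χ ^ 3 = 1) (hpm : p ∣ m) {e : ℕ} (hce : condExp m p ≤ e)
    (a : Form ℤ_[p]) :
    residueC χ p e a = (p : ℂ) ^ e * ((Fintype.card (GL (Fin 2) (ZMod (p ^ e))) : ℂ)⁻¹ *
      ∑ γ : GL (Fin 2) (ZMod (p ^ e)), classIntegral χ p e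
        (eval (mapForm (PadicInt.toZModPow e) a) (γ.val 0 0) (γ.val 0 1))) := by
  have he : e ≠ 0 := fun h => condExp_ne_zero p hpm (Nat.le_zero.1 (h ▸ hce))
  rw [residueC_eq_sum χ p hχ3 hpm hce]
  congr 1
  unfold finiteAverage
  simp_rw [mul_assoc, Finset.sum_mul]
  rw [← Finset.mul_sum]
  congr 1
  rw [Finset.sum_comm, ← Equiv.sum_comp (Equiv.inv (GL (Fin 2) (ZMod (p ^ e))))]
  refine Finset.sum_congr rfl fun γ _ => ?_
  set b := mapForm (PadicInt.toZModPow e) a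
  rw [Finset.sum_eq_single (act γ b)]
  · rw [Equiv.inv_apply, act_inv_act, if_pos rfl, mul_one]
    have h1 : act γ b 0 = ddet γ⁻¹ * eval b (γ.val 0 0) (γ.val 0 1) := by
      have h2 := ddet_mul_eval_act γ b 1 0
      have h3 : ddet γ⁻¹ * ddet γ = 1 := by
        rw [← coe_det, ← coe_det, ← Units.val_mul, ← map_mul, inv_mul_cancel, map_one, Units.val_one]
      simp only [mul_one, mul_zero, add_zero] at h2
      rw [← h2, ← mul_assoc, h3, one_mul]
      simp [eval]
    rw [h1, classIntegral_isUnit_mul χ p he hce (isUnit_ddet γ⁻¹), ← mul_assoc,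
      redChar_inv_mul χ p hχ3 he hce (isUnit_ddet γ⁻¹), one_mul]
  · intro s _ hs
    rw [Equiv.inv_apply, if_neg, mul_zero, zero_mul]
    intro h
    exact hs (by rw [← h, act_act_inv])
  · simp

theorem redChar_pow_three (hχ3 : χ ^ 3 = 1) {e : ℕ} (he : e ≠ 0) (hce : condExp m p ≤ e)
    {r : ZMod (p ^ e)} (hr : IsUnit r) : redChar χ p e r ^ 3 = 1 := by
  obtain ⟨u, rfl⟩ := exists_unit_lift p he hr
  rw [redChar_toZModPow χ p hce, unitChar_pow_three χ p hχ3 u.isUnit]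

theorem redChar_pow {e : ℕ} (he : e ≠ 0) (hce : condExp m p ≤ e)
    {r : ZMod (p ^ e)} (hr : IsUnit r) (n : ℕ) : redChar χ p e (r ^ n) = redChar χ p e r ^ n := by
  obtain ⟨u, rfl⟩ := exists_unit_lift p he hr
  rw [← map_pow, redChar_toZModPow χ p hce, redChar_toZModPow χ p hce, map_pow]

theorem residueC_act (hχ3 : χ ^ 3 = 1) (hpm : p ∣ m) {e : ℕ} (hce : condExp m p ≤ e)
    (g : GL (Fin 2) ℤ_[p]) (a : Form ℤ_[p]) :
    unitChar χ p (ddet g) * residueC χ p e (act g a) = residueC χ p e a := by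
  classical
  have he : e ≠ 0 := fun h => condExp_ne_zero p hpm (Nat.le_zero.1 (h ▸ hce))
  rw [residueC_eq_sum_gl χ p hχ3 hpm hce, residueC_eq_sum_gl χ p hχ3 hpm hce, mapForm_act]
  set k := Matrix.GeneralLinearGroup.map (PadicInt.toZModPow (p := p) e) g with hk
  have h2 : ddet k = PadicInt.toZModPow e (ddet g) := by
    simp [hk, ddet]
  rw [mul_left_comm, mul_left_comm (unitChar χ p (ddet g)), Finset.mul_sum]
  congr 2
  rw [← Equiv.sum_comp (Equiv.mulRight k)
    (fun γ => classIntegral χ p e (eval (mapForm (PadicInt.toZModPow e) a) (γ.val 0 0) (γ.val 0 1)))]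
  refine Finset.sum_congr rfl fun γ _ => ?_
  rw [← redChar_toZModPow χ p hce, ← h2, ← classIntegral_isUnit_mul χ p he hce (isUnit_ddet k),
    ddet_mul_eval_act, Equiv.coe_mulRight, mul_row, mul_row]
  ring_nf

/-- The sum of the integrals of `χ̃_p(t)|t|^{1/3}` over the values of a form on the projective line
modulo `p ^ e`. -/
noncomputable def valueSum (e : ℕ) (a : Form ℤ_[p]) : ℂ :=
  projSum fun x y : ZMod (p ^ e) =>
    classIntegral χ p e (eval (mapForm (PadicInt.toZModPow e) a) x y)

open Classical in
theorem card_nonunits {e : ℕ} :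
    (Finset.univ.filter (fun y : ZMod (p ^ (e + 1)) => ¬ IsUnit y)).card = p ^ e := by
  have h1 := Finset.card_filter_add_card_filter_not (s := Finset.univ)
    (fun y : ZMod (p ^ (e + 1)) => IsUnit y)
  have h2 : (Finset.univ.filter (fun y : ZMod (p ^ (e + 1)) => IsUnit y)).card =
      (p ^ (e + 1)).totient := by
    rw [← ZMod.card_units_eq_totient, ← Finset.card_univ]
    refine (Finset.card_bij (fun (u : (ZMod (p ^ (e + 1)))ˣ) _ => (u : ZMod (p ^ (e + 1))))
      ?_ ?_ ?_).symm
    · intro u _; simp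
    · intro u _ v _ h; exact Units.ext h
    · intro b hb
      rw [Finset.mem_filter] at hb
      exact ⟨hb.2.unit, Finset.mem_univ _, hb.2.unit_spec⟩
  have hp := (Fact.out : p.Prime).one_lt
  rw [h2, Finset.card_univ, ZMod.card, Nat.totient_prime_pow_succ Fact.out] at h1
  generalize (Finset.univ.filter (fun y : ZMod (p ^ (e + 1)) => ¬ IsUnit y)).card = N at h1 ⊢
  have h3 : p ^ (e + 1) = p ^ e * (p - 1) + p ^ e := by
    rw [pow_succ, ← Nat.mul_succ]
    congr 1
    omega
  omega

/-- Scaling (x, y) by a unit t multiplies the value by t³, on which χ_p is trivial, so the summand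
lives on the projective line, which has p^(e-1)(p + 1) points. -/
theorem residueC_eq_valueSum (hχ3 : χ ^ 3 = 1) (hpm : p ∣ m) {e : ℕ} (hce : condExp m p ≤ e)
    (a : Form ℤ_[p]) :
    residueC χ p e a = (p : ℂ) * ((p : ℂ) + 1)⁻¹ * valueSum χ p e a := by
  classical
  have he : e ≠ 0 := fun h => condExp_ne_zero p hpm (Nat.le_zero.1 (h ▸ hce))
  obtain ⟨e, rfl⟩ := Nat.exists_eq_succ_of_ne_zero he
  have hp : (p : ℂ) ≠ 0 := by exact_mod_cast (Fact.out : p.Prime).ne_zero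
  have hp1 : (p : ℂ) + 1 ≠ 0 := by exact_mod_cast Nat.succ_ne_zero p
  have : Nontrivial (ZMod (p ^ (e + 1))) := by
    rw [ZMod.nontrivial_iff]
    exact (Nat.one_lt_pow (by omega) (Fact.out : p.Prime).one_lt).ne'
  rw [residueC_eq_sum_gl χ p hχ3 hpm hce, average_rows (not_isUnit_add p he)
    (fun x y => classIntegral χ p (e + 1) (eval (mapForm (PadicInt.toZModPow (e + 1)) a) x y)),
    card_nonunits, ZMod.card, valueSum]
  · have h0 : (p : ℂ) ^ e * ((p : ℂ) + 1) ≠ 0 := mul_ne_zero (pow_ne_zero _ hp) hp1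
    have h1 : (p : ℂ) ^ (e + 1) + (p : ℂ) ^ e ≠ 0 := by
      rw [pow_succ, ← mul_add_one]; exact h0
    push_cast
    rw [← mul_assoc]
    congr 1
    rw [← div_eq_mul_inv, ← div_eq_mul_inv, div_eq_div_iff h1 hp1, Nat.succ_eq_add_one]
    ring
  · intro t x y ht
    rw [eval_mul_mul, classIntegral_isUnit_mul χ p he hce (ht.pow 3), redChar_pow χ p he hce ht,
      redChar_pow_three χ p hχ3 he hce ht, one_mul]

theorem normC_eq_valueSum (hχ3 : χ ^ 3 = 1) (hpm : p ∣ m) {e : ℕ} (hce : condExp m p ≤ e)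
    (a : Form ℤ_[p]) :
    normC χ p e a = (1 - (p : ℂ)⁻¹) * valueSum χ p e a / discChar χ p a := by
  have hp : (p : ℂ) ≠ 0 := by exact_mod_cast (Fact.out : p.Prime).ne_zero
  have hp1 : (p : ℂ) + 1 ≠ 0 := by exact_mod_cast Nat.succ_ne_zero p
  unfold normC
  rw [residueC_eq_valueSum χ p hχ3 hpm hce]
  congr 1
  have : (1 - (p : ℂ) ^ (-2 : ℤ)) = (1 - (p : ℂ)⁻¹) * ((p : ℂ) + 1) * (p : ℂ)⁻¹ := by
    have h2 : (p : ℂ) ^ (2 : ℤ) = (p : ℂ) ^ 2 := by norm_cast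
    rw [zpow_neg, h2]
    field_simp
    ring
  rw [this]
  field_simp

theorem valuation_unit_mul (u : ℤ_[p]ˣ) (x : ℤ_[p]) : ((u : ℤ_[p]) * x).valuation = x.valuation := by
  by_cases hx : x = 0
  · simp [hx]
  rw [PadicInt.valuation_mul u.ne_zero hx]
  have : (u : ℤ_[p]).valuation = 0 := by
    have h := PadicInt.norm_eq_zpow_neg_valuation u.ne_zero
    rw [PadicInt.norm_units] at h
    have hp : (1 : ℝ) < p := by exact_mod_cast (Fact.out : p.Prime).one_lt
    have h2 := (zpow_eq_one_iff_right₀ (by linarith) hp.ne').1 h.symm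
    omega
  rw [this, zero_add]

theorem discChar_act (g : GL (Fin 2) ℤ_[p]) (a : Form ℤ_[p]) :
    discChar χ p (act g a) = unitChar χ p (ddet g) ^ 2 * discChar χ p a := by
  unfold discChar
  obtain ⟨u, hu⟩ := isUnit_ddet g
  rw [disc_act, ← hu, ← Units.val_pow_eq_pow_val, valuation_unit_mul, PadicInt.coe_mul, mul_div_assoc,
    localChar_unit_mul, Units.val_pow_eq_pow_val, map_pow]

theorem discChar_eq {a : Form ℤ_[p]} {k : ℕ} {u : ℤ_[p]ˣ} (h : disc a = (p : ℤ_[p]) ^ k * u) :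
    discChar χ p a = unitChar χ p u := by
  have hp : (p : ℤ_[p]) ≠ 0 := by exact_mod_cast (Fact.out : p.Prime).ne_zero
  have hp' : (p : ℚ_[p]) ≠ 0 := by exact_mod_cast (Fact.out : p.Prime).ne_zero
  have hv : (disc a).valuation = k := by
    rw [h, mul_comm, valuation_unit_mul, PadicInt.valuation_pow, PadicInt.valuation_p, mul_one]
  unfold discChar
  rw [hv, h, PadicInt.coe_mul, PadicInt.coe_pow]
  rw [mul_comm, mul_div_assoc]
  have : ((p : ℤ_[p]) : ℚ_[p]) ^ k / (p : ℚ_[p]) ^ k = 1 := div_self (pow_ne_zero _ hp')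
  rw [this, mul_one, localChar_unit]

theorem unitChar_ne_zero (hχ3 : χ ^ 3 = 1) {x : ℤ_[p]} (hx : IsUnit x) : unitChar χ p x ≠ 0 := by
  intro h
  have := unitChar_pow_three χ p hχ3 hx
  rw [h] at this
  norm_num at this

/-- C scales by χ_p(det g)⁻¹ and the discriminant character by χ_p(det g)²; these factors agree
because χ³ = 1. -/
theorem normC_act (hχ3 : χ ^ 3 = 1) (hpm : p ∣ m) {e : ℕ} (hce : condExp m p ≤ e)
    (g : GL (Fin 2) ℤ_[p]) (a : Form ℤ_[p]) : normC χ p e (act g a) = normC χ p e a := by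
  unfold normC
  rw [discChar_act, ← residueC_act χ p hχ3 hpm hce g a]
  have h0 := unitChar_ne_zero χ p hχ3 (isUnit_ddet g)
  have h3 := unitChar_pow_three χ p hχ3 (isUnit_ddet g)
  set X := unitChar χ p (ddet g)
  by_cases hd : discChar χ p a = 0
  · simp [hd]
  rw [div_eq_div_iff (mul_ne_zero (pow_ne_zero _ h0) hd) hd]
  linear_combination (-(1 - (p : ℂ) ^ (-2 : ℤ)) * residueC χ p e (act g a) * discChar χ p a) * h3

end ResidueFormula

end BinaryCubic

namespace BinaryCubic

/-! ### Hensel's lemma for roots of units. -/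

section HenselCorollaries

open Polynomial

variable (p : ℕ) [Fact p.Prime]

/-- Hensel's lemma at a simple root modulo `p`. -/
theorem exists_root_of_simple (F : ℤ_[p][X]) (a : ℤ_[p]) (h0 : (p : ℤ_[p]) ∣ F.eval a)
    (h1 : IsUnit (F.derivative.eval a)) : ∃ z, F.eval z = 0 ∧ (p : ℤ_[p]) ∣ z - a := by
  have hn : ‖F.aeval a‖ < ‖F.derivative.aeval a‖ ^ 2 := by
    simp only [Polynomial.coe_aeval_eq_eval]
    rw [PadicInt.isUnit_iff.1 h1, one_pow]
    exact (PadicInt.norm_lt_one_iff_dvd _).2 h0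
  obtain ⟨z, hz, hza, -⟩ := hensels_lemma hn
  rw [Polynomial.coe_aeval_eq_eval] at hz hza
  refine ⟨z, hz, ?_⟩
  rw [PadicInt.isUnit_iff.1 h1] at hza
  exact (PadicInt.norm_lt_one_iff_dvd _).1 hza

theorem isUnit_of_dvd_sub {x y : ℤ_[p]} (h : (p : ℤ_[p]) ∣ x - y) (hy : IsUnit y) : IsUnit x := by
  rw [isUnit_iff_not_dvd] at hy ⊢
  intro hx
  exact hy ((dvd_sub_right hx).1 h)

theorem isUnit_natCast_of_coprime {n : ℕ} (h : p.Coprime n) : IsUnit (n : ℤ_[p]) := by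
  rw [PadicInt.isUnit_iff, PadicInt.norm_natCast_eq_one_iff]
  exact h

theorem exists_sqrt (hp : p ≠ 2) {u s : ℤ_[p]} (hs : IsUnit s) (h : (p : ℤ_[p]) ∣ u - s ^ 2) :
    ∃ t, IsUnit t ∧ t ^ 2 = u ∧ (p : ℤ_[p]) ∣ t - s := by
  have h2 : IsUnit (2 : ℤ_[p]) := by
    exact_mod_cast isUnit_natCast_of_coprime p
      ((Nat.coprime_primes Fact.out Nat.prime_two).2 hp)
  obtain ⟨t, ht, hts⟩ := exists_root_of_simple p (X ^ 2 - C u) s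
    (by simpa using (dvd_neg.2 h)) (by simpa [one_add_one_eq_two] using h2.mul hs)
  exact ⟨t, isUnit_of_dvd_sub p hts hs, by simpa [sub_eq_zero] using ht, hts⟩

theorem exists_cbrt (hp : p ≠ 3) {u s : ℤ_[p]} (hs : IsUnit s) (h : (p : ℤ_[p]) ∣ u - s ^ 3) :
    ∃ t, IsUnit t ∧ t ^ 3 = u := by
  have h3 : IsUnit (3 : ℤ_[p]) := by
    exact_mod_cast isUnit_natCast_of_coprime p
      ((Nat.coprime_primes Fact.out Nat.prime_three).2 hp)
  obtain ⟨t, ht, hts⟩ := exists_root_of_simple p (X ^ 3 - C u) s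
    (by simpa using (dvd_neg.2 h))
    (by simpa [two_add_one_eq_three] using h3.mul (hs.pow 2))
  exact ⟨t, isUnit_of_dvd_sub p hts hs, by simpa [sub_eq_zero] using ht⟩

/-- With u = 1 + 9w and t = 1 + 3x, the equation t³ = u becomes 3x³ + 3x² + x = w, whose derivative
is 1 modulo 3. -/
theorem exists_cbrt_three {u : ℤ_[3]} (h : (9 : ℤ_[3]) ∣ u - 1) : ∃ t, IsUnit t ∧ t ^ 3 = u := by
  obtain ⟨w, hw⟩ := h
  have h1 : IsUnit (1 + (3 : ℤ_[3]) * (2 * w + 3 * w ^ 2)) := by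
    apply isUnit_of_dvd_sub 3 (y := 1) ⟨2 * w + 3 * w ^ 2, by push_cast; ring⟩ isUnit_one
  obtain ⟨x, hx, -⟩ := exists_root_of_simple 3 (C 3 * X ^ 3 + C 3 * X ^ 2 + X - C w) w
    (by simp only [eval_add, eval_sub, eval_mul, eval_C, eval_pow, eval_X]
        exact ⟨w ^ 3 + w ^ 2, by push_cast; ring⟩)
    (by simp only [derivative_add, derivative_sub, derivative_mul, derivative_C, derivative_X_pow,
          derivative_X, eval_add, eval_sub, eval_mul, eval_C, eval_pow, eval_X, eval_zero, eval_one]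
        convert h1 using 1
        push_cast
        ring)
  simp only [eval_add, eval_sub, eval_mul, eval_C, eval_pow, eval_X] at hx
  refine ⟨1 + 3 * x, ?_, ?_⟩
  · exact isUnit_of_dvd_sub 3 (y := 1) ⟨x, by push_cast; ring⟩ isUnit_one
  · linear_combination -hw + 9 * hx

end HenselCorollaries

/-! ### The conductor exponent at p of a cubic character. -/

section Conductor

variable {m : ℕ} [NeZero m] (χ : DirichletCharacter ℂ m) (p : ℕ) [Fact p.Prime]

theorem unitChar_cube (hχ3 : χ ^ 3 = 1) {t : ℤ_[p]} (ht : IsUnit t) : unitChar χ p (t ^ 3) = 1 := by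
  rw [map_pow, unitChar_pow_three χ p hχ3 ht]

theorem unitChar_neg_one (hχ3 : χ ^ 3 = 1) : unitChar χ p (-1) = 1 := by
  rw [← unitChar_cube χ p hχ3 (t := -1) (by simp)]
  norm_num

theorem unitChar_neg (hχ3 : χ ^ 3 = 1) (x : ℤ_[p]) : unitChar χ p (-x) = unitChar χ p x := by
  rw [← neg_one_mul, map_mul, unitChar_neg_one χ p hχ3, one_mul]

/-- If c were at least 2, the unit on which χ_p is nontrivial could be taken congruent to 1 modulo
p; but such units are cubes when p ≠ 3. -/
theorem condExp_eq_one (hχ : χ.IsPrimitive) (hχ3 : χ ^ 3 = 1) (hpm : p ∣ m) (hp : p ≠ 3) :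
    condExp m p = 1 := by
  have hc := condExp_ne_zero p hpm
  by_contra hne
  obtain ⟨ε, hε, hne1⟩ := exists_unitChar_ne_one χ p hχ hpm
  have h1 : (p : ℤ_[p]) ∣ ε - 1 ^ 3 := by
    rw [one_pow]
    exact (dvd_pow_self _ (by omega)).trans hε
  obtain ⟨t, ht, h⟩ := exists_cbrt p hp isUnit_one h1
  rw [← h, unitChar_cube χ p hχ3 ht] at hne1
  exact hne1 rfl

theorem condExp_three {χ : DirichletCharacter ℂ m} (hχ : χ.IsPrimitive) (hχ3 : χ ^ 3 = 1)
    (hpm : 3 ∣ m) : condExp m 3 = 2 := by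
  have hc := condExp_ne_zero 3 hpm
  obtain ⟨ε, hε, hne1⟩ := exists_unitChar_ne_one χ 3 hχ hpm
  by_contra hne
  -- Conductor exponent 1 is impossible because the square of every unit is 1 modulo 3, so χ_3 would
  -- have order dividing both 2 and 3. Exponent 3 or more is impossible because units congruent to 1
  -- modulo 9 are cubes.
  rcases Nat.lt_or_ge (condExp m 3) 2 with h | h
  · have h1 : condExp m 3 = 1 := by omega
    have h2 : unitChar χ 3 ((ε : ℤ_[3]) ^ 2) = 1 := by
      rw [← map_one (unitChar χ 3)]
      apply unitChar_congr
      rw [h1, pow_one]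
      obtain ⟨y, hy⟩ : ∃ y : ℤ, ((3 : ℕ) : ℤ_[3]) ∣ ε - y := by
        obtain ⟨n, -, hn⟩ := PadicInt.exists_mem_range (p := 3) (ε : ℤ_[3])
        rw [PadicInt.maximalIdeal_eq_span_p, Ideal.mem_span_singleton] at hn
        exact ⟨n, by exact_mod_cast hn⟩
      have hy3 : ¬ (3 : ℤ) ∣ y := by
        intro hd
        have h3 : ((3 : ℕ) : ℤ_[3]) ∣ (y : ℤ_[3]) := by
          obtain ⟨w, rfl⟩ := hd
          exact ⟨w, by push_cast; rfl⟩
        exact (isUnit_iff_not_dvd 3 _).1 ε.isUnit ((dvd_sub_left h3).1 hy)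
      have hy2 : (3 : ℤ) ∣ y ^ 2 - 1 := by
        have : y % 3 = 1 ∨ y % 3 = 2 := by omega
        rcases this with h | h
        · exact Int.dvd_of_emod_eq_zero (by rw [pow_two, Int.sub_emod, Int.mul_emod, h]; rfl)
        · exact Int.dvd_of_emod_eq_zero (by rw [pow_two, Int.sub_emod, Int.mul_emod, h]; rfl)
      obtain ⟨w, hw⟩ := hy2
      obtain ⟨z, hz⟩ := hy
      have hw' : (y : ℤ_[3]) ^ 2 - 1 = 3 * w := by exact_mod_cast congrArg (Int.cast (R := ℤ_[3])) hw
      refine ⟨w + z * (ε + y), ?_⟩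
      push_cast at hz ⊢
      linear_combination hw' + (ε + y : ℤ_[3]) * hz
    have h3 := unitChar_pow_three χ 3 hχ3 ε.isUnit
    rw [map_pow] at h2
    rw [pow_succ, h2, one_mul] at h3
    exact hne1 h3
  · have h1 : (9 : ℤ_[3]) ∣ ε - 1 := by
      refine dvd_trans ?_ hε
      have h9 : (9 : ℤ_[3]) = ((3 : ℕ) : ℤ_[3]) ^ 2 := by norm_num
      rw [h9]
      exact pow_dvd_pow _ (by omega)
    obtain ⟨t, ht, h⟩ := exists_cbrt_three h1
    rw [← h, unitChar_cube χ 3 hχ3 ht] at hne1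
    exact hne1 rfl

end Conductor

/-! ### Sums over ℤ/p^e of periodic functions. -/

section PeriodicSums

theorem sum_range_mul_of_periodic {f : ℕ → ℂ} {a : ℕ} (hf : ∀ k, f (k + a) = f k) (b : ℕ) :
    ∑ k ∈ Finset.range (a * b), f k = b * ∑ k ∈ Finset.range a, f k := by
  have hf' : ∀ b k, f (a * b + k) = f k := by
    intro b
    induction b with
    | zero => simp
    | succ b ih =>
      intro k
      rw [Nat.mul_succ, add_right_comm, hf, ih]
  induction b with
  | zero => simp
  | succ b ih =>
    rw [Nat.mul_succ, Finset.sum_range_add, ih, Finset.sum_congr rfl fun k _ => hf' b k]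
    push_cast
    ring

theorem sum_zmod_eq_sum_range {N : ℕ} [NeZero N] (f : ZMod N → ℂ) :
    ∑ x, f x = ∑ k ∈ Finset.range N, f k := by
  symm
  refine Finset.sum_bij (fun k _ => (k : ZMod N)) (fun _ _ => Finset.mem_univ _) ?_ ?_
    (fun _ _ => rfl)
  · intro a ha b hb h
    rw [Finset.mem_range] at ha hb
    have := congrArg ZMod.val h
    rwa [ZMod.val_natCast_of_lt ha, ZMod.val_natCast_of_lt hb] at this
  · intro x _
    exact ⟨x.val, Finset.mem_range.2 (ZMod.val_lt x), ZMod.natCast_zmod_val x⟩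

/-- A fixed period p^j makes the normalized sum independent of e ≥ j; this is why the table values
do not depend on e. -/
theorem sum_zmod_of_periodic {p : ℕ} [Fact p.Prime] {e j : ℕ} (hj : j ≤ e) {f : ZMod (p ^ e) → ℂ}
    (hf : ∀ x, f (x + (p : ZMod (p ^ e)) ^ j) = f x) :
    ∑ x, f x = (p : ℂ) ^ (e - j) * ∑ k ∈ Finset.range (p ^ j), f k := by
  have h1 : p ^ e = p ^ j * p ^ (e - j) := by rw [← pow_add]; congr 1; omega
  rw [sum_zmod_eq_sum_range]
  have h2 : ∀ k : ℕ, f ((k + p ^ j : ℕ) : ZMod (p ^ e)) = f (k : ZMod (p ^ e)) := by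
    intro k
    have := hf k
    push_cast
    exact this
  generalize hF : (fun k : ℕ => f (k : ZMod (p ^ e))) = F
  have h3 := sum_range_mul_of_periodic (f := fun k : ℕ => f (k : ZMod (p ^ e))) h2 (p ^ (e - j))
  rw [hF] at h3
  rw [h1, h3]
  push_cast
  rfl

end PeriodicSums

/-! ### Normalized class integrals and their cancellation on nonunits. -/

section NormalizedValues

variable {m : ℕ} [NeZero m] (χ : DirichletCharacter ℂ m) (p : ℕ) [Fact p.Prime]

/-- The class integrals, normalized to equal `χ_p` on units. -/
noncomputable def classValue (e : ℕ) (s : ZMod (p ^ e)) : ℂ :=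
  ((p ^ e).totient : ℂ) * classIntegral χ p e s

theorem totient_ne_zero (e : ℕ) : ((p ^ e).totient : ℂ) ≠ 0 := by
  have : 0 < (p ^ e).totient := Nat.totient_pos.2 (pow_pos (Fact.out : p.Prime).pos e)
  exact_mod_cast this.ne'

theorem totient_pow_eq {e : ℕ} (he : e ≠ 0) :
    ((p ^ e).totient : ℂ) = (p : ℂ) ^ e * (1 - (p : ℂ)⁻¹) := by
  obtain ⟨e, rfl⟩ := Nat.exists_eq_succ_of_ne_zero he
  have hp : (p : ℂ) ≠ 0 := by exact_mod_cast (Fact.out : p.Prime).ne_zero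
  rw [Nat.succ_eq_add_one, Nat.totient_prime_pow_succ Fact.out, Nat.cast_mul,
    Nat.cast_sub (Fact.out : p.Prime).one_lt.le]
  push_cast
  field_simp
  try ring

theorem classValue_unit (hpm : p ∣ m) {e : ℕ} (hce : condExp m p ≤ e) {u : ℤ_[p]} (hu : IsUnit u) :
    classValue χ p e (PadicInt.toZModPow e u) = unitChar χ p u := by
  have he : e ≠ 0 := fun h => condExp_ne_zero p hpm (Nat.le_zero.1 (h ▸ hce))
  obtain ⟨u, rfl⟩ := hu
  rw [classValue, classIntegral_unit χ p he hce, mul_inv_cancel_left₀ (totient_ne_zero p e)]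

/-- The value of `χ̃_p(p)|p|^{-2/3}`. -/
noncomputable def uniformizerValue : ℂ :=
  (p : ℂ) * ((coprimaryPart χ p p)⁻¹ * (p : ℂ) ^ (-(1 / 3) : ℂ))

/-- The factor p inside `uniformizerValue` is φ(p^e)/φ(p^(e-1)): the normalization is at level e,
while the class of p·u has the volume of a unit class at level e - 1. -/
theorem classValue_p_mul_unit (hpm : p ∣ m) {e : ℕ} (hce : condExp m p + 1 ≤ e) {u : ℤ_[p]}
    (hu : IsUnit u) :
    classValue χ p e (PadicInt.toZModPow e ((p : ℤ_[p]) * u)) =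
      uniformizerValue χ p * unitChar χ p u := by
  obtain ⟨e, rfl⟩ : ∃ k, e = k + 1 := ⟨e - 1, by omega⟩
  have he : e ≠ 0 := fun h => condExp_ne_zero p hpm (by omega)
  have hp : (p : ℂ) ≠ 0 := by exact_mod_cast (Fact.out : p.Prime).ne_zero
  obtain ⟨u, rfl⟩ := hu
  rw [classValue, classIntegral_p_mul_unit χ p he (by omega), totient_pow_eq p (by omega),
    uniformizerValue, ← mul_assoc]
  have h1 := totient_pow_eq p he
  have h2 : (p : ℂ) ^ (e + 1) * (1 - (p : ℂ)⁻¹) * ((p ^ e).totient : ℂ)⁻¹ = p := by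
    have h3 : (p : ℂ) ^ (e + 1) * (1 - (p : ℂ)⁻¹) = p * ((p ^ e).totient : ℂ) := by
      rw [h1]
      ring
    rw [h3, mul_inv_cancel_right₀ (totient_ne_zero p e)]
  rw [h2]
  ring

theorem classValue_unit_mul (e : ℕ) (u : ℤ_[p]ˣ) (s : ZMod (p ^ e)) :
    classValue χ p e (PadicInt.toZModPow e (u : ℤ_[p]) * s) =
      unitChar χ p u * classValue χ p e s := by
  unfold classValue
  rw [classIntegral_unit_mul]
  ring

open Classical in
-- Multiplication by a unit ε with χ_p(ε) ≠ 1 permutes the nonunits and multiplies the sum by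
-- χ_p(ε).
theorem sum_nonunits_classValue (hχ : χ.IsPrimitive) (hpm : p ∣ m) (e : ℕ) :
    ∑ s ∈ Finset.univ.filter (fun y : ZMod (p ^ e) => ¬ IsUnit y), classValue χ p e s = 0 := by
  obtain ⟨ε, -, hε⟩ := exists_unitChar_ne_one χ p hχ hpm
  set S := ∑ s ∈ Finset.univ.filter (fun y : ZMod (p ^ e) => ¬ IsUnit y), classValue χ p e s with hS
  have hu : IsUnit (PadicInt.toZModPow e (ε : ℤ_[p])) := ε.isUnit.map _
  have h1 : S = unitChar χ p ε * S := by
    rw [hS, Finset.mul_sum, Finset.sum_filter, Finset.sum_filter,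
      ← Equiv.sum_comp (Units.mulLeft hu.unit)]
    refine Finset.sum_congr rfl fun y _ => ?_
    have h3 : IsUnit ((Units.mulLeft hu.unit) y) ↔ IsUnit y :=
      Units.isUnit_units_mul hu.unit y
    simp only [h3]
    by_cases h : IsUnit y
    · simp [h]
    · simp only [h, not_false_eq_true, if_true]
      rw [← classValue_unit_mul]
      rfl
  have h2 : (1 - unitChar χ p ε) * S = 0 := by linear_combination h1
  rcases mul_eq_zero.1 h2 with h | h
  · exact absurd (sub_eq_zero.1 h).symm hε
  · exact h

open Classical in
-- The hypotheses make f injective on the finite set of nonunits, hence a permutation of it. This is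
-- the shape of a cubic near a simple zero.
theorem sum_nonunits_comp (hχ : χ.IsPrimitive) (hpm : p ∣ m) {e : ℕ} (f : ZMod (p ^ e) → ZMod (p ^ e))
    (hf : ∀ y, ¬ IsUnit y → ¬ IsUnit (f y))
    (hinj : ∀ y z, ¬ IsUnit y → ¬ IsUnit z → ∃ w, IsUnit w ∧ f y - f z = w * (y - z)) :
    ∑ y ∈ Finset.univ.filter (fun y : ZMod (p ^ e) => ¬ IsUnit y), classValue χ p e (f y) = 0 := by
  rw [← sum_nonunits_classValue χ p hχ hpm e]
  have hi : Set.InjOn f (Finset.univ.filter (fun y : ZMod (p ^ e) => ¬ IsUnit y)) := by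
    intro y hy z hz h
    simp only [Finset.coe_filter, Finset.mem_univ, true_and, Set.mem_ofPred_eq] at hy hz
    obtain ⟨w, hw, h1⟩ := hinj y z hy hz
    rw [h, sub_self] at h1
    exact sub_eq_zero.1 (hw.mul_right_eq_zero.1 h1.symm)
  rw [← Finset.sum_image (f := classValue χ p e) hi]
  congr 1
  apply Finset.eq_of_subset_of_card_le
  · intro x hx
    rw [Finset.mem_image] at hx
    obtain ⟨y, hy, rfl⟩ := hx
    simp only [Finset.mem_filter, Finset.mem_univ, true_and] at hy ⊢
    exact hf y hy
  · rw [Finset.card_image_of_injOn hi]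

open Classical in
/-- Evaluation of the normalized residue factor by a finite sum. -/
theorem normC_eq_of_periodic (hχ3 : χ ^ 3 = 1) (hpm : p ∣ m) {e : ℕ} (hce : condExp m p ≤ e)
    {a : Form ℤ_[p]} {S B : ℂ}
    (hS : ∑ x, classValue χ p e (eval (mapForm (PadicInt.toZModPow e) a) x 1) = (p : ℂ) ^ e * S)
    (hB : ∑ y ∈ Finset.univ.filter (fun y : ZMod (p ^ e) => ¬ IsUnit y),
      classValue χ p e (eval (mapForm (PadicInt.toZModPow e) a) 1 y) = (p : ℂ) ^ e * B) :
    normC χ p e a = (S + B) / discChar χ p a := by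
  have he : e ≠ 0 := fun h => condExp_ne_zero p hpm (Nat.le_zero.1 (h ▸ hce))
  have hp : (p : ℂ) ≠ 0 := by exact_mod_cast (Fact.out : p.Prime).ne_zero
  rw [normC_eq_valueSum χ p hχ3 hpm hce]
  congr 1
  have h1 : ((p ^ e).totient : ℂ) * valueSum χ p e a = (p : ℂ) ^ e * (S + B) := by
    rw [mul_add, ← hS, ← hB, valueSum, projSum, mul_add, Finset.mul_sum, Finset.mul_sum]
    rfl
  rw [totient_pow_eq p he, mul_assoc] at h1
  exact mul_left_cancel₀ (pow_ne_zero e hp) h1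

open Classical in
theorem sum_nonunits_one {e : ℕ} (he : e ≠ 0) {f : ZMod (p ^ e) → ℂ}
    (hf : ∀ y, ¬ IsUnit y → f y = 1) :
    ∑ y ∈ Finset.univ.filter (fun y : ZMod (p ^ e) => ¬ IsUnit y), f y =
      (p : ℂ) ^ e * (p : ℂ)⁻¹ := by
  obtain ⟨e, rfl⟩ := Nat.exists_eq_succ_of_ne_zero he
  have hp : (p : ℂ) ≠ 0 := by exact_mod_cast (Fact.out : p.Prime).ne_zero
  rw [Finset.sum_congr rfl fun y hy => hf y (Finset.mem_filter.1 hy).2, Finset.sum_const,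
    Nat.succ_eq_add_one, card_nonunits]
  simp [pow_succ, hp]

theorem sum_eq_of_periodic {e j : ℕ} (hj : j ≤ e) {f : ZMod (p ^ e) → ℂ}
    (hf : ∀ x : ℤ_[p], f (PadicInt.toZModPow e (x + (p : ℤ_[p]) ^ j)) = f (PadicInt.toZModPow e x)) :
    ∑ x, f x = (p : ℂ) ^ e *
      (((p : ℂ) ^ j)⁻¹ * ∑ k ∈ Finset.range (p ^ j), f (PadicInt.toZModPow e (k : ℤ_[p]))) := by
  have hp : (p : ℂ) ≠ 0 := by exact_mod_cast (Fact.out : p.Prime).ne_zero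
  rw [sum_zmod_of_periodic hj]
  · rw [← mul_assoc]
    congr 1
    · rw [pow_sub₀ _ hp hj]
    · refine Finset.sum_congr rfl fun k _ => ?_
      rw [map_natCast]
  · intro x
    obtain ⟨y, rfl⟩ := exists_toZModPow_eq p e x
    rw [← hf y, map_add, map_pow, map_natCast]

end NormalizedValues

end BinaryCubic

namespace BinaryCubic

/-! ### Forms of unit discriminant. -/

section SmoothSums

variable {m : ℕ} [NeZero m] (χ : DirichletCharacter ℂ m) (p : ℕ) [Fact p.Prime]

open Classical in
/-- The zeros of a function with simple zeros do not contribute. -/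
theorem sum_not_isUnit_eq_zero (hχ : χ.IsPrimitive) (hpm : p ∣ m) {e : ℕ} (he : e ≠ 0)
    (f : ZMod (p ^ e) → ZMod (p ^ e))
    (hf : ∀ x y, ¬ IsUnit (x - y) → ¬ IsUnit (f x) → ∃ w, IsUnit w ∧ f x - f y = w * (x - y)) :
    ∑ x, (if IsUnit (f x) then 0 else classValue χ p e (f x)) = 0 := by
  set g : ZMod (p ^ e) → ℂ := fun x => if IsUnit (f x) then 0 else classValue χ p e (f x) with hg
  set N := Finset.univ.filter (fun y : ZMod (p ^ e) => ¬ IsUnit y) with hN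
  have h0 : (0 : ZMod (p ^ e)) ∈ N := by
    have : Fact (1 < p ^ e) := ⟨Nat.one_lt_pow he (Fact.out : p.Prime).one_lt⟩
    simp [hN]
  have hfu : ∀ x y, ¬ IsUnit y → ¬ IsUnit (f x) → ¬ IsUnit (f (x + y)) := by
    intro x y hy hx h
    obtain ⟨w, hw, h1⟩ := hf x (x + y) (by
      rw [sub_add_cancel_left]; simpa using hy) hx
    rw [sub_add_cancel_left] at h1
    refine not_isUnit_add p he (f x) (w * y) hx ?_ ?_
    · rw [IsUnit.mul_iff]; tauto
    · have : f x + w * y = f (x + y) := by linear_combination h1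
      rwa [this]
  -- On the residue disc of x either f takes only unit values, and all summands vanish, or f maps
  -- the disc bijectively onto the nonunits. Averaging over discs then gives the whole sum, each
  -- element being counted once per nonunit.
  have h1 : ∀ x, ∑ y ∈ N, g (x + y) = 0 := by
    intro x
    by_cases hx : IsUnit (f x)
    · refine Finset.sum_eq_zero fun y hy => ?_
      have hy' := (Finset.mem_filter.1 hy).2
      have : IsUnit (f (x + y)) := by
        by_contra h
        have h2 := hfu (x + y) (-y) (by simpa using hy') h
        rw [add_neg_cancel_right] at h2
        exact h2 hx
      simp [hg, this]
    · rw [← sum_nonunits_comp χ p hχ hpm (fun y => f (x + y)) (fun y hy => hfu x y hy hx)]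
      · refine Finset.sum_congr rfl fun y hy => ?_
        have hy' := (Finset.mem_filter.1 hy).2
        simp [hg, hfu x y hy' hx]
      · intro y z hy hz
        obtain ⟨w, hw, h2⟩ := hf (x + y) (x + z) (by
          rw [add_sub_add_left_eq_sub, sub_eq_add_neg]
          exact not_isUnit_add p he _ _ hy (by simpa using hz)) (hfu x y hy hx)
        exact ⟨w, hw, by rw [h2]; ring⟩
  have h2 : (N.card : ℂ) * ∑ x, g x = 0 := by
    have h3 : ∀ y ∈ N, ∑ x, g x = ∑ x, g (x + y) := fun y _ =>
      (Equiv.sum_comp (Equiv.addRight y) g).symm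
    rw [← nsmul_eq_mul, ← Finset.sum_const, Finset.sum_congr rfl h3, Finset.sum_comm]
    exact Finset.sum_eq_zero fun x _ => h1 x
  rcases mul_eq_zero.1 h2 with h | h
  · have : N.card ≠ 0 := Finset.card_ne_zero_of_mem h0
    exact absurd (by exact_mod_cast h) this
  · exact h

/-- Evaluation of a binary cubic form of unit discriminant. -/
theorem normC_of_isUnit_disc (hχ : χ.IsPrimitive) (hχ3 : χ ^ 3 = 1) (hpm : p ∣ m) {e : ℕ}
    (hce : condExp m p ≤ e) {a : Form ℤ_[p]} (hd : IsUnit (disc a)) {B : ℂ}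
    (hB : (a 0 = 0 ∧ B = 0) ∨
      ((∀ y, ¬ IsUnit y → unitChar χ p (eval a 1 y) = 1) ∧ B = (p : ℂ)⁻¹)) :
    normC χ p e a = (((p : ℂ) ^ condExp m p)⁻¹ *
      ∑ k ∈ Finset.range (p ^ condExp m p), unitChar χ p (eval a k 1) + B) /
        unitChar χ p (disc a) := by
  classical
  have he : e ≠ 0 := fun h => condExp_ne_zero p hpm (Nat.le_zero.1 (h ▸ hce))
  have hD : discChar χ p a = unitChar χ p (disc a) := by
    obtain ⟨u, hu⟩ := hd
    rw [discChar_eq χ p (k := 0) (u := u) (by rw [hu]; simp), hu]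
  rw [← hD]
  set φ := PadicInt.toZModPow (p := p) e with hφ
  apply normC_eq_of_periodic χ p hχ3 hpm hce
  · set f : ZMod (p ^ e) → ZMod (p ^ e) := fun x => eval (mapForm φ a) x 1 with hf
    have hfx : ∀ x : ℤ_[p], f (φ x) = φ (eval a x 1) := by
      intro x
      simp [hf, eval, mapForm]
    have h1 := sum_not_isUnit_eq_zero χ p hχ hpm he f (by
      intro x y hxy hx
      obtain ⟨x, rfl⟩ := exists_toZModPow_eq p e x
      obtain ⟨y, rfl⟩ := exists_toZModPow_eq p e y
      rw [hfx, isUnit_toZModPow_iff p he] at hx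
      rw [← map_sub, isUnit_toZModPow_iff p he] at hxy
      refine ⟨φ (a 0 * (x ^ 2 + x * y + y ^ 2) + a 1 * (x + y) + a 2), ?_, ?_⟩
      · rw [isUnit_toZModPow_iff p he]
        by_contra hw
        rw [isUnit_iff_not_dvd, not_not] at hx hxy hw
        apply (isUnit_iff_not_dvd p _).1 hd
        -- Modulo p one has y ≡ x, so the difference quotient becomes the derivative at x.
        have hw' : (p : ℤ_[p]) ∣ 3 * a 0 * x ^ 2 + 2 * a 1 * x + a 2 := by
          have := dvd_add hw (hxy.mul_left (a 0 * (y + 2 * x) + a 1))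
          convert this using 1
          ring
        -- The cofactors are those of a Bézout identity expressing the discriminant through the
        -- cubic and its derivative: a common zero modulo p would make the discriminant a nonunit.
        have := dvd_add (hx.mul_left ((18 * a 0 ^ 2 * a 2 - 6 * a 0 * a 1 ^ 2) * x + 
          (-27 * a 0 ^ 2 * a 3 + 15 * a 0 * a 1 * a 2 - 4 * a 1 ^ 3)))
          (hw'.mul_left ((2 * a 0 * a 1 ^ 2 - 6 * a 0 ^ 2 * a 2) * x ^ 2 +
            (9 * a 0 ^ 2 * a 3 - 7 * a 0 * a 1 * a 2 + 2 * a 1 ^ 3) * x +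
            (3 * a 0 * a 1 * a 3 - 4 * a 0 * a 2 ^ 2 + a 1 ^ 2 * a 2)))
        convert this using 1
        simp only [disc, eval]
        ring
      · rw [hfx, hfx, ← map_sub, ← map_sub, ← map_mul]
        congr 1
        simp only [eval]
        ring)
    have h2 : ∑ x, classValue χ p e (f x) =
        ∑ x, if IsUnit (f x) then classValue χ p e (f x) else 0 := by
      refine Eq.trans ?_ (add_zero _)
      refine Eq.trans ?_ (congrArg (_ + ·) h1)
      rw [← Finset.sum_add_distrib]
      refine Finset.sum_congr rfl fun x _ => ?_
      split_ifs <;> simp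
    rw [h2]
    have h3 : ∀ x : ℤ_[p], (if IsUnit (f (φ x)) then classValue χ p e (f (φ x)) else 0) =
        unitChar χ p (eval a x 1) := by
      intro x
      have hi := isUnit_toZModPow_iff p he (eval a x 1)
      rw [← hfx] at hi
      split_ifs with h
      · rw [hfx]
        rw [hi] at h
        exact classValue_unit χ p hpm hce h
      · rw [hi] at h
        exact (unitChar_of_not_isUnit χ p hpm h).symm
    rw [sum_eq_of_periodic (j := condExp m p) p hce]
    · congr 2
      exact Finset.sum_congr rfl fun k _ => h3 _
    · intro x
      rw [h3, h3]
      apply unitChar_congr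
      refine ⟨a 0 * ((x + p ^ condExp m p) ^ 2 + (x + p ^ condExp m p) * x + x ^ 2) +
        a 1 * (x + p ^ condExp m p + x) + a 2, ?_⟩
      simp only [eval]
      ring
  · have hy : ∀ y : ZMod (p ^ e), ∃ z : ℤ_[p], φ z = y ∧ (IsUnit y ↔ IsUnit z) := fun y => by
      obtain ⟨z, rfl⟩ := exists_toZModPow_eq p e y
      exact ⟨z, rfl, isUnit_toZModPow_iff p he z⟩
    -- Near the point (1 : 0) either there is a simple zero, contributing nothing, or all p^(e-1)
    -- values have character 1, contributing p⁻¹ after division by p^e.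
    rcases hB with ⟨ha, rfl⟩ | ⟨ha, rfl⟩
    · rw [mul_zero]
      have ha1 : IsUnit (a 1) := by
        rw [isUnit_iff_not_dvd] at hd ⊢
        intro h
        apply hd
        have : disc a = a 1 * (a 1 * a 2 ^ 2 - 4 * a 1 ^ 2 * a 3) := by
          simp only [disc, ha]
          ring
        rw [this]
        exact h.mul_right _
      have hev : ∀ z : ℤ_[p], eval (mapForm φ a) 1 (φ z) = φ (a 1 * z + a 2 * z ^ 2 + a 3 * z ^ 3) := by
        intro z
        simp [eval, mapForm, ha]
      apply sum_nonunits_comp χ p hχ hpm (fun y => eval (mapForm φ a) 1 y)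
      · intro y
        obtain ⟨z, rfl, hz⟩ := hy y
        rw [hz, hev, isUnit_toZModPow_iff p he, isUnit_iff_not_dvd, isUnit_iff_not_dvd, not_not,
          not_not]
        rintro ⟨w, rfl⟩
        exact ⟨a 1 * w + a 2 * w * (p * w) + a 3 * w * (p * w) ^ 2, by ring⟩
      · intro y z
        obtain ⟨y, rfl, hy'⟩ := hy y
        obtain ⟨z, rfl, hz'⟩ := hy z
        rw [hy', hz', isUnit_iff_not_dvd, isUnit_iff_not_dvd, not_not, not_not]
        rintro ⟨y, rfl⟩ ⟨z, rfl⟩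
        refine ⟨φ (a 1 + a 2 * (p * y + p * z) + a 3 * ((p * y) ^ 2 + p * y * (p * z) + (p * z) ^ 2)),
          ?_, ?_⟩
        · rw [isUnit_toZModPow_iff p he]
          exact isUnit_of_dvd_sub p ⟨a 2 * (y + z) + a 3 * (p * y ^ 2 + p * y * z + p * z ^ 2),
            by ring⟩ ha1
        · rw [hev, hev, ← map_sub, ← map_sub, ← map_mul]
          congr 1
          ring
    · apply sum_nonunits_one p he
      intro y hy'
      obtain ⟨z, rfl, hz⟩ := hy y
      rw [hz] at hy'
      have h1 : eval (mapForm φ a) 1 (φ z) = φ (eval a 1 z) := by simp [eval, mapForm]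
      have h2 : IsUnit (eval a 1 z) := by
        by_contra h
        have := ha z hy'
        rw [unitChar_of_not_isUnit χ p hpm h] at this
        exact zero_ne_one this
      rw [h1, classValue_unit χ p hpm hce h2, ha z hy']

end SmoothSums

/-! ### The cubic character modulo 9. -/

section ModNine

variable {m : ℕ} [NeZero m] (χ : DirichletCharacter ℂ m)

/-- The cubic character modulo `9` that maps `2` to `w`. -/
noncomputable def charTable (w : ℂ) (n : ℤ) : ℂ :=
  if n % 9 = 1 ∨ n % 9 = 8 then 1 else if n % 9 = 2 ∨ n % 9 = 7 then w
    else if n % 9 = 4 ∨ n % 9 = 5 then w ^ 2 else 0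

variable {χ} in
theorem unitChar_three_congr (hχ : χ.IsPrimitive) (hχ3 : χ ^ 3 = 1) (hpm : 3 ∣ m) {x y : ℤ_[3]}
    (h : (9 : ℤ_[3]) ∣ x - y) : unitChar χ 3 x = unitChar χ 3 y := by
  apply unitChar_congr
  rw [condExp_three hχ hχ3 hpm]
  convert h using 1
  norm_num

variable {χ} in
-- The class of 2 generates (ℤ/9)ˣ, so the value at 2 determines the character.
theorem unitChar_three_intCast (hχ : χ.IsPrimitive) (hχ3 : χ ^ 3 = 1) (hpm : 3 ∣ m) (n : ℤ) :
    unitChar χ 3 n = charTable (unitChar χ 3 2) n := by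
  have h1 : unitChar χ 3 (n : ℤ_[3]) = unitChar χ 3 ((n % 9 : ℤ) : ℤ_[3]) := by
    apply unitChar_three_congr hχ hχ3 hpm
    have h2 : (n : ℤ) - n % 9 = 9 * (n / 9) := by omega
    exact ⟨((n / 9 : ℤ) : ℤ_[3]), by exact_mod_cast congrArg (Int.cast (R := ℤ_[3])) h2⟩
  have hn : ∀ k : ℤ_[3], unitChar χ 3 (3 * k) = 0 := fun k =>
    unitChar_of_not_isUnit χ 3 hpm (by
      rw [isUnit_iff_not_dvd, not_not]
      exact ⟨k, by push_cast; rfl⟩)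
  have h4 : unitChar χ 3 4 = unitChar χ 3 2 ^ 2 := by
    rw [← map_pow]
    norm_num
  have hc : ∀ {x y : ℤ_[3]}, x = y + 9 → unitChar χ 3 x = unitChar χ 3 y := fun {x y} h =>
    unitChar_three_congr hχ hχ3 hpm ⟨1, by rw [h]; ring⟩
  have h5 : unitChar χ 3 5 = unitChar χ 3 2 ^ 2 := by
    rw [← h4, ← unitChar_neg χ 3 hχ3 4]
    exact hc (by norm_num)
  have h7 : unitChar χ 3 7 = unitChar χ 3 2 := by
    rw [← unitChar_neg χ 3 hχ3 2]
    exact hc (by norm_num)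
  have h8 : unitChar χ 3 8 = 1 := by
    rw [← unitChar_neg_one χ 3 hχ3]
    exact hc (by norm_num)
  have h0 := hn 0
  have h3 := hn 1
  have h6 := hn 2
  norm_num at h0 h3 h6
  have hr : 0 ≤ n % 9 ∧ n % 9 < 9 := by omega
  rw [h1, charTable]
  generalize n % 9 = r at hr
  obtain ⟨hr0, hr9⟩ := hr
  interval_cases r <;> simp [h0, h3, h4, h5, h6, h7, h8]

variable {χ} in
-- A value 1 at the generator 2 would make the character trivial on units, so the value is a
-- primitive cube root of unity.
theorem unitChar_two_relation (hχ : χ.IsPrimitive) (hχ3 : χ ^ 3 = 1) (hpm : 3 ∣ m) :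
    1 + unitChar χ 3 2 + unitChar χ 3 2 ^ 2 = 0 := by
  have h2 : IsUnit (2 : ℤ_[3]) := by
    have := isUnit_natCast_of_coprime 3 (n := 2) (by norm_num)
    exact_mod_cast this
  have h3 := unitChar_pow_three χ 3 hχ3 h2
  have h4 : unitChar χ 3 2 ≠ 1 := by
    intro h
    obtain ⟨ε, -, hε⟩ := exists_unitChar_ne_one χ 3 hχ hpm
    obtain ⟨n, hn⟩ : ∃ n : ℤ, (9 : ℤ_[3]) ∣ (ε : ℤ_[3]) - n := by
      refine ⟨((ε : ℤ_[3]).appr 2 : ℤ), ?_⟩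
      have := PadicInt.appr_spec 2 (ε : ℤ_[3])
      rw [Ideal.mem_span_singleton] at this
      convert this using 1 <;> norm_num
    have h5 := unitChar_three_congr hχ hχ3 hpm hn
    rw [unitChar_three_intCast hχ hχ3 hpm, h] at h5
    have h6 : charTable 1 n = 1 ∨ charTable 1 n = 0 := by
      unfold charTable
      split_ifs <;> simp
    rcases h6 with h6 | h6
    · exact hε (h5.trans h6)
    · exact unitChar_ne_zero χ 3 hχ3 ε.isUnit (h5.trans h6)
  have h5 : (unitChar χ 3 2 - 1) * (1 + unitChar χ 3 2 + unitChar χ 3 2 ^ 2) = 0 := by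
    linear_combination h3
  rcases mul_eq_zero.1 h5 with h | h
  · exact absurd (sub_eq_zero.1 h) h4
  · exact h

end ModNine

end BinaryCubic

set_option linter.unusedSimpArgs false

namespace BinaryCubic

theorem isUnit_intCast_iff (p : ℕ) [Fact p.Prime] (n : ℤ) :
    IsUnit (n : ℤ_[p]) ↔ ¬ (p : ℤ) ∣ n := by
  rw [PadicInt.isUnit_iff, ← PadicInt.norm_int_lt_one_iff_dvd, not_lt]
  exact ⟨fun h => h.ge, fun h => le_antisymm (PadicInt.norm_le_one _) h⟩

/-! ### Reduction to nine residues for p = 3. -/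

section ValuesThree

variable {m : ℕ} [NeZero m] {χ : DirichletCharacter ℂ m}

theorem normC_smooth_three (hχ : χ.IsPrimitive) (hχ3 : χ ^ 3 = 1) (hpm : 3 ∣ m) {e : ℕ}
    (he : 2 ≤ e) {a : Form ℤ_[3]} (A : Form ℤ) (hA : ∀ i, a i = A i) (hd : ¬ 3 ∣ disc A) {B : ℂ}
    (hB : (A 0 = 0 ∧ B = 0) ∨ ((A 0 = 1 ∧ 3 ∣ A 1) ∧ B = 3⁻¹)) :
    normC χ 3 e a = (9⁻¹ * ∑ k ∈ Finset.range 9, charTable (unitChar χ 3 2) (eval A k 1) + B) /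
      charTable (unitChar χ 3 2) (disc A) := by
  have hc := condExp_three hχ hχ3 hpm
  have hdisc : disc a = ((disc A : ℤ) : ℤ_[3]) := by
    simp only [disc, hA]
    push_cast
    rfl
  rw [normC_of_isUnit_disc χ 3 hχ hχ3 hpm (hc.le.trans he) (B := B), hc, hdisc,
    unitChar_three_intCast hχ hχ3 hpm]
  · congr 3
    · norm_num
    · rw [show 3 ^ 2 = 9 by norm_num]
      refine Finset.sum_congr rfl fun k _ => ?_
      rw [← unitChar_three_intCast hχ hχ3 hpm]
      congr 1
      simp only [eval, hA]
      push_cast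
      rfl
  · rw [hdisc, isUnit_intCast_iff]
    exact hd
  · rcases hB with ⟨h0, hB⟩ | ⟨⟨h0, h1⟩, hB⟩
    · left
      exact ⟨by rw [hA, h0, Int.cast_zero], hB⟩
    · right
      refine ⟨fun y hy => ?_, by rw [hB]; norm_num⟩
      rw [isUnit_iff_not_dvd, not_not] at hy
      obtain ⟨y, rfl⟩ := hy
      obtain ⟨w, hw⟩ := h1
      rw [← map_one (unitChar χ 3)]
      apply unitChar_three_congr hχ hχ3 hpm
      simp only [eval, hA, h0, hw]
      refine ⟨w * y + A 2 * y ^ 2 + 3 * A 3 * y ^ 3, ?_⟩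
      push_cast
      ring

open Classical in
-- At x = k prime to 3 the value is a unit, and at multiples of 3 it is exactly 3 times a unit,
-- whence the two branches of the summand.
theorem normC_ramified_three (hχ : χ.IsPrimitive) (hχ3 : χ ^ 3 = 1) (hpm : 3 ∣ m) {e : ℕ}
    (he : 3 ≤ e) {a : Form ℤ_[3]} (A : Form ℤ) (hA : ∀ i, a i = A i) (h2 : 3 ∣ A 2) (h3 : 3 ∣ A 3)
    (h3' : ¬ 3 ∣ A 3 / 3) {k : ℕ} {d : ℤ} (hd : disc A = 3 ^ k * d) (hd3 : ¬ 3 ∣ d) {B : ℂ}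
    (hB : ((A 0 = 0 ∧ A 1 = 1) ∧ B = 0) ∨ ((A 0 = 1 ∧ 3 ∣ A 1) ∧ B = 3⁻¹)) :
    normC χ 3 e a = (9⁻¹ * ∑ k ∈ Finset.range 9,
      (if 3 ∣ k then uniformizerValue χ 3 * charTable (unitChar χ 3 2) (eval A k 1 / 3)
        else charTable (unitChar χ 3 2) (eval A k 1)) + B) / charTable (unitChar χ 3 2) d := by
  have hc := condExp_three hχ hχ3 hpm
  have he0 : e ≠ 0 := by omega
  obtain ⟨C, hC⟩ := h2
  obtain ⟨D, hD⟩ := h3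
  have hD3 : ¬ (3 : ℤ) ∣ D := by
    rwa [hD, Int.mul_ediv_cancel_left _ (by norm_num)] at h3'
  have hDu : IsUnit (D : ℤ_[3]) := (isUnit_intCast_iff 3 D).2 hD3
  have hdu : IsUnit (d : ℤ_[3]) := (isUnit_intCast_iff 3 d).2 hd3
  have hdisc : disc a = ((3 : ℕ) : ℤ_[3]) ^ k * d := by
    have : disc a = ((disc A : ℤ) : ℤ_[3]) := by
      simp only [disc, hA]
      push_cast
      rfl
    rw [this, hd]
    push_cast
    rfl
  have hdc : discChar χ 3 a = charTable (unitChar χ 3 2) d := by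
    obtain ⟨u, hu⟩ := hdu
    rw [discChar_eq χ 3 (k := k) (u := u) (by rw [hdisc, hu]), hu,
      unitChar_three_intCast hχ hχ3 hpm]
  rw [← hdc]
  set φ := PadicInt.toZModPow (p := 3) e with hφ
  have hev : ∀ x y : ℤ_[3], eval (mapForm φ a) (φ x) (φ y) = φ (eval a x y) := by
    intro x y
    simp [eval, mapForm]
  have hev' : ∀ x y : ℤ_[3], eval a x y = A 0 * x ^ 3 + A 1 * x ^ 2 * y + 3 * C * x * y ^ 2 +
      3 * D * y ^ 3 := by
    intro x y
    simp only [eval, hA, hC, hD]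
    push_cast
    ring
  have hunit : ∀ x : ℤ_[3], IsUnit x → IsUnit (eval a x 1) := by
    intro x hx
    rcases hB with ⟨⟨h0, h1⟩, -⟩ | ⟨⟨h0, w, h1⟩, -⟩
    · refine isUnit_of_dvd_sub 3 (y := x ^ 2) ⟨C * x + D, ?_⟩ (hx.pow 2)
      rw [hev', h0, h1]
      push_cast
      ring
    · refine isUnit_of_dvd_sub 3 (y := x ^ 3) ⟨w * x ^ 2 + C * x + D, ?_⟩ (hx.pow 3)
      rw [hev', h0, h1]
      push_cast
      ring
  have hnon : ∀ x : ℤ_[3], ¬ IsUnit x → ∃ u, IsUnit u ∧ eval a x 1 = ((3 : ℕ) : ℤ_[3]) * u := by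
    intro x hx
    rw [isUnit_iff_not_dvd, not_not] at hx
    obtain ⟨z, rfl⟩ := hx
    refine ⟨D + 3 * (A 0 * 3 * z ^ 3 + A 1 * z ^ 2 + C * z), ?_, ?_⟩
    · exact isUnit_of_dvd_sub 3 ⟨A 0 * 3 * z ^ 3 + A 1 * z ^ 2 + C * z, by push_cast; ring⟩ hDu
    · rw [hev']
      push_cast
      ring
  apply normC_eq_of_periodic χ 3 hχ3 hpm (by omega)
  · have hS := sum_eq_of_periodic (e := e) (j := 2) 3 (by omega)
      (f := fun x => classValue χ 3 e (eval (mapForm φ a) x 1)) (by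
        intro x
        -- For x divisible by 3 the difference is divisible by 27, so a(x,1)/3 is still determined
        -- modulo 9 and the period 9 survives on the ramified residues.
        have key : ∃ q, eval a (x + ((3 : ℕ) : ℤ_[3]) ^ 2) 1 = eval a x 1 + 9 * q ∧
            (¬ IsUnit x → (3 : ℤ_[3]) ∣ q) := by
          refine ⟨A 0 * (3 * x ^ 2 + 27 * x + 81) + A 1 * (2 * x + 9) + 3 * C, ?_, ?_⟩
          · rw [hev', hev']
            push_cast
            ring
          · intro hx
            rw [isUnit_iff_not_dvd, not_not] at hx
            obtain ⟨z, rfl⟩ := hx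
            refine ⟨A 0 * (9 * z ^ 2 + 27 * z + 27) + A 1 * (2 * z + 3) + C, ?_⟩
            push_cast
            ring
        obtain ⟨q, hq, hq3⟩ := key
        have h1 : ∀ x : ℤ_[3], eval (mapForm φ a) (φ x) 1 = φ (eval a x 1) := by
          intro x
          rw [← hev, map_one]
        simp only [← hφ]
        rw [h1, h1, hq]
        by_cases hx : IsUnit x
        · have hu := hunit x hx
          rw [classValue_unit χ 3 hpm (by omega) hu, classValue_unit χ 3 hpm (by omega)]
          · exact unitChar_three_congr hχ hχ3 hpm ⟨q, by ring⟩
          · exact isUnit_of_dvd_sub 3 ⟨3 * q, by push_cast; ring⟩ hu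
        · obtain ⟨u, hu, hxu⟩ := hnon x hx
          obtain ⟨q, rfl⟩ := hq3 hx
          rw [hxu, classValue_p_mul_unit χ 3 hpm (by omega) hu]
          have : ((3 : ℕ) : ℤ_[3]) * u + 9 * (3 * q) = ((3 : ℕ) : ℤ_[3]) * (u + 9 * q) := by
            push_cast
            ring
          rw [this, classValue_p_mul_unit χ 3 hpm (by omega)]
          · congr 1
            exact unitChar_three_congr hχ hχ3 hpm ⟨q, by ring⟩
          · exact isUnit_of_dvd_sub 3 ⟨3 * q, by push_cast; ring⟩ hu)
    rw [hS]
    congr 2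
    · norm_num
    · rw [show 3 ^ 2 = 9 by norm_num]
      refine Finset.sum_congr rfl fun k _ => ?_
      have h1 : eval (mapForm φ a) (φ (k : ℤ_[3])) 1 = φ (eval a k 1) := by
        rw [← hev, map_one]
      have h4 : eval a (k : ℤ_[3]) 1 = ((eval A k 1 : ℤ) : ℤ_[3]) := by
        simp only [eval, hA]
        push_cast
        rfl
      have hk : IsUnit (k : ℤ_[3]) ↔ ¬ 3 ∣ k := by
        have := isUnit_intCast_iff 3 (k : ℤ)
        rw [Int.natCast_dvd_natCast, Int.cast_natCast] at this
        exact this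
      simp only [← hφ]
      rw [h1]
      split_ifs with h
      · obtain ⟨u, hu, hku⟩ := hnon k (by rw [hk, not_not]; exact h)
        have h5 : (3 : ℤ) ∣ eval A k 1 := by
          by_contra h6
          have := (isUnit_intCast_iff 3 (eval A k 1)).2 h6
          rw [← h4, hku, isUnit_iff_not_dvd] at this
          exact this ⟨u, rfl⟩
        obtain ⟨n, hn⟩ := h5
        have h7 : u = (n : ℤ_[3]) := by
          rw [h4, hn] at hku
          push_cast at hku
          have h30 : (3 : ℤ_[3]) ≠ 0 := by norm_num
          exact (mul_left_cancel₀ h30 hku).symm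
        rw [hku, classValue_p_mul_unit χ 3 hpm (by omega) hu, hn,
          Int.mul_ediv_cancel_left _ (by norm_num), h7, unitChar_three_intCast hχ hχ3 hpm]
      · rw [classValue_unit χ 3 hpm (by omega) (hunit _ (hk.2 h)), h4,
          unitChar_three_intCast hχ hχ3 hpm]
  -- Near (1 : 0) there is a simple zero in the first case; in the second all values are 1 modulo 9.
  · rcases hB with ⟨⟨h0, h1⟩, rfl⟩ | ⟨⟨h0, w, h1⟩, rfl⟩
    · rw [mul_zero]
      apply sum_nonunits_comp χ 3 hχ hpm (fun y => eval (mapForm φ a) 1 y)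
      · intro y
        obtain ⟨z, rfl⟩ := exists_toZModPow_eq 3 e y
        rw [← map_one φ, hev, isUnit_toZModPow_iff 3 he0, isUnit_toZModPow_iff 3 he0,
          isUnit_iff_not_dvd, isUnit_iff_not_dvd, not_not, not_not, hev', h0, h1]
        rintro ⟨w, rfl⟩
        exact ⟨w + 3 * C * w ^ 2 * 3 + 3 * D * w ^ 3 * 9, by push_cast; ring⟩
      · intro y z _ _
        obtain ⟨y, rfl⟩ := exists_toZModPow_eq 3 e y
        obtain ⟨z, rfl⟩ := exists_toZModPow_eq 3 e z
        refine ⟨φ (1 + 3 * (C * (y + z) + D * (y ^ 2 + y * z + z ^ 2))), ?_, ?_⟩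
        · rw [isUnit_toZModPow_iff 3 he0]
          exact isUnit_of_dvd_sub 3 (y := 1)
            ⟨C * (y + z) + D * (y ^ 2 + y * z + z ^ 2), by push_cast; ring⟩ isUnit_one
        · rw [← map_one φ, hev, hev, ← map_sub, ← map_sub, ← map_mul, hev', hev', h0, h1]
          congr 1
          push_cast
          ring
    · have := sum_nonunits_one 3 (e := e) he0
        (f := fun y => classValue χ 3 e (eval (mapForm φ a) 1 y)) (by
          intro y
          obtain ⟨z, rfl⟩ := exists_toZModPow_eq 3 e y
          rw [← map_one φ, hev, isUnit_toZModPow_iff 3 he0, isUnit_iff_not_dvd, not_not]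
          rintro ⟨z, rfl⟩
          have h9 : (9 : ℤ_[3]) ∣ eval a 1 (((3 : ℕ) : ℤ_[3]) * z) - 1 := by
            rw [hev', h0, h1]
            refine ⟨w * z + 3 * C * z ^ 2 + 9 * D * z ^ 3, ?_⟩
            push_cast
            ring
          rw [classValue_unit χ 3 hpm (by omega)]
          · rw [← map_one (unitChar χ 3)]
            exact unitChar_three_congr hχ hχ3 hpm h9
          · obtain ⟨q, hq⟩ := h9
            exact isUnit_of_dvd_sub 3 (y := 1) ⟨3 * q, by rw [hq]; push_cast; ring⟩ isUnit_one)
      rw [this]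
      norm_num

theorem uniformizerValue_eq (p : ℕ) [Fact p.Prime] (hχ3 : χ ^ 3 = 1) :
    uniformizerValue χ p = p * (coprimaryPart χ p p ^ 2 * (p : ℂ) ^ (-(1 / 3) : ℂ)) := by
  have h := coprimaryPart_pow_three χ p hχ3 (isUnit_coprime_modulus (m := m) p)
  rw [uniformizerValue]
  congr 2
  rw [inv_eq_iff_eq_inv]
  exact eq_inv_of_mul_eq_one_right (by rw [← pow_succ, h])

end ValuesThree

/-! ### Numerical evaluation of the rows for p = 3. -/

section TableThree

variable {m : ℕ} [NeZero m] {χ : DirichletCharacter ℂ m}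

/-- The value of `χ̃_p(p)|p|^{1/3}`. -/
noncomputable def primeTerm (χ : DirichletCharacter ℂ m) (p : ℕ) [Fact p.Prime] : ℂ :=
  coprimaryPart χ p p ^ 2 * (p : ℂ) ^ (-(1 / 3) : ℂ)

theorem uniformizerValue_three (hχ3 : χ ^ 3 = 1) :
    uniformizerValue χ 3 = 3 * primeTerm χ 3 := by
  rw [uniformizerValue_eq 3 hχ3, primeTerm]
  norm_num

theorem inv_eq_sq_of_relation {w : ℂ} (h : 1 + w + w ^ 2 = 0) : w⁻¹ = w ^ 2 :=
  inv_eq_of_mul_eq_one_right (by linear_combination (w - 1) * h)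

/-- Once the nine character values are inserted, the claim is an identity in `w = χ_3(2)` modulo `1
+ w + w² = 0`, where inverses of powers of w are powers again. The other rows are evaluated in the
same manner. -/
theorem normC_three_split (hχ : χ.IsPrimitive) (hχ3 : χ ^ 3 = 1) (hpm : 3 ∣ m) {e : ℕ}
    (he : 2 ≤ e) : normC χ 3 e ![0, 1, -1, 0] = unitChar χ 3 2 / 3 := by
  have h := unitChar_two_relation hχ hχ3 hpm
  rw [normC_smooth_three hχ hχ3 hpm he ![0, 1, -1, 0] (by intro i; fin_cases i <;> simp)
    (by simp [disc]) (B := 0) (by simp)]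
  simp [Finset.sum_range_succ, charTable, disc, eval]
  generalize unitChar χ 3 2 = w at *
  have hw := inv_eq_sq_of_relation h
  simp only [div_eq_mul_inv, inv_pow, hw]
  grind

theorem normC_three_linQuad (hχ : χ.IsPrimitive) (hχ3 : χ ^ 3 = 1) (hpm : 3 ∣ m) {e : ℕ}
    (he : 2 ≤ e) : normC χ 3 e ![0, 1, 0, 1] = unitChar χ 3 2 / 3 := by
  have h := unitChar_two_relation hχ hχ3 hpm
  rw [normC_smooth_three hχ hχ3 hpm he ![0, 1, 0, 1] (by intro i; fin_cases i <;> simp)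
    (by simp [disc]) (B := 0) (by simp)]
  simp [Finset.sum_range_succ, charTable, disc, eval]
  generalize unitChar χ 3 2 = w at *
  have hw := inv_eq_sq_of_relation h
  simp only [div_eq_mul_inv, inv_pow, hw]
  grind

theorem normC_three_irr (hχ : χ.IsPrimitive) (hχ3 : χ ^ 3 = 1) (hpm : 3 ∣ m) {e : ℕ}
    (he : 2 ≤ e) : normC χ 3 e ![1, 0, -1, 1] = unitChar χ 3 2 / 3 := by
  have h := unitChar_two_relation hχ hχ3 hpm
  rw [normC_smooth_three hχ hχ3 hpm he ![1, 0, -1, 1] (by intro i; fin_cases i <;> simp)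
    (by simp [disc]) (B := 3⁻¹) (by simp)]
  simp [Finset.sum_range_succ, charTable, disc, eval]
  generalize unitChar χ 3 2 = w at *
  have hw := inv_eq_sq_of_relation h
  simp only [div_eq_mul_inv, inv_pow, hw]
  grind

theorem normC_three_0_1_0_3 (hχ : χ.IsPrimitive) (hχ3 : χ ^ 3 = 1) (hpm : 3 ∣ m) {e : ℕ}
    (he : 3 ≤ e) : normC χ 3 e ![0, 1, 0, 3] = (1 - unitChar χ 3 2 ^ 2) * primeTerm χ 3 / 3 := by
  have h := unitChar_two_relation hχ hχ3 hpm
  rw [normC_ramified_three hχ hχ3 hpm he ![0, 1, 0, 3] (by intro i; fin_cases i <;> simp) (by simp)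
    (by simp) (by simp) (k := 1) (d := -4) (by simp [disc]) (by norm_num) (B := 0) (by simp)]
  simp [Finset.sum_range_succ, charTable, eval, uniformizerValue_three hχ3]
  generalize unitChar χ 3 2 = w at *
  have hw := inv_eq_sq_of_relation h
  simp only [div_eq_mul_inv, inv_pow, hw]
  grind

theorem normC_three_0_1_0_neg3 (hχ : χ.IsPrimitive) (hχ3 : χ ^ 3 = 1) (hpm : 3 ∣ m) {e : ℕ}
    (he : 3 ≤ e) : normC χ 3 e ![0, 1, 0, -3] = -((1 - unitChar χ 3 2 ^ 2) * primeTerm χ 3 / 3) := by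
  have h := unitChar_two_relation hχ hχ3 hpm
  rw [normC_ramified_three hχ hχ3 hpm he ![0, 1, 0, -3] (by intro i; fin_cases i <;> simp) (by simp)
    (by simp) (by simp) (k := 1) (d := 4) (by simp [disc]) (by norm_num) (B := 0) (by simp)]
  simp [Finset.sum_range_succ, charTable, eval, uniformizerValue_three hχ3]
  generalize unitChar χ 3 2 = w at *
  have hw := inv_eq_sq_of_relation h
  simp only [div_eq_mul_inv, inv_pow, hw]
  grind

theorem normC_three_1_0_3_3 (hχ : χ.IsPrimitive) (hχ3 : χ ^ 3 = 1) (hpm : 3 ∣ m) {e : ℕ}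
    (he : 3 ≤ e) : normC χ 3 e ![1, 0, 3, 3] = (unitChar χ 3 2 - 1) / 3 := by
  have h := unitChar_two_relation hχ hχ3 hpm
  rw [normC_ramified_three hχ hχ3 hpm he ![1, 0, 3, 3] (by intro i; fin_cases i <;> simp) (by simp)
    (by simp) (by simp) (k := 3) (d := -13) (by simp [disc]) (by norm_num) (B := 3⁻¹) (by simp)]
  simp [Finset.sum_range_succ, charTable, eval, uniformizerValue_three hχ3]
  generalize unitChar χ 3 2 = w at *
  have hw := inv_eq_sq_of_relation h
  simp only [div_eq_mul_inv, inv_pow, hw]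
  grind

theorem normC_three_1_0_6_3 (hχ : χ.IsPrimitive) (hχ3 : χ ^ 3 = 1) (hpm : 3 ∣ m) {e : ℕ}
    (he : 3 ≤ e) : normC χ 3 e ![1, 0, 6, 3] = (2 * unitChar χ 3 2 + 1) / 3 := by
  have h := unitChar_two_relation hχ hχ3 hpm
  rw [normC_ramified_three hχ hχ3 hpm he ![1, 0, 6, 3] (by intro i; fin_cases i <;> simp) (by simp)
    (by simp) (by simp) (k := 3) (d := -41) (by simp [disc]) (by norm_num) (B := 3⁻¹) (by simp)]
  simp [Finset.sum_range_succ, charTable, eval, uniformizerValue_three hχ3]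
  generalize unitChar χ 3 2 = w at *
  have hw := inv_eq_sq_of_relation h
  simp only [div_eq_mul_inv, inv_pow, hw]
  grind

theorem normC_three_1_3_0_3 (hχ : χ.IsPrimitive) (hχ3 : χ ^ 3 = 1) (hpm : 3 ∣ m) {e : ℕ}
    (he : 3 ≤ e) : normC χ 3 e ![1, 3, 0, 3] = unitChar χ 3 2 ^ 2 * primeTerm χ 3 := by
  have h := unitChar_two_relation hχ hχ3 hpm
  rw [normC_ramified_three hχ hχ3 hpm he ![1, 3, 0, 3] (by intro i; fin_cases i <;> simp) (by simp)
    (by simp) (by simp) (k := 4) (d := -7) (by simp [disc]) (by norm_num) (B := 3⁻¹) (by simp)]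
  simp [Finset.sum_range_succ, charTable, eval, uniformizerValue_three hχ3]
  generalize unitChar χ 3 2 = w at *
  have hw := inv_eq_sq_of_relation h
  simp only [div_eq_mul_inv, inv_pow, hw]
  grind

theorem normC_three_1_neg3_0_3 (hχ : χ.IsPrimitive) (hχ3 : χ ^ 3 = 1) (hpm : 3 ∣ m) {e : ℕ}
    (he : 3 ≤ e) : normC χ 3 e ![1, -3, 0, 3] = 1 + primeTerm χ 3 := by
  have h := unitChar_two_relation hχ hχ3 hpm
  rw [normC_ramified_three hχ hχ3 hpm he ![1, -3, 0, 3] (by intro i; fin_cases i <;> simp) (by simp)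
    (by simp) (by simp) (k := 4) (d := 1) (by simp [disc]) (by norm_num) (B := 3⁻¹) (by simp)]
  simp [Finset.sum_range_succ, charTable, eval, uniformizerValue_three hχ3]
  generalize unitChar χ 3 2 = w at *
  grind

theorem normC_three_1_neg3_0_12 (hχ : χ.IsPrimitive) (hχ3 : χ ^ 3 = 1) (hpm : 3 ∣ m) {e : ℕ}
    (he : 3 ≤ e) : normC χ 3 e ![1, -3, 0, 12] = unitChar χ 3 2 + primeTerm χ 3 := by
  have h := unitChar_two_relation hχ hχ3 hpm
  rw [normC_ramified_three hχ hχ3 hpm he ![1, -3, 0, 12] (by intro i; fin_cases i <;> simp) (by simp)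
    (by simp) (by simp) (k := 4) (d := -32) (by simp [disc]) (by norm_num) (B := 3⁻¹) (by simp)]
  simp [Finset.sum_range_succ, charTable, eval, uniformizerValue_three hχ3]
  generalize unitChar χ 3 2 = w at *
  have hw := inv_eq_sq_of_relation h
  simp only [div_eq_mul_inv, inv_pow, hw]
  grind

theorem normC_three_1_neg3_0_21 (hχ : χ.IsPrimitive) (hχ3 : χ ^ 3 = 1) (hpm : 3 ∣ m) {e : ℕ}
    (he : 3 ≤ e) : normC χ 3 e ![1, -3, 0, 21] = unitChar χ 3 2 ^ 2 + primeTerm χ 3 := by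
  have h := unitChar_two_relation hχ hχ3 hpm
  rw [normC_ramified_three hχ hχ3 hpm he ![1, -3, 0, 21] (by intro i; fin_cases i <;> simp) (by simp)
    (by simp) (by simp) (k := 4) (d := -119) (by simp [disc]) (by norm_num) (B := 3⁻¹) (by simp)]
  simp [Finset.sum_range_succ, charTable, eval, uniformizerValue_three hχ3]
  generalize unitChar χ 3 2 = w at *
  have hw := inv_eq_sq_of_relation h
  simp only [div_eq_mul_inv, inv_pow, hw]
  grind

theorem normC_three_1_0_0_3 (hχ : χ.IsPrimitive) (hχ3 : χ ^ 3 = 1) (hpm : 3 ∣ m) {e : ℕ}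
    (he : 3 ≤ e) : normC χ 3 e ![1, 0, 0, 3] = primeTerm χ 3 := by
  have h := unitChar_two_relation hχ hχ3 hpm
  rw [normC_ramified_three hχ hχ3 hpm he ![1, 0, 0, 3] (by intro i; fin_cases i <;> simp) (by simp)
    (by simp) (by simp) (k := 5) (d := -1) (by simp [disc]) (by norm_num) (B := 3⁻¹) (by simp)]
  simp [Finset.sum_range_succ, charTable, eval, uniformizerValue_three hχ3]
  generalize unitChar χ 3 2 = w at *
  grind

theorem normC_three_1_0_0_12 (hχ : χ.IsPrimitive) (hχ3 : χ ^ 3 = 1) (hpm : 3 ∣ m) {e : ℕ}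
    (he : 3 ≤ e) : normC χ 3 e ![1, 0, 0, 12] = unitChar χ 3 2 * primeTerm χ 3 := by
  have h := unitChar_two_relation hχ hχ3 hpm
  rw [normC_ramified_three hχ hχ3 hpm he ![1, 0, 0, 12] (by intro i; fin_cases i <;> simp) (by simp)
    (by simp) (by simp) (k := 5) (d := -16) (by simp [disc]) (by norm_num) (B := 3⁻¹) (by simp)]
  simp [Finset.sum_range_succ, charTable, eval, uniformizerValue_three hχ3]
  generalize unitChar χ 3 2 = w at *
  have hw := inv_eq_sq_of_relation h
  simp only [div_eq_mul_inv, inv_pow, hw]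
  grind

theorem normC_three_1_0_0_21 (hχ : χ.IsPrimitive) (hχ3 : χ ^ 3 = 1) (hpm : 3 ∣ m) {e : ℕ}
    (he : 3 ≤ e) : normC χ 3 e ![1, 0, 0, 21] = unitChar χ 3 2 ^ 2 * primeTerm χ 3 := by
  have h := unitChar_two_relation hχ hχ3 hpm
  rw [normC_ramified_three hχ hχ3 hpm he ![1, 0, 0, 21] (by intro i; fin_cases i <;> simp) (by simp)
    (by simp) (by simp) (k := 5) (d := -49) (by simp [disc]) (by norm_num) (B := 3⁻¹) (by simp)]
  simp [Finset.sum_range_succ, charTable, eval, uniformizerValue_three hχ3]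
  generalize unitChar χ 3 2 = w at *
  have hw := inv_eq_sq_of_relation h
  simp only [div_eq_mul_inv, inv_pow, hw]
  grind

end TableThree

end BinaryCubic

namespace BinaryCubic

/-! ### The cubic Gauss sum modulo 9. -/

section TauThree

variable {m : ℕ} [NeZero m] (χ : DirichletCharacter ℂ m) (p : ℕ) [Fact p.Prime]

theorem primaryPart_natCast (n : ℕ) : primaryPart χ p n = unitChar χ p n := by
  rw [unitChar_apply, map_natCast (PadicInt.toZModPow (p := p) (condExp m p))]

theorem tau_eq_sum_range : tau χ p = ∑ k ∈ Finset.range (p ^ condExp m p),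
    unitChar χ p k * (ZMod.stdAddChar (1 : ZMod (p ^ condExp m p))) ^ k := by
  rw [tau, gaussSum, sum_zmod_eq_sum_range]
  refine Finset.sum_congr rfl fun k _ => ?_
  rw [primaryPart_natCast, ← AddChar.map_nsmul_eq_pow, nsmul_one]

variable {χ} in
-- Let z be the basic additive character value, a primitive ninth root of unity. The primitive cube
-- root w = χ_3(2) is z³ or z⁶, and the Gauss sum collapses to 3z or 3z⁸ respectively; in both cases
-- its cube is 27w.
theorem tau_three_pow (hχ : χ.IsPrimitive) (hχ3 : χ ^ 3 = 1) (hpm : 3 ∣ m) :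
    tau χ 3 ^ 3 = 27 * unitChar χ 3 2 := by
  have hc : 3 ^ condExp m 3 = 9 := by rw [condExp_three hχ hχ3 hpm]; norm_num
  rw [tau_eq_sum_range]
  have hz : (ZMod.stdAddChar (1 : ZMod (3 ^ condExp m 3))) ^ 9 = 1 := by
    rw [← AddChar.map_nsmul_eq_pow, nsmul_one, ← hc, ZMod.natCast_self, AddChar.map_zero_eq_one]
  have hz3 : (ZMod.stdAddChar (1 : ZMod (3 ^ condExp m 3))) ^ 3 ≠ 1 := by
    rw [← AddChar.map_nsmul_eq_pow, nsmul_one]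
    intro h
    rw [← (ZMod.stdAddChar (N := 3 ^ condExp m 3)).map_zero_eq_one] at h
    have h1 := ZMod.injective_stdAddChar h
    rw [ZMod.natCast_eq_zero_iff, hc] at h1
    norm_num at h1
  generalize ZMod.stdAddChar (1 : ZMod (3 ^ condExp m 3)) = z at *
  have h1 : ∀ k : ℕ, unitChar χ 3 (k : ℤ_[3]) = charTable (unitChar χ 3 2) k := fun k => by
    rw [← unitChar_three_intCast hχ hχ3 hpm, Int.cast_natCast]
  simp only [h1, hc]
  have h := unitChar_two_relation hχ hχ3 hpm
  simp [Finset.sum_range_succ, charTable]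
  generalize unitChar χ 3 2 = w at *
  have h2 : z ^ 6 + z ^ 3 + 1 = 0 := by
    have : (z ^ 3 - 1) * (z ^ 6 + z ^ 3 + 1) = 0 := by linear_combination hz
    exact (mul_eq_zero.1 this).resolve_left (sub_ne_zero.2 hz3)
  have h3 : (w - z ^ 3) * (w - z ^ 6) = 0 := by linear_combination h - w * h2 + hz
  rcases mul_eq_zero.1 h3 with h4 | h4
  · have h5 : w = z ^ 3 := sub_eq_zero.1 h4
    have : z + w * z ^ 2 + w ^ 2 * z ^ 4 + w ^ 2 * z ^ 5 + w * z ^ 7 + z ^ 8 = 3 * z := by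
      rw [h5]
      linear_combination (2 * z + z ^ 2) * hz + z ^ 2 * h2
    rw [this, h5]
    ring
  · have h5 : w = z ^ 6 := sub_eq_zero.1 h4
    have : z + w * z ^ 2 + w ^ 2 * z ^ 4 + w ^ 2 * z ^ 5 + w * z ^ 7 + z ^ 8 = 3 * z ^ 8 := by
      rw [h5]
      linear_combination (z ^ 7 + z ^ 8 + z ^ 4) * hz + z * h2
    rw [this, h5]
    linear_combination 27 * z ^ 6 * (z ^ 9 + 1) * hz

end TauThree

/-! ### Cubic character sums over a finite field. -/

section CubicCharacterSums

open Finset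

variable {F : Type*} [Field F] [Fintype F] {ψ : MulChar F ℂ}

/-- Uses x² - x = -x(1 - x). -/
theorem sum_sq_sub_self (h1 : ψ (-1) = 1) : ∑ x : F, ψ (x ^ 2 - x) = jacobiSum ψ ψ := by
  rw [jacobiSum]
  refine sum_congr rfl fun x _ => ?_
  rw [← map_mul, ← one_mul (ψ (x ^ 2 - x)), ← h1, ← map_mul]
  congr 1
  ring

/-- The number of square roots of y is 1 plus the quadratic character of y. The constant 1
contributes a full character sum, which vanishes, and y ↦ d y extracts the dependence on d. -/
theorem sum_sq_sub_eq [DecidableEq F] (hψ : ψ ≠ 1) (hF : ringChar F ≠ 2) {d : F} (hd : d ≠ 0) :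
    ∑ x : F, ψ (x ^ 2 - d) = quadraticChar F d * ψ d * ∑ x : F, ψ (x ^ 2 - 1) := by
  have key : ∀ d : F, ∑ x : F, ψ (x ^ 2 - d) = ∑ y : F, (quadraticChar F y : ℂ) * ψ (y - d) := by
    intro d
    have h1 : ∑ x : F, ψ (x ^ 2 - d) = ∑ y : F, ((quadraticChar F y : ℂ) + 1) * ψ (y - d) := by
      rw [← Finset.sum_fiberwise (s := univ) (g := fun x : F => x ^ 2)]
      refine sum_congr rfl fun y _ => ?_
      rw [sum_congr rfl (g := fun _ => ψ (y - d))
        (fun x hx => by rw [(mem_filter.1 hx).2]), sum_const, nsmul_eq_mul]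
      congr 1
      have := quadraticChar_card_sqrts hF y
      rw [← Int.cast_one (R := ℂ), ← Int.cast_add, ← this]
      simp only [Int.cast_natCast]
      congr 2
      ext x
      simp
    have h2 : ∑ y : F, ψ (y - d) = 0 := by
      rw [← MulChar.sum_eq_zero_of_ne_one hψ]
      exact Equiv.sum_comp (Equiv.subRight d) ψ
    rw [h1]
    simp only [add_mul, one_mul, sum_add_distrib, h2, add_zero]
  rw [key, key, mul_sum, ← Equiv.sum_comp (Equiv.mulLeft₀ d hd)]
  refine sum_congr rfl fun y _ => ?_
  have : d * y - d = d * (y - 1) := by ring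
  simp only [Equiv.mulLeft₀_apply, this, map_mul]
  push_cast
  ring

/-- The substitution x ↦ 2x - 1 turns x² - 1 into 4(x² - x). -/
theorem sum_sq_sub_one (h1 : ψ (-1) = 1) (h2 : (2 : F) ≠ 0) :
    ∑ x : F, ψ (x ^ 2 - 1) = ψ 4 * jacobiSum ψ ψ := by
  rw [← sum_sq_sub_self h1, mul_sum,
    ← Equiv.sum_comp ((Equiv.mulLeft₀ (2 : F) h2).trans (Equiv.subRight 1))]
  refine sum_congr rfl fun x _ => ?_
  rw [← map_mul]
  congr 1
  simp only [Equiv.trans_apply, Equiv.mulLeft₀_apply, Equiv.subRight_apply]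
  ring

/-- On a generator of the cyclic group Fˣ the character has a value of order 3, so its kernel
consists of the powers with exponent divisible by 3. -/
theorem exists_cbrt_of_apply_eq_one (hψ : ψ ≠ 1) (hψ3 : ψ ^ 3 = 1) {y : F} (hy : ψ y = 1) :
    ∃ x : F, x ≠ 0 ∧ x ^ 3 = y := by
  have hy0 : y ≠ 0 := by
    rintro rfl
    rw [MulChar.map_zero] at hy
    exact zero_ne_one hy
  obtain ⟨g, hg⟩ := IsCyclic.exists_generator (α := Fˣ)
  have hw : ψ g ≠ 1 := by
    intro h
    apply hψ
    ext u
    obtain ⟨k, rfl⟩ := Subgroup.mem_zpowers_iff.1 (hg u)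
    have : (MulChar.toUnitHom ψ) g = 1 := Units.ext h
    rw [← MulChar.coe_toUnitHom, map_zpow, this, one_zpow, MulChar.one_apply_coe, Units.val_one]
  have hw3 : (MulChar.toUnitHom ψ) g ^ 3 = 1 := by
    ext
    rw [Units.val_pow_eq_pow_val, MulChar.coe_toUnitHom, ← MulChar.pow_apply_coe, hψ3]
    simp
  have ho : orderOf ((MulChar.toUnitHom ψ) g) = 3 :=
    orderOf_eq_prime hw3 fun h => hw (by
      rw [← MulChar.coe_toUnitHom, h]; rfl)
  obtain ⟨k, hk⟩ := Subgroup.mem_zpowers_iff.1 (hg (Units.mk0 y hy0))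
  have h1 : (MulChar.toUnitHom ψ) g ^ k = 1 := by
    rw [← map_zpow, hk]
    ext
    rw [MulChar.coe_toUnitHom]
    exact hy
  rw [← orderOf_dvd_iff_zpow_eq_one, ho] at h1
  obtain ⟨j, rfl⟩ := h1
  refine ⟨((g ^ j : Fˣ) : F), Units.ne_zero _, ?_⟩
  rw [← Units.val_pow_eq_pow_val, ← zpow_natCast, ← zpow_mul, mul_comm]
  exact congrArg Units.val hk

theorem card_cbrt [DecidableEq F] (hψ : ψ ≠ 1) (hψ3 : ψ ^ 3 = 1) {θ : F} (hθ : IsPrimitiveRoot θ 3)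
    (y : F) : ((univ.filter fun x : F => x ^ 3 = y).card : ℂ) = 1 + ψ y + ψ y ^ 2 := by
  by_cases hy : ∃ x, x ^ 3 = y
  · obtain ⟨x, rfl⟩ := hy
    by_cases hx : x = 0
    · subst hx
      have : univ.filter (fun x : F => x ^ 3 = 0 ^ 3) = {0} := by
        ext x
        simp
      rw [this, MulChar.map_nonunit ψ (a := 0 ^ 3) (by simp)]
      simp
    · have h3 : ψ (x ^ 3) = 1 := by
        rw [map_pow, ← MulChar.pow_apply' _ (by norm_num), hψ3, MulChar.one_apply (Ne.isUnit hx)]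
      have h1 : θ ≠ 1 := hθ.ne_one (by norm_num)
      have h2 : 1 + θ + θ ^ 2 = 0 := by
        have := hθ.geom_sum_eq_zero (by norm_num)
        simpa [Finset.sum_range_succ] using this
      have : univ.filter (fun z : F => z ^ 3 = x ^ 3) = {x, x * θ, x * θ ^ 2} := by
        ext z
        simp only [mem_filter, mem_univ, true_and, mem_insert, mem_singleton]
        constructor
        · intro h
          have : (z - x) * ((z - x * θ) * (z - x * θ ^ 2)) = 0 := by
            linear_combination h + (-z ^ 2 * x + z * x ^ 2 * θ) * h2 - (x ^ 3 - z * x ^ 2) * (θ - 1) * h2 +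
              z * x ^ 2 * h2 - z * x ^ 2 * θ * h2
          simpa [sub_eq_zero] using this
        · rintro (rfl | rfl | rfl)
          · rfl
          · rw [mul_pow, hθ.pow_eq_one, mul_one]
          · rw [mul_pow, ← pow_mul, mul_comm 2 3, pow_mul, hθ.pow_eq_one, one_pow, mul_one]
      rw [this, card_insert_of_notMem, card_insert_of_notMem, card_singleton, h3]
      · norm_num
      · rw [mem_singleton]
        intro h
        have h4 := mul_left_cancel₀ hx h
        apply h1
        have h5 : θ ≠ 0 := hθ.ne_zero (by norm_num)
        rw [sq] at h4
        exact (mul_left_cancel₀ h5 (by rw [mul_one]; exact h4)).symm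
      · rw [mem_insert, mem_singleton]
        rintro (h | h)
        · exact h1 (mul_left_cancel₀ hx (by rw [mul_one]; exact h.symm))
        · have h4 : θ ^ 2 = 1 := mul_left_cancel₀ hx (by rw [mul_one]; exact h.symm)
          exact hθ.pow_ne_one_of_pos_of_lt (by norm_num) (by norm_num) h4
  · have h1 : univ.filter (fun x : F => x ^ 3 = y) = ∅ := by
      ext x
      simp only [mem_filter, mem_univ, true_and, notMem_empty, iff_false]
      exact fun h => hy ⟨x, h⟩
    have hy0 : y ≠ 0 := by
      rintro rfl
      exact hy ⟨0, by simp⟩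
    have h2 : ψ y ≠ 1 := fun h => by
      obtain ⟨x, -, hx⟩ := exists_cbrt_of_apply_eq_one hψ hψ3 h
      exact hy ⟨x, hx⟩
    have h3 : ψ y ^ 3 = 1 := by
      rw [← MulChar.pow_apply' _ (by norm_num), hψ3, MulChar.one_apply (Ne.isUnit hy0)]
    have h4 : (ψ y - 1) * (1 + ψ y + ψ y ^ 2) = 0 := by linear_combination h3
    rw [h1, card_empty, Nat.cast_zero]
    exact ((mul_eq_zero.1 h4).resolve_left (sub_ne_zero.2 h2)).symm

/-- Counting cube roots by 1 + ψ + ψ² splits the sum in three: the first part vanishes, the second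
is a twist of J(ψ,ψ), the third is J(ψ⁻¹,ψ) = -ψ(-1) = -1. -/
theorem sum_cube_add (hψ : ψ ≠ 1) (hψ3 : ψ ^ 3 = 1) (h1 : ψ (-1) = 1) {θ : F}
    (hθ : IsPrimitiveRoot θ 3) {α : F} (hα : α ≠ 0) :
    ∑ x : F, ψ (x ^ 3 + α) = ψ α ^ 2 * jacobiSum ψ ψ - 1 := by
  classical
  have h2 : ∑ x : F, ψ (x ^ 3 + α) = ∑ y : F, (1 + ψ y + ψ y ^ 2) * ψ (y + α) := by
    rw [← Finset.sum_fiberwise (s := univ) (g := fun x : F => x ^ 3)]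
    refine sum_congr rfl fun y _ => ?_
    rw [sum_congr rfl (g := fun _ => ψ (y + α))
      (fun x hx => by rw [(mem_filter.1 hx).2]), sum_const, nsmul_eq_mul, card_cbrt hψ hψ3 hθ]
  have h3 : ∑ y : F, ψ (y + α) = 0 := by
    rw [← MulChar.sum_eq_zero_of_ne_one hψ]
    exact Equiv.sum_comp (Equiv.addRight α) ψ
  have hαu : ψ α ^ 3 = 1 := by
    rw [← MulChar.pow_apply' _ (by norm_num), hψ3, MulChar.one_apply (Ne.isUnit hα)]
  have h4 : ∑ y : F, ψ y * ψ (y + α) = ψ α ^ 2 * jacobiSum ψ ψ := by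
    rw [jacobiSum, mul_sum, ← Equiv.sum_comp (Equiv.mulLeft₀ (-α) (neg_ne_zero.2 hα))]
    refine sum_congr rfl fun y _ => ?_
    have e1 : -α * y = (-1) * α * y := by ring
    have e2 : -α * y + α = α * (1 - y) := by ring
    simp only [Equiv.mulLeft₀_apply, e2]
    rw [e1, map_mul, map_mul, map_mul, h1]
    ring
  have h5 : ∑ y : F, ψ y ^ 2 * ψ (y + α) = -1 := by
    have := jacobiSum_nontrivial_inv hψ
    rw [h1, jacobiSum_comm] at this
    rw [← this, jacobiSum, ← Equiv.sum_comp (Equiv.mulLeft₀ (-α) (neg_ne_zero.2 hα))]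
    refine sum_congr rfl fun y _ => ?_
    have e1 : -α * y = (-1) * α * y := by ring
    have e2 : -α * y + α = α * (1 - y) := by ring
    have e3 : ψ⁻¹ = ψ ^ 2 := inv_eq_of_mul_eq_one_right (by rw [← pow_succ', hψ3])
    rw [e3, MulChar.pow_apply' _ (by norm_num)]
    simp only [Equiv.mulLeft₀_apply, e2]
    rw [e1, map_mul, map_mul, map_mul, h1]
    linear_combination (ψ y ^ 2 * ψ (1 - y)) * hαu
  rw [h2]
  simp only [add_mul, one_mul, sum_add_distrib, h3, h4, h5]
  ring

theorem gaussSum_pow_three (hψ : ψ ≠ 1) (hψ3 : ψ ^ 3 = 1) (h1 : ψ (-1) = 1) {φ : AddChar F ℂ}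
    (hφ : φ.IsPrimitive) : gaussSum ψ φ ^ 3 = Fintype.card F * jacobiSum ψ ψ := by
  have ho : orderOf ψ = 3 := orderOf_eq_prime hψ3 hψ
  have := gaussSum_pow_eq_prod_jacobiSum (χ := ψ) (ψ := φ) (by omega) hφ
  rw [ho, h1, one_mul] at this
  rw [this]
  simp

end CubicCharacterSums

end BinaryCubic

namespace BinaryCubic

/-! ### Values for p ≡ 1 mod 3. -/

section ValuesOneModThree

variable {m : ℕ} [NeZero m] {χ : DirichletCharacter ℂ m} {p : ℕ} [Fact p.Prime]

theorem primaryPart_ne_one (hχ : χ.IsPrimitive) (hpm : p ∣ m) : primaryPart χ p ≠ 1 := by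
  intro h
  obtain ⟨ε, -, hε⟩ := exists_unitChar_ne_one χ p hχ hpm
  apply hε
  rw [unitChar_apply, h, MulChar.one_apply (ε.isUnit.map _)]

theorem primaryPart_cube (hχ3 : χ ^ 3 = 1) : primaryPart χ p ^ 3 = 1 := by
  ext u
  rw [MulChar.pow_apply_coe, primaryPart_pow_three χ p hχ3 u.isUnit, MulChar.one_apply_coe]

theorem sum_range_unitChar_eval (a : Form ℤ_[p]) :
    ∑ k ∈ Finset.range (p ^ condExp m p), unitChar χ p (eval a k 1) =
      ∑ x, primaryPart χ p (eval (mapForm (PadicInt.toZModPow (condExp m p)) a) x 1) := by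
  rw [sum_zmod_eq_sum_range]
  refine Finset.sum_congr rfl fun k _ => ?_
  rw [unitChar_apply]
  congr 1
  simp [eval, mapForm]

theorem not_dvd_of_one_mod_three (hp : p % 3 = 1) {n : ℕ} (h : n ∣ 6 ^ 9) : IsUnit (n : ℤ_[p]) := by
  apply isUnit_natCast_of_coprime
  rw [Nat.Prime.coprime_iff_not_dvd Fact.out]
  intro hd
  have h1 := (Nat.Prime.dvd_mul Fact.out).1 ((Fact.out : p.Prime).dvd_of_dvd_pow (hd.trans h) : p ∣ 2 * 3)
  rcases h1 with h1 | h1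
  · have := (Nat.prime_dvd_prime_iff_eq Fact.out Nat.prime_two).1 h1
    omega
  · have := (Nat.prime_dvd_prime_iff_eq Fact.out Nat.prime_three).1 h1
    omega

/-- A square root of `-3` in `ℤ_p`. -/
theorem exists_sqrt_neg_three (hp : p % 3 = 1) : ∃ t : ℤ_[p], IsUnit t ∧ t ^ 2 = -3 := by
  obtain ⟨η, hη⟩ := HasEnoughRootsOfUnity.exists_primitiveRoot (ZMod p) (p - 1)
  have h2 := (Fact.out : p.Prime).two_le
  have hθ : IsPrimitiveRoot (η ^ ((p - 1) / 3)) 3 :=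
    hη.pow (by omega) (by omega)
  have h1 := hθ.geom_sum_eq_zero (by norm_num)
  simp only [Finset.sum_range_succ, Finset.sum_range_zero, pow_zero, pow_one, zero_add] at h1
  obtain ⟨s, hs⟩ := ZMod.ringHom_surjective (PadicInt.toZMod (p := p)) (η ^ ((p - 1) / 3))
  rw [← hs] at h1
  -- If θ² + θ + 1 = 0 then (2θ + 1)² = -3.
  have h3 : (p : ℤ_[p]) ∣ -3 - (2 * s + 1) ^ 2 := by
    have : PadicInt.toZMod (-3 - (2 * s + 1) ^ 2) = PadicInt.toZMod (0 : ℤ_[p]) := by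
      simp only [map_sub, map_neg, map_pow, map_add, map_mul, map_one, map_zero,
        map_ofNat (PadicInt.toZMod (p := p))]
      linear_combination (-4 : ZMod p) * h1
    rwa [toZMod_eq_iff, sub_zero] at this
  have h4 : IsUnit (3 : ℤ_[p]) := by
    exact_mod_cast not_dvd_of_one_mod_three hp (n := 3) (by norm_num)
  have h5 : IsUnit (2 * s + 1) := by
    rw [isUnit_iff_not_dvd] at h4 ⊢
    intro h
    apply h4
    have := (dvd_sub_left (h.trans (dvd_pow_self _ two_ne_zero))).1 h3
    rwa [dvd_neg] at this
  obtain ⟨t, ht, h, -⟩ := exists_sqrt p (by omega) h5 h3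
  exact ⟨t, ht, h⟩

variable (hχ : χ.IsPrimitive) (hχ3 : χ ^ 3 = 1) (hpm : p ∣ m) (hp : p % 3 = 1)
include hχ hχ3 hpm hp

theorem condExp_of_one_mod_three : condExp m p = 1 :=
  condExp_eq_one χ p hχ hχ3 hpm (by omega)

theorem tau_pow_three_eq :
    tau χ p ^ 3 = p * jacobiSum (primaryPart χ p) (primaryPart χ p) := by
  have hc := condExp_of_one_mod_three hχ hχ3 hpm hp
  have : Fact (p ^ condExp m p).Prime := ⟨by rw [hc, pow_one]; exact Fact.out⟩
  have h1 := gaussSum_pow_three (primaryPart_ne_one hχ hpm) (primaryPart_cube hχ3)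
    (ψ := primaryPart χ p) (by
      have := unitChar_neg_one χ p hχ3
      rwa [unitChar_apply, map_neg, map_one] at this) (ZMod.isPrimitive_stdAddChar _)
  rw [ZMod.card] at h1
  rw [tau]
  convert h1 using 2
  rw [hc, pow_one]

theorem jacobiSum_eq :
    jacobiSum (primaryPart χ p) (primaryPart χ p) = tau χ p ^ 3 / p := by
  have hp0 : (p : ℂ) ≠ 0 := by exact_mod_cast (Fact.out : p.Prime).ne_zero
  rw [tau_pow_three_eq hχ hχ3 hpm hp, mul_div_cancel_left₀ _ hp0]

theorem normC_split {e : ℕ} (he : 1 ≤ e) :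
    normC χ p e ![0, 1, -1, 0] = tau χ p ^ 3 / (p : ℂ) ^ 2 := by
  have hc := condExp_of_one_mod_three hχ hχ3 hpm hp
  have hd : disc (![0, 1, -1, 0] : Form ℤ_[p]) = 1 := by simp [disc]
  have : Fact (p ^ condExp m p).Prime := ⟨by rw [hc, pow_one]; exact Fact.out⟩
  have hpow : (p : ℂ) ^ condExp m p = p := by rw [hc, pow_one]
  rw [normC_of_isUnit_disc χ p hχ hχ3 hpm (hc.le.trans he) (by rw [hd]; exact isUnit_one)
    (B := 0) (by simp), hd, sum_range_unitChar_eval, map_one, hpow]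
  have h1 := sum_sq_sub_self (ψ := primaryPart χ p) (by
      have := unitChar_neg_one χ p hχ3
      rwa [unitChar_apply, map_neg, map_one] at this)
  rw [jacobiSum_eq hχ hχ3 hpm hp] at h1
  have h2 : ∀ x : ZMod (p ^ condExp m p),
      eval (mapForm (PadicInt.toZModPow (condExp m p)) ![0, 1, -1, 0]) x 1 = x ^ 2 - x := by
    intro x
    simp [eval, mapForm]
    ring
  simp only [h2]
  rw [h1]
  field_simp
  simp

/-- The sign is the quadratic character of the nonsquare d; the remaining factors χ_p(4) χ_p(d)
cancel against the discriminant 4d. -/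
theorem normC_linQuad {e : ℕ} (he : 1 ≤ e) {d : ℤ_[p]} (hd : IsUnit d)
    (hns : ¬ IsSquare (PadicInt.toZMod d)) :
    normC χ p e ![0, 1, 0, -d] = -(tau χ p ^ 3 / (p : ℂ) ^ 2) := by
  have hc := condExp_of_one_mod_three hχ hχ3 hpm hp
  have hdisc : disc (![0, 1, 0, -d] : Form ℤ_[p]) = 4 * d := by simp [disc]
  have h4 : IsUnit (4 : ℤ_[p]) := by
    exact_mod_cast not_dvd_of_one_mod_three hp (n := 4) (by norm_num)
  have : Fact (p ^ condExp m p).Prime := ⟨by rw [hc, pow_one]; exact Fact.out⟩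
  have hpow : (p : ℂ) ^ condExp m p = p := by rw [hc, pow_one]
  rw [normC_of_isUnit_disc χ p hχ hχ3 hpm (hc.le.trans he) (by rw [hdisc]; exact h4.mul hd)
    (B := 0) (by simp), hdisc, sum_range_unitChar_eval, hpow, map_mul]
  set φ := PadicInt.toZModPow (p := p) (condExp m p) with hφ
  have hψ1 : primaryPart χ p (-1) = 1 := by
    have := unitChar_neg_one χ p hχ3
    rwa [unitChar_apply, map_neg, map_one] at this
  have h2 : ∀ x : ZMod (p ^ condExp m p),
      eval (mapForm φ ![0, 1, 0, -d]) x 1 = x ^ 2 - φ d := by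
    intro x
    simp [eval, mapForm]
    ring
  simp only [h2]
  have hφd : φ d ≠ 0 := (hd.map φ).ne_zero
  have hch : ringChar (ZMod (p ^ condExp m p)) ≠ 2 := by
    rw [ZMod.ringChar_zmod_n, hc, pow_one]
    omega
  have h20 : (2 : ZMod (p ^ condExp m p)) ≠ 0 := by
    have : IsUnit (2 : ℤ_[p]) := by
      exact_mod_cast not_dvd_of_one_mod_three hp (n := 2) (by norm_num)
    have := (this.map φ).ne_zero
    rwa [map_ofNat φ] at this
  have hq : quadraticChar (ZMod (p ^ condExp m p)) (φ d) = -1 := by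
    rw [quadraticChar_neg_one_iff_not_isSquare]
    rintro ⟨s, hs⟩
    obtain ⟨s, rfl⟩ := exists_toZModPow_eq p _ s
    apply hns
    refine ⟨PadicInt.toZMod s, ?_⟩
    rw [← map_mul, toZMod_eq_iff]
    rw [← map_mul, hφ, toZModPow_eq_iff, hc, pow_one] at hs
    exact hs
  rw [sum_sq_sub_eq (primaryPart_ne_one hχ hpm) hch hφd, sum_sq_sub_one hψ1 h20,
    jacobiSum_eq hχ hχ3 hpm hp, hq]
  have e1 : primaryPart χ p (φ d) = unitChar χ p d := rfl
  have e2 : primaryPart χ p 4 = unitChar χ p 4 := by rw [unitChar_apply, map_ofNat φ]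
  rw [e1, e2]
  have n1 := unitChar_ne_zero χ p hχ3 hd
  have n2 := unitChar_ne_zero χ p hχ3 h4
  field_simp
  push_cast
  ring

theorem unitChar_neg_twentySeven (x : ℤ_[p]) :
    unitChar χ p (-27 * x) = unitChar χ p x := by
  have h3 : IsUnit (3 : ℤ_[p]) := by
    exact_mod_cast not_dvd_of_one_mod_three hp (n := 3) (by norm_num)
  rw [map_mul, unitChar_neg χ p hχ3, show (27 : ℤ_[p]) = 3 ^ 3 by norm_num,
    unitChar_cube χ p hχ3 h3, one_mul]

/-- The -1 in the cubic character sum cancels the contribution p⁻¹ of the residue disc at (1 : 0),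
and χ_p(α)² cancels against the discriminant -27α². The computation does not need α to be a noncube.
-/
theorem normC_irr {e : ℕ} (he : 1 ≤ e) {α : ℤ_[p]} (hα : IsUnit α) :
    normC χ p e ![1, 0, 0, α] = tau χ p ^ 3 / (p : ℂ) ^ 2 := by
  have hc := condExp_of_one_mod_three hχ hχ3 hpm hp
  have hp0 : (p : ℂ) ≠ 0 := by exact_mod_cast (Fact.out : p.Prime).ne_zero
  have hdisc : disc (![1, 0, 0, α] : Form ℤ_[p]) = -27 * α ^ 2 := by simp [disc]
  have h27 : IsUnit (-27 : ℤ_[p]) := by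
    have := not_dvd_of_one_mod_three hp (n := 27) (by norm_num)
    rw [IsUnit.neg_iff]
    exact_mod_cast this
  have h2u : IsUnit (2 : ℤ_[p]) := by
    exact_mod_cast not_dvd_of_one_mod_three hp (n := 2) (by norm_num)
  have h3u : IsUnit (3 : ℤ_[p]) := by
    exact_mod_cast not_dvd_of_one_mod_three hp (n := 3) (by norm_num)
  have : Fact (p ^ condExp m p).Prime := ⟨by rw [hc, pow_one]; exact Fact.out⟩
  have hpow : (p : ℂ) ^ condExp m p = p := by rw [hc, pow_one]
  rw [normC_of_isUnit_disc χ p hχ hχ3 hpm (hc.le.trans he)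
    (by rw [hdisc]; exact h27.mul (hα.pow 2)) (B := (p : ℂ)⁻¹)
    (Or.inr ⟨fun y hy => by
      rw [← map_one (unitChar χ p)]
      apply unitChar_congr
      rw [hc, pow_one]
      rw [isUnit_iff_not_dvd, not_not] at hy
      simpa [eval] using (hy.trans (dvd_pow_self _ three_ne_zero)).mul_left α, rfl⟩),
    hdisc, sum_range_unitChar_eval, hpow, unitChar_neg_twentySeven hχ hχ3 hpm hp, map_pow]
  set φ := PadicInt.toZModPow (p := p) (condExp m p) with hφ
  have hψ1 : primaryPart χ p (-1) = 1 := by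
    have := unitChar_neg_one χ p hχ3
    rwa [unitChar_apply, map_neg, map_one] at this
  have h2 : ∀ x : ZMod (p ^ condExp m p),
      eval (mapForm φ ![1, 0, 0, α]) x 1 = x ^ 3 + φ α := by
    intro x
    simp [eval, mapForm]
  simp only [h2]
  obtain ⟨t, -, ht⟩ := exists_sqrt_neg_three hp
  obtain ⟨v, hv⟩ := h2u.exists_right_inv
  have hθ1 : (v * (t - 1)) ^ 2 + v * (t - 1) + 1 = 0 := by
    linear_combination v ^ 2 * ht + (-1 - v - v * t) * hv
  have hθ2 : (φ (v * (t - 1))) ^ 2 + φ (v * (t - 1)) + 1 = 0 := by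
    rw [← map_pow, ← map_add, ← map_one φ, ← map_add, hθ1, map_zero]
  have hθ : IsPrimitiveRoot (φ (v * (t - 1))) 3 := by
    rw [IsPrimitiveRoot.iff_orderOf]
    refine orderOf_eq_prime ?_ ?_
    · linear_combination (φ (v * (t - 1)) - 1) * hθ2
    · intro h
      rw [h] at hθ2
      apply (h3u.map φ).ne_zero
      rw [map_ofNat φ]
      linear_combination hθ2
  rw [sum_cube_add (primaryPart_ne_one hχ hpm) (primaryPart_cube hχ3) hψ1 hθ (hα.map φ).ne_zero,
    jacobiSum_eq hχ hχ3 hpm hp]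
  have e1 : primaryPart χ p (φ α) = unitChar χ p α := rfl
  rw [e1]
  have n1 := unitChar_ne_zero χ p hχ3 hα
  field_simp
  ring

open Classical in
-- Covers v(u² + pαv²) with n = 2 and u³ + pαv³ with n = 3: unit residues contribute χ_p(k)^n, and
-- at k ≡ 0 the value is p times a unit congruent to α.
theorem normC_ramified_of_one_mod_three {e : ℕ} (he : 2 ≤ e) {a : Form ℤ_[p]} {α : ℤ_[p]}
    (hα : IsUnit α) {n : ℕ} (hn : 2 ≤ n) (ha : ∀ x, eval a x 1 = x ^ n + p * α) {B : ℂ}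
    (hB : (a = ![0, 1, 0, p * α] ∧ B = 0) ∨ (a = ![1, 0, 0, p * α] ∧ B = (p : ℂ)⁻¹)) :
    normC χ p e a = ((p : ℂ)⁻¹ * (∑ k ∈ Finset.range (p ^ condExp m p), unitChar χ p k ^ n +
      uniformizerValue χ p * unitChar χ p α) + B) / discChar χ p a := by
  have hc := condExp_of_one_mod_three hχ hχ3 hpm hp
  have he0 : e ≠ 0 := by omega
  set φ := PadicInt.toZModPow (p := p) e with hφ
  have hev : ∀ x y : ℤ_[p], eval (mapForm φ a) (φ x) (φ y) = φ (eval a x y) := by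
    intro x y
    simp [eval, mapForm]
  have hval : ∀ x : ℤ_[p], classValue χ p e (eval (mapForm φ a) (φ x) 1) =
      if IsUnit x then unitChar χ p x ^ n else uniformizerValue χ p * unitChar χ p α := by
    intro x
    rw [← map_one φ, hev, ha]
    split_ifs with hx
    · rw [classValue_unit χ p hpm (by omega), ← map_pow]
      · apply unitChar_congr
        rw [hc]
        exact ⟨α, by ring⟩
      · exact isUnit_of_dvd_sub p ⟨α, by ring⟩ (hx.pow n)
    · rw [isUnit_iff_not_dvd, not_not] at hx
      obtain ⟨z, rfl⟩ := hx
      obtain ⟨n, rfl⟩ : ∃ k, n = k + 2 := ⟨n - 2, by omega⟩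
      have h1 : ((p : ℤ_[p]) * z) ^ (n + 2) + p * α = p * (α + p * (p ^ n * z ^ (n + 2))) := by ring
      rw [h1, classValue_p_mul_unit χ p hpm (by omega)]
      · congr 1
        apply unitChar_congr
        rw [hc]
        exact ⟨p ^ n * z ^ (n + 2), by ring⟩
      · exact isUnit_of_dvd_sub p ⟨p ^ n * z ^ (n + 2), by ring⟩ hα
  apply normC_eq_of_periodic χ p hχ3 hpm (by omega)
  · rw [sum_eq_of_periodic (e := e) (j := 1) p (by omega)]
    · rw [pow_one]
      congr 2
      have hr : Finset.range (p ^ 1) = Finset.range (p ^ condExp m p) := by rw [hc]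
      obtain ⟨N, hN⟩ : ∃ N, p ^ condExp m p = N + 1 :=
        Nat.exists_eq_succ_of_ne_zero (pow_ne_zero _ (Fact.out : p.Prime).ne_zero)
      rw [hr, hN, Finset.sum_range_succ', Finset.sum_range_succ']
      simp only [← hφ, hval]
      have h0 : unitChar χ p 0 = 0 := unitChar_of_not_isUnit χ p hpm not_isUnit_zero
      simp only [Nat.cast_zero, not_isUnit_zero, if_false, h0, zero_pow (by omega : n ≠ 0), add_zero]
      congr 1
      refine Finset.sum_congr rfl fun k hk => ?_
      rw [if_pos]
      apply isUnit_natCast_of_coprime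
      rw [Nat.Prime.coprime_iff_not_dvd Fact.out]
      intro hd
      rw [hc, pow_one] at hN
      have := Nat.le_of_dvd (by omega) hd
      have := Finset.mem_range.1 hk
      omega
    · intro x
      simp only [← hφ, hval]
      have h1 : IsUnit (x + (p : ℤ_[p]) ^ 1) ↔ IsUnit x :=
        ⟨fun h => isUnit_of_dvd_sub p ⟨-1, by ring⟩ h, fun h => isUnit_of_dvd_sub p ⟨1, by ring⟩ h⟩
      simp only [h1]
      split_ifs
      · congr 1
        apply unitChar_congr
        rw [hc]
        exact ⟨1, by ring⟩
      · rfl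
  · rcases hB with ⟨rfl, rfl⟩ | ⟨rfl, rfl⟩
    · rw [mul_zero]
      have hev' : ∀ y : ℤ_[p], eval (![0, 1, 0, p * α] : Form ℤ_[p]) 1 y = y * (1 + p * α * y ^ 2) := by
        intro y
        simp [eval]
        ring
      apply sum_nonunits_comp χ p hχ hpm (fun y => eval (mapForm φ ![0, 1, 0, p * α]) 1 y)
      · intro y
        obtain ⟨z, rfl⟩ := exists_toZModPow_eq p e y
        rw [← map_one φ, hev, isUnit_toZModPow_iff p he0, isUnit_toZModPow_iff p he0, hev',
          IsUnit.mul_iff]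
        tauto
      · intro y z _ _
        obtain ⟨y, rfl⟩ := exists_toZModPow_eq p e y
        obtain ⟨z, rfl⟩ := exists_toZModPow_eq p e z
        refine ⟨φ (1 + p * α * (y ^ 2 + y * z + z ^ 2)), ?_, ?_⟩
        · rw [isUnit_toZModPow_iff p he0]
          exact isUnit_of_dvd_sub p (y := 1) ⟨α * (y ^ 2 + y * z + z ^ 2), by ring⟩ isUnit_one
        · rw [← map_one φ, hev, hev, ← map_sub, ← map_sub, ← map_mul, hev', hev']
          congr 1
          ring
    · apply sum_nonunits_one p he0
      intro y hy
      obtain ⟨z, rfl⟩ := exists_toZModPow_eq p e y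
      rw [isUnit_toZModPow_iff p he0, isUnit_iff_not_dvd, not_not] at hy
      have h1 : eval (![1, 0, 0, p * α] : Form ℤ_[p]) 1 z = 1 + p * (α * z ^ 3) := by
        simp [eval]
        ring
      rw [← map_one φ, hev, h1, classValue_unit χ p hpm (by omega), ← map_one (unitChar χ p)]
      · apply unitChar_congr
        rw [hc]
        exact ⟨α * z ^ 3, by ring⟩
      · exact isUnit_of_dvd_sub p (y := 1) ⟨α * z ^ 3, by ring⟩ isUnit_one

/-- The squares of χ_p sum to zero, so only the ramified residue is left; division by χ_p(-4α)
produces χ_p(2)⁻² = χ_p(2). -/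
theorem normC_121 {e : ℕ} (he : 2 ≤ e) (α : ℤ_[p]ˣ) :
    normC χ p e ![0, 1, 0, p * α] = unitChar χ p 2 * primeTerm χ p := by
  have hc := condExp_of_one_mod_three hχ hχ3 hpm hp
  have hp0 : (p : ℂ) ≠ 0 := by exact_mod_cast (Fact.out : p.Prime).ne_zero
  have h2u : IsUnit (2 : ℤ_[p]) := by
    exact_mod_cast not_dvd_of_one_mod_three hp (n := 2) (by norm_num)
  have hd : IsUnit (-(2 ^ 2 * (α : ℤ_[p]))) := ((h2u.pow 2).mul α.isUnit).neg
  have hdc : discChar χ p ![0, 1, 0, p * α] = unitChar χ p 2 ^ 2 * unitChar χ p α := by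
    rw [discChar_eq χ p (k := 1) (u := hd.unit) (by simp [disc]; ring), IsUnit.unit_spec,
      unitChar_neg χ p hχ3, map_mul, map_pow]
  rw [normC_ramified_of_one_mod_three hχ hχ3 hpm hp he α.isUnit le_rfl
    (fun x => by simp [eval]) (Or.inl ⟨rfl, rfl⟩), hdc]
  have hs : ∑ k ∈ Finset.range (p ^ condExp m p), unitChar χ p k ^ 2 = 0 := by
    have hψ : primaryPart χ p ^ 2 ≠ 1 := by
      intro h
      have h1 := primaryPart_cube (p := p) hχ3
      rw [pow_succ, h, one_mul] at h1
      exact primaryPart_ne_one hχ hpm h1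
    rw [← MulChar.sum_eq_zero_of_ne_one hψ, sum_zmod_eq_sum_range]
    refine Finset.sum_congr rfl fun k _ => ?_
    rw [MulChar.pow_apply' _ two_ne_zero, primaryPart_natCast]
  rw [hs, uniformizerValue_eq p hχ3, ← primeTerm]
  have n1 := unitChar_ne_zero χ p hχ3 h2u
  have n2 := unitChar_ne_zero χ p hχ3 α.isUnit
  have n3 := unitChar_pow_three χ p hχ3 h2u
  field_simp
  linear_combination (-(p * primeTerm χ p * unitChar χ p α)) * n3

/-- Since χ_p³ = 1 on units, the unit residues give (p - 1)/p, and the disc at (1 : 0) completes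
this to 1; then one divides by χ_p(α)². -/
theorem normC_13 {e : ℕ} (he : 2 ≤ e) (α : ℤ_[p]ˣ) :
    normC χ p e ![1, 0, 0, p * α] = unitChar χ p α + unitChar χ p α ^ 2 * primeTerm χ p := by
  have hc := condExp_of_one_mod_three hχ hχ3 hpm hp
  have hp0 : (p : ℂ) ≠ 0 := by exact_mod_cast (Fact.out : p.Prime).ne_zero
  have h27 : IsUnit (-27 : ℤ_[p]) := by
    have := not_dvd_of_one_mod_three hp (n := 27) (by norm_num)
    rw [IsUnit.neg_iff]
    exact_mod_cast this
  have hd : IsUnit (-27 * (α : ℤ_[p]) ^ 2) := h27.mul (α.isUnit.pow 2)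
  have hdc : discChar χ p ![1, 0, 0, p * α] = unitChar χ p α ^ 2 := by
    rw [discChar_eq χ p (k := 2) (u := hd.unit) (by simp [disc]; ring), IsUnit.unit_spec,
      unitChar_neg_twentySeven hχ hχ3 hpm hp, map_pow]
  rw [normC_ramified_of_one_mod_three hχ hχ3 hpm hp he α.isUnit (n := 3) (by norm_num)
    (fun x => by simp [eval]) (Or.inr ⟨rfl, rfl⟩), hdc]
  have hs : ∑ k ∈ Finset.range (p ^ condExp m p), unitChar χ p k ^ 3 = (p : ℂ) - 1 := by
    obtain ⟨N, hN⟩ : ∃ N, p ^ condExp m p = N + 1 :=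
      Nat.exists_eq_succ_of_ne_zero (pow_ne_zero _ (Fact.out : p.Prime).ne_zero)
    have h0 : unitChar χ p 0 = 0 := unitChar_of_not_isUnit χ p hpm not_isUnit_zero
    rw [hN, Finset.sum_range_succ', Nat.cast_zero, h0, zero_pow three_ne_zero, add_zero]
    have hN' : p = N + 1 := by rw [← hN, hc, pow_one]
    rw [Finset.sum_congr rfl (g := fun _ => 1), Finset.sum_const, Finset.card_range, hN']
    · simp
    · intro k hk
      apply unitChar_pow_three χ p hχ3
      apply isUnit_natCast_of_coprime
      rw [Nat.Prime.coprime_iff_not_dvd Fact.out]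
      intro hd
      have := Nat.le_of_dvd (by omega) hd
      have := Finset.mem_range.1 hk
      omega
  rw [hs, uniformizerValue_eq p hχ3, ← primeTerm]
  have n2 := unitChar_ne_zero χ p hχ3 α.isUnit
  have n3 := unitChar_pow_three χ p hχ3 α.isUnit
  field_simp
  linear_combination (-(p * primeTerm χ p * unitChar χ p α) - p) * n3

end ValuesOneModThree

end BinaryCubic

namespace BinaryCubic

/-! ### The derivative of the action. -/

section Tangent

variable {R : Type*} [CommRing R]

/-- The derivative at the identity of the action on `x`, in the direction `(q r; s t)`. -/
def tangent (x : Form R) (q r s t : R) : Form R :=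
  ![2 * x 0 * q + x 1 * r - x 0 * t, x 1 * q + 2 * x 2 * r + 3 * x 0 * s,
    3 * x 3 * r + 2 * x 1 * s + x 2 * t, -x 3 * q + x 2 * s + 2 * x 3 * t]

/-- The remainder of second order in the Taylor expansion of the action at the identity. -/
def tangentRem (x : Form R) (ε q r s t : R) : Form R :=
  ![3 * q ^ 2 * x 0 + 2 * q * r * x 1 + r ^ 2 * x 2 - (q * t - r * s) * x 0 +
      ε * (q ^ 3 * x 0 + q ^ 2 * r * x 1 + q * r ^ 2 * x 2 + r ^ 3 * x 3),
    6 * q * s * x 0 + (q ^ 2 + 2 * q * t + 2 * r * s) * x 1 + (2 * q * r + 2 * r * t) * x 2 +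
      3 * r ^ 2 * x 3 - (q * t - r * s) * x 1 +
      ε * (3 * q ^ 2 * s * x 0 + (q ^ 2 * t + 2 * q * r * s) * x 1 +
        (r ^ 2 * s + 2 * q * r * t) * x 2 + 3 * r ^ 2 * t * x 3),
    6 * t * r * x 3 + (t ^ 2 + 2 * q * t + 2 * r * s) * x 2 + (2 * t * s + 2 * s * q) * x 1 +
      3 * s ^ 2 * x 0 - (q * t - r * s) * x 2 +
      ε * (3 * t ^ 2 * r * x 3 + (t ^ 2 * q + 2 * t * r * s) * x 2 +
        (s ^ 2 * r + 2 * t * s * q) * x 1 + 3 * s ^ 2 * q * x 0),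
    3 * t ^ 2 * x 3 + 2 * t * s * x 2 + s ^ 2 * x 1 - (q * t - r * s) * x 3 +
      ε * (t ^ 3 * x 3 + t ^ 2 * s * x 2 + t * s ^ 2 * x 1 + s ^ 3 * x 0)]

theorem subst_one_add (x : Form R) (ε q r s t : R) (i : Fin 4) :
    subst (1 + ε * q) (ε * r) (ε * s) (1 + ε * t) x i =
      ((1 + ε * q) * (1 + ε * t) - ε * r * (ε * s)) * x i + ε * tangent x q r s t i +
      ε ^ 2 * tangentRem x ε q r s t i := by
  fin_cases i <;> simp [subst, tangent, tangentRem] <;> ring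

/-- The determinant of the 4×4 matrix of the derivative is the discriminant of x. -/
theorem exists_tangent {x : Form R} (hd : IsUnit (disc x)) (b : Form R) :
    ∃ q r s t : R, tangent x q r s t = b := by
  set A : Matrix (Fin 4) (Fin 4) R := !![2 * x 0, x 1, 0, -x 0; x 1, 2 * x 2, 3 * x 0, 0;
    0, 3 * x 3, 2 * x 1, x 2; -x 3, 0, x 2, 2 * x 3] with hA
  have hdet : A.det = disc x := by
    rw [hA]
    simp [Matrix.det_succ_row_zero, Fin.sum_univ_succ, disc, Fin.succAbove]
    ring
  have hu : IsUnit A.det := by rw [hdet]; exact hd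
  have h1 : A.mulVec (A⁻¹.mulVec b) = b := by
    rw [Matrix.mulVec_mulVec, Matrix.mul_nonsing_inv A hu, Matrix.one_mulVec]
  set v := A⁻¹.mulVec b
  refine ⟨v 0, v 1, v 2, v 3, ?_⟩
  rw [← h1]
  funext i
  fin_cases i <;> simp [hA, tangent, Matrix.mulVec, dotProduct, Fin.sum_univ_succ] <;> ring

end Tangent

/-! ### Newton's method for orbits. -/

section SmoothHensel

variable (p : ℕ) [Fact p.Prime]

theorem isUnit_disc_of_congr {x a : Form ℤ_[p]} (h : ∀ i, (p : ℤ_[p]) ∣ x i - a i)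
    (hd : IsUnit (disc a)) : IsUnit (disc x) := by
  apply isUnit_of_dvd_sub p _ hd
  have h1 : ∀ i, PadicInt.toZMod (x i) = PadicInt.toZMod (a i) := fun i =>
    (toZMod_eq_iff p _ _).2 (h i)
  rw [← toZMod_eq_iff, ← disc_mapForm, ← disc_mapForm]
  congr 1
  exact funext h1

theorem continuous_act (x : Form ℤ_[p]) : Continuous fun g : GL (Fin 2) ℤ_[p] => act g x := by
  have h : ∀ i j, Continuous fun g : GL (Fin 2) ℤ_[p] => g.val i j := fun i j =>
    (Units.continuous_val (M := Matrix (Fin 2) (Fin 2) ℤ_[p])).matrix_elem i j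
  have h00 := h 0 0
  have h01 := h 0 1
  have h10 := h 1 0
  have h11 := h 1 1
  have hd : Continuous fun g : GL (Fin 2) ℤ_[p] =>
      (((Matrix.GeneralLinearGroup.det g)⁻¹ : ℤ_[p]ˣ) : ℤ_[p]) := by
    have : ∀ g : GL (Fin 2) ℤ_[p], (((Matrix.GeneralLinearGroup.det g)⁻¹ : ℤ_[p]ˣ) : ℤ_[p]) =
        (g⁻¹).val 0 0 * (g⁻¹).val 1 1 - (g⁻¹).val 0 1 * (g⁻¹).val 1 0 := by
      intro g
      rw [← map_inv, coe_det]
    simp only [this]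
    have h' : ∀ i j, Continuous fun g : GL (Fin 2) ℤ_[p] => (g⁻¹).val i j := fun i j =>
      (h i j).comp continuous_inv
    exact ((h' 0 0).mul (h' 1 1)).sub ((h' 0 1).mul (h' 1 0))
  refine continuous_pi fun i => ?_
  simp only [act_apply]
  refine hd.mul ?_
  fin_cases i <;> simp only [subst] <;> simp <;> fun_prop

/-- GL₂(ℤ_p) is compact, so membership in an orbit can be tested by approximation. -/
theorem isClosed_orbit (x : Form ℤ_[p]) : IsClosed (orbit x) := by
  have : orbit x = Set.range fun g : GL (Fin 2) ℤ_[p] => act g x := by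
    ext y
    exact ⟨fun ⟨g, hg⟩ => ⟨g, hg.symm⟩, fun ⟨g, hg⟩ => ⟨g, hg.symm⟩⟩
  rw [this]
  exact (isCompact_range (continuous_act p x)).isClosed

theorem mem_of_forall_pow_dvd {s : Set (Form ℤ_[p])} (hs : IsClosed s) {a : Form ℤ_[p]}
    (h : ∀ k : ℕ, ∃ y ∈ s, ∀ i, (p : ℤ_[p]) ^ k ∣ y i - a i) : a ∈ s := by
  rw [← hs.closure_eq, Metric.mem_closure_iff]
  intro ε hε
  have hp : (1 : ℝ) < p := by exact_mod_cast (Fact.out : p.Prime).one_lt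
  obtain ⟨k, hk⟩ := exists_pow_lt_of_lt_one hε (inv_lt_one_of_one_lt₀ hp)
  obtain ⟨y, hy, hya⟩ := h k
  refine ⟨y, hy, ?_⟩
  rw [dist_comm, dist_pi_lt_iff hε]
  intro i
  rw [dist_eq_norm]
  refine lt_of_le_of_lt ?_ hk
  have h1 := (PadicInt.norm_le_pow_iff_mem_span_pow (y i - a i) k).2
    (Ideal.mem_span_singleton.2 (hya i))
  rwa [zpow_neg, zpow_natCast, ← inv_pow] at h1

/-- Newton's method for the action of `GL₂(ℤ_p)` on forms: if `L` is a lattice such that the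
derivative of the action is onto `L` modulo `p`, with remainders in `L`, at all points of
`a + pL`, then `a + pL` is contained in the orbit of `a`. -/
theorem mem_orbit_of_tangent (L : Submodule ℤ_[p] (Form ℤ_[p])) {x a : Form ℤ_[p]}
    (hL : ∀ y, (∃ b ∈ L, y = a + (p : ℤ_[p]) • b) → ∀ b ∈ L, ∃ q r s t,
      (∃ c ∈ L, tangent y q r s t = b + (p : ℤ_[p]) • c) ∧
      ∀ k : ℕ, tangentRem y ((p : ℤ_[p]) ^ (k + 1)) q r s t ∈ L)
    (h : ∃ b ∈ L, x = a + (p : ℤ_[p]) • b) : x ∈ orbit a := by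
  -- The form x is moved towards a: the orbit of x is shown to contain forms agreeing with a to
  -- every precision.
  apply mem_orbit_symm
  apply mem_of_forall_pow_dvd p (isClosed_orbit p x)
  suffices H : ∀ k : ℕ, ∃ y ∈ orbit x, ∃ b ∈ L, y = a + (p : ℤ_[p]) ^ (k + 1) • b by
    intro k
    obtain ⟨y, hy, b, -, rfl⟩ := H k
    refine ⟨_, hy, fun i => (pow_dvd_pow _ (Nat.le_succ k)).trans ⟨b i, ?_⟩⟩
    simp
  intro k
  induction k with
  | zero =>
    obtain ⟨b, hb, hx⟩ := h
    exact ⟨x, mem_orbit_self x, b, hb, by simpa using hx⟩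
  | succ k ih =>
    obtain ⟨y, hy, b, hb, hya⟩ := ih
    -- The direction is chosen for `-b`, so that the first order term cancels the current error.
    obtain ⟨q, r, s, t, ⟨c, hc, htan⟩, hrem⟩ := hL y
      ⟨(p : ℤ_[p]) ^ k • b, L.smul_mem _ hb, by rw [hya, smul_smul, pow_succ']⟩ (-b) (L.neg_mem hb)
    have hw := hrem k
    set ε := (p : ℤ_[p]) ^ (k + 1) with hε
    set w := tangentRem y ε q r s t with hw'
    set D := (1 + ε * q) * (1 + ε * t) - ε * r * (ε * s) with hD
    -- The determinant is 1 to first order, and its effect on the error `ε * b` is of second order.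
    obtain ⟨z, hz⟩ : ∃ z, D = 1 + ε * z := ⟨q + t + ε * (q * t - r * s), by rw [hD]; ring⟩
    have hDu : IsUnit D :=
      isUnit_of_dvd_sub p (y := 1) ⟨p ^ k * z, by rw [hz, hε]; ring⟩ isUnit_one
    obtain ⟨v, hv⟩ := hDu.exists_right_inv
    refine ⟨act (glOf _ _ _ _ hDu) y, mem_orbit_trans (act_mem_orbit _ _) hy,
      v • (c + (p : ℤ_[p]) ^ k • (w + z • b)),
      L.smul_mem _ (L.add_mem hc (L.smul_mem _ (L.add_mem hw (L.smul_mem _ hb)))), ?_⟩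
    have h2 := (glOf_act_eq_iff _ _ _ _ hDu y _).1 rfl
    funext i
    have h3 := congrFun h2 i
    rw [subst_one_add, ← hD, ← hw'] at h3
    have h4 := congrFun htan i
    have h5 := congrFun hya i
    simp only [Pi.add_apply, Pi.smul_apply, Pi.neg_apply, smul_eq_mul] at h4 h5 ⊢
    apply hDu.mul_left_cancel
    have h6 : (p : ℤ_[p]) ^ (k + 1 + 1) = ε * p := by rw [hε, pow_succ]
    have h7 : ε = p ^ k * p := by rw [hε, pow_succ]
    rw [h6]
    linear_combination -h3 + ε * h4 + D * h5 + ε * b i * hz -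
      (ε * p * (c i + p ^ k * (w i + z * b i))) * hv + ε * (w i + z * b i) * h7

/-- Forms of unit discriminant that agree modulo `p` are equivalent. -/
theorem mem_orbit_of_congr {x a : Form ℤ_[p]} (h : ∀ i, (p : ℤ_[p]) ∣ x i - a i)
    (hd : IsUnit (disc a)) : x ∈ orbit a := by
  apply mem_orbit_of_tangent p ⊤
  · rintro y ⟨b, -, rfl⟩ b' -
    have hu := isUnit_disc_of_congr p (x := a + (p : ℤ_[p]) • b) (fun i => ⟨b i, by simp⟩) hd
    obtain ⟨q, r, s, t, h⟩ := exists_tangent hu b'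
    exact ⟨q, r, s, t, ⟨0, Submodule.mem_top, by simpa using h⟩, fun k => Submodule.mem_top⟩
  · choose b hb using h
    exact ⟨b, Submodule.mem_top, funext fun i => by
      simp only [Pi.add_apply, Pi.smul_apply, smul_eq_mul]
      linear_combination hb i⟩

end SmoothHensel

end BinaryCubic

namespace BinaryCubic

/-! ### Stabilizers along an orbit. -/

section Stabilizers

variable {R : Type*} [CommRing R]

theorem stabCard_act (k : GL (Fin 2) R) (a : Form R) : stabCard (act k a) = stabCard a := by
  unfold stabCard
  refine Nat.card_congr (Equiv.subtypeEquiv (MulAut.conj k⁻¹).toEquiv fun g => ?_)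
  simp only [MulEquiv.toEquiv_eq_coe, EquivLike.coe_coe, MulAut.conj_apply, inv_inv]
  rw [act_mul, act_mul]
  constructor
  · intro h
    rw [h, act_inv_act]
  · intro h
    have := congrArg (act k) h
    rwa [act_act_inv] at this

theorem stabCard_of_mem_orbit {x a : Form R} (h : x ∈ orbit a) : stabCard x = stabCard a := by
  obtain ⟨k, rfl⟩ := h
  exact stabCard_act k a

end Stabilizers

/-! ### Orbits determined by a congruence. -/

section Isolation

variable (p : ℕ) [Fact p.Prime]

/-- All forms congruent modulo `p^e` to a form equivalent to `a` are equivalent to `a`. -/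
def Isolated (e : ℕ) (a : Form ℤ_[p]) : Prop :=
  ∀ x y : Form ℤ_[p], y ∈ orbit a → (∀ i, (p : ℤ_[p]) ^ e ∣ x i - y i) → x ∈ orbit a

theorem mapForm_eq_iff (e : ℕ) (x y : Form ℤ_[p]) :
    mapForm (PadicInt.toZModPow e) x = mapForm (PadicInt.toZModPow e) y ↔
      ∀ i, (p : ℤ_[p]) ^ e ∣ x i - y i := by
  simp only [funext_iff, mapForm, toZModPow_eq_iff]

theorem mapForm_mem_orbit_iff {e : ℕ} (he : e ≠ 0) (x a : Form ℤ_[p]) :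
    mapForm (PadicInt.toZModPow e) x ∈ orbit (mapForm (PadicInt.toZModPow e) a) ↔
      ∃ y ∈ orbit a, ∀ i, (p : ℤ_[p]) ^ e ∣ x i - y i := by
  constructor
  · rintro ⟨γ, hγ⟩
    obtain ⟨g, rfl⟩ := gl_map_surjective p he γ
    refine ⟨act g a, act_mem_orbit g a, ?_⟩
    rw [← mapForm_eq_iff, hγ, mapForm_act]
  · rintro ⟨y, hy, h⟩
    rw [(mapForm_eq_iff p e x y).2 h]
    exact mapForm_mem_orbit _ hy

theorem Isolated.mono {e e' : ℕ} (hee' : e ≤ e') {a : Form ℤ_[p]} (h : Isolated p e a) :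
    Isolated p e' a := fun x y hy hxy =>
  h x y hy fun i => (pow_dvd_pow _ hee').trans (hxy i)

theorem Isolated.of_mem_orbit {e : ℕ} {a b : Form ℤ_[p]} (h : Isolated p e a) (hb : b ∈ orbit a) :
    Isolated p e b := by
  unfold Isolated
  rw [orbit_eq hb]
  exact h

theorem Isolated.orbit_eq {e : ℕ} (he : e ≠ 0) {a : Form ℤ_[p]} (h : Isolated p e a) :
    {x | mapForm (PadicInt.toZModPow e) x ∈ orbit (mapForm (PadicInt.toZModPow e) a)} =
      orbit a := by
  ext x
  rw [Set.mem_ofPred_eq, mapForm_mem_orbit_iff p he]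
  constructor
  · rintro ⟨y, hy, hxy⟩
    exact h x y hy hxy
  · intro hx
    exact ⟨x, hx, fun i => by simp⟩

theorem exists_mem_orbit_of_toZMod {x a : Form ℤ_[p]}
    (h : mapForm PadicInt.toZMod x ∈ orbit (mapForm PadicInt.toZMod a)) :
    ∃ y ∈ orbit a, ∀ i, (p : ℤ_[p]) ∣ x i - y i := by
  obtain ⟨γ, hγ⟩ := h
  choose f hf using ZMod.ringHom_surjective (PadicInt.toZMod (p := p))
  have hdet : PadicInt.toZMod (f (γ.val 0 0) * f (γ.val 1 1) - f (γ.val 0 1) * f (γ.val 1 0)) =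
      ddet γ := by
    simp only [map_sub, map_mul, hf]
  have hu : IsUnit (f (γ.val 0 0) * f (γ.val 1 1) - f (γ.val 0 1) * f (γ.val 1 0)) := by
    rw [isUnit_iff_not_dvd]
    intro hd
    have h0 := (toZMod_eq_iff p (f (γ.val 0 0) * f (γ.val 1 1) - f (γ.val 0 1) * f (γ.val 1 0)) 0).2
      (by rwa [sub_zero])
    rw [hdet, map_zero] at h0
    exact (isUnit_ddet γ).ne_zero h0
  refine ⟨act (glOf _ _ _ _ hu) a, act_mem_orbit _ _, fun i => ?_⟩
  rw [← toZMod_eq_iff]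
  have h1 : Matrix.GeneralLinearGroup.map PadicInt.toZMod (glOf _ _ _ _ hu) = γ := by
    ext i j
    fin_cases i <;> fin_cases j <;> simp [glOf_val, hf]
  have h2 := mapForm_act PadicInt.toZMod (glOf _ _ _ _ hu) a
  rw [h1, ← hγ] at h2
  exact (congrFun h2 i).symm

theorem mem_orbit_of_toZMod {x a : Form ℤ_[p]} (hd : IsUnit (disc a))
    (h : mapForm PadicInt.toZMod x ∈ orbit (mapForm PadicInt.toZMod a)) : x ∈ orbit a := by
  obtain ⟨y, hy, hxy⟩ := exists_mem_orbit_of_toZMod p h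
  refine mem_orbit_trans (mem_orbit_of_congr p hxy ?_) hy
  obtain ⟨g, rfl⟩ := hy
  rw [disc_act]
  exact ((isUnit_ddet g).pow 2).mul hd

theorem isolated_of_isUnit_disc {a : Form ℤ_[p]} (hd : IsUnit (disc a)) : Isolated p 1 a := by
  intro x y hy h
  refine mem_orbit_trans (mem_orbit_of_congr p (fun i => by simpa using h i) ?_) hy
  obtain ⟨g, rfl⟩ := hy
  rw [disc_act]
  exact ((isUnit_ddet g).pow 2).mul hd

theorem formsOfType_ramified_of_mem_orbit {D : Set (Form (ZMod (p ^ 2)))} {a x : Form ℤ_[p]}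
    (ha : ∃ d ∈ D, mapForm (PadicInt.toZModPow 2) a ∈ orbit d) (hx : x ∈ orbit a) :
    ∃ d ∈ D, mapForm (PadicInt.toZModPow 2) x ∈ orbit d := by
  obtain ⟨d, hd, h⟩ := ha
  exact ⟨d, hd, mem_orbit_trans (mapForm_mem_orbit _ hx) h⟩

theorem exists_mem_orbit_of_ramified {D : Set (Form (ZMod (p ^ 2)))} {a : Form ℤ_[p]}
    (ha : ∃ d ∈ D, mapForm (PadicInt.toZModPow 2) a ∈ orbit d) :
    ∃ b, a ∈ orbit b ∧ mapForm (PadicInt.toZModPow 2) b ∈ D := by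
  obtain ⟨d, hd, γ, hγ⟩ := ha
  obtain ⟨g, rfl⟩ := gl_map_surjective p two_ne_zero γ
  refine ⟨act g⁻¹ a, ⟨g, (act_act_inv g a).symm⟩, ?_⟩
  rw [mapForm_act, hγ, ← act_mul, ← map_mul, inv_mul_cancel, map_one, act_one]
  exact hd

theorem norm_disc_of_mem_orbit {x a : Form ℤ_[p]} (h : x ∈ orbit a) : ‖disc x‖ = ‖disc a‖ := by
  obtain ⟨g, rfl⟩ := h
  rw [disc_act, norm_mul, norm_pow, PadicInt.isUnit_iff.1 (isUnit_ddet g), one_pow, one_mul]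

theorem norm_inv_of_eq {x u : ℤ_[p]} {k : ℕ} (h : x = (p : ℤ_[p]) ^ k * u) (hu : IsUnit u) :
    ‖x‖⁻¹ = ((p ^ k : ℕ) : ℝ) := by
  rw [h, norm_mul, norm_pow, PadicInt.isUnit_iff.1 hu, mul_one, PadicInt.norm_p]
  push_cast
  rw [inv_pow, inv_inv]

end Isolation

/-! ### Criteria for admissibility and for a table row. -/

section Admissibility

variable {m : ℕ} [NeZero m] (χ : DirichletCharacter ℂ m) (p : ℕ) [Fact p.Prime]

theorem residueC_congr {e : ℕ} {x y : Form ℤ_[p]} (h : ∀ i, (p : ℤ_[p]) ^ e ∣ x i - y i) :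
    residueC χ p e x = residueC χ p e y := by
  have : charFun p e x = charFun p e y := by
    unfold charFun
    congr 1
    choose z hz using h
    ext w
    simp only [Set.mem_ofPred_eq]
    constructor
    · rintro ⟨v, hv⟩
      exact ⟨fun i => v i + z i, fun i => (hv i).trans (congrArg (fun t : ℤ_[p] => (t : ℚ_[p]))
        (by linear_combination hz i))⟩
    · rintro ⟨v, hv⟩
      exact ⟨fun i => v i - z i, fun i => (hv i).trans (congrArg (fun t : ℤ_[p] => (t : ℚ_[p]))
        (by linear_combination -hz i))⟩
  unfold residueC
  rw [this]

/-- The discriminant condition in admissibility is automatic if the residue factor is not zero. -/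
theorem admissible_of_isolated (hχ3 : χ ^ 3 = 1) (hpm : p ∣ m) {e : ℕ} (hce : condExp m p ≤ e)
    {a : Form ℤ_[p]} (ha : Isolated p e a) (hd : disc a ≠ 0) (hC : normC χ p e a ≠ 0) :
    Admissible χ p e a := by
  have he : e ≠ 0 := fun h => condExp_ne_zero p hpm (Nat.le_zero.1 (h ▸ hce))
  refine ⟨hce, ha.orbit_eq p he, fun a' ha' => ?_⟩
  rw [mapForm_eq_iff] at ha'
  obtain ⟨g, hg⟩ := ha a' a (mem_orbit_self a) ha'
  refine ⟨?_, ?_⟩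
  · rw [hg, disc_act]
    exact mul_ne_zero (pow_ne_zero _ (isUnit_ddet g).ne_zero) hd
  -- For `a'` and `a` the quotients agree by invariance along the orbit, and the nonzero numerators
  -- agree because the residue factor depends only on the class modulo p^e; hence the denominators
  -- agree.
  · have h1 : normC χ p e a' = normC χ p e a := by rw [hg, normC_act χ p hχ3 hpm hce]
    unfold normC at h1 hC
    rw [residueC_congr χ p ha'] at h1
    have h2 : discChar χ p a ≠ 0 := fun h => hC (by rw [h, div_zero])
    have h3 : (1 - (p : ℂ) ^ (-2 : ℤ)) * residueC χ p e a ≠ 0 := fun h => hC (by rw [h, zero_div])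
    have h4 : discChar χ p a' ≠ 0 := fun h => hC (by rw [← h1, h, div_zero])
    rw [div_eq_div_iff h4 h2] at h1
    exact (mul_left_cancel₀ h3 h1).symm

theorem admissible_of_isUnit_disc (hpm : p ∣ m) {e : ℕ} (hce : condExp m p ≤ e)
    {a : Form ℤ_[p]} (hd : IsUnit (disc a)) : Admissible χ p e a := by
  have he : e ≠ 0 := fun h => condExp_ne_zero p hpm (Nat.le_zero.1 (h ▸ hce))
  refine ⟨hce, ((isolated_of_isUnit_disc p hd).mono p (by omega)).orbit_eq p he, fun a' ha' => ?_⟩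
  have h1 : (p : ℤ_[p]) ^ e ∣ disc a' - disc a := by
    rw [← toZModPow_eq_iff, ← disc_mapForm, ← disc_mapForm, ha']
  have hd' : IsUnit (disc a') := isUnit_of_dvd_sub p ((dvd_pow_self _ he).trans h1) hd
  refine ⟨hd'.ne_zero, ?_⟩
  rw [discChar_eq χ p (k := 0) (u := hd'.unit) (by simp),
    discChar_eq χ p (k := 0) (u := hd.unit) (by simp)]
  exact unitChar_congr χ p ((pow_dvd_pow _ hce).trans h1)

/-- Every entry of a row is constant along the orbit, so it suffices to treat one isolated
representative with nonzero value. -/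
theorem tableRow_of_isolated (hχ3 : χ ^ 3 = 1) (hpm : p ∣ m) {e₀ : ℕ} (hce : condExp m p ≤ e₀)
    {r : Form ℤ_[p]} (hr : Isolated p e₀ r) {val : ℂ} (hval : val ≠ 0)
    (hC : ∀ e, e₀ ≤ e → normC χ p e r = val) {k s : ℕ} {u : ℤ_[p]}
    (hd : disc r = (p : ℤ_[p]) ^ k * u) (hu : IsUnit u) (hs : stabCard r = s) {a : Form ℤ_[p]}
    (ha : a ∈ orbit r) : TableRow χ p a e₀ val (p ^ k) s := by
  refine ⟨fun e he => ?_, ?_, ?_⟩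
  · have h1 : normC χ p e a = val := by
      obtain ⟨g, rfl⟩ := ha
      rw [normC_act χ p hχ3 hpm (hce.trans he), hC e he]
    refine ⟨admissible_of_isolated χ p hχ3 hpm (hce.trans he)
      ((hr.of_mem_orbit p ha).mono p he) ?_ (h1 ▸ hval), h1⟩
    have h2 := norm_disc_of_mem_orbit p ha
    intro h0
    rw [h0, norm_zero, eq_comm, norm_eq_zero, hd] at h2
    have hp : (p : ℤ_[p]) ≠ 0 := by exact_mod_cast (Fact.out : p.Prime).ne_zero
    exact mul_ne_zero (pow_ne_zero _ hp) hu.ne_zero h2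
  · rw [norm_disc_of_mem_orbit p ha]
    exact norm_inv_of_eq p hd hu
  · rw [stabCard_of_mem_orbit ha, hs]

theorem tableRow_of_isUnit_disc (hχ3 : χ ^ 3 = 1) (hpm : p ∣ m) {e₀ : ℕ} (hce : condExp m p ≤ e₀)
    {r : Form ℤ_[p]} {val : ℂ} (hC : ∀ e, e₀ ≤ e → normC χ p e r = val) {s : ℕ}
    (hd : IsUnit (disc r)) (hs : stabCard r = s) {a : Form ℤ_[p]}
    (ha : a ∈ orbit r) : TableRow χ p a e₀ val 1 s := by
  have hda : IsUnit (disc a) := by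
    obtain ⟨g, rfl⟩ := ha
    rw [disc_act]
    exact ((isUnit_ddet g).pow 2).mul hd
  refine ⟨fun e he => ⟨admissible_of_isUnit_disc χ p hpm (hce.trans he) hda, ?_⟩, ?_, ?_⟩
  · obtain ⟨g, rfl⟩ := ha
    rw [normC_act χ p hχ3 hpm (hce.trans he), hC e he]
  · rw [PadicInt.isUnit_iff.1 hda]
    norm_num
  · rw [stabCard_of_mem_orbit ha, hs]

end Admissibility

end BinaryCubic

namespace BinaryCubic

/-! ### Normal forms over a field, and diagonalization by the Hessian. -/

section FieldClassification

variable {F : Type*} [Field F]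

/-- Put [ij] = rᵢsⱼ - rⱼsᵢ and let lᵢ be the linear factors. From [23]l₁ - [13]l₂ + [12]l₃ = 0,
sending u to -[23]l₁ and v to -[13]l₂ sends u - v to [12]l₃; the product of the constants is the
determinant. -/
theorem mem_orbit_of_isSplit {a : Form F} (ha : IsSplit a) : a ∈ orbit ![0, 1, -1, 0] := by
  obtain ⟨r₁, s₁, r₂, s₂, r₃, s₃, h12, h13, h23, rfl⟩ := ha
  refine mem_orbit_of_subst (-(r₂ * s₃ - r₃ * s₂) * r₁) (-(r₁ * s₃ - r₃ * s₁) * r₂)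
    (-(r₂ * s₃ - r₃ * s₂) * s₁) (-(r₁ * s₃ - r₃ * s₁) * s₂) ?_ ?_
  · have : -(r₂ * s₃ - r₃ * s₂) * r₁ * (-(r₁ * s₃ - r₃ * s₁) * s₂) -
        -(r₁ * s₃ - r₃ * s₁) * r₂ * (-(r₂ * s₃ - r₃ * s₂) * s₁) =
        (r₂ * s₃ - r₃ * s₂) * (r₁ * s₃ - r₃ * s₁) * (r₁ * s₂ - r₂ * s₁) := by ring
    rw [this]
    exact (mul_ne_zero (mul_ne_zero h23 h13) h12).isUnit
  · funext i
    fin_cases i <;> simp [subst] <;> ring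

/-- With q the quadratic factor, send v to the linear factor ru + sv and u to the polarization of q
at its zero (s, -r). Then u² - dv² becomes q(s,-r)·q, and q(s,-r) is the determinant. -/
theorem mem_orbit_of_isLinQuad (h2 : (2 : F) ≠ 0) {a : Form F} (ha : IsLinQuad a) :
    ∃ d, ¬ IsSquare d ∧ a ∈ orbit ![0, 1, 0, -d] := by
  obtain ⟨r, s, q₀, q₁, q₂, hrs, hq, rfl⟩ := ha
  refine ⟨(q₁ ^ 2 - 4 * q₀ * q₂) / 4, ?_, ?_⟩
  · rintro ⟨t, ht⟩
    have h4 : (4 : F) ≠ 0 := by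
      have : (4 : F) = 2 * 2 := by norm_num
      rw [this]
      exact mul_ne_zero h2 h2
    rw [div_eq_iff h4] at ht
    have h0 : q₀ ≠ 0 := by simpa using hq 1 0 (by simp)
    apply hq (-q₁ + 2 * t) (2 * q₀) (by simp [h0, h2])
    linear_combination -q₀ * ht
  · refine mem_orbit_of_subst ((2 * q₀ * s - q₁ * r) / 2) r ((q₁ * s - 2 * q₂ * r) / 2) s ?_ ?_
    · have : (2 * q₀ * s - q₁ * r) / 2 * s - r * ((q₁ * s - 2 * q₂ * r) / 2) =
          q₀ * s ^ 2 + q₁ * s * (-r) + q₂ * (-r) ^ 2 := by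
        field_simp
        ring
      rw [this]
      refine (hq s (-r) ?_).isUnit
      intro h
      rw [Prod.mk.injEq, neg_eq_zero] at h
      exact hrs (by rw [h.1, h.2])
    · have h4 : (4 : F) = 2 * 2 := by norm_num
      funext i
      fin_cases i <;> simp [subst] <;> rw [h4] <;> field_simp <;> ring

/-- A form whose Hessian splits is equivalent to a diagonal one. -/
theorem exists_diagonal {R : Type*} [CommRing R] [IsDomain R] (h3 : (3 : R) ≠ 0) {a : Form R}
    (hd : disc a ≠ 0) {ρ A B C s : R} (hρ : hess a = (ρ * A, ρ * B, ρ * C))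
    (hs : s ^ 2 = B ^ 2 - 4 * A * C) (hu : IsUnit (2 * s * (s + B))) :
    ∃ b₀ b₃ : R, ![b₀, 0, 0, b₃] ∈ orbit a ∧
      2 * s * (s + B) * b₀ = eval a (-(s + B)) (2 * A) ∧
      2 * s * (s + B) * b₃ = eval a (2 * C) (-(s + B)) := by
  have hdet : -(s + B) * -(s + B) - 2 * A * (2 * C) = 2 * s * (s + B) := by
    linear_combination -hs
  have hu' : IsUnit (-(s + B) * -(s + B) - 2 * A * (2 * C)) := hdet ▸ hu
  -- The two rows of `g` are isotropic vectors of the quadratic form (A, B, C), so the transformed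
  -- Hessian has vanishing outer coefficients.
  set g := glOf _ _ _ _ hu' with hg
  have hdd : ddet g = 2 * s * (s + B) := (ddet_glOf _ _ _ _ hu').trans hdet
  have hb := hess_act g a
  have hdb : disc (act g a) ≠ 0 := by
    rw [disc_act]
    exact mul_ne_zero (pow_ne_zero _ (isUnit_ddet g).ne_zero) hd
  have e0 := ddet_mul_eval_act g a 1 0
  have e3 := ddet_mul_eval_act g a 0 1
  set b := act g a with hbdef
  have g00 : g.val 0 0 = -(s + B) := rfl
  have g01 : g.val 0 1 = 2 * A := rfl
  have g10 : g.val 1 0 = 2 * C := rfl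
  have g11 : g.val 1 1 = -(s + B) := rfl
  rw [hρ, g00, g01, g10, g11] at hb
  have hA : b 1 ^ 2 - 3 * b 0 * b 2 = 0 := by
    have := congrArg Prod.fst hb
    simp only [hess] at this
    rw [this]
    linear_combination ρ * A * hs
  have hC : b 2 ^ 2 - 3 * b 1 * b 3 = 0 := by
    have := congrArg (fun z => z.2.2) hb
    simp only [hess] at this
    rw [this]
    linear_combination ρ * C * hs
  have hB : b 1 * b 2 - 9 * b 0 * b 3 ≠ 0 := by
    intro h0
    have := hess_disc b
    simp only [hess, hA, h0, hC] at this
    have h4 : -3 * disc b = 0 := by rw [← this]; ring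
    rcases mul_eq_zero.1 h4 with h | h
    · exact h3 (neg_eq_zero.1 h)
    · exact hdb h
  -- The outer coefficients give b₁² = 3b₀b₂ and b₂² = 3b₁b₃, so b₁b₂ is annihilated by the nonzero
  -- middle coefficient of the Hessian.
  have h12 : b 1 * b 2 = 0 := by
    have : b 1 * b 2 * (b 1 * b 2 - 9 * b 0 * b 3) = 0 := by
      linear_combination b 2 ^ 2 * hA + 3 * b 0 * b 2 * hC
    exact (mul_eq_zero.1 this).resolve_right hB
  have h1 : b 1 = 0 := by
    rcases mul_eq_zero.1 h12 with h | h
    · exact h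
    · rw [h] at hA
      exact pow_eq_zero_iff two_ne_zero |>.1 (by linear_combination hA)
  have h2 : b 2 = 0 := by
    rw [h1] at hC
    exact pow_eq_zero_iff two_ne_zero |>.1 (by linear_combination hC)
  refine ⟨b 0, b 3, ?_, ?_, ?_⟩
  · have : (![b 0, 0, 0, b 3] : Form R) = b := by
      funext i
      fin_cases i <;> simp [h1, h2]
    rw [this]
    exact act_mem_orbit g a
  · rw [hdd, g00, g01, g10, g11] at e0
    have : eval b 1 0 = b 0 := by simp [eval]
    rw [this] at e0
    rw [e0]
    simp
  · rw [hdd, g00, g01, g10, g11] at e3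
    have : eval b 0 1 = b 3 := by simp [eval]
    rw [this] at e3
    rw [e3]
    simp

/-- Diagonal forms with unit leading coefficient can be made monic. -/
theorem diagonal_mem_orbit {R : Type*} [CommRing R] {b₀ b₃ : R} (h : IsUnit b₀) :
    ![1, 0, 0, b₀ ^ 2 * b₃] ∈ orbit ![b₀, 0, 0, b₃] := by
  refine mem_orbit_of_subst 1 0 0 b₀ (by simpa using h) ?_
  funext i
  fin_cases i <;> simp [subst]
  ring

theorem diagonal_cube_mem_orbit {R : Type*} [CommRing R] {t α : R} (ht : IsUnit t) :
    ![1, 0, 0, t ^ 3 * α] ∈ orbit ![1, 0, 0, α] := by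
  refine mem_orbit_of_subst t 0 0 (t ^ 2) (by simpa using ht.mul (ht.pow 2)) ?_
  funext i
  fin_cases i <;> simp [subst] <;> ring

end FieldClassification

/-! ### Irreducible cubics over 𝔽_p. -/

section IrreducibleForms

/-- The discriminant of an irreducible cubic form over `𝔽_p` is a nonzero square. -/
theorem isSquare_disc_of_isIrr {p : ℕ} [Fact p.Prime] {a : Form (ZMod p)} (ha : IsIrr a) :
    ∃ w, w ≠ 0 ∧ disc a = w ^ 2 := by
  let K := AlgebraicClosure (ZMod p)
  let ι := algebraMap (ZMod p) K
  have ha0 : a 0 ≠ 0 := by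
    have := ha 1 0 (by simp)
    simpa [eval] using this
  have hι : Function.Injective ι := ι.injective
  have hfix : ∀ x : K, x ^ p = x → ∃ y, ι y = x := by
    intro x hx
    have h1 : x ∈ (⊥ : Subfield K) := (Subfield.mem_bot_iff_pow_eq_self K p).2 hx
    rw [← ZMod.fieldRange_castHom_eq_bot p] at h1
    obtain ⟨y, hy⟩ := h1
    refine ⟨y, ?_⟩
    rw [← hy, RingHom.ext_zmod ι (ZMod.castHom dvd_rfl K)]
  have hcoef : ∀ i, ι (a i) ^ p = ι (a i) := fun i => by rw [← map_pow, ZMod.pow_card]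
  have ha0' : ι (a 0) ≠ 0 := by rw [map_ne_zero_iff _ hι]; exact ha0
  set f : K → K := fun x => ι (a 0) * x ^ 3 + ι (a 1) * x ^ 2 + ι (a 2) * x + ι (a 3) with hf
  have hfrob : ∀ x, f x = 0 → f (x ^ p) = 0 := by
    intro x hx
    have := congrArg (fun z => z ^ p) hx
    simp only [hf] at this ⊢
    rw [add_pow_char, add_pow_char, add_pow_char, mul_pow, mul_pow, mul_pow, hcoef, hcoef, hcoef,
      hcoef, zero_pow (Fact.out : p.Prime).ne_zero] at this
    rw [← this]
    ring
  have hno : ∀ y, f (ι y) ≠ 0 := by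
    intro y hy
    apply ha y 1 (by simp)
    apply hι
    rw [map_zero, ← hy]
    simp [hf, eval]
  obtain ⟨θ, hθ⟩ : ∃ θ, f θ = 0 := by
    have hdeg : (Polynomial.C (ι (a 0)) * Polynomial.X ^ 3 + Polynomial.C (ι (a 1)) * Polynomial.X ^ 2 +
        Polynomial.C (ι (a 2)) * Polynomial.X + Polynomial.C (ι (a 3))).degree = 3 :=
      Polynomial.degree_cubic ha0'
    obtain ⟨θ, hθ⟩ := IsAlgClosed.exists_root _ (by rw [hdeg]; norm_num)
    exact ⟨θ, by simpa [hf, Polynomial.IsRoot] using hθ⟩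
  have hsub : ∀ x y : K, (x - y) ^ p = x ^ p - y ^ p := fun x y => sub_pow_char x y
  set η := θ ^ p with hη
  have hηf : f η = 0 := hfrob θ hθ
  have hne : θ ≠ η := by
    intro h
    obtain ⟨y, hy⟩ := hfix θ h.symm
    exact hno y (hy ▸ hθ)
  obtain ⟨v, hv⟩ : ∃ v, ι (a 0) * v = 1 := ⟨_, mul_inv_cancel₀ ha0'⟩
  -- the third root
  obtain ⟨κ, hκ⟩ : ∃ κ, κ = -ι (a 1) * v - θ - η := ⟨_, rfl⟩
  have hsum : ι (a 0) * (θ + η + κ) = -ι (a 1) := by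
    rw [hκ]; linear_combination -ι (a 1) * hv
  have hprod2 : ι (a 0) * (θ * η + θ * κ + η * κ) = ι (a 2) := by
    have h1 : (θ - η) * (ι (a 0) * (θ ^ 2 + θ * η + η ^ 2) + ι (a 1) * (θ + η) + ι (a 2)) = 0 := by
      simp only [hf] at hθ hηf
      linear_combination hθ - hηf
    have h2 := (mul_eq_zero.1 h1).resolve_left (sub_ne_zero.2 hne)
    linear_combination -h2 + (θ + η) * hsum
  have hprod3 : ι (a 0) * (θ * η * κ) = -ι (a 3) := by
    simp only [hf] at hθ
    linear_combination hθ + θ * hprod2 - θ ^ 2 * hsum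
  have hfac : ∀ x, f x = ι (a 0) * ((x - θ) * (x - η) * (x - κ)) := by
    intro x
    simp only [hf]
    linear_combination -hprod2 * x + x ^ 2 * hsum + hprod3
  -- Frobenius permutes the roots. If it exchanged θ and η, the third root would be fixed and hence
  -- rational; if it fixed η, injectivity would give θ = η.
  have hηp : η ^ p = κ := by
    have h1 := hfrob η hηf
    rw [hfac] at h1
    rcases mul_eq_zero.1 ((mul_eq_zero.1 h1).resolve_left ha0') with h | h
    · rcases mul_eq_zero.1 h with h | h
      · exfalso
        have h2 : η ^ p = θ := sub_eq_zero.1 h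
        have hvp : v ^ p = v := by
          have := congrArg (fun z => z ^ p) hv
          simp only [mul_pow, hcoef, one_pow] at this
          exact mul_left_cancel₀ ha0' (this.trans hv.symm)
        have h3 : κ ^ p = κ := by
          rw [hκ, hsub, hsub, mul_pow, hvp, h2, ← hη, neg_pow, hcoef]
          have : (-1 : K) ^ p = -1 := by
            rw [← map_one ι, ← map_neg, ← map_pow, ZMod.pow_card]
          rw [this]
          ring
        obtain ⟨y, hy⟩ := hfix κ h3
        apply hno y
        rw [hy, hfac]
        ring
      · exfalso
        have h2 : (η - θ) ^ p = 0 := by rw [hsub, ← hη, h]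
        exact hne (sub_eq_zero.1 (pow_eq_zero_iff (Fact.out : p.Prime).ne_zero |>.1 h2)).symm
    · exact sub_eq_zero.1 h
  have hκp : κ ^ p = θ := by
    have h1 := congrArg (fun z => z ^ p) hsum
    simp only [mul_pow, hcoef, add_pow_char, ← hη, hηp] at h1
    have h2 : (-ι (a 1)) ^ p = -ι (a 1) := by rw [← map_neg, ← map_pow, ZMod.pow_card]
    rw [h2, ← hsum] at h1
    have h3 := mul_left_cancel₀ ha0' h1
    linear_combination h3
  -- Frobenius permutes the three roots cyclically, so this square root of the discriminant is fixed
  -- and lies in 𝔽_p.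
  set w := ι (a 0) ^ 2 * ((θ - η) * (η - κ) * (κ - θ)) with hw
  have hwp : w ^ p = w := by
    rw [hw, mul_pow, mul_pow, mul_pow, hsub θ η, hsub η κ, hsub κ θ, ← hη, hηp, hκp, ← pow_mul, mul_comm 2 p,
      pow_mul, hcoef]
    ring
  obtain ⟨y, hy⟩ := hfix w hwp
  refine ⟨y, ?_, hι ?_⟩
  · rintro rfl
    have hw0 : w ≠ 0 := by
      have hp0 := (Fact.out : p.Prime).ne_zero
      have h1 : θ - η ≠ 0 := sub_ne_zero.2 hne
      have h2 : η - κ ≠ 0 := by rw [hη, ← hηp, ← hsub]; exact pow_ne_zero p h1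
      have h3 : κ - θ ≠ 0 := by rw [← hηp, ← hκp, ← hsub]; exact pow_ne_zero p h2
      exact mul_ne_zero (pow_ne_zero 2 ha0') (mul_ne_zero (mul_ne_zero h1 h2) h3)
    exact hw0 (by rw [← hy, map_zero])
  rw [map_pow, hy, hw]
  simp only [disc, map_sub, map_add, map_mul, map_pow, map_ofNat ι]
  have e1 : ι (a 1) = -(ι (a 0) * (θ + η + κ)) := by rw [hsum, neg_neg]
  have e3 : ι (a 3) = -(ι (a 0) * (θ * η * κ)) := by rw [hprod3, neg_neg]
  rw [e1, e3, ← hprod2]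
  ring

end IrreducibleForms

end BinaryCubic

namespace BinaryCubic

theorem mapForm_vec {R S : Type*} [CommRing R] [CommRing S] (f : R →+* S) (a b c d : R) :
    mapForm f ![a, b, c, d] = ![f a, f b, f c, f d] := by
  funext i
  fin_cases i <;> rfl

set_option maxRecDepth 100000 in
-- The four inequalities exclude roots at the four points of ℙ¹(𝔽₃); a finite check shows that all
-- such cubics are equivalent to u³ - uv² + v³.
theorem exists_subst_zmod_three : ∀ a b c d : ZMod 3, a ≠ 0 → d ≠ 0 → a + b + c + d ≠ 0 →
    -a + b - c + d ≠ 0 → ∃ α β γ δ : ZMod 3, α * δ - β * γ ≠ 0 ∧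
      α ^ 3 + α * β ^ 2 * (-1) + β ^ 3 = (α * δ - β * γ) * a ∧
      (3 * α ^ 2 * γ + (β ^ 2 * γ + 2 * α * β * δ) * (-1) + 3 * β ^ 2 * δ) = (α * δ - β * γ) * b ∧
      (3 * α * γ ^ 2 + (α * δ ^ 2 + 2 * β * γ * δ) * (-1) + 3 * β * δ ^ 2) = (α * δ - β * γ) * c ∧
      (γ ^ 3 + γ * δ ^ 2 * (-1) + δ ^ 3) = (α * δ - β * γ) * d := by
  decide

/-! ### Orbits of types (3), (21) and (111). -/

section Unramified

variable {p : ℕ} [Fact p.Prime]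

theorem mem_orbit_of_t111 {a : Form ℤ_[p]} (ha : a ∈ formsOfType p .t111) :
    a ∈ orbit ![0, 1, -1, 0] := by
  refine mem_orbit_of_toZMod p (by simp [disc]) ?_
  rw [mapForm_vec]
  simpa using mem_orbit_of_isSplit ha

theorem mem_t111 : (![0, 1, -1, 0] : Form ℤ_[p]) ∈ formsOfType p .t111 := by
  show IsSplit _
  refine ⟨1, 0, 0, 1, 1, -1, by simp, by simp, by simp, ?_⟩
  rw [mapForm_vec]
  simp

theorem isUnit_of_toZMod_ne_zero {x : ℤ_[p]} (h : PadicInt.toZMod x ≠ 0) : IsUnit x := by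
  rw [isUnit_iff_not_dvd]
  intro hd
  apply h
  rw [← map_zero (PadicInt.toZMod (p := p)), toZMod_eq_iff, sub_zero]
  exact hd

theorem toZMod_ne_zero_of_isUnit {x : ℤ_[p]} (h : IsUnit x) : PadicInt.toZMod x ≠ 0 :=
  (h.map (PadicInt.toZMod (p := p))).ne_zero

theorem isUnit_two (hp : p ≠ 2) : IsUnit (2 : ℤ_[p]) := by
  have := isUnit_natCast_of_coprime (p := p) (n := 2)
    ((Nat.coprime_primes Fact.out Nat.prime_two).2 hp)
  exact_mod_cast this

theorem isUnit_disc_linQuad (hp : p ≠ 2) {d : ℤ_[p]} (hd : IsUnit d) :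
    IsUnit (disc (![0, 1, 0, -d] : Form ℤ_[p])) := by
  have : disc (![0, 1, 0, -d] : Form ℤ_[p]) = 2 ^ 2 * d := by
    simp [disc]; norm_num
  rw [this]
  exact ((isUnit_two hp).pow 2).mul hd

theorem exists_mem_orbit_of_t21 (hp : p ≠ 2) {a : Form ℤ_[p]} (ha : a ∈ formsOfType p .t21) :
    ∃ d, IsUnit d ∧ ¬ IsSquare (PadicInt.toZMod d) ∧ a ∈ orbit ![0, 1, 0, -d] := by
  have h2 : (2 : ZMod p) ≠ 0 := by
    have := toZMod_ne_zero_of_isUnit (isUnit_two hp)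
    rwa [map_ofNat (PadicInt.toZMod (p := p))] at this
  obtain ⟨d, hd, h⟩ := mem_orbit_of_isLinQuad h2 ha
  obtain ⟨d, rfl⟩ := ZMod.ringHom_surjective (PadicInt.toZMod (p := p)) d
  have hu : IsUnit d := isUnit_of_toZMod_ne_zero fun h0 => hd ⟨0, by rw [h0, mul_zero]⟩
  refine ⟨d, hu, hd, mem_orbit_of_toZMod p (isUnit_disc_linQuad hp hu) ?_⟩
  rw [mapForm_vec]
  simpa using h

theorem exists_not_isSquare (hp : p ≠ 2) :
    ∃ d : ℤ_[p], IsUnit d ∧ ¬ IsSquare (PadicInt.toZMod d) := by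
  obtain ⟨d, hd⟩ := FiniteField.exists_nonsquare (F := ZMod p) (by rwa [ringChar.eq (ZMod p) p])
  obtain ⟨d, rfl⟩ := ZMod.ringHom_surjective (PadicInt.toZMod (p := p)) d
  exact ⟨d, isUnit_of_toZMod_ne_zero fun h0 => hd ⟨0, by rw [h0, mul_zero]⟩, hd⟩

theorem mem_t21 {d : ℤ_[p]} (hd : ¬ IsSquare (PadicInt.toZMod d)) :
    (![0, 1, 0, -d] : Form ℤ_[p]) ∈ formsOfType p .t21 := by
  show IsLinQuad _
  refine ⟨0, 1, 1, 0, -PadicInt.toZMod d, by simp, ?_, ?_⟩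
  · intro u v huv h
    by_cases hv : v = 0
    · subst hv
      apply huv
      simpa using h
    · apply hd
      refine ⟨u / v, ?_⟩
      field_simp
      linear_combination -h
  · rw [mapForm_vec]
    simp

/-- Both -3 and the discriminant are squares, so the Hessian splits over 𝔽_p and the form can be
diagonalized. -/
theorem exists_mem_orbit_of_isIrr (hp : p % 3 = 1) {a : Form (ZMod p)} (ha : IsIrr a) :
    ∃ α, α ≠ 0 ∧ a ∈ orbit ![1, 0, 0, α] := by
  obtain ⟨w, hw, hD⟩ := isSquare_disc_of_isIrr ha
  obtain ⟨t, ht, ht3⟩ := exists_sqrt_neg_three hp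
  have ht' : (PadicInt.toZMod t : ZMod p) ^ 2 = -3 := by
    rw [← map_pow, ht3, map_neg, map_ofNat (PadicInt.toZMod (p := p))]
  have ht0 := toZMod_ne_zero_of_isUnit ht
  have h2 : (2 : ZMod p) ≠ 0 := by
    have := toZMod_ne_zero_of_isUnit (isUnit_two (p := p) (by rintro rfl; omega))
    rwa [map_ofNat (PadicInt.toZMod (p := p))] at this
  have h3 : (3 : ZMod p) ≠ 0 := by
    rw [← neg_ne_zero, ← ht']
    exact pow_ne_zero 2 ht0
  have hd0 : disc a ≠ 0 := by rw [hD]; exact pow_ne_zero 2 hw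
  -- Of the two square roots ±s at least one satisfies s + B ≠ 0.
  obtain ⟨s, hs, hsB⟩ : ∃ s, s ^ 2 = (hess a).2.1 ^ 2 - 4 * (hess a).1 * (hess a).2.2 ∧
      s ≠ 0 ∧ s + (hess a).2.1 ≠ 0 := by
    have hs2 : (PadicInt.toZMod t * w) ^ 2 =
        (hess a).2.1 ^ 2 - 4 * (hess a).1 * (hess a).2.2 := by
      rw [hess_disc, hD, mul_pow, ht']
    have hs0 : PadicInt.toZMod t * w ≠ 0 := mul_ne_zero ht0 hw
    by_cases h : PadicInt.toZMod t * w + (hess a).2.1 = 0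
    · refine ⟨-(PadicInt.toZMod t * w), by rw [neg_sq, hs2], neg_ne_zero.2 hs0, fun h' => ?_⟩
      exact mul_ne_zero h2 hs0 (by linear_combination h - h')
    · exact ⟨_, hs2, hs0, h⟩
  obtain ⟨b₀, b₃, hb, -⟩ := exists_diagonal h3 hd0 (ρ := 1) (A := (hess a).1) (B := (hess a).2.1)
    (C := (hess a).2.2) (by simp) hs (mul_ne_zero (mul_ne_zero h2 hsB.1) hsB.2).isUnit
  have hdb : b₀ ≠ 0 ∧ b₃ ≠ 0 := by
    obtain ⟨g, hg⟩ := hb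
    have h1 : disc ![b₀, 0, 0, b₃] ≠ 0 := by
      rw [hg, disc_act]
      exact mul_ne_zero (pow_ne_zero _ (isUnit_ddet g).ne_zero) hd0
    constructor <;> rintro rfl <;> simp [disc] at h1
  exact ⟨b₀ ^ 2 * b₃, mul_ne_zero (pow_ne_zero 2 hdb.1) hdb.2,
    mem_orbit_symm (mem_orbit_trans (diagonal_mem_orbit hdb.1.isUnit) hb)⟩

theorem isUnit_three (hp : p ≠ 3) : IsUnit (3 : ℤ_[p]) := by
  have := isUnit_natCast_of_coprime (p := p) (n := 3)
    ((Nat.coprime_primes Fact.out Nat.prime_three).2 hp)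
  exact_mod_cast this

theorem isUnit_disc_diagonal (hp : p ≠ 3) {α : ℤ_[p]} (hα : IsUnit α) :
    IsUnit (disc (![1, 0, 0, α] : Form ℤ_[p])) := by
  have : disc (![1, 0, 0, α] : Form ℤ_[p]) = -(3 ^ 3 * α ^ 2) := by
    simp [disc]; norm_num
  rw [this]
  exact (((isUnit_three hp).pow 3).mul (hα.pow 2)).neg

theorem exists_mem_orbit_of_t3 (hp : p % 3 = 1) {a : Form ℤ_[p]} (ha : a ∈ formsOfType p .t3) :
    ∃ α, IsUnit α ∧ a ∈ orbit ![1, 0, 0, α] := by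
  obtain ⟨α, hα, h⟩ := exists_mem_orbit_of_isIrr hp ha
  obtain ⟨α, rfl⟩ := ZMod.ringHom_surjective (PadicInt.toZMod (p := p)) α
  have hu := isUnit_of_toZMod_ne_zero hα
  refine ⟨α, hu, mem_orbit_of_toZMod p (isUnit_disc_diagonal (by rintro rfl; omega) hu) ?_⟩
  rw [mapForm_vec]
  simpa using h

theorem mem_t3 {α : ℤ_[p]} (hα : ∀ t : ZMod p, t ^ 3 ≠ PadicInt.toZMod α) :
    (![1, 0, 0, α] : Form ℤ_[p]) ∈ formsOfType p .t3 := by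
  intro u v huv h
  rw [mapForm_vec] at h
  simp only [eval, map_one, map_zero, Matrix.cons_val_zero, Matrix.cons_val_one, Matrix.cons_val]
    at h
  by_cases hv : v = 0
  · subst hv
    apply huv
    simpa using h
  · apply hα (-u / v)
    field_simp
    linear_combination -h

theorem mem_orbit_of_t21_three {a : Form ℤ_[3]} (ha : a ∈ formsOfType 3 .t21) :
    a ∈ orbit ![0, 1, 0, 1] := by
  obtain ⟨d, -, hd, h⟩ := exists_mem_orbit_of_t21 (by norm_num) ha
  refine mem_orbit_trans h (mem_orbit_of_toZMod 3 ?_ ?_)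
  · simpa using isUnit_disc_linQuad (p := 3) (by norm_num) (d := -1) (by simp)
  · have : ∀ x : ZMod 3, ¬ IsSquare x → -x = 1 := by decide
    rw [mapForm_vec, mapForm_vec, map_neg, this _ hd, map_one]
    exact mem_orbit_self _

theorem isUnit_disc_three_irr : IsUnit (disc (![1, 0, -1, 1] : Form ℤ_[3])) := by
  have h : disc (![1, 0, -1, 1] : Form ℤ_[3]) = ((-23 : ℤ) : ℤ_[3]) := by simp [disc]; norm_num
  rw [h, isUnit_intCast_iff]
  norm_num

theorem mem_orbit_of_t3_three {a : Form ℤ_[3]} (ha : a ∈ formsOfType 3 .t3) :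
    a ∈ orbit ![1, 0, -1, 1] := by
  refine mem_orbit_of_toZMod 3 isUnit_disc_three_irr ?_
  have ha' : IsIrr (mapForm PadicInt.toZMod a) := ha
  generalize mapForm PadicInt.toZMod a = x at ha'
  have h10 := ha' 1 0 (by simp)
  have h01 := ha' 0 1 (by simp)
  have h11 := ha' 1 1 (by simp)
  have h1n := ha' (-1) 1 (by simp)
  simp only [eval] at h10 h01 h11 h1n
  obtain ⟨α, β, γ, δ, hΔ, e0, e1, e2, e3⟩ := exists_subst_zmod_three (x 0) (x 1) (x 2) (x 3)
    (by simpa using h10) (by simpa using h01) (by simpa using h11)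
    (fun h => h1n (by linear_combination h))
  rw [mapForm_vec]
  refine mem_orbit_of_subst α β γ δ hΔ.isUnit ?_
  funext i
  fin_cases i
  · simpa [subst] using e0
  · simpa [subst] using e1
  · simpa [subst] using e2
  · simpa [subst] using e3

theorem mem_t3_three : (![1, 0, -1, 1] : Form ℤ_[3]) ∈ formsOfType 3 .t3 := by
  show IsIrr _
  rw [mapForm_vec]
  simp only [map_one, map_zero, map_neg, IsIrr, eval]
  decide

end Unramified

/-! ### Least admissible exponents for unit discriminant. -/

section MinimalExponents

variable {m : ℕ} [NeZero m] {χ : DirichletCharacter ℂ m} {p : ℕ} [Fact p.Prime]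

/-- The lower bound is just the requirement e ≥ c, which bites as soon as the type is inhabited. -/
theorem minimalExp_of_isUnit_disc (hpm : p ∣ m) {σ : MaxType} (hne : (formsOfType p σ).Nonempty)
    (h : ∀ a ∈ formsOfType p σ, IsUnit (disc a)) : MinimalExp χ p σ (condExp m p) := by
  refine ⟨fun a ha => admissible_of_isUnit_disc χ p hpm le_rfl (h a ha), fun e he => ?_⟩
  obtain ⟨a, ha⟩ := hne
  exact (he a ha).1

theorem isUnit_disc_of_mem_orbit {x a : Form ℤ_[p]} (h : x ∈ orbit a) (hd : IsUnit (disc a)) :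
    IsUnit (disc x) := by
  obtain ⟨g, rfl⟩ := h
  rw [disc_act]
  exact ((isUnit_ddet g).pow _).mul hd

theorem minimalExp_t111 (hpm : p ∣ m) : MinimalExp χ p .t111 (condExp m p) :=
  minimalExp_of_isUnit_disc hpm ⟨_, mem_t111⟩ fun _ ha =>
    isUnit_disc_of_mem_orbit (mem_orbit_of_t111 ha) (by simp [disc])

theorem minimalExp_t21 (hp : p ≠ 2) (hpm : p ∣ m) : MinimalExp χ p .t21 (condExp m p) := by
  obtain ⟨d, -, hd⟩ := exists_not_isSquare hp
  refine minimalExp_of_isUnit_disc hpm ⟨_, mem_t21 hd⟩ fun _ ha => ?_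
  obtain ⟨d, hd, -, h⟩ := exists_mem_orbit_of_t21 hp ha
  exact isUnit_disc_of_mem_orbit h (isUnit_disc_linQuad hp hd)

theorem minimalExp_t3_three (hpm : 3 ∣ m) : MinimalExp χ 3 .t3 (condExp m 3) :=
  minimalExp_of_isUnit_disc hpm ⟨_, mem_t3_three⟩ fun _ ha =>
    isUnit_disc_of_mem_orbit (mem_orbit_of_t3_three ha) isUnit_disc_three_irr

/-- A unit ε with χ_p(ε) ≠ 1 is not a cube modulo p, so (1, 0, 0, ε) witnesses that the type is
nonempty. -/
theorem minimalExp_t3 (hp : p % 3 = 1) (hχ : χ.IsPrimitive) (hχ3 : χ ^ 3 = 1) (hpm : p ∣ m) :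
    MinimalExp χ p .t3 (condExp m p) := by
  obtain ⟨ε, -, hε⟩ := exists_unitChar_ne_one χ p hχ hpm
  have hα : ∀ t : ZMod p, t ^ 3 ≠ PadicInt.toZMod (ε : ℤ_[p]) := by
    intro t ht
    obtain ⟨t, rfl⟩ := ZMod.ringHom_surjective (PadicInt.toZMod (p := p)) t
    have htu : IsUnit t := isUnit_of_toZMod_ne_zero fun h0 =>
      toZMod_ne_zero_of_isUnit ε.isUnit (by rw [← ht, h0, zero_pow three_ne_zero])
    apply hε
    rw [← map_pow, toZMod_eq_iff] at ht
    rw [← unitChar_cube χ p hχ3 htu]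
    refine (unitChar_congr χ p ?_).symm
    rwa [condExp_of_one_mod_three hχ hχ3 hpm hp, pow_one]
  refine minimalExp_of_isUnit_disc hpm ⟨_, mem_t3 hα⟩ fun _ ha => ?_
  obtain ⟨α, hα, h⟩ := exists_mem_orbit_of_t3 hp ha
  exact isUnit_disc_of_mem_orbit h (isUnit_disc_diagonal (by rintro rfl; omega) hα)

end MinimalExponents

end BinaryCubic

namespace BinaryCubic

/-! ### Orbits of types (1²1_max) and (1³_max). -/

section Ramified

variable {p : ℕ} [Fact p.Prime]

theorem exists_disc_eq {R : Type*} [CommRing R] {x a : Form R} (h : x ∈ orbit a) :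
    ∃ Δ, IsUnit Δ ∧ disc x = Δ ^ 2 * disc a := by
  obtain ⟨g, rfl⟩ := h
  exact ⟨_, isUnit_ddet g, disc_act g a⟩

theorem exists_eq_p_mul {y : ℤ_[p]} {t : ZMod (p ^ 2)}
    (h : PadicInt.toZModPow 2 y = (p : ZMod (p ^ 2)) * t) :
    ∃ w, y = p * w ∧ (IsUnit t → IsUnit w) := by
  obtain ⟨t', rfl⟩ := exists_toZModPow_eq p 2 t
  have h' : PadicInt.toZModPow 2 y = PadicInt.toZModPow 2 ((p : ℤ_[p]) * t') := by
    rw [h, map_mul, map_natCast]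
  rw [toZModPow_eq_iff] at h'
  obtain ⟨w, hw⟩ := h'
  refine ⟨t' + p * w, by linear_combination hw, fun ht => ?_⟩
  exact isUnit_of_dvd_sub p ⟨w, by ring⟩ ((isUnit_toZModPow_iff p two_ne_zero t').1 ht)

/-- A form x close to the orbit of a has the same type, hence is equivalent to some r in S.
Transporting the congruence to r leaves only the question whether r can be close to the orbit of a
without lying in it. -/
theorem isolated_of_representatives {D : Set (Form (ZMod (p ^ 2)))} {S : Set (Form ℤ_[p])}
    (hS : ∀ x, (∃ d ∈ D, mapForm (PadicInt.toZModPow 2) x ∈ orbit d) → ∃ r ∈ S, x ∈ orbit r)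
    {e : ℕ} (he : 2 ≤ e) {a : Form ℤ_[p]}
    (ha : ∃ d ∈ D, mapForm (PadicInt.toZModPow 2) a ∈ orbit d)
    (h : ∀ r ∈ S, ∀ z ∈ orbit a, (∀ i, (p : ℤ_[p]) ^ e ∣ z i - r i) → r ∈ orbit a) :
    Isolated p e a := by
  intro x y hy hxy
  have hx2 : mapForm (PadicInt.toZModPow 2) x = mapForm (PadicInt.toZModPow 2) y :=
    (mapForm_eq_iff p 2 x y).2 fun i => (pow_dvd_pow _ he).trans (hxy i)
  obtain ⟨d, hd, hyd⟩ := formsOfType_ramified_of_mem_orbit p ha hy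
  obtain ⟨r, hr, g, rfl⟩ := hS x ⟨d, hd, hx2 ▸ hyd⟩
  refine mem_orbit_trans (act_mem_orbit g r) (h r hr (act g⁻¹ y)
    (mem_orbit_trans (act_mem_orbit _ _) hy) ?_)
  rw [← mapForm_eq_iff] at hxy ⊢
  rw [mapForm_act, ← hxy, ← mapForm_act, act_inv_act]

theorem mem_t121max {α : ℤ_[p]} (hα : IsUnit α) :
    (![0, 1, 0, p * α] : Form ℤ_[p]) ∈ formsOfType p .t121max := by
  refine ⟨_, ?_, mem_orbit_self _⟩
  rw [mapForm_vec]
  refine ⟨by simp, by simp, ⟨0, by simp⟩, PadicInt.toZModPow 2 α, hα.map _, by simp⟩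

theorem mem_t13max_of {b c d : ℤ_[p]} (hd : IsUnit d) :
    (![1, p * b, p * c, p * d] : Form ℤ_[p]) ∈ formsOfType p .t13max := by
  refine ⟨_, ?_, mem_orbit_self _⟩
  rw [mapForm_vec]
  exact ⟨by simp, ⟨PadicInt.toZModPow 2 b, by simp⟩, ⟨PadicInt.toZModPow 2 c, by simp⟩,
    PadicInt.toZModPow 2 d, hd.map _, by simp⟩

theorem mem_orbit_of_t121max (hp : p ≠ 2) {a : Form ℤ_[p]} (ha : a ∈ formsOfType p .t121max) :
    ∃ α : ℤ_[p], IsUnit α ∧ a ∈ orbit ![0, 1, 0, p * α] := by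
  obtain ⟨a, hab, h0, h1, ⟨c, hc⟩, d, hdu, hd⟩ := exists_mem_orbit_of_ramified p ha
  replace h0 : (p : ℤ_[p]) ^ 2 ∣ a 0 - 0 :=
    (toZModPow_eq_iff p 2 _ _).1 (by rw [map_zero]; exact h0)
  have h1' : IsUnit (a 1) := (isUnit_toZModPow_iff p two_ne_zero _).1 h1
  obtain ⟨c, hc, -⟩ := exists_eq_p_mul hc
  obtain ⟨d, hd, hdu'⟩ := exists_eq_p_mul hd
  replace hdu := hdu' hdu
  -- The simple root at (1 : 0) modulo p is lifted to ℤ_p; the substitution `hstep` below moves it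
  -- to (1 : 0).
  open Polynomial in
  obtain ⟨y, hy, hyp⟩ := exists_root_of_simple p
    (C (a 0) + C (a 1) * X + C (a 2) * X ^ 2 + C (a 3) * X ^ 3) 0
    (by simpa using (dvd_pow_self (p : ℤ_[p]) two_ne_zero).trans h0) (by simpa using h1')
  simp only [Polynomial.eval_add, Polynomial.eval_mul, Polynomial.eval_C, Polynomial.eval_X,
    Polynomial.eval_pow] at hy
  obtain ⟨w, hw⟩ := isUnit_two hp
  obtain ⟨y', hy'⟩ : ∃ y', y = p * y' := by simpa [dvd_def] using hyp
  set B := a 1 + 2 * y * a 2 + 3 * y ^ 2 * a 3 with hB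
  have hBu : IsUnit B :=
    isUnit_of_dvd_sub p ⟨2 * y' * a 2 + 3 * y' * y * a 3, by rw [hB, hy']; ring⟩ h1'
  -- Half the third coefficient divided by p, used for completing the square.
  obtain ⟨h, hh⟩ : ∃ h : ℤ_[p], 2 * h = c + 3 * y * d :=
    ⟨((w⁻¹ : ℤ_[p]ˣ) : ℤ_[p]) * (c + 3 * y * d), by rw [← hw, Units.mul_inv_cancel_left]⟩
  refine ⟨B * d - p * h ^ 2, isUnit_of_dvd_sub p ⟨-h ^ 2, by ring⟩ (hBu.mul hdu), ?_⟩
  have hstep : (![0, B, p * (c + 3 * y * d), p * d] : Form ℤ_[p]) ∈ orbit a := by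
    refine mem_orbit_of_subst 1 y 0 1 (by simp) ?_
    funext i
    fin_cases i
    · simp [subst]; linear_combination hy
    · simp [subst, hB]
    · simp [subst, hc, hd]; ring
    · simp [subst, hd]
  refine mem_orbit_trans hab (mem_orbit_trans (mem_orbit_symm hstep) ?_)
  refine mem_orbit_of_subst B 0 (p * h) 1 (by simpa using hBu) ?_
  rw [← hh]
  funext i
  fin_cases i <;> simp [subst] <;> ring

theorem quadratic_scale_mem_orbit {R : Type*} [CommRing R] {μ α : R} (hμ : IsUnit μ) :
    ![0, 1, 0, μ ^ 2 * α] ∈ orbit ![0, 1, 0, α] := by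
  refine mem_orbit_of_subst 1 0 0 μ (by simpa using hμ) ?_
  funext i
  fin_cases i <;> simp [subst]
  ring

theorem disc_t121max (α : ℤ_[p]) : disc (![0, 1, 0, p * α] : Form ℤ_[p]) = p * (-(2 ^ 2 * α)) := by
  simp [disc]; ring

/-- The discriminant -4pα modulo p² determines α modulo p up to unit squares, and a unit congruent
to a unit square modulo p is a square. -/
theorem isolated_t121max (hp : p ≠ 2) {α : ℤ_[p]} (hα : IsUnit α) :
    Isolated p 2 ![0, 1, 0, p * α] := by
  have hp0 : (p : ℤ_[p]) ≠ 0 := by exact_mod_cast (Fact.out : p.Prime).ne_zero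
  refine isolated_of_representatives (S := {r | ∃ β : ℤ_[p], IsUnit β ∧ r = ![0, 1, 0, p * β]})
    (fun x hx => ?_) le_rfl (mem_t121max hα) ?_
  · obtain ⟨β, hβ, h⟩ := mem_orbit_of_t121max hp hx
    exact ⟨_, ⟨β, hβ, rfl⟩, h⟩
  rintro _ ⟨β, hβ, rfl⟩ z hz hzr
  obtain ⟨Δ, hΔ, hdz⟩ := exists_disc_eq hz
  rw [← mapForm_eq_iff] at hzr
  have h1 := congrArg disc hzr
  rw [disc_mapForm, disc_mapForm, toZModPow_eq_iff, hdz, disc_t121max, disc_t121max] at h1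
  have h2 : (p : ℤ_[p]) ∣ 2 ^ 2 * (β - Δ ^ 2 * α) := by
    obtain ⟨w, hw⟩ := h1
    exact ⟨w, mul_left_cancel₀ hp0 (by linear_combination hw)⟩
  have h3 : (p : ℤ_[p]) ∣ β - Δ ^ 2 * α := ((isUnit_two hp).pow 2).dvd_mul_left.1 h2
  obtain ⟨α, rfl⟩ := hα
  obtain ⟨w, hw⟩ := h3
  obtain ⟨t, ht, ht2, -⟩ := exists_sqrt p hp (u := β * (α⁻¹ : ℤ_[p]ˣ)) hΔ
    ⟨w * (α⁻¹ : ℤ_[p]ˣ), by linear_combination (α⁻¹ : ℤ_[p]ˣ) * hw + Δ ^ 2 * α.mul_inv⟩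
  have h4 : t ^ 2 * (p * α) = p * β := by
    rw [ht2]; linear_combination p * β * α.mul_inv
  rw [← h4]
  exact quadratic_scale_mem_orbit ht

theorem mem_orbit_of_t13max {a : Form ℤ_[p]} (ha : a ∈ formsOfType p .t13max) :
    ∃ b c d : ℤ_[p], IsUnit d ∧ a ∈ orbit ![1, p * b, p * c, p * d] := by
  obtain ⟨a, hab, h0, ⟨b, hb⟩, ⟨c, hc⟩, d, hdu, hd⟩ := exists_mem_orbit_of_ramified p ha
  have h0' : IsUnit (a 0) := (isUnit_toZModPow_iff p two_ne_zero _).1 h0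
  obtain ⟨b, hb, -⟩ := exists_eq_p_mul hb
  obtain ⟨c, hc, -⟩ := exists_eq_p_mul hc
  obtain ⟨d, hd, hdu'⟩ := exists_eq_p_mul hd
  refine ⟨b, a 0 * c, a 0 ^ 2 * d, (h0'.pow 2).mul (hdu' hdu), mem_orbit_trans hab
    (mem_orbit_symm (mem_orbit_of_subst 1 0 0 (a 0) (by simpa using h0') ?_))⟩
  funext i
  fin_cases i <;> simp [subst, hb, hc, hd] <;> ring

/-- If the Hessian of `(1, pb, pc, pd)` splits, then the form is equivalent to a pure cubic. -/
theorem exists_pure_of_hess {b c d ρ A B C s : ℤ_[p]} (hd : IsUnit d)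
    (hdisc : disc (![1, p * b, p * c, p * d] : Form ℤ_[p]) ≠ 0)
    (hρ : hess ![1, p * b, p * c, p * d] = (ρ * A, ρ * B, ρ * (p * C)))
    (hs : s ^ 2 = B ^ 2 - 4 * A * (p * C)) (hu : IsUnit (2 * s * (s + B))) :
    ∃ α : ℤ_[p], IsUnit α ∧ (![1, p * b, p * c, p * d] : Form ℤ_[p]) ∈ orbit ![1, 0, 0, p * α] := by
  have h3 : (3 : ℤ_[p]) ≠ 0 := by norm_num
  obtain ⟨b₀, b₃, hb, e0, e3⟩ := exists_diagonal h3 hdisc hρ hs hu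
  have hsB : IsUnit (s + B) := isUnit_of_mul_isUnit_right hu
  have hb0 : IsUnit b₀ := by
    have : IsUnit (2 * s * (s + B) * b₀) := by
      rw [e0]
      refine isUnit_of_dvd_sub p (y := (-(s + B)) ^ 3) ⟨b * (-(s + B)) ^ 2 * (2 * A) +
        c * (-(s + B)) * (2 * A) ^ 2 + d * (2 * A) ^ 3, ?_⟩ (hsB.neg.pow 3)
      simp [eval]; ring
    exact isUnit_of_mul_isUnit_right this
  obtain ⟨v, hv⟩ := hu
  have hb3 : ∃ w, IsUnit w ∧ b₃ = p * w := by
    set M := d * (-(s + B)) ^ 3 + p * (c * (2 * C) * (-(s + B)) ^ 2 +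
      p * b * (2 * C) ^ 2 * (-(s + B)) + p * (2 * C) ^ 3) with hM
    have hMu : IsUnit M := isUnit_of_dvd_sub p ⟨c * (2 * C) * (-(s + B)) ^ 2 +
      p * b * (2 * C) ^ 2 * (-(s + B)) + p * (2 * C) ^ 3, by rw [hM]; ring⟩
      (hd.mul (hsB.neg.pow 3))
    refine ⟨(v⁻¹ : ℤ_[p]ˣ) * M, v⁻¹.isUnit.mul hMu, ?_⟩
    have e3' : 2 * s * (s + B) * b₃ = p * M := by
      rw [e3, hM]; simp [eval]; ring
    rw [← hv] at e3'
    linear_combination (v⁻¹ : ℤ_[p]ˣ) * e3' - b₃ * v.mul_inv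
  obtain ⟨w, hw, rfl⟩ := hb3
  refine ⟨b₀ ^ 2 * w, (hb0.pow 2).mul hw, mem_orbit_symm ?_⟩
  have := mem_orbit_trans (diagonal_mem_orbit (b₃ := p * w) hb0) hb
  rwa [mul_left_comm] at this

/-- Since 3 is a unit, a translation removes the quadratic coefficient. The Hessian is then p·(-3c',
-9d', p c'²), and the discriminant of the second factor is a unit square modulo p, so the Hessian
splits. -/
theorem exists_mem_orbit_of_t13max (hp2 : p ≠ 2) (hp3 : p ≠ 3) {a : Form ℤ_[p]}
    (ha : a ∈ formsOfType p .t13max) : ∃ α : ℤ_[p], IsUnit α ∧ a ∈ orbit ![1, 0, 0, p * α] := by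
  obtain ⟨b, c, d, hd, h⟩ := mem_orbit_of_t13max ha
  have hp0 : (p : ℤ_[p]) ≠ 0 := by exact_mod_cast (Fact.out : p.Prime).ne_zero
  have h3 := isUnit_three hp3
  obtain ⟨w, hw⟩ := isUnit_three hp3
  obtain ⟨t, ht⟩ : ∃ t : ℤ_[p], b = 3 * t := ⟨((w⁻¹ : ℤ_[p]ˣ) : ℤ_[p]) * b, by rw [← hw, Units.mul_inv_cancel_left]⟩
  subst ht
  set c' := c - 3 * p * t ^ 2 with hc'
  set d' := d - p * t * c + 2 * p ^ 2 * t ^ 3 with hd'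
  have hdu : IsUnit d' := isUnit_of_dvd_sub p ⟨-t * c + 2 * p * t ^ 3, by rw [hd']; ring⟩ hd
  have hstep : (![1, p * 0, p * c', p * d'] : Form ℤ_[p]) ∈ orbit ![1, p * (3 * t), p * c, p * d] := by
    refine mem_orbit_of_subst 1 0 (-(p * t)) 1 (by simp) ?_
    funext i
    fin_cases i <;> simp [subst, hc', hd'] <;> ring
  have h9 : IsUnit (-(9 * d')) := by
    have := ((h3.pow 2).mul hdu).neg
    norm_num at this
    simpa using this
  -- The root is chosen congruent to B = -9d', so that s + B ≡ 2B is a unit.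
  obtain ⟨s, hs, hs2, hsB⟩ := exists_sqrt p hp2 (u := (-(9 * d')) ^ 2 - 4 * (-(3 * c')) * (p * c' ^ 2))
    h9 ⟨12 * c' ^ 3, by ring⟩
  obtain ⟨z, hz⟩ := hsB
  have hsum : IsUnit (s + -(9 * d')) :=
    isUnit_of_dvd_sub p (y := 2 * -(9 * d')) ⟨z, by linear_combination hz⟩
      ((isUnit_two hp2).mul h9)
  have hdisc : disc (![1, p * 0, p * c', p * d'] : Form ℤ_[p]) ≠ 0 := by
    have : disc (![1, p * 0, p * c', p * d'] : Form ℤ_[p]) =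
        p ^ 2 * (-(3 ^ 3 * d' ^ 2) + p * (-4 * c' ^ 3)) := by simp [disc]; ring
    rw [this]
    refine mul_ne_zero (pow_ne_zero 2 hp0) (IsUnit.ne_zero ?_)
    exact isUnit_of_dvd_sub p ⟨-4 * c' ^ 3, by ring⟩ ((h3.pow 3).mul (hdu.pow 2)).neg
  have hhess : hess (![1, p * 0, p * c', p * d'] : Form ℤ_[p]) =
      (p * -(3 * c'), p * -(9 * d'), p * (p * c' ^ 2)) := by
    simp only [hess, Prod.mk.injEq, Matrix.cons_val_zero, Matrix.cons_val_one, Matrix.cons_val]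
    exact ⟨by ring, by ring, by ring⟩
  obtain ⟨α, hα, h'⟩ := exists_pure_of_hess hdu hdisc hhess hs2
    (((isUnit_two hp2).mul hs).mul hsum)
  exact ⟨α, hα, mem_orbit_trans h (mem_orbit_trans (mem_orbit_symm hstep) h')⟩

theorem mem_t13max {α : ℤ_[p]} (hα : IsUnit α) :
    (![1, 0, 0, p * α] : Form ℤ_[p]) ∈ formsOfType p .t13max := by
  simpa using mem_t13max_of (p := p) (b := 0) (c := 0) hα

/-- Comparing the outer coefficients modulo p² shows that the substitution is triangular modulo p
and that β ≡ A³α; then β/α is a cube by Hensel's lemma. -/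
theorem isolated_t13max (hp2 : p ≠ 2) (hp3 : p ≠ 3) {α : ℤ_[p]} (hα : IsUnit α) :
    Isolated p 2 ![1, 0, 0, p * α] := by
  have hp0 : (p : ℤ_[p]) ≠ 0 := by exact_mod_cast (Fact.out : p.Prime).ne_zero
  have hprime : Prime (p : ℤ_[p]) := PadicInt.prime_p
  refine isolated_of_representatives (S := {r | ∃ β : ℤ_[p], IsUnit β ∧ r = ![1, 0, 0, p * β]})
    (fun x hx => ?_) le_rfl (mem_t13max hα) ?_
  · obtain ⟨β, hβ, h⟩ := exists_mem_orbit_of_t13max hp2 hp3 hx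
    exact ⟨_, ⟨β, hβ, rfl⟩, h⟩
  rintro _ ⟨β, hβ, rfl⟩ z hz hzr
  obtain ⟨A, B, C, D, hΔ, hsub⟩ := exists_subst_of_mem_orbit hz
  obtain ⟨z0, hz0⟩ := hzr 0
  obtain ⟨z3, hz3⟩ := hzr 3
  have e0 := congrFun hsub 0
  have e3 := congrFun hsub 3
  simp [subst] at e0 e3 hz0 hz3
  obtain ⟨C, rfl⟩ : (p : ℤ_[p]) ∣ C := hprime.dvd_of_dvd_pow (n := 3)
    ⟨(A * D - B * C) * (β + p * z3) - D ^ 3 * α, by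
      linear_combination e3 + (A * D - B * C) * hz3⟩
  have hAD : IsUnit (A * D) := isUnit_of_dvd_sub p ⟨B * C, by ring⟩ hΔ
  have hA := isUnit_of_mul_isUnit_left hAD
  have hD := isUnit_of_mul_isUnit_right hAD
  have h1 : (p : ℤ_[p]) ∣ A ^ 2 - D := by
    refine hA.dvd_mul_left.1 ⟨-B * C + (A * D - B * (p * C)) * p * z0 - B ^ 3 * α, ?_⟩
    linear_combination e0 + (A * D - B * (p * C)) * hz0
  have h2 : (p : ℤ_[p]) ∣ A * β - D ^ 2 * α := by
    refine hD.dvd_mul_left.1 ⟨B * C * β - (A * D - B * (p * C)) * z3 + p * C ^ 3, ?_⟩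
    apply mul_left_cancel₀ hp0
    linear_combination -e3 - (A * D - B * (p * C)) * hz3
  have h3 : (p : ℤ_[p]) ∣ β - A ^ 3 * α := by
    refine hA.dvd_mul_left.1 ?_
    have := dvd_sub h2 (h1.mul_right (α * (A ^ 2 + D)))
    rwa [show A * β - D ^ 2 * α - (A ^ 2 - D) * (α * (A ^ 2 + D)) = A * (β - A ^ 3 * α) by ring]
      at this
  obtain ⟨α, rfl⟩ := hα
  obtain ⟨w, hw⟩ := h3
  obtain ⟨t, ht, ht2⟩ := exists_cbrt p hp3 (u := β * (α⁻¹ : ℤ_[p]ˣ)) hA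
    ⟨w * (α⁻¹ : ℤ_[p]ˣ), by linear_combination (α⁻¹ : ℤ_[p]ˣ) * hw + A ^ 3 * α.mul_inv⟩
  have h4 : t ^ 3 * (p * α) = p * β := by
    rw [ht2]; linear_combination p * β * α.mul_inv
  rw [← h4]
  exact diagonal_cube_mem_orbit ht

theorem three_cases {α : ℤ_[3]} (hα : IsUnit α) : (3 : ℤ_[3]) ∣ α - 1 ∨ (3 : ℤ_[3]) ∣ α + 1 := by
  have h := toZMod_ne_zero_of_isUnit hα
  have h2 : ∀ x : ZMod 3, x ≠ 0 → x = 1 ∨ x = -1 := by decide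
  rcases h2 _ h with h | h
  · left
    rw [← map_one (PadicInt.toZMod (p := 3)), toZMod_eq_iff] at h
    exact_mod_cast h
  · right
    rw [← map_one (PadicInt.toZMod (p := 3)), ← map_neg, toZMod_eq_iff, sub_neg_eq_add] at h
    exact_mod_cast h

theorem mem_orbit_of_t121max_three {a : Form ℤ_[3]} (ha : a ∈ formsOfType 3 .t121max) :
    a ∈ orbit ![0, 1, 0, 3] ∨ a ∈ orbit ![0, 1, 0, -3] := by
  obtain ⟨α, hα, h⟩ := mem_orbit_of_t121max (by norm_num) ha
  rcases three_cases hα with h1 | h1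
  · left
    obtain ⟨t, ht, ht2, -⟩ := exists_sqrt 3 (by norm_num) (u := α) (s := 1) isUnit_one
      (by simpa using h1)
    have := quadratic_scale_mem_orbit (α := 3) ht
    rw [ht2, mul_comm] at this
    exact mem_orbit_trans h (by exact_mod_cast this)
  · right
    obtain ⟨w, hw⟩ := h1
    obtain ⟨t, ht, ht2, -⟩ := exists_sqrt 3 (by norm_num) (u := -α) (s := 1) isUnit_one
      ⟨-w, by push_cast; linear_combination -hw⟩
    have := quadratic_scale_mem_orbit (α := -3) ht
    rw [ht2, neg_mul_neg, mul_comm] at this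
    exact mem_orbit_trans h (by exact_mod_cast this)

/-- The discriminants are -12 and 12, and the action changes them by unit squares; but -1 is not a
square modulo 3. -/
theorem disjoint_t121max_three :
    Disjoint (orbit (![0, 1, 0, 3] : Form ℤ_[3])) (orbit ![0, 1, 0, -3]) := by
  rw [Set.disjoint_left]
  intro x h1 h2
  obtain ⟨Δ, hΔ, e1⟩ := exists_disc_eq h1
  obtain ⟨Δ', hΔ', e2⟩ := exists_disc_eq h2
  rw [e1] at e2
  simp [disc] at e2
  have h3 : Δ ^ 2 + Δ' ^ 2 = 0 := by
    have h12 : (12 : ℤ_[3]) ≠ 0 := by norm_num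
    apply mul_left_cancel₀ h12
    linear_combination -e2
  have h4 := congrArg (PadicInt.toZMod (p := 3)) h3
  rw [map_add, map_pow, map_pow, map_zero] at h4
  have : ∀ x y : ZMod 3, x ≠ 0 → y ≠ 0 → x ^ 2 + y ^ 2 ≠ 0 := by decide
  exact this _ _ (toZMod_ne_zero_of_isUnit hΔ) (toZMod_ne_zero_of_isUnit hΔ') h4

end Ramified

end BinaryCubic

namespace BinaryCubic

/-! ### Totally ramified forms over ℤ₃: normal forms. -/

section WildClassification

theorem isUnit_of_three_dvd_sub {x y : ℤ_[3]} (h : (3 : ℤ_[3]) ∣ x - y) (hy : IsUnit y) :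
    IsUnit x :=
  isUnit_of_dvd_sub 3 (by exact_mod_cast h) hy

/-- Forms over `ℤ_3` with all coefficients but the first divisible by `3`. -/
def tailLattice : Submodule ℤ_[3] (Form ℤ_[3]) where
  carrier := {b | ∃ b₀ b₁ b₂ b₃, b = ![b₀, 3 * b₁, 3 * b₂, 3 * b₃]}
  zero_mem' := ⟨0, 0, 0, 0, by funext i; fin_cases i <;> simp⟩
  add_mem' := by
    rintro _ _ ⟨a₀, a₁, a₂, a₃, rfl⟩ ⟨b₀, b₁, b₂, b₃, rfl⟩
    exact ⟨a₀ + b₀, a₁ + b₁, a₂ + b₂, a₃ + b₃, by funext i; fin_cases i <;> simp <;> ring⟩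
  smul_mem' := by
    rintro c _ ⟨b₀, b₁, b₂, b₃, rfl⟩
    exact ⟨c * b₀, c * b₁, c * b₂, c * b₃, by funext i; fin_cases i <;> simp <;> ring⟩

theorem tangentRem_tail (x b c d η q r s t : ℤ_[3]) :
    tangentRem ![x, 3 * b, 3 * c, 3 * d] (3 * η) q r s t =
      ![tangentRem ![x, 3 * b, 3 * c, 3 * d] (3 * η) q r s t 0,
        3 * (2 * q * s * x + (q ^ 2 + 2 * q * t + 2 * r * s) * b + (2 * q * r + 2 * r * t) * c +
          3 * r ^ 2 * d - (q * t - r * s) * b +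
          η * (3 * q ^ 2 * s * x + (q ^ 2 * t + 2 * q * r * s) * (3 * b) +
            (r ^ 2 * s + 2 * q * r * t) * (3 * c) + 3 * r ^ 2 * t * (3 * d))),
        3 * (6 * t * r * d + (t ^ 2 + 2 * q * t + 2 * r * s) * c + (2 * t * s + 2 * s * q) * b +
          s ^ 2 * x - (q * t - r * s) * c +
          η * (3 * t ^ 2 * r * (3 * d) + (t ^ 2 * q + 2 * t * r * s) * (3 * c) +
            (s ^ 2 * r + 2 * t * s * q) * (3 * b) + 3 * s ^ 2 * q * x)),
        3 * (3 * t ^ 2 * d + 2 * t * s * c + s ^ 2 * b - (q * t - r * s) * d +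
          η * (t ^ 3 * (3 * d) + t ^ 2 * s * (3 * c) + t * s ^ 2 * (3 * b) + s ^ 3 * x))] := by
  funext i
  fin_cases i <;> simp [tangentRem] <;> ring

theorem mem_orbit_of_congr_tail {b c d : ℤ_[3]} (hc : IsUnit c) {x : Form ℤ_[3]}
    (hx : ∃ b₀ b₁ b₂ b₃, x = ![1 + 3 * b₀, 3 * (b + 3 * b₁), 3 * (c + 3 * b₂), 3 * (d + 3 * b₃)]) :
    x ∈ orbit ![1, 3 * b, 3 * c, 3 * d] := by
  refine mem_orbit_of_tangent 3 tailLattice ?_ ?_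
  · rintro _ ⟨_, ⟨z₀, z₁, z₂, z₃, rfl⟩, rfl⟩ _ ⟨β₀, β₁, β₂, β₃, rfl⟩
    have hC : IsUnit (c + 3 * z₂) := isUnit_of_three_dvd_sub ⟨z₂, by ring⟩ hc
    obtain ⟨u, hu⟩ := isUnit_iff_exists_inv.1 hC
    -- The equations are solved modulo 3 in triangular order: t = -q - β₀ from the first
    -- coefficient, then s from the fourth, q from the third and r from the second, dividing by the
    -- unit c.
    obtain ⟨s, hs⟩ : ∃ s, s = u * (β₃ - (d + 3 * z₃) * β₀) := ⟨_, rfl⟩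
    obtain ⟨q, hq⟩ : ∃ q, q = u * (2 * (b + 3 * z₁) * s - β₂) - β₀ := ⟨_, rfl⟩
    obtain ⟨r, hr⟩ : ∃ r, r = -u * (β₁ - (b + 3 * z₁) * q - s) := ⟨_, rfl⟩
    refine ⟨q, r, s, -q - β₀, ⟨![q + 2 * z₀ * q + (b + 3 * z₁) * r + z₀ * (q + β₀),
      3 * (-β₁ + (b + 3 * z₁) * q + s + z₀ * s), 3 * ((d + 3 * z₃) * r),
      3 * (-(d + 3 * z₃) * (q + β₀))], ⟨_, _, _, _, rfl⟩, ?_⟩, fun k => ?_⟩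
    · funext i
      fin_cases i <;> simp [tangent]
      · ring
      · linear_combination 6 * (c + 3 * z₂) * hr - 6 * (β₁ - (b + 3 * z₁) * q - s) * hu
      · linear_combination -3 * (c + 3 * z₂) * hq - 3 * (2 * (b + 3 * z₁) * s - β₂) * hu
      · linear_combination 3 * (c + 3 * z₂) * hs + 3 * (β₃ - (d + 3 * z₃) * β₀) * hu
    · generalize -q - β₀ = t
      refine ⟨_, _, _, _, Eq.trans ?_ (tangentRem_tail (1 + 3 * z₀) (b + 3 * z₁) (c + 3 * z₂) (d + 3 * z₃) (3 ^ k)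
        q r s t)⟩
      congr 1
      · funext i
        fin_cases i <;> simp <;> ring
      · push_cast; ring
  · obtain ⟨b₀, b₁, b₂, b₃, rfl⟩ := hx
    refine ⟨_, ⟨b₀, b₁, b₂, b₃, rfl⟩, ?_⟩
    funext i
    fin_cases i <;> simp <;> ring

/-- The lattice of directions in which the forms `(1, 3b, 0, 3d)` can be moved. -/
def monicLattice : Submodule ℤ_[3] (Form ℤ_[3]) where
  carrier := {b | ∃ b₀ b₁ b₂ b₃, b = ![b₀, 3 * b₁, 9 * b₂, 3 * (b₀ + 3 * b₃)]}
  zero_mem' := ⟨0, 0, 0, 0, by funext i; fin_cases i <;> simp⟩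
  add_mem' := by
    rintro _ _ ⟨a₀, a₁, a₂, a₃, rfl⟩ ⟨b₀, b₁, b₂, b₃, rfl⟩
    exact ⟨a₀ + b₀, a₁ + b₁, a₂ + b₂, a₃ + b₃, by funext i; fin_cases i <;> simp <;> ring⟩
  smul_mem' := by
    rintro c _ ⟨b₀, b₁, b₂, b₃, rfl⟩
    exact ⟨c * b₀, c * b₁, c * b₂, c * b₃, by funext i; fin_cases i <;> simp <;> ring⟩

theorem tangentRem_monic_mem (x b c d η q r s t : ℤ_[3]) :
    tangentRem ![1 + 3 * x, 3 * b, 9 * c, 3 * (1 + 3 * d)] (3 * η) q r (3 * s) t ∈ monicLattice := by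
  refine ⟨tangentRem ![1 + 3 * x, 3 * b, 9 * c, 3 * (1 + 3 * d)] (3 * η) q r (3 * s) t 0,
    2 * q * (3 * s) * (1 + 3 * x) + (q ^ 2 + 2 * q * t + 2 * r * (3 * s)) * b +
      (2 * q * r + 2 * r * t) * (3 * c) + 3 * r ^ 2 * (1 + 3 * d) - (q * t - r * (3 * s)) * b +
      η * (3 * q ^ 2 * (3 * s) * (1 + 3 * x) + (q ^ 2 * t + 2 * q * r * (3 * s)) * (3 * b) +
        (r ^ 2 * (3 * s) + 2 * q * r * t) * (9 * c) + 3 * r ^ 2 * t * (3 * (1 + 3 * d))),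
    2 * t * r * (1 + 3 * d) + (t ^ 2 + 2 * q * t + 2 * r * (3 * s)) * c +
      (2 * t * s + 2 * s * q) * b + 3 * s ^ 2 * (1 + 3 * x) - (q * t - r * (3 * s)) * c +
      η * (3 * t ^ 2 * r * (1 + 3 * d) + (t ^ 2 * q + 2 * t * r * (3 * s)) * (3 * c) +
        (3 * s ^ 2 * r + 2 * t * s * q) * (3 * b) + 9 * s ^ 2 * q * (1 + 3 * x)),
    t ^ 2 * (1 + 3 * d) + 6 * t * s * c + 3 * s ^ 2 * b + r * s * (1 + 3 * d) - q * t * d +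
      η * (t ^ 3 * (1 + 3 * d) + t ^ 2 * s * (9 * c) + 9 * t * s ^ 2 * b + 9 * s ^ 3 * (1 + 3 * x)) -
      (q ^ 2 * (1 + 3 * x) + 2 * q * r * b + 3 * r ^ 2 * c - q * t * x + r * s * (1 + 3 * x) +
        η * (q ^ 3 * (1 + 3 * x) + q ^ 2 * r * (3 * b) + q * r ^ 2 * (9 * c) +
          r ^ 3 * (3 * (1 + 3 * d)))), ?_⟩
  funext i
  fin_cases i <;> simp [tangentRem] <;> ring

theorem mem_orbit_of_congr_monic {b d : ℤ_[3]} (hb : IsUnit b) {x : Form ℤ_[3]}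
    (hx : ∃ b₀ b₁ b₂ b₃, x = ![1 + 3 * b₀, 3 * (b + 3 * b₁), 27 * b₂,
      3 * (1 + 3 * d + 3 * (b₀ + 3 * b₃))]) :
    x ∈ orbit ![1, 3 * b, 0, 3 * (1 + 3 * d)] := by
  refine mem_orbit_of_tangent 3 monicLattice ?_ ?_
  · rintro _ ⟨_, ⟨z₀, z₁, z₂, z₃, rfl⟩, rfl⟩ _ ⟨β₀, β₁, β₂, β₃, rfl⟩
    have hB : IsUnit (b + 3 * z₁) := isUnit_of_three_dvd_sub ⟨z₁, by ring⟩ hb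
    set B := b + 3 * z₁ with hBdef
    set D := d + z₀ + 3 * z₃ with hD
    obtain ⟨u, hu⟩ := isUnit_iff_exists_inv.1 hB
    -- Here the second coefficient determines q, the fourth r, and the third s, dividing by the unit
    -- B. The lower left entry of the direction is 3s, which keeps the remainder inside the lattice.
    obtain ⟨q, hq⟩ : ∃ q, q = u * β₁ := ⟨_, rfl⟩
    obtain ⟨r, hr⟩ : ∃ r, r = u * (-(1 + D + 2 * z₀) * q - (1 + 2 * D + z₀) * (q + β₀) - β₃) :=
      ⟨_, rfl⟩
    obtain ⟨s, hs⟩ : ∃ s, s = -u * (β₂ - (1 + 3 * D) * r) := ⟨_, rfl⟩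
    refine ⟨q, r, 3 * s, -q - β₀, ?_, fun k => ?_⟩
    · refine ⟨_, ⟨q + 3 * z₀ * q + B * r + z₀ * β₀, 6 * z₂ * r + (1 + 3 * z₀) * s,
        (1 + 3 * D) * r - β₂ - z₂ * (q + β₀), 3 * z₂ * s, rfl⟩, ?_⟩
      have hBq : B * q = β₁ := by linear_combination B * hq + β₁ * hu
      have hBr : B * r = -(1 + D + 2 * z₀) * q - (1 + 2 * D + z₀) * (q + β₀) - β₃ := by
        linear_combination B * hr +
          (-(1 + D + 2 * z₀) * q - (1 + 2 * D + z₀) * (q + β₀) - β₃) * hu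
      have hBs : B * s = -(β₂ - (1 + 3 * D) * r) := by
        linear_combination B * hs - (β₂ - (1 + 3 * D) * r) * hu
      funext i
      fin_cases i <;> simp [tangent]
      · ring
      · linear_combination 3 * hBq
      · linear_combination 18 * hBs
      · linear_combination -9 * hBr
    · have := tangentRem_monic_mem z₀ B (3 * z₂) D (3 ^ k) q r s (-q - β₀)
      convert this using 2
      · funext i
        fin_cases i <;> simp [hBdef, hD] <;> ring
      · push_cast; ring
  · obtain ⟨b₀, b₁, b₂, b₃, rfl⟩ := hx
    refine ⟨_, ⟨b₀, b₁, b₂, b₃, rfl⟩, ?_⟩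
    funext i
    fin_cases i <;> simp <;> ring

theorem scale_mem_orbit {R : Type*} [CommRing R] {t b c d : R} (ht : IsUnit t) :
    ![1, t * b, t ^ 2 * c, t ^ 3 * d] ∈ orbit ![1, b, c, d] := by
  refine mem_orbit_of_subst t 0 0 (t ^ 2) (by simpa using ht.mul (ht.pow 2)) ?_
  funext i
  fin_cases i <;> simp [subst] <;> ring

/-- As c is a unit, v ↦ v + (b/c)u makes the quadratic coefficient divisible by 9; after that only c
modulo 3 matters. -/
theorem mem_orbit_of_linear_unit {b c d : ℤ_[3]} (hc : IsUnit c) (hd : (3 : ℤ_[3]) ∣ d - 1) :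
    (![1, 3 * b, 3 * c, 3 * d] : Form ℤ_[3]) ∈ orbit ![1, 0, 3, 3] ∨
      (![1, 3 * b, 3 * c, 3 * d] : Form ℤ_[3]) ∈ orbit ![1, 0, 6, 3] := by
  obtain ⟨u, hu⟩ := isUnit_iff_exists_inv.1 hc
  obtain ⟨w, hw⟩ := hd
  have hstep : (![1 + 3 * (b * (u * b) + c * (u * b) ^ 2 + d * (u * b) ^ 3),
      3 * (0 + 3 * (b + d * (u * b) ^ 2)), 3 * (c + 3 * (u * b) * d), 3 * d] : Form ℤ_[3]) ∈
      orbit ![1, 3 * b, 3 * c, 3 * d] := by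
    refine mem_orbit_of_subst 1 (u * b) 0 1 (by simp) ?_
    funext i
    fin_cases i <;> simp [subst]
    · ring
    · linear_combination 6 * b * hu
    · ring
  have key : ∀ C : ℤ_[3], (3 : ℤ_[3]) ∣ c - C → IsUnit C →
      (![1, 3 * b, 3 * c, 3 * d] : Form ℤ_[3]) ∈ orbit ![1, 3 * 0, 3 * C, 3 * 1] := by
    rintro C ⟨v, hv⟩ hC
    refine mem_orbit_trans (mem_orbit_symm hstep) (mem_orbit_of_congr_tail hC
      ⟨b * (u * b) + c * (u * b) ^ 2 + d * (u * b) ^ 3, b + d * (u * b) ^ 2, v + u * b * d, w, ?_⟩)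
    rw [show d = 1 + 3 * w by linear_combination hw,
      show c + 3 * (u * b) * (1 + 3 * w) = C + 3 * (v + u * b * (1 + 3 * w)) by
        linear_combination hv]
  have h2 : IsUnit (2 : ℤ_[3]) := isUnit_two (by norm_num)
  rcases three_cases hc with h | ⟨v, hv⟩
  · left
    simpa using key 1 h isUnit_one
  · right
    have := key 2 ⟨v - 1, by linear_combination hv⟩ h2
    norm_num at this
    exact this

/-- The translation u ↦ u + 3gv with 3g² + 2bg + c = 0 removes the third coefficient. Scaling by
±b⁻¹ normalizes the second to ±3, the sign being used to get D ≡ 1. -/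
theorem mem_orbit_of_quadratic_unit {b c d : ℤ_[3]} (hb : IsUnit b) (hd : IsUnit d) :
    ∃ ε D : ℤ_[3], (ε = 1 ∨ ε = -1) ∧ (3 : ℤ_[3]) ∣ D - 1 ∧
      (![1, 3 * b, 9 * c, 3 * d] : Form ℤ_[3]) ∈ orbit ![1, 3 * ε, 0, 3 * D] := by
  have h2 : IsUnit (2 : ℤ_[3]) := isUnit_two (by norm_num)
  obtain ⟨u, hu⟩ := isUnit_iff_exists_inv.1 hb
  open Polynomial in
  obtain ⟨g, hg, -⟩ := exists_root_of_simple 3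
    (C 3 * X ^ 2 + C (2 * b) * X + C c : ℤ_[3][X]) (u * c)
    ⟨u ^ 2 * c ^ 2 + c, by simp; linear_combination 2 * c * hu⟩
    (by
      simp
      refine isUnit_of_three_dvd_sub (y := 2 * b) ⟨2 * (u * c), by ring⟩ (h2.mul hb))
  simp only [Polynomial.eval_add, Polynomial.eval_mul, Polynomial.eval_C, Polynomial.eval_X,
    Polynomial.eval_pow] at hg
  have hstep : (![1, 3 * (b + 3 * g), 0, 3 * (d + 3 * (3 * g ^ 3 + 3 * g ^ 2 * b + 3 * g * c))] :
      Form ℤ_[3]) ∈ orbit ![1, 3 * b, 9 * c, 3 * d] := by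
    refine mem_orbit_of_subst 1 0 (3 * g) 1 (by simp) ?_
    funext i
    fin_cases i <;> simp [subst]
    · ring
    · linear_combination 9 * hg
    · ring
  have hB : IsUnit (b + 3 * g) := isUnit_of_three_dvd_sub ⟨g, by ring⟩ hb
  have hD : IsUnit (d + 3 * (3 * g ^ 3 + 3 * g ^ 2 * b + 3 * g * c)) :=
    isUnit_of_three_dvd_sub ⟨3 * g ^ 3 + 3 * g ^ 2 * b + 3 * g * c, by ring⟩ hd
  generalize b + 3 * g = B at *
  generalize d + 3 * (3 * g ^ 3 + 3 * g ^ 2 * b + 3 * g * c) = D at *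
  obtain ⟨U, hU⟩ := isUnit_iff_exists_inv.1 hB
  have hUu : IsUnit U := IsUnit.of_mul_eq_one B (by rw [mul_comm]; exact hU)
  rcases three_cases ((hUu.pow 3).mul hD) with h | ⟨w, hw⟩
  · refine ⟨1, U ^ 3 * D, Or.inl rfl, h, mem_orbit_trans (mem_orbit_symm hstep) (mem_orbit_symm ?_)⟩
    have := scale_mem_orbit (b := 3 * B) (c := 0) (d := 3 * D) hUu
    rwa [show U * (3 * B) = 3 * 1 by linear_combination 3 * hU, mul_zero,
      mul_left_comm] at this
  · refine ⟨-1, -(U ^ 3 * D), Or.inr rfl, ⟨-w, by linear_combination -hw⟩,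
      mem_orbit_trans (mem_orbit_symm hstep) (mem_orbit_symm ?_)⟩
    have := scale_mem_orbit (b := 3 * B) (c := 0) (d := 3 * D) hUu.neg
    rwa [show -U * (3 * B) = 3 * -1 by linear_combination -3 * hU, mul_zero,
      show (-U) ^ 3 * (3 * D) = 3 * -(U ^ 3 * D) by ring] at this

theorem nine_cases {d : ℤ_[3]} (hd : (3 : ℤ_[3]) ∣ d - 1) :
    (9 : ℤ_[3]) ∣ d - 1 ∨ (9 : ℤ_[3]) ∣ d - 4 ∨ (9 : ℤ_[3]) ∣ d - 7 := by
  obtain ⟨w, hw⟩ := hd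
  have h3 : ∀ x : ZMod 3, x = 0 ∨ x = 1 ∨ x = 2 := by decide
  have key : ∀ n : ℕ, PadicInt.toZMod w = (n : ZMod 3) → (3 : ℤ_[3]) ∣ w - n := by
    intro n hn
    rw [← map_natCast (PadicInt.toZMod (p := 3)), toZMod_eq_iff] at hn
    exact_mod_cast hn
  rcases h3 (PadicInt.toZMod w) with h | h | h
  · obtain ⟨v, hv⟩ := key 0 (by simpa using h)
    exact Or.inl ⟨v, by push_cast at hv; linear_combination hw + 3 * hv⟩
  · obtain ⟨v, hv⟩ := key 1 (by simpa using h)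
    exact Or.inr (Or.inl ⟨v, by push_cast at hv; linear_combination hw + 3 * hv⟩)
  · obtain ⟨v, hv⟩ := key 2 (by simpa using h)
    exact Or.inr (Or.inr ⟨v, by push_cast at hv; linear_combination hw + 3 * hv⟩)

/-- Two monic forms with the same quadratic coefficient are equivalent if their constant
coefficients agree to sufficient precision. -/
theorem mem_orbit_of_dvd_sub {b d D : ℤ_[3]} (hb : IsUnit b) (hD : (3 : ℤ_[3]) ∣ D - 1)
    (h : (9 : ℤ_[3]) ∣ d - D) :
    (![1, 3 * b, 0, 3 * d] : Form ℤ_[3]) ∈ orbit ![1, 3 * b, 0, 3 * D] := by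
  obtain ⟨w, hw⟩ := h
  obtain ⟨v, hv⟩ := hD
  obtain rfl : D = 1 + 3 * v := by linear_combination hv
  refine mem_orbit_of_congr_monic hb ⟨0, 0, 0, w, ?_⟩
  rw [show d = 1 + 3 * v + 9 * w by linear_combination hw]
  funext i
  fin_cases i <;> simp
  ring

/-- The Hessian is 27 times a form of discriminant congruent to d² modulo 3, hence it splits. -/
theorem exists_mem_orbit_of_pure {b c d : ℤ_[3]} (hd : IsUnit d) :
    ∃ α, IsUnit α ∧ (![1, 9 * b, 9 * c, 3 * d] : Form ℤ_[3]) ∈ orbit ![1, 0, 0, 3 * α] := by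
  have h2 : IsUnit (2 : ℤ_[3]) := isUnit_two (by norm_num)
  have hB : IsUnit (3 * b * c - d) :=
    isUnit_of_three_dvd_sub (y := -d) ⟨b * c, by ring⟩ hd.neg
  obtain ⟨s, hs, hs2, z, hz⟩ := exists_sqrt 3 (by norm_num)
    (u := (3 * b * c - d) ^ 2 - 4 * (3 * b ^ 2 - c) * (3 * (c ^ 2 - b * d))) hB
    ⟨-(4 * (3 * b ^ 2 - c) * (c ^ 2 - b * d)), by push_cast; ring⟩
  push_cast at hz
  have hsum : IsUnit (s + (3 * b * c - d)) :=
    isUnit_of_three_dvd_sub (y := 2 * (3 * b * c - d)) ⟨z, by linear_combination hz⟩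
      (h2.mul hB)
  have hform : (![1, 9 * b, 9 * c, 3 * d] : Form ℤ_[3]) =
      ![1, ((3 : ℕ) : ℤ_[3]) * (3 * b), ((3 : ℕ) : ℤ_[3]) * (3 * c), ((3 : ℕ) : ℤ_[3]) * d] := by
    funext i
    fin_cases i <;> simp <;> ring
  have hhess : hess (![1, ((3 : ℕ) : ℤ_[3]) * (3 * b), ((3 : ℕ) : ℤ_[3]) * (3 * c),
      ((3 : ℕ) : ℤ_[3]) * d] : Form ℤ_[3]) = (27 * (3 * b ^ 2 - c), 27 * (3 * b * c - d),
        27 * (((3 : ℕ) : ℤ_[3]) * (c ^ 2 - b * d))) := by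
    simp only [hess, Prod.mk.injEq, Matrix.cons_val_zero, Matrix.cons_val_one, Matrix.cons_val]
    push_cast
    exact ⟨by ring, by ring, by ring⟩
  have hdisc : disc (![1, ((3 : ℕ) : ℤ_[3]) * (3 * b), ((3 : ℕ) : ℤ_[3]) * (3 * c),
      ((3 : ℕ) : ℤ_[3]) * d] : Form ℤ_[3]) ≠ 0 := by
    intro h0
    have h1 := hess_disc (![1, ((3 : ℕ) : ℤ_[3]) * (3 * b), ((3 : ℕ) : ℤ_[3]) * (3 * c),
      ((3 : ℕ) : ℤ_[3]) * d] : Form ℤ_[3])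
    rw [h0, hhess] at h1
    push_cast at h1
    have h27 : (27 : ℤ_[3]) ^ 2 ≠ 0 := by norm_num
    apply mul_ne_zero h27 (pow_ne_zero 2 hs.ne_zero)
    linear_combination h1 + 27 ^ 2 * hs2
  obtain ⟨α, hα, h⟩ := exists_pure_of_hess hd hdisc hhess (s := s)
    (by push_cast; linear_combination hs2) ((h2.mul hs).mul hsum)
  exact ⟨α, hα, by rw [hform]; exact_mod_cast h⟩

theorem mem_orbit_pure_of_dvd_sub {α A : ℤ_[3]} (hA : (3 : ℤ_[3]) ∣ A - 1)
    (h : (9 : ℤ_[3]) ∣ α - A) :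
    (![1, 0, 0, 3 * α] : Form ℤ_[3]) ∈ orbit ![1, 0, 0, 3 * A] := by
  have hAu : IsUnit A := isUnit_of_three_dvd_sub hA isUnit_one
  obtain ⟨u, hu⟩ := isUnit_iff_exists_inv.1 hAu
  obtain ⟨w, hw⟩ := h
  obtain ⟨t, ht, ht3⟩ := exists_cbrt_three (u := α * u) ⟨w * u, by linear_combination u * hw + hu⟩
  have := diagonal_cube_mem_orbit (α := 3 * A) ht
  rwa [ht3, show α * u * (3 * A) = 3 * α by linear_combination 3 * α * hu] at this

end WildClassification

end BinaryCubic

namespace BinaryCubic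

/-! ### The nine totally ramified orbits over ℤ₃. -/

section WildRepresentatives

/-- The form `(1, 3b, 3c, 3d)` over `ℤ_3`. -/
noncomputable def wildForm (t : ℤ × ℤ × ℤ) : Form ℤ_[3] := ![1, 3 * t.1, 3 * t.2.1, 3 * t.2.2]

/-- Coefficients `(b, c, d)` of representatives `(1, 3b, 3c, 3d)` for the totally ramified maximal
forms over `ℤ_3`. -/
def wildIndices : Finset (ℤ × ℤ × ℤ) :=
  {(0, 1, 1), (0, 2, 1), (1, 0, 1), (-1, 0, 1), (-1, 0, 4), (-1, 0, 7), (0, 0, 1), (0, 0, 4),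
    (0, 0, 7)}

theorem sign_mem_orbit {b c d : ℤ_[3]} :
    (![1, 3 * b, 3 * c, 3 * d] : Form ℤ_[3]) ∈ orbit ![1, 3 * -b, 3 * c, 3 * -d] := by
  have := scale_mem_orbit (t := (-1 : ℤ_[3])) (b := 3 * -b) (c := 3 * c) (d := 3 * -d) (by simp)
  convert this using 1
  funext i
  fin_cases i <;> simp <;> ring

theorem int_mem_orbit_of_subst {x y : Form ℤ_[3]} (α β γ δ : ℤ) (h : α * δ - β * γ = 1)
    (hx : subst (α : ℤ_[3]) β γ δ y = x) : x ∈ orbit y := by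
  have h' : (α : ℤ_[3]) * δ - β * γ = 1 := by exact_mod_cast h
  refine mem_orbit_of_subst α β γ δ (by rw [h']; exact isUnit_one) ?_
  rw [hx, h']
  simp

/-- Three cases: c a unit; c divisible by 3 and b a unit; both divisible by 3. In the second case
the sign b ≡ 1 gives a single orbit, since the candidates D ≡ 1, 4, 7 modulo 9 fall together,
whereas b ≡ -1 keeps them apart. -/
theorem exists_wildForm {b c d : ℤ_[3]} (hd : (3 : ℤ_[3]) ∣ d - 1) :
    ∃ t ∈ wildIndices, (![1, 3 * b, 3 * c, 3 * d] : Form ℤ_[3]) ∈ orbit (wildForm t) := by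
  have hdu : IsUnit d := isUnit_of_three_dvd_sub hd isUnit_one
  by_cases hc : IsUnit c
  · rcases mem_orbit_of_linear_unit (b := b) hc hd with h | h
    · exact ⟨(0, 1, 1), by decide, by simpa [wildForm] using h⟩
    · exact ⟨(0, 2, 1), by decide, by simp only [wildForm]; norm_num; exact h⟩
  obtain ⟨c, rfl⟩ : (3 : ℤ_[3]) ∣ c := by
    rw [isUnit_iff_not_dvd, not_not] at hc
    exact_mod_cast hc
  by_cases hb : IsUnit b
  · obtain ⟨ε, D, hε, hD, h⟩ := mem_orbit_of_quadratic_unit (c := c) hb hdu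
    rw [show (9 : ℤ_[3]) * c = 3 * (3 * c) by ring] at h
    rcases hε with rfl | rfl
    · refine ⟨(1, 0, 1), by decide, mem_orbit_trans h ?_⟩
      have e1 : (wildForm (1, 0, 1)) = ![1, 3 * 1, 0, 3 * 1] := by simp [wildForm]
      rw [e1]
      rcases nine_cases hD with h9 | h9 | h9
      · exact mem_orbit_of_dvd_sub isUnit_one (by simp) h9
      -- The integral substitution takes (1, 3, 0, 3) to a form which `mem_orbit_of_congr_monic`
      -- places in the orbit of (1, 3, 0, 12). The next case reaches (1, 3, 0, 21) in the same way.
      · refine mem_orbit_trans (mem_orbit_of_dvd_sub isUnit_one ⟨1, by norm_num⟩ h9)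
          (mem_orbit_symm (mem_orbit_trans (b := ![7, -42, 81, -51]) (mem_orbit_symm ?_) ?_))
        · exact int_mem_orbit_of_subst (-2) 1 3 (-2) (by norm_num)
            (by funext i; fin_cases i <;> simp [subst] <;> norm_num)
        · have := mem_orbit_of_congr_monic (b := 1) (d := 1) (x := ![7, -42, 81, -51]) isUnit_one
            ⟨2, -5, 3, -3, by funext i; fin_cases i <;> simp <;> norm_num⟩
          convert this using 2
          norm_num
      · refine mem_orbit_trans (mem_orbit_of_dvd_sub isUnit_one ⟨2, by norm_num⟩ h9)
          (mem_orbit_symm (mem_orbit_trans (b := ![-23, -114, -189, -105]) (mem_orbit_symm ?_) ?_))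
        · exact int_mem_orbit_of_subst (-2) (-1) (-3) (-2) (by norm_num)
            (by funext i; fin_cases i <;> simp [subst] <;> norm_num)
        · have := mem_orbit_of_congr_monic (b := 1) (d := 2) (x := ![-23, -114, -189, -105])
            isUnit_one ⟨-8, -13, -7, -2, by funext i; fin_cases i <;> simp <;> norm_num⟩
          convert this using 2
          norm_num
    · have key : ∀ n : ℤ, (-1, 0, n) ∈ wildIndices → (3 : ℤ_[3]) ∣ n - 1 → (9 : ℤ_[3]) ∣ D - n →
          ∃ t ∈ wildIndices, (![1, 3 * b, 3 * (3 * c), 3 * d] : Form ℤ_[3]) ∈ orbit (wildForm t) := by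
        intro n hn h3 h9
        refine ⟨_, hn, mem_orbit_trans h ?_⟩
        have := mem_orbit_of_dvd_sub (b := -1) (by simp) h3 h9
        simpa [wildForm] using this
      rcases nine_cases hD with h9 | h9 | h9
      · exact key 1 (by decide) (by simp) (by simpa using h9)
      · exact key 4 (by decide) ⟨1, by norm_num⟩ (by simpa using h9)
      · exact key 7 (by decide) ⟨2, by norm_num⟩ (by simpa using h9)
  · obtain ⟨b, rfl⟩ : (3 : ℤ_[3]) ∣ b := by
      rw [isUnit_iff_not_dvd, not_not] at hb
      exact_mod_cast hb
    obtain ⟨α, hα, h⟩ := exists_mem_orbit_of_pure (b := b) (c := c) hdu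
    obtain ⟨A, hA, h'⟩ : ∃ A : ℤ_[3], (3 : ℤ_[3]) ∣ A - 1 ∧
        (![1, 9 * b, 9 * c, 3 * d] : Form ℤ_[3]) ∈ orbit ![1, 0, 0, 3 * A] := by
      rcases three_cases hα with h1 | ⟨w, hw⟩
      · exact ⟨α, h1, h⟩
      · refine ⟨-α, ⟨-w, by linear_combination -hw⟩, mem_orbit_trans h ?_⟩
        have := sign_mem_orbit (b := 0) (c := 0) (d := α)
        simpa using this
    have key : ∀ n : ℤ, (0, 0, n) ∈ wildIndices → (3 : ℤ_[3]) ∣ n - 1 → (9 : ℤ_[3]) ∣ A - n →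
        ∃ t ∈ wildIndices,
          (![1, 3 * (3 * b), 3 * (3 * c), 3 * d] : Form ℤ_[3]) ∈ orbit (wildForm t) := by
      intro n hn h3 h9
      refine ⟨_, hn, ?_⟩
      have := mem_orbit_trans h' (mem_orbit_pure_of_dvd_sub h3 h9)
      rw [← mul_assoc, ← mul_assoc]
      norm_num
      simpa [wildForm] using this
    rcases nine_cases hA with h9 | h9 | h9
    · exact key 1 (by decide) (by simp) (by simpa using h9)
    · exact key 4 (by decide) ⟨1, by norm_num⟩ (by simpa using h9)
    · exact key 7 (by decide) ⟨2, by norm_num⟩ (by simpa using h9)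

theorem exists_mem_orbit_wildForm {a : Form ℤ_[3]} (ha : a ∈ formsOfType 3 .t13max) :
    ∃ t ∈ wildIndices, a ∈ orbit (wildForm t) := by
  obtain ⟨b, c, d, hd, h⟩ := mem_orbit_of_t13max ha
  push_cast at h
  rcases three_cases hd with h1 | ⟨w, hw⟩
  · obtain ⟨t, ht, h'⟩ := exists_wildForm (b := b) (c := c) h1
    exact ⟨t, ht, mem_orbit_trans h h'⟩
  · obtain ⟨t, ht, h'⟩ := exists_wildForm (b := -b) (c := c) (d := -d)
      ⟨-w, by linear_combination -hw⟩
    exact ⟨t, ht, mem_orbit_trans h (mem_orbit_trans sign_mem_orbit h')⟩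

theorem wildForm_mem {t : ℤ × ℤ × ℤ} (ht : t ∈ wildIndices) :
    wildForm t ∈ formsOfType 3 .t13max := by
  have hd : ∀ t ∈ wildIndices, ¬ (3 : ℤ) ∣ t.2.2 := by decide
  have hu : IsUnit ((t.2.2 : ℤ) : ℤ_[3]) := by
    rw [isUnit_intCast_iff]
    exact_mod_cast hd t ht
  have := mem_t13max_of (p := 3) (b := t.1) (c := t.2.1) hu
  simpa [wildForm] using this

/-- A substitution relating the two forms modulo 27 is upper triangular and unipotent modulo 3.
Hence c modulo 3, and then b modulo 3, are unchanged, and d modulo 9 can move only through the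
determinant Δ and δ³, both of which are 1 modulo 9 in the cases considered. -/
theorem wildForm_invariants {b c d b' c' d' : ℤ_[3]} (hd : (3 : ℤ_[3]) ∣ d - 1)
    (hd' : (3 : ℤ_[3]) ∣ d' - 1) {z : Form ℤ_[3]} (hz : z ∈ orbit ![1, 3 * b, 3 * c, 3 * d])
    (h : ∀ i, (27 : ℤ_[3]) ∣ z i - (![1, 3 * b', 3 * c', 3 * d'] : Form ℤ_[3]) i) :
    (3 : ℤ_[3]) ∣ c' - c ∧ (c = 0 → c' = 0 → (3 : ℤ_[3]) ∣ b' - b ∧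
      ((b = 0 ∧ b' = 0) ∨ (b = -1 ∧ b' = -1) → (9 : ℤ_[3]) ∣ d' - d)) := by
  have h3 : (3 : ℤ_[3]) ≠ 0 := by norm_num
  have hprime : Prime (3 : ℤ_[3]) := by exact_mod_cast (PadicInt.prime_p (p := 3))
  obtain ⟨α, β, γ, δ, hΔ, hsub⟩ := exists_subst_of_mem_orbit hz
  obtain ⟨w₀, hw₀⟩ := h 0
  obtain ⟨w₁, hw₁⟩ := h 1
  obtain ⟨w₂, hw₂⟩ := h 2
  obtain ⟨w₃, hw₃⟩ := h 3
  have e0 := congrFun hsub 0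
  have e1 := congrFun hsub 1
  have e2 := congrFun hsub 2
  have e3 := congrFun hsub 3
  simp only [subst, Matrix.cons_val_zero, Matrix.cons_val_one, Matrix.cons_val, mul_one] at e0 e1 e2 e3 hw₀ hw₁ hw₂ hw₃
  rw [sub_eq_iff_eq_add] at hw₀ hw₁ hw₂ hw₃
  rw [hw₀] at e0
  rw [hw₁] at e1
  rw [hw₂] at e2
  rw [hw₃] at e3
  obtain ⟨γ, rfl⟩ : (3 : ℤ_[3]) ∣ γ := hprime.dvd_of_dvd_pow (n := 3)
    ⟨(α * δ - β * γ) * (9 * w₃ + d') - (γ ^ 2 * δ * b + γ * δ ^ 2 * c + δ ^ 3 * d), by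
      linear_combination e3⟩
  set Δ := α * δ - β * (3 * γ) with hΔdef
  have f1 : 3 * α ^ 2 * γ + (α ^ 2 * δ + 6 * α * β * γ) * b + (3 * β ^ 2 * γ + 2 * α * β * δ) * c +
      3 * β ^ 2 * δ * d = Δ * (9 * w₁ + b') := by
    apply mul_left_cancel₀ h3
    linear_combination e1
  have f2 : 9 * α * γ ^ 2 + (9 * β * γ ^ 2 + 6 * α * γ * δ) * b + (α * δ ^ 2 + 6 * β * γ * δ) * c +
      3 * β * δ ^ 2 * d = Δ * (9 * w₂ + c') := by
    apply mul_left_cancel₀ h3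
    linear_combination e2
  have f3 : 9 * γ ^ 3 + 9 * γ ^ 2 * δ * b + 3 * γ * δ ^ 2 * c + δ ^ 3 * d = Δ * (9 * w₃ + d') := by
    apply mul_left_cancel₀ h3
    linear_combination e3
  set φ := PadicInt.toZMod (p := 3) with hφ
  have hφ3 : φ 3 = 0 := by rw [map_ofNat φ]; decide
  have hφ9 : φ 9 = 0 := by rw [map_ofNat φ]; decide
  have hφ6 : φ 6 = 0 := by rw [map_ofNat φ]; decide
  have hφ27 : φ 27 = 0 := by rw [map_ofNat φ]; decide
  have key : ∀ x y, (3 : ℤ_[3]) ∣ x - y ↔ φ x = φ y := fun x y => by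
    rw [hφ, toZMod_eq_iff]; push_cast; rfl
  have hφd : φ d = 1 := by rw [(key d 1).1 hd, map_one]
  have hφd' : φ d' = 1 := by rw [(key d' 1).1 hd', map_one]
  have hΔφ : φ Δ = φ α * φ δ := by simp [hΔdef, hφ3]
  have hΔ0 : φ α * φ δ ≠ 0 := hΔφ ▸ toZMod_ne_zero_of_isUnit hΔ
  have g0 : φ α ^ 3 = φ α * φ δ := by
    have := congrArg φ e0
    simpa [hφ3, hφ27, hΔφ] using this
  have g3 : φ δ ^ 3 = φ α * φ δ := by
    have := congrArg φ f3
    simpa [hφ3, hφ9, hΔφ, hφd, hφd'] using this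
  -- Comparing first and last coefficients modulo 3 forces both diagonal entries to be 1.
  have hdec : ∀ x y : ZMod 3, x * y ≠ 0 → x ^ 3 = x * y → y ^ 3 = x * y → x = 1 ∧ y = 1 := by decide
  obtain ⟨hα, hδ⟩ := hdec _ _ hΔ0 g0 g3
  have hcc : φ c' = φ c := by
    have := congrArg φ f2
    simpa [hφ3, hφ9, hφ6, hΔφ, hα, hδ] using this.symm
  refine ⟨(key _ _).2 hcc, ?_⟩
  rintro rfl rfl
  have hbb : φ b' = φ b := by
    have := congrArg φ f1
    simpa [hφ3, hφ9, hφ6, hΔφ, hα, hδ] using this.symm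
  refine ⟨(key _ _).2 hbb, ?_⟩
  obtain ⟨a, ha⟩ := (key α 1).2 (by rw [hα, map_one])
  obtain ⟨e, he⟩ := (key δ 1).2 (by rw [hδ, map_one])
  obtain ⟨k, hk⟩ := hd
  have hδ3 : δ ^ 3 = 1 + 9 * (e + 3 * e ^ 2 + 3 * e ^ 3) := by
    rw [show δ = 1 + 3 * e by linear_combination he]; ring
  rintro (⟨rfl, rfl⟩ | ⟨rfl, rfl⟩)
  · have f1' : α ^ 2 * γ + β ^ 2 * δ * d = 3 * (Δ * w₁) := by
      apply mul_left_cancel₀ h3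
      linear_combination f1
    have f2' : 3 * α * γ ^ 2 + β * δ ^ 2 * d = 3 * (Δ * w₂) := by
      apply mul_left_cancel₀ h3
      linear_combination f2
    have hβ : φ β = 0 := by
      have := congrArg φ f2'
      simpa [hφ3, hφd, hδ] using this
    obtain ⟨B, hB⟩ := (key β 0).2 (by rw [hβ, map_zero])
    rw [sub_zero] at hB
    have hX : Δ = 1 + 9 * (a + 3 * a ^ 2 + 3 * a ^ 3 + 9 * B ^ 3 * d - 3 * Δ * w₀) := by
      rw [show α = 1 + 3 * a by linear_combination ha, hB] at e0
      linear_combination -e0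
    refine ⟨γ ^ 3 + (e + 3 * e ^ 2 + 3 * e ^ 3) * d - Δ * w₃ -
      (a + 3 * a ^ 2 + 3 * a ^ 3 + 9 * B ^ 3 * d - 3 * Δ * w₀) * d', ?_⟩
    linear_combination -f3 + d * hδ3 - d' * hX
  -- The sign b = -1 enters here: -3β + 3β³ is divisible by 9, so Δ ≡ 1 modulo 9. With b = 1 this
  -- fails, in accordance with the merging of those orbits.
  · have hβ : φ (β ^ 3) = φ β := by
      have : ∀ x : ZMod 3, x ^ 3 = x := by decide
      rw [map_pow, this]
    obtain ⟨n, hn⟩ := (key _ _).2 hβ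
    have hX : Δ = 1 + 9 * (a + 3 * a ^ 2 + 3 * a ^ 3 - 2 * a * β - 3 * a ^ 2 * β + n + β * k +
        3 * n * k - 3 * Δ * w₀) := by
      rw [show α = 1 + 3 * a by linear_combination ha, show β ^ 3 = β + 3 * n by linear_combination hn,
        show d = 1 + 3 * k by linear_combination hk] at e0
      linear_combination -e0
    refine ⟨γ ^ 3 - γ ^ 2 * δ + (e + 3 * e ^ 2 + 3 * e ^ 3) * d - Δ * w₃ -
      (a + 3 * a ^ 2 + 3 * a ^ 3 - 2 * a * β - 3 * a ^ 2 * β + n + β * k +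
        3 * n * k - 3 * Δ * w₀) * d', ?_⟩
    linear_combination -f3 + d * hδ3 - d' * hX

theorem wildIndices_injective : ∀ t ∈ wildIndices, ∀ t' ∈ wildIndices, (3 : ℤ) ∣ t'.2.1 - t.2.1 →
    (t.2.1 = 0 → t'.2.1 = 0 → (3 : ℤ) ∣ t'.1 - t.1 ∧
      ((t.1 = 0 ∧ t'.1 = 0) ∨ (t.1 = -1 ∧ t'.1 = -1) → (9 : ℤ) ∣ t'.2.2 - t.2.2)) → t' = t := by
  decide

/-- Serves twice: the congruence modulo 27 isolates each orbit, and its special case of equality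
shows that the orbits are disjoint. -/
theorem eq_of_congr_wildForm {t t' : ℤ × ℤ × ℤ} (ht : t ∈ wildIndices) (ht' : t' ∈ wildIndices)
    {z : Form ℤ_[3]} (hz : z ∈ orbit (wildForm t))
    (h : ∀ i, (3 : ℤ_[3]) ^ 3 ∣ z i - wildForm t' i) : t' = t := by
  have hd : ∀ t ∈ wildIndices, (3 : ℤ) ∣ t.2.2 - 1 := by decide
  have hdvd : ∀ (n : ℕ) (x y : ℤ), (3 : ℤ_[3]) ^ n ∣ x - y ↔ (3 : ℤ) ^ n ∣ x - y := by
    intro n x y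
    have := PadicInt.pow_p_dvd_int_iff (p := 3) n (x - y)
    push_cast at this
    exact this
  have hdvd3 : ∀ x y : ℤ, (3 : ℤ_[3]) ∣ x - y ↔ (3 : ℤ) ∣ x - y := by simpa using hdvd 1
  have hdvd9 : ∀ x y : ℤ, (9 : ℤ_[3]) ∣ x - y ↔ (9 : ℤ) ∣ x - y := by
    have := hdvd 2
    norm_num at this
    exact this
  have h1 : ∀ t ∈ wildIndices, (3 : ℤ_[3]) ∣ ((t.2.2 : ℤ) : ℤ_[3]) - 1 := by
    intro t ht
    have := (hdvd3 t.2.2 1).2 (hd t ht)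
    simpa using this
  obtain ⟨hc, hb⟩ := wildForm_invariants (h1 t ht) (h1 t' ht') hz (by
    intro i
    have := h i
    norm_num at this
    exact this)
  refine wildIndices_injective t ht t' ht' ((hdvd3 _ _).1 hc) fun h0 h0' => ?_
  obtain ⟨h2, h3⟩ := hb (by exact_mod_cast h0) (by exact_mod_cast h0')
  refine ⟨(hdvd3 _ _).1 h2, fun h4 => (hdvd9 _ _).1 (h3 ?_)⟩
  rcases h4 with ⟨h, h'⟩ | ⟨h, h'⟩
  · exact Or.inl ⟨by exact_mod_cast h, by exact_mod_cast h'⟩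
  · exact Or.inr ⟨by rw [h]; simp, by rw [h']; simp⟩

theorem isolated_wildForm {t : ℤ × ℤ × ℤ} (ht : t ∈ wildIndices) : Isolated 3 3 (wildForm t) := by
  refine isolated_of_representatives (S := {r | ∃ t ∈ wildIndices, r = wildForm t})
    (fun x hx => ?_) (by norm_num) (wildForm_mem ht) ?_
  · obtain ⟨t', ht', h⟩ := exists_mem_orbit_wildForm hx
    exact ⟨_, ⟨t', ht', rfl⟩, h⟩
  rintro _ ⟨t', ht', rfl⟩ z hz hzr
  rw [eq_of_congr_wildForm ht ht' hz (by exact_mod_cast hzr)]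
  exact mem_orbit_self _

theorem pairwiseDisjoint_wildForm :
    (wildForm '' (wildIndices : Set (ℤ × ℤ × ℤ))).PairwiseDisjoint orbit := by
  rintro _ ⟨t, ht, rfl⟩ _ ⟨t', ht', rfl⟩ hne
  refine Set.disjoint_left.2 fun x hx hx' => hne ?_
  rw [eq_of_congr_wildForm ht ht' (mem_orbit_trans (mem_orbit_symm hx') hx) (by simp)]

theorem wildForm_image : wildForm '' (wildIndices : Set (ℤ × ℤ × ℤ)) =
    ({![1, 0, 3, 3], ![1, 0, 6, 3], ![1, 3, 0, 3], ![1, -3, 0, 3], ![1, -3, 0, 12],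
      ![1, -3, 0, 21], ![1, 0, 0, 3], ![1, 0, 0, 12], ![1, 0, 0, 21]} : Set (Form ℤ_[3])) := by
  simp only [wildIndices, Finset.coe_insert, Finset.coe_singleton, Set.image_insert_eq,
    Set.image_singleton, wildForm]
  norm_num

end WildRepresentatives

end BinaryCubic

namespace BinaryCubic

/-! ### Automorphisms of determinant one. -/

section Automorphisms

variable {R : Type*} [CommRing R]

/-- The derivative of the action on `a` in the direction of the matrix attached to its Hessian. -/
def hessDeriv (a : Form R) : Form R :=
  let A := (hess a).1
  let B := (hess a).2.1
  let C := (hess a).2.2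
  ![-3 * B * a 0 + 2 * A * a 1, -6 * C * a 0 - B * a 1 + 4 * A * a 2,
    -4 * C * a 1 + B * a 2 + 6 * A * a 3, -2 * C * a 2 + 3 * B * a 3]

/-- Substituting τ + yH, with H the trace zero matrix built from the Hessian, keeps `a` in the span
of `a` and its derivative along H, with coefficients polynomial in τ and y. -/
theorem subst_hess (a : Form R) (τ y : R) (i : Fin 4) :
    subst (τ - y * (hess a).2.1) (2 * (y * (hess a).1)) (2 * -(y * (hess a).2.2))
      (τ + y * (hess a).2.1) a i =
      (τ ^ 3 - 9 * disc a * τ * y ^ 2) * a i + (τ ^ 2 * y - disc a * y ^ 3) * hessDeriv a i := by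
  fin_cases i <;> simp [subst, hess, hessDeriv, disc] <;> ring

theorem subst_mul_mul (t α β γ δ : R) (a : Form R) (i : Fin 4) :
    subst (t * α) (t * β) (t * γ) (t * δ) a i = t ^ 3 * subst α β γ δ a i := by
  fin_cases i <;> simp [subst] <;> ring

theorem hessDeriv_minors (a : Form R) :
    a 0 * hessDeriv a 1 - a 1 * hessDeriv a 0 = -2 * (hess a).1 ^ 2 ∧
      a 2 * hessDeriv a 3 - a 3 * hessDeriv a 2 = -2 * (hess a).2.2 ^ 2 ∧
      3 * (a 0 * hessDeriv a 3 - a 3 * hessDeriv a 0) =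
        -2 * (hess a).2.1 ^ 2 + 2 * (hess a).1 * (hess a).2.2 := by
  simp only [hess, hessDeriv, Matrix.cons_val_zero, Matrix.cons_val_one, Matrix.cons_val]
  exact ⟨by ring, by ring, by ring⟩

theorem hess_of_subst [IsDomain R] {α β γ δ Δ : R} {a : Form R} (hΔ : α * δ - β * γ = Δ)
    (hΔ0 : Δ ≠ 0) (h : subst α β γ δ a = fun i => Δ * a i) :
    (hess a).1 * α ^ 2 + (hess a).2.1 * α * β + (hess a).2.2 * β ^ 2 = (hess a).1 ∧
      2 * (hess a).1 * α * γ + (hess a).2.1 * (α * δ + β * γ) + 2 * (hess a).2.2 * β * δ =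
        (hess a).2.1 ∧
      (hess a).1 * γ ^ 2 + (hess a).2.1 * γ * δ + (hess a).2.2 * δ ^ 2 = (hess a).2.2 := by
  have h1 := congrArg hess h
  rw [hess_subst, hess_smul, hΔ] at h1
  simp only [Prod.mk.injEq] at h1
  have h2 := pow_ne_zero 2 hΔ0
  exact ⟨mul_left_cancel₀ h2 h1.1, mul_left_cancel₀ h2 h1.2.1, mul_left_cancel₀ h2 h1.2.2⟩

theorem hess_ne_zero [IsDomain R] [CharZero R] {a : Form R} (hd : disc a ≠ 0) :
    (hess a).1 ≠ 0 ∨ (hess a).2.2 ≠ 0 ∨ (hess a).1 = 0 ∧ (hess a).2.1 ≠ 0 := by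
  by_cases hA : (hess a).1 = 0
  · right; right
    refine ⟨hA, fun hB => hd ?_⟩
    have := hess_disc a
    rw [hA, hB] at this
    have h3 : (3 : R) ≠ 0 := by norm_num
    apply mul_left_cancel₀ h3
    linear_combination this
  · exact Or.inl hA

theorem automorphism_of_det_one {K : Type*} [Field K] [CharZero K] {α β γ δ : K} {a : Form K}
    (hd : disc a ≠ 0) (hΔ : α * δ - β * γ = 1) (h : subst α β γ δ a = a) :
    (α = 1 ∧ β = 0 ∧ γ = 0 ∧ δ = 1) ∨ ∃ y, disc a * y ^ 2 = 1 ∧ 2 * α = -1 - y * (hess a).2.1 ∧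
      β = y * (hess a).1 ∧ γ = -(y * (hess a).2.2) ∧ 2 * δ = -1 + y * (hess a).2.1 := by
  have h2 : (2 : K) ≠ 0 := by norm_num
  have h3 : (3 : K) ≠ 0 := by norm_num
  obtain ⟨i1, i2, i3⟩ := hess_of_subst hΔ one_ne_zero (by simpa using h)
  -- Invariance of the Hessian makes (β, δ - α, -γ) proportional to its coefficients; the
  -- proportionality factor is y below.
  have c1 : β * (hess a).2.1 = (δ - α) * (hess a).1 := by
    apply mul_left_cancel₀ h2
    linear_combination 2 * δ * i1 - β * i2 - (2 * (hess a).1 * α + (hess a).2.1 * β) * hΔ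
  have c2 : β * (hess a).2.2 = -γ * (hess a).1 := by
    apply mul_left_cancel₀ h2
    linear_combination α * i2 - 2 * γ * i1 - ((hess a).2.1 * α + 2 * (hess a).2.2 * β) * hΔ
  have c3 : (δ - α) * (hess a).2.2 = -γ * (hess a).2.1 := by
    apply mul_left_cancel₀ h2
    linear_combination 2 * α * i3 - γ * i2 - ((hess a).2.1 * γ + 2 * (hess a).2.2 * δ) * hΔ
  obtain ⟨y, hy1, hy2, hy3⟩ : ∃ y, β = y * (hess a).1 ∧ δ - α = y * (hess a).2.1 ∧
      γ = -(y * (hess a).2.2) := by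
    rcases hess_ne_zero hd with hA | hC | ⟨hA, hB⟩
    · refine ⟨β / (hess a).1, ?_, ?_, ?_⟩ <;> field_simp
      · linear_combination -c1
      · linear_combination c2
    · refine ⟨-γ / (hess a).2.2, ?_, ?_, ?_⟩ <;> field_simp
      · linear_combination c2
      · linear_combination c3
    · rw [hA] at c1 c2 ⊢
      refine ⟨(δ - α) / (hess a).2.1, ?_, ?_, ?_⟩ <;> field_simp
      · linear_combination c1
      · linear_combination c3
  obtain ⟨τ, hτ⟩ : ∃ τ, τ = α + δ := ⟨_, rfl⟩
  -- Twice the automorphism is τ + yH, so scaling by 2 contributes the factor 8.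
  have e : ∀ i, 8 * a i = (τ ^ 3 - 9 * disc a * τ * y ^ 2) * a i +
      (τ ^ 2 * y - disc a * y ^ 3) * hessDeriv a i := by
    intro i
    rw [← subst_hess, show τ - y * (hess a).2.1 = 2 * α by linear_combination hτ + hy2,
      show τ + y * (hess a).2.1 = 2 * δ by linear_combination hτ - hy2, ← hy1, ← hy3,
      subst_mul_mul, h]
    norm_num
  have hdet : τ ^ 2 + 3 * disc a * y ^ 2 = 4 := by
    have := hess_disc a
    have h4 : 4 * (α * δ - β * γ) = τ ^ 2 - (y * (hess a).2.1) ^ 2 +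
        4 * (y * (hess a).1) * (y * (hess a).2.2) := by
      rw [hτ, ← hy2, ← hy1, hy3]; ring
    rw [hΔ] at h4
    linear_combination -h4 + y ^ 2 * this
  obtain ⟨m1, m2, m3⟩ := hessDeriv_minors a
  have hQ : τ ^ 2 * y - disc a * y ^ 3 = 0 := by
    set Q := τ ^ 2 * y - disc a * y ^ 3
    rcases hess_ne_zero hd with hA | hC | ⟨hA, hB⟩
    · have : -2 * (hess a).1 ^ 2 * Q = 0 := by
        linear_combination a 1 * e 0 - a 0 * e 1 - Q * m1
      simpa [hA] using this
    · have : -2 * (hess a).2.2 ^ 2 * Q = 0 := by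
        linear_combination a 3 * e 2 - a 2 * e 3 - Q * m2
      simpa [hC] using this
    · rw [hA] at m3
      have : -2 * (hess a).2.1 ^ 2 * Q = 0 := by
        linear_combination 3 * (a 3 * e 0 - a 0 * e 3) - Q * m3
      simpa [hB] using this
  have hP : τ ^ 3 - 9 * disc a * τ * y ^ 2 = 8 := by
    by_contra hne
    apply hd
    have h0 : ∀ i, a i = 0 := fun i => by
      have := e i
      rw [hQ, zero_mul, add_zero, eq_comm, ← sub_eq_zero, ← sub_mul] at this
      exact (mul_eq_zero.1 this).resolve_left (sub_ne_zero.2 hne)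
    simp [disc, h0]
  -- The system is τ³ - 9Pτy² = 8, y(τ² - Py²) = 0, τ² + 3Py² = 4. Either y = 0 and τ = 2, or Py² =
  -- τ² = 1 and τ = -1.
  by_cases hy : y = 0
  · left
    rw [hy] at hdet hP hy1 hy2 hy3
    have h8 : τ = 2 := by linear_combination 4⁻¹ * hP - τ / 4 * hdet
    refine ⟨?_, by simpa using hy1, by simpa using hy3, ?_⟩
    · apply mul_left_cancel₀ h2; linear_combination h8 - hτ - hy2
    · apply mul_left_cancel₀ h2; linear_combination h8 - hτ + hy2
  · right
    have hτ2 : τ ^ 2 = disc a * y ^ 2 := by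
      apply mul_left_cancel₀ hy
      linear_combination hQ
    have h1 : disc a * y ^ 2 = 1 := by linear_combination (hdet - hτ2) / 4
    have hτ1 : τ = -1 := by
      linear_combination -hP / 8 + τ / 8 * hτ2 - τ * h1
    refine ⟨y, h1, ?_, hy1, hy3, ?_⟩
    · linear_combination hτ1 - hτ - hy2
    · linear_combination hτ1 - hτ + hy2

/-- The elements of determinant `1` in the stabilizer. -/
def stabOne (a : Form R) : Set (GL (Fin 2) R) := {g | act g a = a ∧ ddet g = 1}

theorem gl_ext {g h : GL (Fin 2) R} (h00 : g.val 0 0 = h.val 0 0) (h01 : g.val 0 1 = h.val 0 1)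
    (h10 : g.val 1 0 = h.val 1 0) (h11 : g.val 1 1 = h.val 1 1) : g = h := by
  ext i j
  fin_cases i <;> fin_cases j <;> assumption

/-- The classification over the fraction field, with y = n/m and denominators cleared. -/
theorem automorphism_of_mem_stabOne [IsDomain R] [CharZero R] (K : Type*) [Field K] [Algebra R K]
    [IsFractionRing R K] {a : Form R} (hd : disc a ≠ 0)
    {g : GL (Fin 2) R} (hg : g ∈ stabOne a) : g = 1 ∨ ∃ n m : R, m ≠ 0 ∧ disc a * n ^ 2 = m ^ 2 ∧
      m * (2 * g.val 0 0) = -m - n * (hess a).2.1 ∧ m * g.val 0 1 = n * (hess a).1 ∧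
      m * g.val 1 0 = -(n * (hess a).2.2) ∧ m * (2 * g.val 1 1) = -m + n * (hess a).2.1 := by
  have : CharZero K := charZero_of_injective_algebraMap (IsFractionRing.injective R K)
  set φ : R →+* K := algebraMap R K with hφ
  have hφi : Function.Injective φ := IsFractionRing.injective R K
  obtain ⟨hga, hg1⟩ := hg
  have hsub := ddet_smul_act g a
  rw [hga, hg1] at hsub
  have hsub' : subst (φ (g.val 0 0)) (φ (g.val 0 1)) (φ (g.val 1 0)) (φ (g.val 1 1)) (mapForm φ a) =
      mapForm φ a := by
    funext i
    have := congrArg φ (congrFun hsub i)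
    rw [one_mul] at this
    rw [show mapForm φ a i = φ (a i) from rfl, this]
    fin_cases i <;> simp [subst, mapForm, map_ofNat φ]
  have hdet : φ (g.val 0 0) * φ (g.val 1 1) - φ (g.val 0 1) * φ (g.val 1 0) = 1 := by
    rw [← map_mul, ← map_mul, ← map_sub, ← map_one φ]
    exact congrArg φ hg1
  have hh : hess (mapForm φ a) = (φ (hess a).1, φ (hess a).2.1, φ (hess a).2.2) := by
    simp [hess, mapForm, map_ofNat φ]
  have hd' : disc (mapForm φ a) ≠ 0 := by
    rw [disc_mapForm, map_ne_zero_iff _ hφi]; exact hd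
  rcases automorphism_of_det_one hd' hdet hsub' with ⟨h1, h2, h3, h4⟩ | ⟨y, h0, h1, h2, h3, h4⟩
  · left
    refine gl_ext (hφi ?_) (hφi ?_) (hφi ?_) (hφi ?_)
    · rw [h1]; simp
    · rw [h2]; simp
    · rw [h3]; simp
    · rw [h4]; simp
  · right
    rw [disc_mapForm] at h0
    rw [hh] at h1 h2 h3 h4
    obtain ⟨n, m, hm, rfl⟩ := IsFractionRing.div_surjective (A := R) y
    have hm0 : m ≠ 0 := nonZeroDivisors.ne_zero hm
    have hφm : φ m ≠ 0 := by rw [Ne, map_eq_zero_iff _ hφi]; exact hm0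
    rw [← hφ] at *
    have hφ2 : φ 2 = 2 := map_ofNat φ 2
    refine ⟨n, m, hm0, hφi ?_, hφi ?_, hφi ?_, hφi ?_, hφi ?_⟩ <;>
      simp only [map_mul, map_pow, map_sub, map_add, map_neg, hφ2]
    · field_simp at h0; exact h0
    · rw [h1]; field_simp
    · rw [h2]; field_simp
    · rw [h3]; field_simp
    · rw [h4]; field_simp

end Automorphisms

end BinaryCubic

namespace BinaryCubic

/-! ### Orders of stabilizers from the discriminant and from roots. -/

section StabilizerOrders

variable {R : Type*} [CommRing R] [IsDomain R] [CharZero R]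

theorem ddet_of_act_eq {a : Form R} (hd : disc a ≠ 0) {g : GL (Fin 2) R} (hg : act g a = a) :
    ddet g = 1 ∨ ddet g = -1 := by
  have h := disc_act g a
  rw [hg] at h
  have h1 : (ddet g - 1) * (ddet g + 1) = 0 := by
    apply mul_right_cancel₀ hd
    linear_combination -h
  rcases mul_eq_zero.1 h1 with h1 | h1
  · exact Or.inl (sub_eq_zero.1 h1)
  · exact Or.inr (eq_neg_of_add_eq_zero_left h1)

/-- An automorphism of determinant -1 negates the Hessian's compatible trace part, so its trace
vanishes and it is an involution with a nonzero fixed vector. The form takes opposite values there,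
i.e. it has a root. -/
theorem ddet_eq_one_of_no_root {a : Form R} (hd : disc a ≠ 0)
    (hr : ∀ u v, eval a u v = 0 → u = 0 ∧ v = 0) {g : GL (Fin 2) R} (hg : act g a = a) :
    ddet g = 1 := by
  refine (ddet_of_act_eq hd hg).resolve_right fun h1 => ?_
  have h2 : (2 : R) ≠ 0 := by norm_num
  have hsub := ddet_smul_act g a
  have hev := ddet_mul_eval_act g a
  rw [hg, h1] at hsub hev
  have hΔ : g.val 0 0 * g.val 1 1 - g.val 0 1 * g.val 1 0 = -1 := h1
  generalize g.val 0 0 = α at *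
  generalize g.val 0 1 = β at *
  generalize g.val 1 0 = γ at *
  generalize g.val 1 1 = δ at *
  obtain ⟨i1, i2, i3⟩ := hess_of_subst hΔ (by simp) hsub.symm
  have hA : (α + δ) * (hess a).1 = 0 := by
    apply mul_left_cancel₀ h2
    linear_combination -2 * δ * i1 + β * i2 + (2 * (hess a).1 * α + (hess a).2.1 * β) * hΔ
  have hC : (α + δ) * (hess a).2.2 = 0 := by
    apply mul_left_cancel₀ h2
    linear_combination -2 * α * i3 + γ * i2 + ((hess a).2.1 * γ + 2 * (hess a).2.2 * δ) * hΔ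
  have hB : (α + δ) * (hess a).2.1 = 0 := by
    apply mul_left_cancel₀ h2
    linear_combination -α * i2 + 2 * γ * i1 + ((hess a).2.1 * α + 2 * (hess a).2.2 * β) * hΔ
      - δ * i2 + 2 * β * i3 + ((hess a).2.1 * δ + 2 * (hess a).1 * γ) * hΔ
  have htr : α + δ = 0 := by
    rcases hess_ne_zero hd with h | h | ⟨-, h⟩
    · exact (mul_eq_zero.1 hA).resolve_right h
    · exact (mul_eq_zero.1 hC).resolve_right h
    · exact (mul_eq_zero.1 hB).resolve_right h
  obtain rfl : δ = -α := by linear_combination htr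
  have key : ∀ u v, α * u + γ * v = u → β * u + -α * v = v → u = 0 ∧ v = 0 := by
    intro u v hu hv
    apply hr
    have := hev u v
    rw [hu, hv] at this
    apply mul_left_cancel₀ h2
    linear_combination -this
  -- The fixed vectors tested are the rows of g + 1; both can vanish only if 2 = 0.
  have k1 := (key (α + 1) β (by linear_combination -hΔ) (by ring)).1
  have k2 := (key γ (-α + 1) (by ring) (by linear_combination -hΔ)).2
  apply h2
  linear_combination k1 + k2

theorem stabCard_eq_ncard (a : Form R) : stabCard a = {g | act g a = a}.ncard :=
  Nat.card_coe_set_eq _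

theorem stabCard_of_no_root {a : Form R} (hd : disc a ≠ 0)
    (hr : ∀ u v, eval a u v = 0 → u = 0 ∧ v = 0) : stabCard a = (stabOne a).ncard := by
  rw [stabCard_eq_ncard]
  congr 1
  ext g
  exact ⟨fun hg => ⟨hg, ddet_eq_one_of_no_root hd hr hg⟩, fun hg => hg.1⟩

theorem ddet_mul (g h : GL (Fin 2) R) : ddet (g * h) = ddet g * ddet h := by
  rw [← coe_det, ← coe_det, ← coe_det, map_mul, Units.val_mul]

/-- A stabilizer containing an element of determinant `-1`. -/
theorem stabCard_of_reflection {a : Form R} (hd : disc a ≠ 0) (hfin : (stabOne a).Finite)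
    {σ : GL (Fin 2) R} (hσ : act σ a = a) (hσ1 : ddet σ = -1) :
    stabCard a = 2 * (stabOne a).ncard := by
  have hset : {g | act g a = a} = stabOne a ∪ (σ * ·) '' stabOne a := by
    ext g
    constructor
    · intro hg
      rcases ddet_of_act_eq hd hg with h | h
      · exact Or.inl ⟨hg, h⟩
      · refine Or.inr ⟨σ⁻¹ * g, ⟨?_, ?_⟩, mul_inv_cancel_left σ g⟩
        · rw [act_mul, show act g a = a from hg]
          conv_lhs => rw [← hσ]
          exact act_inv_act σ a
        · have := ddet_mul σ (σ⁻¹ * g)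
          rw [mul_inv_cancel_left, h, hσ1] at this
          linear_combination this
    · rintro (hg | ⟨h, hh, rfl⟩)
      · exact hg.1
      · show act (σ * h) a = a
        rw [act_mul, hh.1, hσ]
  have hdisj : Disjoint (stabOne a) ((σ * ·) '' stabOne a) := by
    rw [Set.disjoint_left]
    rintro _ hg ⟨h, hh, rfl⟩
    have h1 := ddet_mul σ h
    rw [hσ1, hh.2] at h1
    have h2 : ddet (σ * h) = 1 := hg.2
    rw [h2] at h1
    norm_num at h1
  rw [stabCard_eq_ncard, hset, Set.ncard_union_eq hdisj hfin (hfin.image _),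
    Set.ncard_image_of_injective _ (mul_right_injective σ), two_mul]

/-- A nontrivial automorphism of determinant 1 would make the discriminant a square in the fraction
field. -/
theorem stabOne_eq_singleton {a : Form R} (hd : disc a ≠ 0)
    (hs : ∀ n m : R, m ≠ 0 → disc a * n ^ 2 ≠ m ^ 2) : stabOne a = {1} := by
  ext g
  constructor
  · intro hg
    rcases automorphism_of_mem_stabOne (FractionRing R) hd hg with h | ⟨n, m, hm, h, -⟩
    · exact h
    · exact absurd h (hs n m hm)
  · rintro rfl
    exact ⟨act_one a, by simp [ddet]⟩

/-- If the discriminant is a square and the Hessian is integral with respect to its root, then there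
are three automorphisms of determinant `1`. -/
theorem ncard_stabOne_of_sq {a : Form R} {s A B C α δ : R} (hs0 : s ≠ 0) (hs : disc a = s ^ 2)
    (hA : (hess a).1 = s * A) (hB : (hess a).2.1 = s * B) (hC : (hess a).2.2 = s * C)
    (hα : 2 * α = -1 - B) (hδ : 2 * δ = -1 + B) : (stabOne a).ncard = 3 := by
  have h2 : (2 : R) ≠ 0 := by norm_num
  have hd : disc a ≠ 0 := by rw [hs]; exact pow_ne_zero 2 hs0
  have hABC : B ^ 2 - 4 * A * C = -3 := by
    have := hess_disc a
    rw [hA, hB, hC, hs] at this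
    apply mul_left_cancel₀ (pow_ne_zero 2 hs0)
    linear_combination this
  have hdet : α * δ - A * -C = 1 := by
    apply mul_left_cancel₀ (pow_ne_zero 2 h2)
    linear_combination 2 * δ * hα - (1 + B) * hδ - hABC
  have hdet' : δ * α - -A * C = 1 := by linear_combination hdet
  -- The signs ε = ±1 correspond to the two roots ±1/s of P y² = 1, with τ = -1.
  have hsub : ∀ ε : R, ε ^ 2 = 1 → ∀ x y, 2 * x = -1 - ε * B → 2 * y = -1 + ε * B →
      subst x (ε * A) (-(ε * C)) y a = a := by
    intro ε hε x y hx hy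
    funext i
    have h := subst_hess a (-s) ε i
    rw [hA, hB, hC, hs, show -s - ε * (s * B) = (2 * s) * x by linear_combination -s * hx,
      show -s + ε * (s * B) = (2 * s) * y by linear_combination -s * hy,
      show 2 * (ε * (s * A)) = (2 * s) * (ε * A) by ring,
      show 2 * -(ε * (s * C)) = (2 * s) * -(ε * C) by ring, subst_mul_mul] at h
    apply mul_left_cancel₀ (pow_ne_zero 3 (mul_ne_zero h2 hs0))
    rw [h]
    linear_combination (9 * s ^ 3 * a i - s ^ 2 * ε * hessDeriv a i) * hε
  have hu := hdet ▸ isUnit_one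
  have hu' := hdet' ▸ isUnit_one
  set g₁ := glOf α A (-C) δ hu
  set g₂ := glOf δ (-A) C α hu'
  have hg₁ : g₁ ∈ stabOne a := by
    refine ⟨(glOf_act_eq_iff _ _ _ _ hu _ _).2 ?_, (ddet_glOf _ _ _ _ hu).trans hdet⟩
    have := hsub 1 (by ring) α δ (by linear_combination hα) (by linear_combination hδ)
    simp only [one_mul] at this
    rw [this, hdet]
    simp
  have hg₂ : g₂ ∈ stabOne a := by
    refine ⟨(glOf_act_eq_iff _ _ _ _ hu' _ _).2 ?_, (ddet_glOf _ _ _ _ hu').trans hdet'⟩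
    have := hsub (-1) (by ring) δ α (by linear_combination hδ) (by linear_combination hα)
    simp only [neg_mul, one_mul, neg_neg] at this
    rw [this, hdet']
    simp
  have h1 : (1 : GL (Fin 2) R) ∈ stabOne a := ⟨act_one a, by simp [ddet]⟩
  have htr : α + δ = -1 := by
    apply mul_left_cancel₀ h2
    linear_combination hα + hδ
  have e : ∀ g h : GL (Fin 2) R, g = h → ∀ i j, g.val i j = h.val i j := by
    rintro g _ rfl i j; rfl
  have hne : ∀ x y, x + y = (-1 : R) → ¬ ((1 : R) = x ∧ (1 : R) = y) := by
    rintro _ _ h ⟨rfl, rfl⟩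
    norm_num at h
  have hne01 : (1 : GL (Fin 2) R) ≠ g₁ := fun h =>
    hne α δ htr ⟨e _ _ h 0 0, e _ _ h 1 1⟩
  have hne02 : (1 : GL (Fin 2) R) ≠ g₂ := fun h =>
    hne δ α ((add_comm _ _).trans htr) ⟨e _ _ h 0 0, e _ _ h 1 1⟩
  have hne12 : g₁ ≠ g₂ := by
    intro h
    have k0 : α = δ := e _ _ h 0 0
    have k1 : A = -A := e _ _ h 0 1
    have k2 : A = 0 := by
      apply mul_left_cancel₀ h2
      linear_combination k1
    have k3 : B = 0 := by
      apply mul_left_cancel₀ h2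
      linear_combination hα - hδ - 2 * k0
    rw [k2, k3] at hABC
    norm_num at hABC
  have hset : stabOne a = {1, g₁, g₂} := by
    ext g
    constructor
    · intro hg
      rcases automorphism_of_mem_stabOne (FractionRing R) hd hg with h | ⟨n, m, hm, h, e1, e2, e3, e4⟩
      · exact Or.inl h
      · rw [hA] at e2
        rw [hB] at e1 e4
        rw [hC] at e3
        rw [hs] at h
        have h' : (s * n - m) * (s * n + m) = 0 := by linear_combination h
        rcases mul_eq_zero.1 h' with h' | h'
        · refine Or.inr (Or.inl (gl_ext ?_ ?_ ?_ ?_))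
          · show _ = α
            apply mul_left_cancel₀ (mul_ne_zero hm h2)
            linear_combination e1 - m * hα - B * h'
          · show _ = A
            apply mul_left_cancel₀ hm
            linear_combination e2 + A * h'
          · show _ = -C
            apply mul_left_cancel₀ hm
            linear_combination e3 - C * h'
          · show _ = δ
            apply mul_left_cancel₀ (mul_ne_zero hm h2)
            linear_combination e4 - m * hδ + B * h'
        · refine Or.inr (Or.inr (gl_ext ?_ ?_ ?_ ?_))
          · show _ = δ
            apply mul_left_cancel₀ (mul_ne_zero hm h2)
            linear_combination e1 - m * hδ - B * h'
          · show _ = -A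
            apply mul_left_cancel₀ hm
            linear_combination e2 + A * h'
          · show _ = C
            apply mul_left_cancel₀ hm
            linear_combination e3 - C * h'
          · show _ = α
            apply mul_left_cancel₀ (mul_ne_zero hm h2)
            linear_combination e4 - m * hα + B * h'
    · rintro (rfl | rfl | rfl)
      · exact h1
      · exact hg₁
      · exact hg₂
  rw [hset]
  exact Set.ncard_eq_three.2 ⟨_, _, _, hne01, hne02, hne12, rfl⟩

end StabilizerOrders

/-! ### Rootless forms and nonsquares over ℤ_p. -/

section Roots

variable {p : ℕ} [Fact p.Prime]

theorem eq_zero_of_forall_pow_dvd {x : ℤ_[p]} (h : ∀ n : ℕ, (p : ℤ_[p]) ^ n ∣ x) : x = 0 := by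
  by_contra hx
  have := (PadicInt.mem_span_pow_iff_le_valuation x hx (x.valuation + 1)).1
    (Ideal.mem_span_singleton.2 (h _))
  omega

theorem valuation_of_isUnit {x : ℤ_[p]} (h : IsUnit x) : x.valuation = 0 := by
  by_contra hx
  rw [isUnit_iff_not_dvd] at h
  apply h
  rw [← Ideal.mem_span_singleton, ← pow_one (p : ℤ_[p]),
    PadicInt.mem_span_pow_iff_le_valuation x (fun h0 => hx (by rw [h0]; simp))]
  omega

/-- Infinite descent: a common factor p can be removed from a root by homogeneity, so both
coordinates are divisible by every power of p. -/
theorem no_root_of_descent {a : Form ℤ_[p]}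
    (h : ∀ u v, eval a u v = 0 → (p : ℤ_[p]) ∣ u ∧ (p : ℤ_[p]) ∣ v) {u v : ℤ_[p]}
    (huv : eval a u v = 0) : u = 0 ∧ v = 0 := by
  have hp0 : (p : ℤ_[p]) ≠ 0 := by exact_mod_cast (Fact.out : p.Prime).ne_zero
  have key : ∀ n : ℕ, ∃ u' v', eval a u' v' = 0 ∧ u = (p : ℤ_[p]) ^ n * u' ∧ v = (p : ℤ_[p]) ^ n * v' := by
    intro n
    induction n with
    | zero => exact ⟨u, v, huv, by simp, by simp⟩
    | succ n ih =>
      obtain ⟨u', v', h0, hu, hv⟩ := ih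
      obtain ⟨⟨u'', rfl⟩, v'', rfl⟩ := h u' v' h0
      refine ⟨u'', v'', ?_, by rw [hu]; ring, by rw [hv]; ring⟩
      rw [eval_mul_mul] at h0
      exact (mul_eq_zero.1 h0).resolve_left (pow_ne_zero 3 hp0)
  constructor
  · apply eq_zero_of_forall_pow_dvd
    intro n
    obtain ⟨u', -, -, hu, -⟩ := key n
    exact ⟨u', hu⟩
  · apply eq_zero_of_forall_pow_dvd
    intro n
    obtain ⟨-, v', -, -, hv⟩ := key n
    exact ⟨v', hv⟩

theorem no_root_of_t3 {a : Form ℤ_[p]} (ha : a ∈ formsOfType p .t3) (u v : ℤ_[p])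
    (huv : eval a u v = 0) : u = 0 ∧ v = 0 := by
  refine no_root_of_descent (fun u v huv => ?_) huv
  have h : IsIrr (mapForm PadicInt.toZMod a) := ha
  have h1 : eval (mapForm PadicInt.toZMod a) (PadicInt.toZMod u) (PadicInt.toZMod v) = 0 := by
    rw [eval_mapForm, huv, map_zero]
  have h2 : (PadicInt.toZMod u, PadicInt.toZMod v) = ((0 : ZMod p), (0 : ZMod p)) := by
    by_contra hne
    exact h _ _ hne h1
  rw [Prod.mk.injEq, ← map_zero (PadicInt.toZMod (p := p)), toZMod_eq_iff, toZMod_eq_iff, sub_zero,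
    sub_zero] at h2
  exact h2

theorem no_root_of_eisenstein {b c d : ℤ_[p]} (hd : IsUnit d) (u v : ℤ_[p])
    (huv : eval ![1, p * b, p * c, p * d] u v = 0) : u = 0 ∧ v = 0 := by
  have hp0 : (p : ℤ_[p]) ≠ 0 := by exact_mod_cast (Fact.out : p.Prime).ne_zero
  have hprime : Prime (p : ℤ_[p]) := PadicInt.prime_p
  refine no_root_of_descent (fun u v huv => ?_) huv
  simp only [eval, Matrix.cons_val_zero, Matrix.cons_val_one, Matrix.cons_val, one_mul] at huv
  obtain ⟨w, rfl⟩ : (p : ℤ_[p]) ∣ u := hprime.dvd_of_dvd_pow (n := 3)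
    ⟨-(b * u ^ 2 * v + c * u * v ^ 2 + d * v ^ 3), by linear_combination huv⟩
  refine ⟨dvd_mul_right _ _, hprime.dvd_of_dvd_pow (n := 3) (hd.dvd_mul_left.1
    ⟨-(p * w ^ 3 + p * b * w ^ 2 * v + c * w * v ^ 2), ?_⟩)⟩
  apply mul_left_cancel₀ hp0
  linear_combination huv

/-- Valuations exclude odd k; for even k the unit parts would exhibit u as a square modulo p. -/
theorem mul_sq_ne_sq {k : ℕ} {u : ℤ_[p]} (hu : IsUnit u)
    (h : Odd k ∨ ¬ IsSquare (PadicInt.toZMod u)) (n m : ℤ_[p]) (hm : m ≠ 0) :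
    (p : ℤ_[p]) ^ k * u * n ^ 2 ≠ m ^ 2 := by
  intro he
  have hp0 : (p : ℤ_[p]) ≠ 0 := by exact_mod_cast (Fact.out : p.Prime).ne_zero
  have hn : n ≠ 0 := by
    rintro rfl
    exact hm (pow_eq_zero_iff two_ne_zero |>.1 (by rw [← he]; ring))
  have hn' := PadicInt.unitCoeff_spec hn
  have hm' := PadicInt.unitCoeff_spec hm
  set x := PadicInt.unitCoeff hn
  set y := PadicInt.unitCoeff hm
  have hv := congrArg PadicInt.valuation he
  rw [PadicInt.valuation_mul (mul_ne_zero (pow_ne_zero _ hp0) hu.ne_zero) (pow_ne_zero 2 hn),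
    PadicInt.valuation_mul (pow_ne_zero _ hp0) hu.ne_zero, PadicInt.valuation_pow,
    PadicInt.valuation_pow, PadicInt.valuation_pow, PadicInt.valuation_p,
    valuation_of_isUnit hu] at hv
  rcases h with ⟨j, hj⟩ | h
  · omega
  apply h
  rw [hn', hm', mul_pow, mul_pow, ← pow_mul, ← pow_mul] at he
  have h1 : u * (x : ℤ_[p]) ^ 2 = (y : ℤ_[p]) ^ 2 := by
    apply mul_right_cancel₀ (pow_ne_zero (m.valuation * 2) hp0)
    rw [← he, show m.valuation * 2 = k + n.valuation * 2 by omega, pow_add]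
    ring
  have h2 : u = ((x⁻¹ : ℤ_[p]ˣ) * y) * ((x⁻¹ : ℤ_[p]ˣ) * y) := by
    linear_combination ((x⁻¹ : ℤ_[p]ˣ) : ℤ_[p]) ^ 2 * h1 - u * (x * (x⁻¹ : ℤ_[p]ˣ) + 1) * x.mul_inv
  rw [h2, map_mul]
  exact ⟨_, rfl⟩

end Roots

end BinaryCubic

namespace BinaryCubic

/-! ### Stabilizers of the representatives. -/

section StabilizerTable

theorem stabCard_split {R : Type*} [CommRing R] [IsDomain R] [CharZero R] :
    stabCard (![0, 1, -1, 0] : Form R) = 6 := by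
  have h3 : (stabOne (![0, 1, -1, 0] : Form R)).ncard = 3 :=
    ncard_stabOne_of_sq (s := 1) (A := 1) (B := -1) (C := 1) (α := 0) (δ := -1) one_ne_zero
      (by simp [disc]) (by simp [hess]) (by simp [hess]) (by simp [hess]) (by norm_num)
      (by norm_num)
  have hu : IsUnit ((0 : R) * 0 - 1 * 1) := by simp
  rw [stabCard_of_reflection (σ := glOf 0 1 1 0 hu) (by simp [disc])
    (Set.finite_of_ncard_ne_zero (by rw [h3]; norm_num)) ?_ (by rw [ddet_glOf]; norm_num), h3]
  rw [glOf_act_eq_iff]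
  funext i
  fin_cases i <;> simp [subst]

theorem stabCard_linQuad {R : Type*} [CommRing R] [IsDomain R] [CharZero R] {x : R} (hx : x ≠ 0)
    (hs : ∀ n m : R, m ≠ 0 → disc (![0, 1, 0, x] : Form R) * n ^ 2 ≠ m ^ 2) :
    stabCard (![0, 1, 0, x] : Form R) = 2 := by
  have hd : disc (![0, 1, 0, x] : Form R) ≠ 0 := by simpa [disc] using hx
  have h1 := stabOne_eq_singleton hd hs
  have hu : IsUnit ((1 : R) * -1 - 0 * 0) := by simp
  rw [stabCard_of_reflection (σ := glOf 1 0 0 (-1) hu) hd (by rw [h1]; exact Set.finite_singleton _)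
    ?_ (by rw [ddet_glOf]; norm_num), h1, Set.ncard_singleton]
  rw [glOf_act_eq_iff]
  funext i
  fin_cases i <;> simp [subst]
  ring

variable {p : ℕ} [Fact p.Prime]

theorem stabCard_t21 {d : ℤ_[p]} (hd : IsUnit d)
    (hns : ¬ IsSquare (PadicInt.toZMod d)) : stabCard (![0, 1, 0, -d] : Form ℤ_[p]) = 2 := by
  refine stabCard_linQuad (neg_ne_zero.2 hd.ne_zero) fun n m hm h => ?_
  refine mul_sq_ne_sq (k := 0) hd (Or.inr hns) (2 * n) m hm ?_
  rw [← h]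
  simp [disc]; ring

theorem stabCard_t121max (hp : p ≠ 2) {α : ℤ_[p]} (hα : IsUnit α) :
    stabCard (![0, 1, 0, p * α] : Form ℤ_[p]) = 2 := by
  have hp0 : (p : ℤ_[p]) ≠ 0 := by exact_mod_cast (Fact.out : p.Prime).ne_zero
  refine stabCard_linQuad (mul_ne_zero hp0 hα.ne_zero) fun n m hm h => ?_
  refine mul_sq_ne_sq (k := 1) (((isUnit_two hp).pow 2).mul hα).neg (Or.inl odd_one) n m hm ?_
  rw [← h, disc_t121max, pow_one]

theorem stabCard_pure (hp : p % 3 = 1) {x : ℤ_[p]} (hx : x ≠ 0)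
    (hr : ∀ u v, eval ![1, 0, 0, x] u v = 0 → u = 0 ∧ v = 0) :
    stabCard (![1, 0, 0, x] : Form ℤ_[p]) = 3 := by
  obtain ⟨t, ht, ht3⟩ := exists_sqrt_neg_three hp
  have hd : disc (![1, 0, 0, x] : Form ℤ_[p]) = (3 * t * x) ^ 2 := by
    simp [disc]; linear_combination -9 * x ^ 2 * ht3
  have h3 : (3 : ℤ_[p]) ≠ 0 := by norm_num
  have hs : 3 * t * x ≠ 0 := mul_ne_zero (mul_ne_zero h3 ht.ne_zero) hx
  obtain ⟨w, hw⟩ := isUnit_iff_exists_inv.1 (isUnit_two (p := p) (by rintro rfl; omega))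
  rw [stabCard_of_no_root (by rw [hd]; exact pow_ne_zero 2 hs) hr]
  refine ncard_stabOne_of_sq (s := 3 * t * x) (A := 0) (B := t) (C := 0) (α := w * (-1 - t))
    (δ := w * (-1 + t)) hs hd (by simp [hess]) ?_ (by simp [hess]) ?_ ?_
  · simp [hess]; linear_combination -3 * x * ht3
  · linear_combination (-1 - t) * hw
  · linear_combination (-1 + t) * hw

theorem stabCard_t13max (hp : p % 3 = 1) {α : ℤ_[p]} (hα : IsUnit α) :
    stabCard (![1, 0, 0, p * α] : Form ℤ_[p]) = 3 := by
  have hp0 : (p : ℤ_[p]) ≠ 0 := by exact_mod_cast (Fact.out : p.Prime).ne_zero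
  refine stabCard_pure hp (mul_ne_zero hp0 hα.ne_zero) fun u v h => ?_
  exact no_root_of_eisenstein (b := 0) (c := 0) hα u v (by simpa using h)

theorem stabCard_irr_three : stabCard (![1, 0, -1, 1] : Form ℤ_[3]) = 3 := by
  obtain ⟨s, hs, hs2, -⟩ := exists_sqrt 3 (by norm_num) (u := (-23 : ℤ_[3])) (s := 1) isUnit_one
    ⟨-8, by norm_num⟩
  obtain ⟨w, hw⟩ := isUnit_iff_exists_inv.1 (isUnit_two (p := 3) (by norm_num))
  obtain ⟨r, hr⟩ := isUnit_iff_exists_inv.1 hs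
  have hd : disc (![1, 0, -1, 1] : Form ℤ_[3]) = s ^ 2 := by rw [hs2]; simp [disc]; norm_num
  rw [stabCard_of_no_root isUnit_disc_three_irr.ne_zero (no_root_of_t3 mem_t3_three)]
  refine ncard_stabOne_of_sq (s := s) (A := 3 * r) (B := -9 * r) (C := r) (α := w * (-1 + 9 * r))
    (δ := w * (-1 - 9 * r)) hs.ne_zero hd ?_ ?_ ?_ ?_ ?_
  · simp [hess]; linear_combination -3 * hr
  · simp [hess]; linear_combination -9 * hr
  · simp [hess]; linear_combination -hr
  · linear_combination (-1 + 9 * r) * hw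
  · linear_combination (-1 - 9 * r) * hw

theorem no_root_wildForm {t : ℤ × ℤ × ℤ} (ht : t ∈ wildIndices) (u v : ℤ_[3])
    (huv : eval (wildForm t) u v = 0) : u = 0 ∧ v = 0 := by
  have hd : ∀ t ∈ wildIndices, ¬ (3 : ℤ) ∣ t.2.2 := by decide
  have hu : IsUnit ((t.2.2 : ℤ) : ℤ_[3]) := by
    rw [isUnit_intCast_iff]
    exact_mod_cast hd t ht
  exact no_root_of_eisenstein (b := t.1) (c := t.2.1) hu u v (by simpa [wildForm] using huv)

/-- The discriminant is not a square, having odd valuation or unit part congruent to -1 modulo 3. -/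
theorem stabCard_wildForm_one {t : ℤ × ℤ × ℤ} (ht : t ∈ wildIndices) {k : ℕ} {n : ℤ}
    (hd : disc (wildForm t) = ((3 : ℕ) : ℤ_[3]) ^ k * n) (hn : ¬ (3 : ℤ) ∣ n)
    (h : Odd k ∨ (3 : ℤ) ∣ n + 1) : stabCard (wildForm t) = 1 := by
  have hu : IsUnit (n : ℤ_[3]) := by rw [isUnit_intCast_iff]; exact_mod_cast hn
  have hd0 : disc (wildForm t) ≠ 0 := by
    rw [hd]; exact mul_ne_zero (pow_ne_zero k (by norm_num)) hu.ne_zero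
  rw [stabCard_of_no_root hd0 (no_root_wildForm ht), stabOne_eq_singleton hd0,
    Set.ncard_singleton]
  intro x y hy
  rw [hd]
  refine mul_sq_ne_sq hu (h.imp_right fun h => ?_) x y hy
  have h1 : ((n : ℤ) : ZMod 3) = -1 := by
    rw [← sub_eq_zero, sub_neg_eq_add]
    exact_mod_cast (ZMod.intCast_zmod_eq_zero_iff_dvd _ 3).2 (by exact_mod_cast h)
  rw [map_intCast, h1]
  decide

/-- The discriminant is 81(4n - 3n²), and the second factor is 1 modulo 3, hence a square. -/
theorem stabCard_wildForm_three {n : ℤ} (ht : (-1, 0, n) ∈ wildIndices)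
    (h : (3 : ℤ) ∣ 4 * n - 3 * n ^ 2 - 1) : stabCard (wildForm (-1, 0, n)) = 3 := by
  obtain ⟨w, hw⟩ := isUnit_iff_exists_inv.1 (isUnit_two (p := 3) (by norm_num))
  obtain ⟨k, hk⟩ := h
  obtain ⟨s, hs, hs2, -⟩ := exists_sqrt 3 (by norm_num) (u := (4 * n - 3 * n ^ 2 : ℤ_[3])) (s := 1)
    isUnit_one ⟨k, by
      have : ((4 * n - 3 * n ^ 2 - 1 : ℤ) : ℤ_[3]) = ((3 * k : ℤ) : ℤ_[3]) := by rw [hk]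
      push_cast at this ⊢
      linear_combination this⟩
  obtain ⟨r, hr⟩ := isUnit_iff_exists_inv.1 hs
  have hd : disc (wildForm (-1, 0, n)) = (9 * s) ^ 2 := by
    rw [mul_pow, hs2]; simp [wildForm, disc]; ring
  have h9 : (9 * s : ℤ_[3]) ≠ 0 := mul_ne_zero (by norm_num) hs.ne_zero
  rw [stabCard_of_no_root (by rw [hd]; exact pow_ne_zero 2 h9) (no_root_wildForm ht)]
  refine ncard_stabOne_of_sq (s := 9 * s) (A := r) (B := -3 * n * r) (C := 3 * n * r)
    (α := w * (-1 + 3 * n * r)) (δ := w * (-1 - 3 * n * r)) h9 hd ?_ ?_ ?_ ?_ ?_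
  · simp [wildForm, hess]; linear_combination -9 * hr
  · simp [wildForm, hess]; linear_combination -27 * n * hr
  · simp [wildForm, hess]; linear_combination -27 * n * hr
  · linear_combination (-1 + 3 * n * r) * hw
  · linear_combination (-1 - 3 * n * r) * hw

end StabilizerTable

end BinaryCubic

namespace BinaryCubic

/-! ### Nonvanishing of the table values. -/

section PrimeTerm

variable {m : ℕ} [NeZero m] {χ : DirichletCharacter ℂ m} {p : ℕ} [Fact p.Prime]

theorem primeTerm_pow_three (hχ3 : χ ^ 3 = 1) : primeTerm χ p ^ 3 = (p : ℂ)⁻¹ := by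
  have hp : p.Prime := Fact.out
  have hp0 : (p : ℂ) ≠ 0 := by exact_mod_cast hp.ne_zero
  have hu : IsUnit (p : ZMod (m / p ^ condExp m p)) :=
    (ZMod.isUnit_iff_coprime _ _).2 (Nat.coprime_ordCompl hp (NeZero.ne m))
  rw [primeTerm, mul_pow, ← pow_mul, mul_comm 2 3, pow_mul, coprimaryPart_pow_three χ p hχ3 hu,
    one_pow, one_mul, ← Complex.cpow_nat_mul, ← Complex.cpow_neg_one]
  norm_num

theorem primeTerm_ne_zero (hχ3 : χ ^ 3 = 1) : primeTerm χ p ≠ 0 := by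
  intro h
  have := primeTerm_pow_three (p := p) hχ3
  rw [h, zero_pow three_ne_zero, eq_comm, inv_eq_zero] at this
  exact (Fact.out : p.Prime).ne_zero (by exact_mod_cast this)

/-- The cube of `primeTerm` is 1/p, while that of -x is -1. Nonvanishing is what the admissibility
criterion requires. -/
theorem add_primeTerm_ne_zero (hχ3 : χ ^ 3 = 1) {x : ℂ} (hx : x ^ 3 = 1) :
    x + primeTerm χ p ≠ 0 := by
  intro h
  have h1 := primeTerm_pow_three (p := p) hχ3
  have hp0 : (p : ℂ) ≠ 0 := by exact_mod_cast (Fact.out : p.Prime).ne_zero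
  rw [eq_neg_of_add_eq_zero_right h, neg_pow, hx] at h1
  field_simp at h1
  have h2 : ((p + 1 : ℕ) : ℂ) = 0 := by push_cast; linear_combination -h1
  exact Nat.succ_ne_zero p (by exact_mod_cast h2)

theorem minimalExp_of_tableRow {σ : MaxType} {e₀ : ℕ}
    (h : ∀ a ∈ formsOfType p σ, ∃ v d s, TableRow χ p a e₀ v d s)
    (h' : ∀ e, (∀ a ∈ formsOfType p σ, Admissible χ p e a) → e₀ ≤ e) : MinimalExp χ p σ e₀ := by
  refine ⟨fun a ha => ?_, fun e he => h' e he⟩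
  obtain ⟨v, d, s, hrow⟩ := h a ha
  exact (hrow.1 e₀ le_rfl).1

end PrimeTerm

/-! ### The table for p ≡ 1 mod 3. -/

section Tame

variable {m : ℕ} [NeZero m] {χ : DirichletCharacter ℂ m} {p : ℕ} [Fact p.Prime]

theorem no_root_of_mem_orbit {R : Type*} [CommRing R] {x a : Form R} (h : x ∈ orbit a)
    (hr : ∀ u v, eval a u v = 0 → u = 0 ∧ v = 0) (u v : R) (huv : eval x u v = 0) :
    u = 0 ∧ v = 0 := by
  obtain ⟨g, rfl⟩ := h
  have h1 := ddet_mul_eval_act g a u v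
  rw [huv, mul_zero] at h1
  obtain ⟨e1, e2⟩ := hr _ _ h1.symm
  have hd : ddet g = g.val 0 0 * g.val 1 1 - g.val 0 1 * g.val 1 0 := rfl
  have hu := isUnit_ddet g
  rw [hd] at hu
  constructor
  · apply hu.mul_left_cancel
    linear_combination g.val 1 1 * e1 - g.val 1 0 * e2
  · apply hu.mul_left_cancel
    linear_combination g.val 0 0 * e2 - g.val 0 1 * e1

theorem table_t3 (hχ : χ.IsPrimitive) (hχ3 : χ ^ 3 = 1) (hpm : p ∣ m)
    (hp : p % 3 = 1) : MinimalExp χ p .t3 1 ∧ ∀ a ∈ formsOfType p .t3,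
    TableRow χ p a 1 (tau χ p ^ 3 / (p : ℂ) ^ 2) 1 3 := by
  have hc := condExp_of_one_mod_three hχ hχ3 hpm hp
  refine ⟨hc ▸ minimalExp_t3 hp hχ hχ3 hpm, fun a ha => ?_⟩
  obtain ⟨α, hα, h⟩ := exists_mem_orbit_of_t3 hp ha
  refine tableRow_of_isUnit_disc χ p hχ3 hpm hc.le (fun e he => normC_irr hχ hχ3 hpm hp he hα)
    (isUnit_disc_diagonal (by rintro rfl; omega) hα) (stabCard_pure hp hα.ne_zero ?_) h
  exact no_root_of_mem_orbit (mem_orbit_symm h) (no_root_of_t3 ha)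

theorem table_t21 (hχ : χ.IsPrimitive) (hχ3 : χ ^ 3 = 1) (hpm : p ∣ m)
    (hp : p % 3 = 1) : MinimalExp χ p .t21 1 ∧ ∀ a ∈ formsOfType p .t21,
    TableRow χ p a 1 (-(tau χ p ^ 3 / (p : ℂ) ^ 2)) 1 2 := by
  have hc := condExp_of_one_mod_three hχ hχ3 hpm hp
  have hp2 : p ≠ 2 := by rintro rfl; omega
  refine ⟨hc ▸ minimalExp_t21 hp2 hpm, fun a ha => ?_⟩
  obtain ⟨d, hd, hns, h⟩ := exists_mem_orbit_of_t21 hp2 ha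
  exact tableRow_of_isUnit_disc χ p hχ3 hpm hc.le
    (fun e he => normC_linQuad hχ hχ3 hpm hp he hd hns) (isUnit_disc_linQuad hp2 hd)
    (stabCard_t21 hd hns) h

theorem table_t111 (hχ : χ.IsPrimitive) (hχ3 : χ ^ 3 = 1) (hpm : p ∣ m)
    (hp : p % 3 = 1) : MinimalExp χ p .t111 1 ∧ ∀ a ∈ formsOfType p .t111,
    TableRow χ p a 1 (tau χ p ^ 3 / (p : ℂ) ^ 2) 1 6 := by
  have hc := condExp_of_one_mod_three hχ hχ3 hpm hp
  refine ⟨hc ▸ minimalExp_t111 hpm, fun a ha => ?_⟩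
  exact tableRow_of_isUnit_disc χ p hχ3 hpm hc.le (fun e he => normC_split hχ hχ3 hpm hp he)
    (by simp [disc]) stabCard_split (mem_orbit_of_t111 ha)

theorem row_t121max (hχ : χ.IsPrimitive) (hχ3 : χ ^ 3 = 1) (hpm : p ∣ m)
    (hp : p % 3 = 1) (α : ℤ_[p]ˣ) {a : Form ℤ_[p]} (ha : a ∈ orbit ![0, 1, 0, (p : ℤ_[p]) * α]) :
    TableRow χ p a 2 (primaryPart χ p 2 * coprimaryPart χ p p ^ 2 * (p : ℂ) ^ (-(1 / 3) : ℂ))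
      p 2 := by
  have hc := condExp_of_one_mod_three hχ hχ3 hpm hp
  have hp2 : p ≠ 2 := by rintro rfl; omega
  have h2 : primaryPart χ p 2 = unitChar χ p 2 := by
    have := primaryPart_natCast χ p 2
    exact_mod_cast this
  rw [h2, mul_assoc, show coprimaryPart χ p p ^ 2 * (p : ℂ) ^ (-(1 / 3) : ℂ) = primeTerm χ p from rfl]
  have := tableRow_of_isolated χ p hχ3 hpm (k := 1) (hc.le.trans one_le_two)
    (isolated_t121max hp2 α.isUnit) (mul_ne_zero (unitChar_ne_zero χ p hχ3 (isUnit_two hp2))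
      (primeTerm_ne_zero hχ3)) (fun e he => normC_121 hχ hχ3 hpm hp he α)
    (by rw [pow_one]; exact disc_t121max _) (((isUnit_two hp2).pow 2).mul α.isUnit).neg
    (stabCard_t121max hp2 α.isUnit) ha
  rwa [pow_one] at this

theorem table_t121max (hχ : χ.IsPrimitive) (hχ3 : χ ^ 3 = 1) (hpm : p ∣ m)
    (hp : p % 3 = 1) : MinimalExp χ p .t121max 2 ∧
    formsOfType p .t121max = (⋃ α : ℤ_[p]ˣ, orbit ![0, 1, 0, (p : ℤ_[p]) * α]) ∧
    ∀ α : ℤ_[p]ˣ, ∀ a ∈ orbit ![0, 1, 0, (p : ℤ_[p]) * α], TableRow χ p a 2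
      (primaryPart χ p 2 * coprimaryPart χ p p ^ 2 * (p : ℂ) ^ (-(1 / 3) : ℂ)) p 2 := by
  have hc := condExp_of_one_mod_three hχ hχ3 hpm hp
  have hp2 : p ≠ 2 := by rintro rfl; omega
  refine ⟨minimalExp_of_tableRow (fun a ha => ?_) fun e he => ?_, ?_,
    fun α a ha => row_t121max hχ hχ3 hpm hp α ha⟩
  · obtain ⟨α, hα, h⟩ := mem_orbit_of_t121max hp2 ha
    exact ⟨_, _, _, row_t121max hχ hχ3 hpm hp hα.unit h⟩
  · by_contra hlt
    have h1 := he _ (mem_t121max isUnit_one)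
    have hce := h1.1
    obtain rfl : e = 1 := by omega
    -- This form agrees with (0, 1, 0, p) modulo p and has discriminant zero, so e = 1 is not
    -- admissible.
    refine (h1.2.2 ![0, 1, 0, 0] ((mapForm_eq_iff p 1 _ _).2 fun i => ?_)).1 (by simp [disc])
    fin_cases i <;> simp
  · ext a
    rw [Set.mem_iUnion]
    constructor
    · intro ha
      obtain ⟨α, hα, h⟩ := mem_orbit_of_t121max hp2 ha
      exact ⟨hα.unit, h⟩
    · rintro ⟨α, h⟩
      exact formsOfType_ramified_of_mem_orbit p (mem_t121max α.isUnit) h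

theorem row_t13max (hχ : χ.IsPrimitive) (hχ3 : χ ^ 3 = 1) (hpm : p ∣ m)
    (hp : p % 3 = 1) (α : ℤ_[p]ˣ) {a : Form ℤ_[p]} (ha : a ∈ orbit ![1, 0, 0, (p : ℤ_[p]) * α]) :
    TableRow χ p a 2 (primaryPart χ p (PadicInt.toZModPow _ (α : ℤ_[p]))
      + primaryPart χ p (PadicInt.toZModPow _ (α : ℤ_[p])) ^ 2
        * coprimaryPart χ p p ^ 2 * (p : ℂ) ^ (-(1 / 3) : ℂ)) (p ^ 2) 3 := by
  have hc := condExp_of_one_mod_three hχ hχ3 hpm hp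
  have hp2 : p ≠ 2 := by rintro rfl; omega
  have hp3 : p ≠ 3 := by rintro rfl; omega
  rw [← unitChar_apply, mul_assoc,
    show coprimaryPart χ p p ^ 2 * (p : ℂ) ^ (-(1 / 3) : ℂ) = primeTerm χ p from rfl]
  have hX := unitChar_pow_three χ p hχ3 α.isUnit
  refine tableRow_of_isolated χ p hχ3 hpm (hc.le.trans one_le_two)
    (isolated_t13max hp2 hp3 α.isUnit) ?_ (fun e he => normC_13 hχ hχ3 hpm hp he α)
    (u := -(3 ^ 3 * (α : ℤ_[p]) ^ 2)) ?_ (((isUnit_three hp3).pow 3).mul (α.isUnit.pow 2)).neg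
    (stabCard_t13max hp α.isUnit) ha
  -- With X = χ_p(α) and T the prime term, X³ = 1 gives X + X²T = X²(X² + T).
  · have h1 := add_primeTerm_ne_zero (p := p) hχ3 (x := unitChar χ p α ^ 2)
      (by rw [← pow_mul, mul_comm, pow_mul, hX, one_pow])
    have h2 := mul_ne_zero (pow_ne_zero 2 (unitChar_ne_zero χ p hχ3 α.isUnit)) h1
    convert h2 using 1
    linear_combination -unitChar χ p α * hX
  · simp [disc]; ring

theorem table_t13max (hχ : χ.IsPrimitive) (hχ3 : χ ^ 3 = 1) (hpm : p ∣ m)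
    (hp : p % 3 = 1) : MinimalExp χ p .t13max 2 ∧
    formsOfType p .t13max = (⋃ α : ℤ_[p]ˣ, orbit ![1, 0, 0, (p : ℤ_[p]) * α]) ∧
    ∀ α : ℤ_[p]ˣ, ∀ a ∈ orbit ![1, 0, 0, (p : ℤ_[p]) * α], TableRow χ p a 2
      (primaryPart χ p (PadicInt.toZModPow _ (α : ℤ_[p]))
        + primaryPart χ p (PadicInt.toZModPow _ (α : ℤ_[p])) ^ 2
          * coprimaryPart χ p p ^ 2 * (p : ℂ) ^ (-(1 / 3) : ℂ)) (p ^ 2) 3 := by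
  have hc := condExp_of_one_mod_three hχ hχ3 hpm hp
  have hp2 : p ≠ 2 := by rintro rfl; omega
  have hp3 : p ≠ 3 := by rintro rfl; omega
  refine ⟨minimalExp_of_tableRow (fun a ha => ?_) fun e he => ?_, ?_,
    fun α a ha => row_t13max hχ hχ3 hpm hp α ha⟩
  · obtain ⟨α, hα, h⟩ := exists_mem_orbit_of_t13max hp2 hp3 ha
    exact ⟨_, _, _, row_t13max hχ hχ3 hpm hp hα.unit h⟩
  · by_contra hlt
    have h1 := he _ (mem_t13max isUnit_one)
    have hce := h1.1
    obtain rfl : e = 1 := by omega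
    -- Congruent to (1, 0, 0, p) modulo p, with discriminant zero.
    refine (h1.2.2 ![1, 0, 0, 0] ((mapForm_eq_iff p 1 _ _).2 fun i => ?_)).1 (by simp [disc])
    fin_cases i <;> simp
  · ext a
    rw [Set.mem_iUnion]
    constructor
    · intro ha
      obtain ⟨α, hα, h⟩ := exists_mem_orbit_of_t13max hp2 hp3 ha
      exact ⟨hα.unit, h⟩
    · rintro ⟨α, h⟩
      exact formsOfType_ramified_of_mem_orbit p (mem_t13max α.isUnit) h

end Tame

end BinaryCubic

namespace BinaryCubic

/-! ### The table for p = 3: unramified and partially ramified types. -/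

section Wild

variable {m : ℕ} [NeZero m] {χ : DirichletCharacter ℂ m}

theorem tau_three_div (hχ : χ.IsPrimitive) (hχ3 : χ ^ 3 = 1) (hpm : 3 ∣ m) :
    tau χ 3 ^ 3 / ((3 : ℕ) : ℂ) ^ 4 = unitChar χ 3 2 / 3 := by
  rw [tau_three_pow hχ hχ3 hpm]
  push_cast
  ring

theorem primaryPart_two : primaryPart χ 3 2 = unitChar χ 3 2 := by
  have := primaryPart_natCast χ 3 2
  exact_mod_cast this

theorem primaryPart_four : primaryPart χ 3 4 = unitChar χ 3 2 ^ 2 := by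
  have := primaryPart_natCast χ 3 4
  push_cast at this
  rw [this, ← map_pow]
  norm_num

theorem primaryPart_seven (hχ : χ.IsPrimitive) (hχ3 : χ ^ 3 = 1) (hpm : 3 ∣ m) :
    primaryPart χ 3 7 = unitChar χ 3 2 := by
  have := primaryPart_natCast χ 3 7
  push_cast at this
  have h := unitChar_three_intCast hχ hχ3 hpm 7
  push_cast at h
  rw [this, h]
  norm_num [charTable]

theorem wild_table_t3 (hχ : χ.IsPrimitive) (hχ3 : χ ^ 3 = 1) (hpm : 3 ∣ m) :
    MinimalExp χ 3 .t3 2 ∧ ∀ a ∈ formsOfType 3 .t3,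
      TableRow χ 3 a 2 (tau χ 3 ^ 3 / ((3 : ℕ) : ℂ) ^ 4) 1 3 := by
  have hc := condExp_three hχ hχ3 hpm
  rw [tau_three_div hχ hχ3 hpm]
  exact ⟨hc ▸ minimalExp_t3_three hpm, fun a ha => tableRow_of_isUnit_disc χ 3 hχ3 hpm hc.le
    (fun e he => normC_three_irr hχ hχ3 hpm he) isUnit_disc_three_irr stabCard_irr_three
    (mem_orbit_of_t3_three ha)⟩

theorem wild_table_t21 (hχ : χ.IsPrimitive) (hχ3 : χ ^ 3 = 1) (hpm : 3 ∣ m) :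
    MinimalExp χ 3 .t21 2 ∧ ∀ a ∈ formsOfType 3 .t21,
      TableRow χ 3 a 2 (tau χ 3 ^ 3 / ((3 : ℕ) : ℂ) ^ 4) 1 2 := by
  have hc := condExp_three hχ hχ3 hpm
  have h3 : (3 : ℕ) ≠ 2 := by norm_num
  rw [tau_three_div hχ hχ3 hpm]
  refine ⟨hc ▸ minimalExp_t21 h3 hpm, fun a ha => tableRow_of_isUnit_disc χ 3 hχ3 hpm hc.le
    (fun e he => normC_three_linQuad hχ hχ3 hpm he) ?_ ?_ (mem_orbit_of_t21_three ha)⟩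
  · simpa using isUnit_disc_linQuad (p := 3) h3 (d := -1) (by simp)
  · have := stabCard_t21 (p := 3) (d := -1) (by simp) (by rw [map_neg, map_one]; decide)
    simpa using this

theorem wild_table_t111 (hχ : χ.IsPrimitive) (hχ3 : χ ^ 3 = 1) (hpm : 3 ∣ m) :
    MinimalExp χ 3 .t111 2 ∧ ∀ a ∈ formsOfType 3 .t111,
      TableRow χ 3 a 2 (tau χ 3 ^ 3 / ((3 : ℕ) : ℂ) ^ 4) 1 6 := by
  have hc := condExp_three hχ hχ3 hpm
  rw [tau_three_div hχ hχ3 hpm]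
  exact ⟨hc ▸ minimalExp_t111 hpm, fun a ha => tableRow_of_isUnit_disc χ 3 hχ3 hpm hc.le
    (fun e he => normC_three_split hχ hχ3 hpm he) (by simp [disc]) stabCard_split
    (mem_orbit_of_t111 ha)⟩

theorem unitChar_two_sq_ne_one (hχ : χ.IsPrimitive) (hχ3 : χ ^ 3 = 1) (hpm : 3 ∣ m) :
    unitChar χ 3 2 ^ 2 ≠ 1 := by
  intro h
  have h1 := unitChar_two_relation hχ hχ3 hpm
  have h2 : unitChar χ 3 2 = -2 := by linear_combination h1 - h
  rw [h2] at h
  norm_num at h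

/-- Conductor exponent 2 leaves only e = 2 to be excluded, and two forms congruent modulo 9 whose
discriminants have equal valuation but different characters exclude it. -/
theorem three_le_of_admissible (hχ : χ.IsPrimitive) (hχ3 : χ ^ 3 = 1) (hpm : 3 ∣ m) {e : ℕ}
    {a a' : Form ℤ_[3]} (h : Admissible χ 3 e a) {k : ℕ} {n n' : ℤ}
    (ha : disc a = ((3 : ℕ) : ℤ_[3]) ^ k * n) (ha' : disc a' = ((3 : ℕ) : ℤ_[3]) ^ k * n')
    (hn : ¬ (3 : ℤ) ∣ n) (hn' : ¬ (3 : ℤ) ∣ n') (haa' : ∀ i, ((3 : ℕ) : ℤ_[3]) ^ 2 ∣ a' i - a i)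
    (hne : charTable (unitChar χ 3 2) n' ≠ charTable (unitChar χ 3 2) n) : 3 ≤ e := by
  by_contra hlt
  have hce := h.1
  rw [condExp_three hχ hχ3 hpm] at hce
  obtain rfl : e = 2 := by omega
  have h1 := (h.2.2 a' ((mapForm_eq_iff 3 2 _ _).2 haa')).2
  have hu : IsUnit (n : ℤ_[3]) := by rw [isUnit_intCast_iff]; exact_mod_cast hn
  have hu' : IsUnit (n' : ℤ_[3]) := by rw [isUnit_intCast_iff]; exact_mod_cast hn'
  rw [discChar_eq χ 3 (u := hu.unit) ha, discChar_eq χ 3 (u := hu'.unit) ha', IsUnit.unit_spec,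
    IsUnit.unit_spec, unitChar_three_intCast hχ hχ3 hpm, unitChar_three_intCast hχ hχ3 hpm] at h1
  exact hne h1

theorem isUnit_int_of_not_dvd {n : ℤ} (hn : ¬ (3 : ℤ) ∣ n) : IsUnit (n : ℤ_[3]) := by
  rw [isUnit_intCast_iff]
  exact_mod_cast hn

theorem three_cpow : ((3 : ℕ) : ℂ) ^ (-(4 / 3) : ℂ) = ((3 : ℕ) : ℂ) ^ (-(1 / 3) : ℂ) / 3 := by
  rw [show (-(4 / 3) : ℂ) = -(1 / 3) - 1 by norm_num, Complex.cpow_sub _ _ (by norm_num),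
    Complex.cpow_one]
  norm_num

theorem wild_row_t121max (hχ : χ.IsPrimitive) (hχ3 : χ ^ 3 = 1) (hpm : 3 ∣ m) {a : Form ℤ_[3]}
    (ha : a ∈ orbit ![0, 1, 0, 3]) : TableRow χ 3 a 3 ((1 - primaryPart χ 3 4) *
      coprimaryPart χ 3 ((3 : ℕ) : ZMod (m / 3 ^ condExp m 3)) ^ 2 *
      ((3 : ℕ) : ℂ) ^ (-(4 / 3) : ℂ)) 3 2 := by
  have hc := condExp_three hχ hχ3 hpm
  have hval : (1 - primaryPart χ 3 4) *
      coprimaryPart χ 3 ((3 : ℕ) : ZMod (m / 3 ^ condExp m 3)) ^ 2 *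
      ((3 : ℕ) : ℂ) ^ (-(4 / 3) : ℂ) = (1 - unitChar χ 3 2 ^ 2) * primeTerm χ 3 / 3 := by
    rw [primaryPart_four, three_cpow, primeTerm]
    ring
  have hne : (1 - unitChar χ 3 2 ^ 2) * primeTerm χ 3 / 3 ≠ 0 :=
    div_ne_zero (mul_ne_zero (sub_ne_zero.2 (unitChar_two_sq_ne_one hχ hχ3 hpm).symm)
      (primeTerm_ne_zero hχ3)) (by norm_num)
  rw [hval]
  have hr := isolated_t121max (p := 3) (by norm_num) (α := 1) isUnit_one
  have hs := stabCard_t121max (p := 3) (by norm_num) (α := 1) isUnit_one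
  rw [mul_one] at hr hs
  exact tableRow_of_isolated χ 3 hχ3 hpm (k := 1) (u := ((-4 : ℤ) : ℤ_[3])) (hc.le.trans (by norm_num))
    (hr.mono 3 (by norm_num)) hne (fun e he => normC_three_0_1_0_3 hχ hχ3 hpm he)
    (by simp [disc]; norm_num) (isUnit_int_of_not_dvd (by norm_num)) hs ha

theorem wild_row_t121max_neg (hχ : χ.IsPrimitive) (hχ3 : χ ^ 3 = 1) (hpm : 3 ∣ m) {a : Form ℤ_[3]}
    (ha : a ∈ orbit ![0, 1, 0, -3]) : TableRow χ 3 a 3 (-((1 - primaryPart χ 3 4) *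
      coprimaryPart χ 3 ((3 : ℕ) : ZMod (m / 3 ^ condExp m 3)) ^ 2 *
      ((3 : ℕ) : ℂ) ^ (-(4 / 3) : ℂ))) 3 2 := by
  have hc := condExp_three hχ hχ3 hpm
  have hval : -((1 - primaryPart χ 3 4) *
      coprimaryPart χ 3 ((3 : ℕ) : ZMod (m / 3 ^ condExp m 3)) ^ 2 *
      ((3 : ℕ) : ℂ) ^ (-(4 / 3) : ℂ)) = -((1 - unitChar χ 3 2 ^ 2) * primeTerm χ 3 / 3) := by
    rw [primaryPart_four, three_cpow, primeTerm]
    ring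
  have hne : -((1 - unitChar χ 3 2 ^ 2) * primeTerm χ 3 / 3) ≠ 0 :=
    neg_ne_zero.2 (div_ne_zero (mul_ne_zero
      (sub_ne_zero.2 (unitChar_two_sq_ne_one hχ hχ3 hpm).symm) (primeTerm_ne_zero hχ3))
      (by norm_num))
  rw [hval]
  have hr := isolated_t121max (p := 3) (by norm_num) (α := -1) (by simp)
  have hs := stabCard_t121max (p := 3) (by norm_num) (α := -1) (by simp)
  rw [mul_neg_one] at hr hs
  exact tableRow_of_isolated χ 3 hχ3 hpm (k := 1) (u := ((4 : ℤ) : ℤ_[3])) (hc.le.trans (by norm_num))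
    (hr.mono 3 (by norm_num)) hne (fun e he => normC_three_0_1_0_neg3 hχ hχ3 hpm he)
    (by simp [disc]; norm_num) (isUnit_int_of_not_dvd (by norm_num)) hs ha

theorem formsOfType_t121max_three :
    formsOfType 3 .t121max = orbit ![0, 1, 0, 3] ∪ orbit ![0, 1, 0, -3] := by
  have h1 := mem_t121max (p := 3) (α := 1) isUnit_one
  have h2 := mem_t121max (p := 3) (α := -1) (by simp)
  rw [mul_one] at h1
  rw [mul_neg_one] at h2
  ext a
  constructor
  · exact mem_orbit_of_t121max_three
  · rintro (h | h)
    · exact formsOfType_ramified_of_mem_orbit 3 h1 h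
    · exact formsOfType_ramified_of_mem_orbit 3 h2 h

theorem minimalExp_t121max_three (hχ : χ.IsPrimitive) (hχ3 : χ ^ 3 = 1) (hpm : 3 ∣ m) :
    MinimalExp χ 3 .t121max 3 := by
  refine minimalExp_of_tableRow (fun a ha => ?_) fun e he => ?_
  · rcases mem_orbit_of_t121max_three ha with h | h
    · exact ⟨_, _, _, wild_row_t121max hχ hχ3 hpm h⟩
    · exact ⟨_, _, _, wild_row_t121max_neg hχ hχ3 hpm h⟩
  · have h1 := he ![0, 1, 0, 3] (by rw [formsOfType_t121max_three]; exact Or.inl (mem_orbit_self _))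
    -- The unit parts -4 and -16 of the discriminants have characters w² and w, where w = χ_3(2).
    refine three_le_of_admissible hχ hχ3 hpm h1 (a' := ![0, 1, 0, 12]) (k := 1) (n := -4) (n' := -16)
      (by simp [disc]; norm_num) (by simp [disc]; norm_num) (by norm_num) (by norm_num) ?_ ?_
    · intro i
      fin_cases i <;> simp
      exact ⟨1, by norm_num⟩
    · have h2 := unitChar_two_sq_ne_one hχ hχ3 hpm
      have h3 := unitChar_two_relation hχ hχ3 hpm
      norm_num [charTable]
      intro h4
      apply h2
      have h5 : unitChar χ 3 2 * (unitChar χ 3 2 - 1) = 0 := by linear_combination -h4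
      rcases mul_eq_zero.1 h5 with h | h
      · rw [h] at h3; norm_num at h3
      · rw [sub_eq_zero.1 h]; norm_num

end Wild

end BinaryCubic

namespace BinaryCubic

/-! ### The table for p = 3: totally ramified types. -/

section WildRamified

variable {m : ℕ} [NeZero m] {χ : DirichletCharacter ℂ m}

theorem unitChar_two_pow_three (hχ : χ.IsPrimitive) (hχ3 : χ ^ 3 = 1) (hpm : 3 ∣ m) :
    unitChar χ 3 2 ^ 3 = 1 := by
  linear_combination (unitChar χ 3 2 - 1) * unitChar_two_relation hχ hχ3 hpm

theorem unitChar_two_ne_zero (hχ : χ.IsPrimitive) (hχ3 : χ ^ 3 = 1) (hpm : 3 ∣ m) :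
    unitChar χ 3 2 ≠ 0 := by
  intro h
  have := unitChar_two_relation hχ hχ3 hpm
  rw [h] at this
  norm_num at this

theorem unitChar_two_ne_one (hχ : χ.IsPrimitive) (hχ3 : χ ^ 3 = 1) (hpm : 3 ∣ m) :
    unitChar χ 3 2 ≠ 1 := fun h =>
  unitChar_two_sq_ne_one hχ hχ3 hpm (by rw [h, one_pow])

theorem two_mul_unitChar_two_add_one_ne_zero (hχ : χ.IsPrimitive) (hχ3 : χ ^ 3 = 1)
    (hpm : 3 ∣ m) : 2 * unitChar χ 3 2 + 1 ≠ 0 := by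
  intro h
  have h1 := unitChar_two_relation hχ hχ3 hpm
  have : (3 : ℂ) = 0 := by linear_combination 4 * h1 - (2 * unitChar χ 3 2 + 1) * h
  norm_num at this

theorem tableRow_wildForm (hχ : χ.IsPrimitive) (hχ3 : χ ^ 3 = 1) (hpm : 3 ∣ m)
    {t : ℤ × ℤ × ℤ} (ht : t ∈ wildIndices) {k s : ℕ} {n : ℤ} {val : ℂ} {a r : Form ℤ_[3]}
    (hr : wildForm t = r) (hd : disc (wildForm t) = ((3 : ℕ) : ℤ_[3]) ^ k * n) (hn : ¬ (3 : ℤ) ∣ n)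
    (hs : stabCard (wildForm t) = s) (hval : val ≠ 0)
    (hC : ∀ e, 3 ≤ e → normC χ 3 e r = val) (ha : a ∈ orbit r) :
    TableRow χ 3 a 3 val (3 ^ k) s := by
  subst hr
  exact tableRow_of_isolated χ 3 hχ3 hpm ((condExp_three hχ hχ3 hpm).le.trans (by norm_num))
    (isolated_wildForm ht) hval hC hd (isUnit_int_of_not_dvd hn) hs ha

theorem tableRow_wildForm_one (hχ : χ.IsPrimitive) (hχ3 : χ ^ 3 = 1) (hpm : 3 ∣ m)
    {t : ℤ × ℤ × ℤ} (ht : t ∈ wildIndices) {k : ℕ} {n : ℤ} {val : ℂ} {a r : Form ℤ_[3]}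
    (hr : wildForm t = r) (hd : disc r = ((3 : ℕ) : ℤ_[3]) ^ k * n) (hn : ¬ (3 : ℤ) ∣ n)
    (h : Odd k ∨ (3 : ℤ) ∣ n + 1) (hval : val ≠ 0)
    (hC : ∀ e, 3 ≤ e → normC χ 3 e r = val) (ha : a ∈ orbit r) :
    TableRow χ 3 a 3 val (3 ^ k) 1 := by
  rw [← hr] at hd
  exact tableRow_wildForm hχ hχ3 hpm ht hr hd hn (stabCard_wildForm_one ht hd hn h) hval hC ha

theorem wild_row_1_0_3_3 (hχ : χ.IsPrimitive) (hχ3 : χ ^ 3 = 1) (hpm : 3 ∣ m) {a : Form ℤ_[3]}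
    (ha : a ∈ orbit ![1, 0, 3, 3]) :
    TableRow χ 3 a 3 ((primaryPart χ 3 2 - 1) / ((3 : ℕ) : ℂ)) (3 ^ 3) 1 := by
  rw [primaryPart_two]
  exact tableRow_wildForm_one hχ hχ3 hpm (t := (0, 1, 1)) (by decide) (n := -13)
    (by simp [wildForm]) (by simp [disc]; norm_num) (by norm_num) (Or.inl (by decide))
    (div_ne_zero (sub_ne_zero.2 (unitChar_two_ne_one hχ hχ3 hpm)) (by norm_num))
    (fun e he => by simpa using normC_three_1_0_3_3 hχ hχ3 hpm he) ha

theorem wild_row_1_0_6_3 (hχ : χ.IsPrimitive) (hχ3 : χ ^ 3 = 1) (hpm : 3 ∣ m) {a : Form ℤ_[3]}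
    (ha : a ∈ orbit ![1, 0, 6, 3]) :
    TableRow χ 3 a 3 ((2 * primaryPart χ 3 2 + 1) / ((3 : ℕ) : ℂ)) (3 ^ 3) 1 := by
  rw [primaryPart_two]
  exact tableRow_wildForm_one hχ hχ3 hpm (t := (0, 2, 1)) (by decide) (n := -41)
    (by simp [wildForm]; norm_num) (by simp [disc]; norm_num) (by norm_num) (Or.inl (by decide))
    (div_ne_zero (two_mul_unitChar_two_add_one_ne_zero hχ hχ3 hpm) (by norm_num))
    (fun e he => by simpa using normC_three_1_0_6_3 hχ hχ3 hpm he) ha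

theorem wild_row_1_3_0_3 (hχ : χ.IsPrimitive) (hχ3 : χ ^ 3 = 1) (hpm : 3 ∣ m) {a : Form ℤ_[3]}
    (ha : a ∈ orbit ![1, 3, 0, 3]) :
    TableRow χ 3 a 3 (primaryPart χ 3 4 *
      coprimaryPart χ 3 ((3 : ℕ) : ZMod (m / 3 ^ condExp m 3)) ^ 2 *
      ((3 : ℕ) : ℂ) ^ (-(1 / 3) : ℂ)) (3 ^ 4) 1 := by
  rw [primaryPart_four, mul_assoc]
  exact tableRow_wildForm_one hχ hχ3 hpm (t := (1, 0, 1)) (by decide) (n := -7)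
    (by simp [wildForm]) (by simp [disc]; norm_num) (by norm_num) (Or.inr (by decide))
    (mul_ne_zero (pow_ne_zero 2 (unitChar_two_ne_zero hχ hχ3 hpm)) (primeTerm_ne_zero hχ3))
    (fun e he => normC_three_1_3_0_3 hχ hχ3 hpm he) ha

theorem wild_row_cyclic (hχ : χ.IsPrimitive) (hχ3 : χ ^ 3 = 1) (hpm : 3 ∣ m) {α : ℕ}
    (hα : α ∈ ({1, 4, 7} : Set ℕ)) {a : Form ℤ_[3]}
    (ha : a ∈ orbit ![1, -3, 0, 3 * (α : ℤ_[3])]) :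
    TableRow χ 3 a 3 (primaryPart χ 3 α ^ 2 +
      coprimaryPart χ 3 ((3 : ℕ) : ZMod (m / 3 ^ condExp m 3)) ^ 2 *
      ((3 : ℕ) : ℂ) ^ (-(1 / 3) : ℂ)) (3 ^ 4) 3 := by
  have hω := unitChar_two_pow_three hχ hχ3 hpm
  change TableRow χ 3 a 3 (primaryPart χ 3 α ^ 2 + primeTerm χ 3) (3 ^ 4) 3
  rcases hα with rfl | rfl | rfl
  · rw [Nat.cast_one, map_one, one_pow]
    exact tableRow_wildForm hχ hχ3 hpm (t := (-1, 0, 1)) (by decide) (n := 1)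
      (by simp [wildForm]) (by simp [disc, wildForm]; norm_num) (by norm_num)
      (stabCard_wildForm_three (by decide) (by norm_num)) (add_primeTerm_ne_zero hχ3 (one_pow 3))
      (fun e he => by simpa using normC_three_1_neg3_0_3 hχ hχ3 hpm he) ha
  · have h4 : primaryPart χ 3 ((4 : ℕ) : ZMod (3 ^ condExp m 3)) ^ 2 = unitChar χ 3 2 := by
      rw [Nat.cast_ofNat, primaryPart_four]
      linear_combination unitChar χ 3 2 * hω
    rw [h4]
    exact tableRow_wildForm hχ hχ3 hpm (t := (-1, 0, 4)) (by decide) (n := -32)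
      (by simp [wildForm]) (by simp [disc, wildForm]; norm_num) (by norm_num)
      (stabCard_wildForm_three (by decide) (by norm_num)) (add_primeTerm_ne_zero hχ3 hω)
      (fun e he => by
        have := normC_three_1_neg3_0_12 hχ hχ3 hpm he
        norm_num at this ⊢
        exact this) ha
  · have h7 : primaryPart χ 3 ((7 : ℕ) : ZMod (3 ^ condExp m 3)) ^ 2 = unitChar χ 3 2 ^ 2 := by
      rw [Nat.cast_ofNat, primaryPart_seven hχ hχ3 hpm]
    rw [h7]
    exact tableRow_wildForm hχ hχ3 hpm (t := (-1, 0, 7)) (by decide) (n := -119)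
      (by simp [wildForm]) (by simp [disc, wildForm]; norm_num) (by norm_num)
      (stabCard_wildForm_three (by decide) (by norm_num))
      (add_primeTerm_ne_zero hχ3 (by linear_combination (unitChar χ 3 2 ^ 3 + 1) * hω))
      (fun e he => by
        have := normC_three_1_neg3_0_21 hχ hχ3 hpm he
        norm_num at this ⊢
        exact this) ha

theorem wild_row_pure (hχ : χ.IsPrimitive) (hχ3 : χ ^ 3 = 1) (hpm : 3 ∣ m) {α : ℕ}
    (hα : α ∈ ({1, 4, 7} : Set ℕ)) {a : Form ℤ_[3]}
    (ha : a ∈ orbit ![1, 0, 0, 3 * (α : ℤ_[3])]) :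
    TableRow χ 3 a 3 (primaryPart χ 3 α ^ 2 *
      coprimaryPart χ 3 ((3 : ℕ) : ZMod (m / 3 ^ condExp m 3)) ^ 2 *
      ((3 : ℕ) : ℂ) ^ (-(1 / 3) : ℂ)) (3 ^ 5) 1 := by
  have hω := unitChar_two_pow_three hχ hχ3 hpm
  have hω0 := unitChar_two_ne_zero hχ hχ3 hpm
  rw [mul_assoc]
  change TableRow χ 3 a 3 (primaryPart χ 3 α ^ 2 * primeTerm χ 3) (3 ^ 5) 1
  rcases hα with rfl | rfl | rfl
  · rw [Nat.cast_one, map_one, one_pow, one_mul]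
    exact tableRow_wildForm_one hχ hχ3 hpm (t := (0, 0, 1)) (by decide) (n := -1)
      (by simp [wildForm]) (by simp [disc]; norm_num) (by norm_num) (Or.inl (by decide))
      (primeTerm_ne_zero hχ3) (fun e he => by simpa using normC_three_1_0_0_3 hχ hχ3 hpm he) ha
  · have h4 : primaryPart χ 3 ((4 : ℕ) : ZMod (3 ^ condExp m 3)) ^ 2 = unitChar χ 3 2 := by
      rw [Nat.cast_ofNat, primaryPart_four]
      linear_combination unitChar χ 3 2 * hω
    rw [h4]
    exact tableRow_wildForm_one hχ hχ3 hpm (t := (0, 0, 4)) (by decide) (n := -16)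
      (by simp [wildForm]) (by simp [disc]; norm_num) (by norm_num) (Or.inl (by decide))
      (mul_ne_zero hω0 (primeTerm_ne_zero hχ3))
      (fun e he => by
        have := normC_three_1_0_0_12 hχ hχ3 hpm he
        norm_num at this ⊢
        exact this) ha
  · have h7 : primaryPart χ 3 ((7 : ℕ) : ZMod (3 ^ condExp m 3)) ^ 2 = unitChar χ 3 2 ^ 2 := by
      rw [Nat.cast_ofNat, primaryPart_seven hχ hχ3 hpm]
    rw [h7]
    exact tableRow_wildForm_one hχ hχ3 hpm (t := (0, 0, 7)) (by decide) (n := -49)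
      (by simp [wildForm]) (by simp [disc]; norm_num) (by norm_num) (Or.inl (by decide))
      (mul_ne_zero (pow_ne_zero 2 hω0) (primeTerm_ne_zero hχ3))
      (fun e he => by
        have := normC_three_1_0_0_21 hχ hχ3 hpm he
        norm_num at this ⊢
        exact this) ha

theorem mem_t13max_three_iff (a : Form ℤ_[3]) : a ∈ formsOfType 3 .t13max ↔
    ∃ r ∈ ({![1, 0, 3, 3], ![1, 0, 6, 3], ![1, 3, 0, 3], ![1, -3, 0, 3], ![1, -3, 0, 12],
      ![1, -3, 0, 21], ![1, 0, 0, 3], ![1, 0, 0, 12], ![1, 0, 0, 21]} : Set (Form ℤ_[3])),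
      a ∈ orbit r := by
  rw [← wildForm_image]
  constructor
  · intro h
    obtain ⟨t, ht, h⟩ := exists_mem_orbit_wildForm h
    exact ⟨_, ⟨t, ht, rfl⟩, h⟩
  · rintro ⟨_, ⟨t, ht, rfl⟩, h⟩
    exact formsOfType_ramified_of_mem_orbit 3 (wildForm_mem ht) h

theorem pairwiseDisjoint_t13max_three :
    ({![1, 0, 3, 3], ![1, 0, 6, 3], ![1, 3, 0, 3], ![1, -3, 0, 3], ![1, -3, 0, 12],
      ![1, -3, 0, 21], ![1, 0, 0, 3], ![1, 0, 0, 12], ![1, 0, 0, 21]} :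
      Set (Form ℤ_[3])).PairwiseDisjoint orbit :=
  wildForm_image ▸ pairwiseDisjoint_wildForm

theorem minimalExp_t13max_three (hχ : χ.IsPrimitive) (hχ3 : χ ^ 3 = 1) (hpm : 3 ∣ m) :
    MinimalExp χ 3 .t13max 3 := by
  have e4 : (12 : ℤ_[3]) = 3 * ((4 : ℕ) : ℤ_[3]) := by norm_num
  have e7 : (21 : ℤ_[3]) = 3 * ((7 : ℕ) : ℤ_[3]) := by norm_num
  refine minimalExp_of_tableRow (fun a ha => ?_) fun e he => ?_
  · obtain ⟨r, hr, h⟩ := (mem_t13max_three_iff a).1 ha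
    rcases hr with rfl | rfl | rfl | rfl | rfl | rfl | rfl | rfl | rfl
    · exact ⟨_, _, _, wild_row_1_0_3_3 hχ hχ3 hpm h⟩
    · exact ⟨_, _, _, wild_row_1_0_6_3 hχ hχ3 hpm h⟩
    · exact ⟨_, _, _, wild_row_1_3_0_3 hχ hχ3 hpm h⟩
    · exact ⟨_, _, _, wild_row_cyclic hχ hχ3 hpm (α := 1) (by simp) (by simpa using h)⟩
    · exact ⟨_, _, _, wild_row_cyclic hχ hχ3 hpm (α := 4) (by simp) (by rwa [← e4])⟩
    · exact ⟨_, _, _, wild_row_cyclic hχ hχ3 hpm (α := 7) (by simp) (by rwa [← e7])⟩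
    · exact ⟨_, _, _, wild_row_pure hχ hχ3 hpm (α := 1) (by simp) (by simpa using h)⟩
    · exact ⟨_, _, _, wild_row_pure hχ hχ3 hpm (α := 4) (by simp) (by rwa [← e4])⟩
    · exact ⟨_, _, _, wild_row_pure hχ hχ3 hpm (α := 7) (by simp) (by rwa [← e7])⟩
  · have h1 := he ![1, 0, 0, 3] ((mem_t13max_three_iff _).2 ⟨_, by simp, mem_orbit_self _⟩)
    -- The unit parts -1 and -16 of the discriminants have characters 1 and w = χ_3(2).
    refine three_le_of_admissible hχ hχ3 hpm h1 (a' := ![1, 0, 0, 12]) (k := 5) (n := -1)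
      (n' := -16) (by simp [disc]; norm_num) (by simp [disc]; norm_num) (by norm_num) (by norm_num)
      ?_ ?_
    · intro i
      fin_cases i <;> simp
      exact ⟨1, by norm_num⟩
    · norm_num [charTable]
      exact unitChar_two_ne_one hχ hχ3 hpm

end WildRamified

end BinaryCubic

theorem mainTheorem9 {m : ℕ} [NeZero m] (χ : DirichletCharacter ℂ m) (hχ : χ.IsPrimitive)
    (hχ3 : χ ^ 3 = 1) (p : ℕ) [Fact p.Prime] (hpm : p ∣ m) :
    (p % 3 = 1 →
      (MinimalExp χ p .t3 1 ∧
        ∀ a ∈ formsOfType p .t3,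
          TableRow χ p a 1 (tau χ p ^ 3 / (p : ℂ) ^ 2) 1 3) ∧
      (MinimalExp χ p .t21 1 ∧
        ∀ a ∈ formsOfType p .t21,
          TableRow χ p a 1 (-(tau χ p ^ 3 / (p : ℂ) ^ 2)) 1 2) ∧
      (MinimalExp χ p .t111 1 ∧
        ∀ a ∈ formsOfType p .t111,
          TableRow χ p a 1 (tau χ p ^ 3 / (p : ℂ) ^ 2) 1 6) ∧
      (MinimalExp χ p .t121max 2 ∧
        (formsOfType p .t121max =
          ⋃ α : ℤ_[p]ˣ, orbit ![0, 1, 0, (p : ℤ_[p]) * α]) ∧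
        ∀ α : ℤ_[p]ˣ, ∀ a ∈ orbit ![0, 1, 0, (p : ℤ_[p]) * α],
          TableRow χ p a 2
            (primaryPart χ p 2 * coprimaryPart χ p p ^ 2
              * (p : ℂ) ^ (-(1 / 3) : ℂ)) p 2) ∧
      (MinimalExp χ p .t13max 2 ∧
        (formsOfType p .t13max =
          ⋃ α : ℤ_[p]ˣ, orbit ![1, 0, 0, (p : ℤ_[p]) * α]) ∧
        ∀ α : ℤ_[p]ˣ, ∀ a ∈ orbit ![1, 0, 0, (p : ℤ_[p]) * α],
          TableRow χ p a 2
            (primaryPart χ p (PadicInt.toZModPow _ (α : ℤ_[p]))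
              + primaryPart χ p (PadicInt.toZModPow _ (α : ℤ_[p])) ^ 2
                * coprimaryPart χ p p ^ 2 * (p : ℂ) ^ (-(1 / 3) : ℂ)) (p ^ 2) 3)) ∧
    (p = 3 →
      tau χ p ^ 3 / (p : ℂ) ^ 4 = primaryPart χ p 2 / p ∧
      (MinimalExp χ p .t3 2 ∧
        ∀ a ∈ formsOfType p .t3,
          TableRow χ p a 2 (tau χ p ^ 3 / (p : ℂ) ^ 4) 1 3) ∧
      (MinimalExp χ p .t21 2 ∧
        ∀ a ∈ formsOfType p .t21,
          TableRow χ p a 2 (tau χ p ^ 3 / (p : ℂ) ^ 4) 1 2) ∧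
      (MinimalExp χ p .t111 2 ∧
        ∀ a ∈ formsOfType p .t111,
          TableRow χ p a 2 (tau χ p ^ 3 / (p : ℂ) ^ 4) 1 6) ∧
      (MinimalExp χ p .t121max 3 ∧
        (formsOfType p .t121max =
          orbit ![0, 1, 0, 3] ∪ orbit ![0, 1, 0, -3]) ∧
        Disjoint (orbit (![0, 1, 0, 3] : Form ℤ_[p]))
          (orbit ![0, 1, 0, -3]) ∧
        (∀ a ∈ orbit ![0, 1, 0, 3],
          TableRow χ p a 3
            ((1 - primaryPart χ p 4) * coprimaryPart χ p p ^ 2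
              * (p : ℂ) ^ (-(4 / 3) : ℂ)) p 2) ∧
        ∀ a ∈ orbit ![0, 1, 0, -3],
          TableRow χ p a 3
            (-((1 - primaryPart χ p 4) * coprimaryPart χ p p ^ 2
              * (p : ℂ) ^ (-(4 / 3) : ℂ))) p 2) ∧
      (MinimalExp χ p .t13max 3 ∧
        (∀ a, a ∈ formsOfType p .t13max ↔
          ∃ r ∈ ({![1, 0, 3, 3], ![1, 0, 6, 3], ![1, 3, 0, 3],
            ![1, -3, 0, 3], ![1, -3, 0, 12], ![1, -3, 0, 21],
            ![1, 0, 0, 3], ![1, 0, 0, 12], ![1, 0, 0, 21]} : Set (Form ℤ_[p])),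
            a ∈ orbit r) ∧
        ({![1, 0, 3, 3], ![1, 0, 6, 3], ![1, 3, 0, 3],
          ![1, -3, 0, 3], ![1, -3, 0, 12], ![1, -3, 0, 21],
          ![1, 0, 0, 3], ![1, 0, 0, 12], ![1, 0, 0, 21]} :
            Set (Form ℤ_[p])).PairwiseDisjoint orbit ∧
        (∀ a ∈ orbit ![1, 0, 3, 3],
          TableRow χ p a 3 ((primaryPart χ p 2 - 1) / p) (p ^ 3) 1) ∧
        (∀ a ∈ orbit ![1, 0, 6, 3],
          TableRow χ p a 3 ((2 * primaryPart χ p 2 + 1) / p) (p ^ 3) 1) ∧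
        (∀ a ∈ orbit ![1, 3, 0, 3],
          TableRow χ p a 3
            (primaryPart χ p 4 * coprimaryPart χ p p ^ 2
              * (p : ℂ) ^ (-(1 / 3) : ℂ)) (p ^ 4) 1) ∧
        (∀ α ∈ ({1, 4, 7} : Set ℕ), ∀ a ∈ orbit ![1, -3, 0, 3 * (α : ℤ_[p])],
          TableRow χ p a 3
            (primaryPart χ p α ^ 2
              + coprimaryPart χ p p ^ 2 * (p : ℂ) ^ (-(1 / 3) : ℂ)) (p ^ 4) 3) ∧
        ∀ α ∈ ({1, 4, 7} : Set ℕ), ∀ a ∈ orbit ![1, 0, 0, 3 * (α : ℤ_[p])],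
          TableRow χ p a 3
            (primaryPart χ p α ^ 2 * coprimaryPart χ p p ^ 2
              * (p : ℂ) ^ (-(1 / 3) : ℂ)) (p ^ 5) 1)) := by
  refine ⟨fun hp => ⟨table_t3 hχ hχ3 hpm hp, table_t21 hχ hχ3 hpm hp, table_t111 hχ hχ3 hpm hp,
    table_t121max hχ hχ3 hpm hp, table_t13max hχ hχ3 hpm hp⟩, ?_⟩
  rintro rfl
  exact ⟨(tau_three_div hχ hχ3 hpm).trans (by rw [primaryPart_two, Nat.cast_ofNat]),
    wild_table_t3 hχ hχ3 hpm, wild_table_t21 hχ hχ3 hpm, wild_table_t111 hχ hχ3 hpm,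
    ⟨minimalExp_t121max_three hχ hχ3 hpm, formsOfType_t121max_three, disjoint_t121max_three,
      fun _ ha => wild_row_t121max hχ hχ3 hpm ha, fun _ ha => wild_row_t121max_neg hχ hχ3 hpm ha⟩,
    minimalExp_t13max_three hχ hχ3 hpm, mem_t13max_three_iff, pairwiseDisjoint_t13max_three,
    fun _ ha => wild_row_1_0_3_3 hχ hχ3 hpm ha, fun _ ha => wild_row_1_0_6_3 hχ hχ3 hpm ha,
    fun _ ha => wild_row_1_3_0_3 hχ hχ3 hpm ha,
    fun _ hα _ ha => wild_row_cyclic hχ hχ3 hpm hα ha,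
    fun _ hα _ ha => wild_row_pure hχ hχ3 hpm hα ha⟩
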